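/- **Notation.** Let $\eta_0:\mathbb R\to[0,1]$ be an even smooth function supported in $[-8/5,8/5]$ and equal to $1$ on $[-5/4,5/4]$. For $k\ge 1$ put $\eta_k(\xi)=\chi_k(\xi)=\eta_0(\xi/2^k)-\eta_0(\xi/2^{k-1})$, let $P_k$ ($k\ge1$) and $P_{\le 0}$ be the Fourier multipliers on $L^2(\mathbb R^2)$ with symbols $\chi_k(\xi)$ and $\eta_0(\xi)$, where $(\xi,\mu,\tau)$ are the variables dual to $(x,y,t)$, and let $\omega(\xi,\mu)=\xi^3+\mu^2/\xi$. Let $$\|\phi\|_{H^{s,0}}=\|(1+|\xi|^2)^{s/2}\widehat\phi(\xi,\mu)\|_{L^2_{\xi,\mu}},\qquad H^{\infty,0}=\bigcap_{\sigma\ge0}H^{\sigma,0}.$$ For an integer $k\ge0$ let $$\|f\|_{X_k}=\sum_{j\ge0}2^{j/2}\|\eta_j(\tau-\omega(\xi,\mu))f(\xi,\mu,\tau)\|_{L^2_{\xi,\mu,\tau}},\qquad \|f\|_{F_k}=\sup_{t_k\in\mathbb R}\big\|\mathcal F[f\cdot\eta_0(2^k(t-t_k))]\big\|_{X_k},$$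 where $\mathcal F$ is the space-time Fourier transform, and for $0<T\le 1$ let $\|f\|_{F_k(T)}$ be the infimum of $\|\tilde f\|_{F_k}$ over all $\tilde f\in C(\mathbb R;L^2(\mathbb R^2))$ with $\tilde f=f$ on $[-T,T]$. Finally let $$\|u\|_{F^s(T)}^2=\|P_{\le0}u\|_{F_0(T)}^2+\sum_{k\ge1}2^{2sk}\|P_ku\|_{F_k(T)}^2,\qquad \|u\|_{E^s(T)}^2=\|P_{\le0}u(0)\|_{L^2}^2+\sum_{k\ge1}\sup_{t\in[-T,T]}2^{2sk}\|P_ku(t)\|_{L^2}^2 .$$ These quantities take values in $[0,\infty]$. **Proposition 3.3.** Let $s>1/2$ and $\varepsilon>0$. There is a constant $C$, depending only on $s$, $\varepsilon$ and $\eta_0$, such that for every $T\in(0,1]$ and every real-valued $u\in C([-T,T]:H^{\infty,0})$ that solves the KP-I equation $$\partial_tu+\partial_x^3u-\partial_x^{-1}\partial_y^2u+\tfrac12\partial_x(u^2)=0$$ on $\mathbb R^2\times(-T,T)$ in the sense of distributions, i.e. (testing the equation with $x$-derivatives) $\iint \big[u\,(\partial_t\partial_x\psi+\partial_x^4\psi-\partial_y^2\psi)+\tfrac12u^2\,\partial_x^2\psi\big]\,dx\,dy\,dt=0$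 for all $\psi\in C_c^\infty(\mathbb R^2\times(-T,T))$, one has, with $u_0=u(0)$, $$\|u\|_{E^s(T)}^2\le C\Big(\|u_0\|_{H^{s,0}}^2+\|u\|_{F^{1/2+\varepsilon}(T)}\,\|u\|_{F^s(T)}^2\Big).$$ -/

import Mathlib

open MeasureTheory Set Filter Topology
open scoped ENNReal NNReal FourierTransform BoundedContinuousFunction ContDiff

noncomputable section

namespace KPI

/-- The plane `ℝ²`; the coordinates of `z` are `x = z 0` and `y = z 1` (on the Fourier side
`ξ` and `μ`). -/
abbrev Plane : Type := EuclideanSpace ℝ (Fin 2)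

/-- The complex space `L²(ℝ²)`. -/
abbrev L2 : Type := Lp (α := Plane) ℂ 2 volume

/-! ### Frequency variables

Mathlib's Fourier transform uses the character `exp (-2πi ⟨z, ζ⟩)`. The angular frequency
belonging to `ζ` is `2πζ`, and so every Fourier symbol `m(ξ, μ)` written for the character
`exp (-i (x ξ + y μ))` is evaluated at `(2π ζ 0, 2π ζ 1)`. The weighted `L²` norms below are then
exactly those of the unitary Fourier transform in angular frequency. -/

/-- The angular frequency `ξ` dual to `x`. -/
def freqX (ζ : Plane) : ℝ := 2 * Real.pi * ζ 0

/-- The angular frequency `μ` dual to `y`. -/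
def freqY (ζ : Plane) : ℝ := 2 * Real.pi * ζ 1

/-- The dispersion relation `ω(ξ, μ) = ξ³ + μ² / ξ` (relevant only for `ξ ≠ 0`, that is, almost
everywhere). -/
def omega (ξ μ : ℝ) : ℝ := ξ ^ 3 + μ ^ 2 / ξ

/-! ### Littlewood-Paley decomposition in `x` -/

/-- An even smooth function `η₀ : ℝ → [0, 1]` supported in `[-8/5, 8/5]` and equal to `1` on
`[-5/4, 5/4]`. -/
structure Cutoff where
  toFun : ℝ → ℝ
  smooth : ContDiff ℝ ∞ toFun
  even : ∀ x, toFun (-x) = toFun x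
  mem_Icc : ∀ x, toFun x ∈ Icc (0 : ℝ) 1
  support_subset : Function.support toFun ⊆ Icc (-(8 / 5)) (8 / 5)
  eq_one : ∀ x ∈ Icc (-(5 / 4) : ℝ) (5 / 4), toFun x = 1

/-- The inhomogeneous dyadic partition of unity: `η_0` for `k = 0`, and
`η_k(x) = η₀(x / 2^k) - η₀(x / 2^(k-1))` for `k ≥ 1`. For `k ≥ 1` this is also the symbol `χ_k`
of `P_k`, and for `k = 0` it is (off the null set `ξ = 0`) the symbol `∑_{l ≤ 0} χ_l` of
`P_{≤ 0}`. -/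
def Cutoff.dyadic (η : Cutoff) : ℕ → ℝ → ℝ
  | 0, x => η.toFun x
  | k + 1, x => η.toFun (x / 2 ^ (k + 1)) - η.toFun (x / 2 ^ k)

theorem Cutoff.continuous_dyadic (η : Cutoff) (k : ℕ) : Continuous (η.dyadic k) := by
  have h := η.smooth.continuous
  cases k with
  | zero => exact h
  | succ k =>
    exact (h.comp (continuous_id.div_const _)).sub (h.comp (continuous_id.div_const _))

theorem Cutoff.norm_dyadic_le (η : Cutoff) (k : ℕ) (x : ℝ) : ‖η.dyadic k x‖ ≤ 1 := by
  rw [Real.norm_eq_abs, abs_le]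
  cases k with
  | zero =>
    have h := η.mem_Icc x
    exact ⟨by have := h.1; simp only [dyadic]; linarith, h.2⟩
  | succ k =>
    have h := η.mem_Icc (x / 2 ^ (k + 1))
    have h' := η.mem_Icc (x / 2 ^ k)
    simp only [dyadic]
    constructor <;> linarith [h.1, h.2, h'.1, h'.2]

/-- The dyadic functions as bounded continuous functions. -/
def Cutoff.dyadicBCF (η : Cutoff) (k : ℕ) : ℝ →ᵇ ℝ :=
  BoundedContinuousFunction.ofNormedAddCommGroup (η.dyadic k) (η.continuous_dyadic k) 1
    (η.norm_dyadic_le k)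

theorem memLp_symbol_smul (m : ℝ →ᵇ ℝ) (φ : L2) :
    MemLp (fun ζ : Plane => m (freqX ζ) • φ ζ) 2 volume := by
  have hc : Continuous fun ζ : Plane => m (freqX ζ) := by
    unfold freqX
    fun_prop
  refine MemLp.of_le_mul (c := ‖m‖) (Lp.memLp φ)
    (hc.aestronglyMeasurable.smul (Lp.aestronglyMeasurable φ)) (Eventually.of_forall fun ζ => ?_)
  rw [norm_smul]
  exact mul_le_mul_of_nonneg_right (m.norm_coe_le_norm _) (norm_nonneg _)

/-- The Fourier multiplier on `L²(ℝ²)` with symbol `m(ξ)`. -/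
def multX (m : ℝ →ᵇ ℝ) (φ : L2) : L2 :=
  𝓕⁻ ((memLp_symbol_smul m (𝓕 φ)).toLp _)

/-- The Littlewood-Paley projections in `x`: `P_{≤ 0}` for `k = 0` and `P_k` for `k ≥ 1`. -/
def proj (η : Cutoff) (k : ℕ) (φ : L2) : L2 := multX (η.dyadicBCF k) φ

/-! ### The anisotropic Sobolev spaces `H^{s,0}` -/

/-- The norm `‖(1 + |ξ|²)^(s/2) φ̂(ξ, μ)‖_{L²}` of `H^{s,0}`, infinite if `φ ∉ H^{s,0}`. -/
def sobolevNorm (s : ℝ) (φ : L2) : ℝ≥0∞ :=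
  eLpNorm (fun ζ : Plane => (1 + freqX ζ ^ 2) ^ (s / 2) • (𝓕 φ : L2) ζ) 2 volume

/-- `u ∈ C([-T, T] : H^{∞,0})`, where `H^{∞,0} = ⋂_{σ ≥ 0} H^{σ,0}` with its natural topology.
The values of `u` outside `[-T, T]` are irrelevant. -/
def IsContinuousHInfty (T : ℝ) (u : ℝ → L2) : Prop :=
  ∀ σ : ℝ, 0 ≤ σ → ∀ t ∈ Icc (-T) T, sobolevNorm σ (u t) < (⊤ : ℝ≥0∞) ∧
    Tendsto (fun r => sobolevNorm σ (u r - u t)) (𝓝[Icc (-T) T] t) (𝓝 0)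

/-! ### The short-time Fourier restriction norms -/

/-- The space-time Fourier transform of a (time-integrable) `f : ℝ → L²(ℝ²)`: the Fourier
transform in time followed by the one in space. As a function of `τ` and `ζ`, it is
`𝓕 f (ζ, τ)`. -/
def spaceTimeFourier (f : ℝ → L2) (τ : ℝ) : L2 := 𝓕 ((𝓕 f : ℝ → L2) τ)

/-- The norm `∑_{j ≥ 0} 2^(j/2) ‖η_j(τ - ω(ξ, μ)) F(ξ, μ, τ)‖_{L²_{ξ, μ, τ}}`. -/
def xNorm (η : Cutoff) (F : ℝ → L2) : ℝ≥0∞ :=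
  ∑' j : ℕ, (2 : ℝ≥0∞) ^ ((j : ℝ) / 2) *
    (∫⁻ τ : ℝ, ∫⁻ ζ : Plane,
      ‖η.dyadic j (2 * Real.pi * τ - omega (freqX ζ) (freqY ζ)) • F τ ζ‖ₑ ^ (2 : ℝ))
        ^ (1 / 2 : ℝ)

/-- The norm of `F_k`: the supremum over `t_k ∈ ℝ` of the `X_k` norm of the space-time Fourier
transform of `η₀(2^k (t - t_k)) f(t)`. -/
def fkNorm (η : Cutoff) (k : ℕ) (f : ℝ → L2) : ℝ≥0∞ :=
  ⨆ tk : ℝ, xNorm η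
    (spaceTimeFourier fun t => η.toFun (2 ^ k * (t - tk)) • f t)

/-- The norm of `F_k(T)`: the infimum of the `F_k` norms of all extensions `g ∈ C(ℝ; L²)` of
the restriction of `f` to `[-T, T]`. -/
def fkNormOn (η : Cutoff) (k : ℕ) (T : ℝ) (f : ℝ → L2) : ℝ≥0∞ :=
  ⨅ (g : ℝ → L2) (_ : Continuous g) (_ : EqOn g f (Icc (-T) T)), fkNorm η k g

/-- The norm of `F^s(T)`; the term `k = 0` is `‖P_{≤ 0} u‖²_{F_0(T)}`. -/
def fNorm (η : Cutoff) (s T : ℝ) (u : ℝ → L2) : ℝ≥0∞ :=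
  (∑' k : ℕ, (2 : ℝ≥0∞) ^ (2 * s * (k : ℝ)) *
    fkNormOn η k T (fun t => proj η k (u t)) ^ (2 : ℝ)) ^ (1 / 2 : ℝ)

/-- The norm of `E^s(T)`. -/
def eNorm (η : Cutoff) (s T : ℝ) (u : ℝ → L2) : ℝ≥0∞ :=
  (‖proj η 0 (u 0)‖ₑ ^ (2 : ℝ) +
    ∑' k : ℕ, ⨆ t ∈ Icc (-T) T,
      (2 : ℝ≥0∞) ^ (2 * s * ((k + 1 : ℕ) : ℝ)) * ‖proj η (k + 1) (u t)‖ₑ ^ (2 : ℝ))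
    ^ (1 / 2 : ℝ)

/-! ### The KP-I equation -/

/-- The directional derivative of a function of `(t, (x, y))`. -/
def dirDeriv (v : ℝ × Plane) (ψ : ℝ × Plane → ℝ) : ℝ × Plane → ℝ :=
  fun p => fderiv ℝ ψ p v

/-- The partial derivative in `t`. -/
def dt : (ℝ × Plane → ℝ) → ℝ × Plane → ℝ := dirDeriv (1, 0)

/-- The partial derivative in `x`. -/
def dx : (ℝ × Plane → ℝ) → ℝ × Plane → ℝ := dirDeriv (0, EuclideanSpace.single 0 1)

/-- The partial derivative in `y`. -/
def dy : (ℝ × Plane → ℝ) → ℝ × Plane → ℝ := dirDeriv (0, EuclideanSpace.single 1 1)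

/-- `u` solves `∂ₜu + ∂ₓ³u - ∂ₓ⁻¹∂_y²u + ∂ₓ(u²)/2 = 0` on `ℝ² × (-T, T)` in the sense of
distributions. Since `u(t)` is only in `L²` with respect to `y`, the term `∂ₓ⁻¹∂_y²u` is paired
with `x`-derivatives `∂ₓψ` of test functions, `⟨∂ₓ⁻¹∂_y²u, ∂ₓψ⟩ = -⟨u, ∂_y²ψ⟩`, and the equation
tested with `-∂ₓψ` reads
`∫∫ u (∂ₜ∂ₓψ + ∂ₓ⁴ψ - ∂_y²ψ) + (u²/2) ∂ₓ²ψ = 0`. -/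
def SolvesKPI (T : ℝ) (u : ℝ → L2) : Prop :=
  ∀ ψ : ℝ × Plane → ℝ, ContDiff ℝ ∞ ψ → HasCompactSupport ψ →
    tsupport ψ ⊆ Ioo (-T) T ×ˢ univ →
    ∫ t : ℝ, ∫ z : Plane,
      ((dt (dx ψ) (t, z) + dx (dx (dx (dx ψ))) (t, z) - dy (dy ψ) (t, z)) • u t z
        + (dx (dx ψ) (t, z) / 2) • (u t z) ^ 2) = 0

/-- `u ∈ C([-T, T] : H^{∞,0})` is a real-valued solution of KP-I on `ℝ² × (-T, T)`. -/
structure IsSmoothSolution (T : ℝ) (u : ℝ → L2) : Prop where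
  real_valued : ∀ t ∈ Icc (-T) T, ∀ᵐ z : Plane, (u t z).im = 0
  continuous_hInfty : IsContinuousHInfty T u
  solves : SolvesKPI T u

end KPI

end

noncomputable section

namespace KPI

open ENNReal (ofReal ofReal_mul ofReal_le_ofReal ofReal_pow ofReal_ne_top ofReal_one ofReal_ofNat
  tsum_le_tsum rpow_natCast rpow_mul mul_ne_top rpow_ne_top_of_nonneg rpow_two
  ofReal_tsum_of_nonneg add_ne_top one_le_ofReal)
open Real (norm_of_nonneg sqrt_nonneg sq_sqrt sqrt_mul fourierInv_eq norm_eq_abs fourierChar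
  smoothTransition fourier_real_eq pi_le_four pi_pos)
open SchwartzMap (fourierInv_coe fourier_coe)
open Complex (I exp real_smul norm_real ofRealCLM continuous_ofReal reCLM I_sq)
open MeasureTheory.Measure (restrict_apply_univ volume_eq_prod)
open scoped Real SchwartzMap

local notation "ℝ²" => ℝ × ℝ
local notation "ℝ³" => ℝ × ℝ²
local notation "ℝ⁴" => ℝ² × ℝ²

/-! ### Tools for lower Lebesgue integrals -/

lemma lintegral_sq_le {α : Type*} [MeasurableSpace α] {m : Measure α} {X A B : α → ℝ≥0∞}
    (hA : AEMeasurable A m) (hB : AEMeasurable B m) (h : ∀ᵐ x ∂m, X x ^ 2 ≤ A x * B x) :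
    (∫⁻ x, X x ∂m) ^ 2 ≤ (∫⁻ x, A x ∂m) * ∫⁻ x, B x ∂m := by
  have h1 : ∫⁻ x, X x ∂m ≤ ∫⁻ x, ((fun x => A x ^ (1 / 2 : ℝ)) * fun x => B x ^ (1 / 2 : ℝ)) x ∂m := by
    refine lintegral_mono_ae (h.mono fun x hx => ?_)
    have h2 := ENNReal.rpow_le_rpow hx (by norm_num : (0 : ℝ) ≤ 1 / 2)
    rw [← rpow_natCast, ← rpow_mul, ENNReal.mul_rpow_of_nonneg _ _ (by norm_num)] at h2
    simpa using h2
  have h3 := ENNReal.lintegral_mul_le_Lp_mul_Lq m (p := 2) (q := 2)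
    Real.HolderConjugate.two_two (hA.pow_const (1 / 2 : ℝ)) (hB.pow_const (1 / 2 : ℝ))
  have h4 := h1.trans h3
  have e : ∀ y : ℝ≥0∞, (y ^ (1 / 2 : ℝ)) ^ (2 : ℝ) = y := fun y => by rw [← rpow_mul]; norm_num
  simp only [e] at h4
  calc (∫⁻ x, X x ∂m) ^ 2 ≤ ((∫⁻ x, A x ∂m) ^ (1 / 2 : ℝ) * (∫⁻ x, B x ∂m) ^ (1 / 2 : ℝ)) ^ 2 := by
        gcongr
    _ = _ := by
        rw [mul_pow, ← rpow_natCast, ← rpow_natCast]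
        norm_num [e]

lemma lintegral_mul_sq_le {α : Type*} [MeasurableSpace α] {m : Measure α} {f g : α → ℝ≥0∞}
    (hf : AEMeasurable f m) (hg : AEMeasurable g m) :
    (∫⁻ x, f x * g x ∂m) ^ 2 ≤ (∫⁻ x, f x ^ 2 ∂m) * ∫⁻ x, g x ^ 2 ∂m :=
  lintegral_sq_le (hf.pow_const 2) (hg.pow_const 2) (.of_forall fun x => by rw [mul_pow])

lemma lintegral_comp_le_of_le_deriv {s : Set ℝ} (hs : MeasurableSet s) {f f' w : ℝ → ℝ}
    (hf : ∀ x ∈ s, HasDerivAt f (f' x) x) (hinj : InjOn f s) (hw : ∀ x ∈ s, w x ≤ |f' x|)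
    (F : ℝ → ℝ≥0∞) : ∫⁻ x in s, ofReal (w x) * F (f x) ≤ ∫⁻ y, F y := by
  calc ∫⁻ x in s, ofReal (w x) * F (f x)
      ≤ ∫⁻ x in s, ofReal |f' x| * F (f x) := by
        refine setLIntegral_mono' hs fun x hx => ?_
        gcongr; exact hw x hx
    _ = ∫⁻ y in f '' s, F y :=
        (lintegral_image_eq_lintegral_abs_deriv_mul hs (fun x hx => (hf x hx).hasDerivWithinAt)
          hinj F).symm
    _ ≤ ∫⁻ y, F y := setLIntegral_le_lintegral _ _

lemma le_ofReal_inv_mul {J : ℝ} (hJ : 0 < J) {A B : ℝ≥0∞} (h : ofReal J * A ≤ B) :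
    A ≤ ofReal J⁻¹ * B := by
  calc A = ofReal J⁻¹ * (ofReal J * A) := by
        rw [← mul_assoc, ← ofReal_mul (by positivity), inv_mul_cancel₀ hJ.ne']; simp
    _ ≤ _ := by gcongr

lemma lintegral_scale_left {a : ℝ} (ha : a ≠ 0) (G : ℝ → ℝ≥0∞) :
    ∫⁻ y, G y = ofReal |a| * ∫⁻ v, G (a * v) := by
  have h := Real.smul_map_volume_mul_left ha
  conv_lhs => rw [← h, lintegral_smul_measure]
  congr 1
  exact lintegral_map_equiv G (Homeomorph.mulLeft₀ a ha).toMeasurableEquiv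

lemma lintegral_prod₂ {α β : Type*} [MeasureSpace α] [MeasureSpace β]
    [SFinite (volume : Measure α)] [SFinite (volume : Measure β)] {F : α × β → ℝ≥0∞}
    (hF : Measurable F) : ∫⁻ z, F z = ∫⁻ x, ∫⁻ y, F (x, y) :=
  lintegral_prod F hF.aemeasurable

lemma lintegral_prod_symm₂ {α β : Type*} [MeasureSpace α] [MeasureSpace β]
    [SFinite (volume : Measure α)] [SFinite (volume : Measure β)] {F : α × β → ℝ≥0∞}
    (hF : Measurable F) : ∫⁻ z, F z = ∫⁻ y, ∫⁻ x, F (x, y) :=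
  lintegral_prod_symm F hF.aemeasurable

lemma lintegral_lintegral_add_comm {G : Type*} [MeasurableSpace G] [AddCommGroup G]
    [MeasurableAdd₂ G] [MeasurableNeg G] (m : Measure G) [SFinite m] [m.IsAddRightInvariant]
    {F : G → G → ℝ≥0∞} (hF : Measurable (Function.uncurry F)) :
    ∫⁻ p, ∫⁻ q, F p q ∂m ∂m = ∫⁻ r, ∫⁻ p, F p (r - p) ∂m ∂m := by
  have h : Measurable fun z : G × G => (z.2, z.1 - z.2) := by
    simp only [sub_eq_add_neg]
    exact measurable_snd.prodMk (measurable_fst.add measurable_snd.neg)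
  rw [lintegral_lintegral_swap (f := fun r p => F p (r - p)) (hF.comp h).aemeasurable]
  congr 1; ext p
  simp only [sub_eq_add_neg]
  rw [lintegral_add_right_eq_self (fun q => F p q) (-p)]

/-! ### The resonance function -/

/-- The resonance function of the dispersion relation. -/
def reson (p q : ℝ²) : ℝ := omega p.1 p.2 + omega q.1 q.2 - omega (p.1 + q.1) (p.2 + q.2)

/-- The normalized difference of the slopes `μ / ξ`. -/
def slopeDiff (p q : ℝ²) : ℝ := (p.2 / p.1 - q.2 / q.1) / (p.1 + q.1)

@[fun_prop]
lemma measurable_omega : Measurable fun p : ℝ² => omega p.1 p.2 := by unfold omega; fun_prop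

@[fun_prop]
lemma measurable_reson : Measurable fun z : ℝ⁴ => reson z.1 z.2 := by unfold reson omega; fun_prop

@[fun_prop]
lemma measurable_slopeDiff : Measurable fun z : ℝ⁴ => slopeDiff z.1 z.2 := by
  unfold slopeDiff; fun_prop

lemma reson_eq {p q : ℝ²} (hp : p.1 ≠ 0) (hq : q.1 ≠ 0) (hpq : p.1 + q.1 ≠ 0) :
    reson p q = p.1 * q.1 * (p.1 + q.1) * (slopeDiff p q ^ 2 - 3) := by
  unfold reson slopeDiff omega
  field_simp
  ring

lemma reson_comm (p q : ℝ²) : reson p q = reson q p := by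
  unfold reson; rw [add_comm p.1, add_comm p.2]; ring

lemma reson_sub {x y ξ μ : ℝ} (hx : x ≠ 0) (hX : ξ - x ≠ 0) (hξ : ξ ≠ 0) :
    reson (x, y) ((ξ, μ) - (x, y)) =
      -3 * (x * (ξ - x)) * ξ + ξ / (x * (ξ - x)) * (y - x * μ / ξ) ^ 2 := by
  simp only [reson, omega, Prod.mk_sub_mk]
  rw [show x + (ξ - x) = ξ by ring, show y + (μ - y) = μ by ring]
  field_simp
  ring

lemma slopeDiff_sub {x y ξ μ : ℝ} (hx : x ≠ 0) (hX : ξ - x ≠ 0) (hξ : ξ ≠ 0) :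
    slopeDiff (x, y) ((ξ, μ) - (x, y)) = (y - x * μ / ξ) / (x * (ξ - x)) := by
  simp only [slopeDiff, Prod.mk_sub_mk]
  rw [show x + (ξ - x) = ξ by ring]
  field_simp
  ring

/-- The trilinear form that is estimated, restricted to a set of frequencies. -/
def bform (S : Set ℝ⁴) (f g : ℝ² → ℝ≥0∞) (H : ℝ² × ℝ → ℝ≥0∞) : ℝ≥0∞ :=
  ∫⁻ p, ∫⁻ q, S.indicator 1 (p, q) * (f p * g q * H (p + q, reson p q))

section bform

variable {S : Set ℝ⁴} {f g : ℝ² → ℝ≥0∞} {H : ℝ² × ℝ → ℝ≥0∞}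

lemma measurable_bform_integrand (hS : MeasurableSet S) (hf : Measurable f) (hg : Measurable g)
    (hH : Measurable H) : Measurable (Function.uncurry fun p q : ℝ² =>
      S.indicator (1 : ℝ⁴ → ℝ≥0∞) (p, q) * (f p * g q * H (p + q, reson p q))) := by
  have h1 : Measurable (S.indicator (1 : ℝ⁴ → ℝ≥0∞)) := measurable_one.indicator hS
  unfold Function.uncurry
  fun_prop

lemma bform_eq (hS : MeasurableSet S) (hf : Measurable f) (hg : Measurable g)
    (hH : Measurable H) : bform S f g H =
      ∫⁻ r, ∫⁻ p, S.indicator 1 (p, r - p) * (f p * g (r - p) * H (r, reson p (r - p))) := by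
  unfold bform
  rw [lintegral_lintegral_add_comm volume (measurable_bform_integrand hS hf hg hH)]
  simp only [add_sub_cancel]

lemma bform_swap (hS : MeasurableSet S) (hf : Measurable f) (hg : Measurable g)
    (hH : Measurable H) : bform S f g H = bform (Prod.swap ⁻¹' S) g f H := by
  unfold bform
  rw [lintegral_lintegral_swap (measurable_bform_integrand hS hf hg hH).aemeasurable]
  congr 1; ext q; congr 1; ext p
  rw [add_comm p, reson_comm p, mul_comm (f p)]
  rfl

end bform

/-! ### Transversal interactions -/

lemma lintegral_comp_quadratic_le {e α c : ℝ} (hα : α ≠ 0) (hc : 0 < c) (F : ℝ → ℝ≥0∞) :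
    ofReal (|α| * c) * ∫⁻ v in {v : ℝ | c ≤ |v|}, F (e + α * v ^ 2) ≤ ∫⁻ s, F s := by
  have key : ∀ s : Set ℝ, MeasurableSet s → (∀ x ∈ s, c ≤ |x|) → InjOn (fun x : ℝ => x ^ 2) s →
      ofReal (2 * (|α| * c)) * ∫⁻ v in s, F (e + α * v ^ 2) ≤ ∫⁻ s, F s := by
    intro s hs hcs hinj
    rw [← lintegral_const_mul' _ _ ofReal_ne_top]
    refine lintegral_comp_le_of_le_deriv (f := fun v => e + α * v ^ 2)
      (f' := fun v => α * (2 * v)) hs ?_ ?_ ?_ F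
    · intro x _
      have := ((hasDerivAt_pow 2 x).const_mul α).const_add e
      simpa using this
    · intro x hx y hy h
      apply hinj hx hy
      simp only at h ⊢
      exact mul_left_cancel₀ hα (by linarith)
    · intro x hx
      rw [abs_mul, abs_mul]
      have := hcs x hx
      have : |α| * c ≤ |α| * |x| := by gcongr
      rw [abs_two]; linarith
  have hunion : {v : ℝ | c ≤ |v|} = Ici c ∪ Iic (-c) := by
    ext v; simp only [mem_ofPred_eq, mem_union, mem_Ici, mem_Iic, le_abs]
    constructor <;> rintro (h | h) <;> [left; right; left; right] <;> linarith
  have h1 := key (Ici c) measurableSet_Ici (fun x hx => le_trans hx (le_abs_self x)) (by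
    intro x hx y hy h
    have hx' : c ≤ x := hx
    have hy' : c ≤ y := hy
    exact (pow_left_inj₀ (by linarith) (by linarith) two_ne_zero).1 h)
  have h2 := key (Iic (-c)) measurableSet_Iic (fun x hx => by
      have hx' : x ≤ -c := hx
      rw [abs_of_neg (by linarith)]; linarith) (by
    intro x hx y hy h
    have hx' : x ≤ -c := hx
    have hy' : y ≤ -c := hy
    have h' : (-x) ^ 2 = (-y) ^ 2 := by simpa using h
    have := (pow_left_inj₀ (by linarith) (by linarith) two_ne_zero).1 h'
    linarith)
  have h3 : ∫⁻ v in {v : ℝ | c ≤ |v|}, F (e + α * v ^ 2) ≤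
      (∫⁻ v in Ici c, F (e + α * v ^ 2)) + ∫⁻ v in Iic (-c), F (e + α * v ^ 2) := by
    rw [hunion]; exact lintegral_union_le _ _ _
  have h4 : ofReal (2 * (|α| * c)) * ∫⁻ v in {v : ℝ | c ≤ |v|}, F (e + α * v ^ 2) ≤
      2 * ∫⁻ s, F s := by
    calc _ ≤ ofReal (2 * (|α| * c)) * ((∫⁻ v in Ici c, F (e + α * v ^ 2)) +
          ∫⁻ v in Iic (-c), F (e + α * v ^ 2)) := by gcongr
      _ ≤ (∫⁻ s, F s) + ∫⁻ s, F s := by rw [mul_add]; gcongr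
      _ = _ := by rw [two_mul]
  rw [ofReal_mul two_pos.le, mul_assoc, ofReal_ofNat] at h4
  exact (ENNReal.mul_le_mul_iff_right (by norm_num) (by norm_num)).1 h4

variable {f g : ℝ² → ℝ≥0∞} {H : ℝ² × ℝ → ℝ≥0∞}

/-- The set of interactions with transversal slopes. -/
def transversal (c : ℝ) : Set ℝ⁴ := {z | c ≤ |slopeDiff z.1 z.2|}

lemma measurableSet_transversal (c : ℝ) : MeasurableSet (transversal c) :=
  measurableSet_le measurable_const (measurable_slopeDiff.abs)

lemma lintegral_transversal_slice {c x ξ μ : ℝ} (hc : 0 < c) (hx : x ≠ 0) (hX : ξ - x ≠ 0)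
    (hξ : ξ ≠ 0) (F : ℝ → ℝ≥0∞) :
    ofReal (c * |ξ|) * ∫⁻ y, (transversal c).indicator 1 ((x, y), (ξ, μ) - (x, y)) *
      F (reson (x, y) ((ξ, μ) - (x, y))) ≤ ∫⁻ s, F s := by
  have hp : x * (ξ - x) ≠ 0 := mul_ne_zero hx hX
  have h := lintegral_comp_quadratic_le (e := -3 * (x * (ξ - x)) * ξ) (α := ξ / (x * (ξ - x)))
    (c := c * |x * (ξ - x)|) (div_ne_zero hξ hp) (by positivity) F
  rw [abs_div, show |ξ| / |x * (ξ - x)| * (c * |x * (ξ - x)|) = c * |ξ| by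
    have := abs_ne_zero.2 hp; field_simp] at h
  refine le_trans (le_of_eq ?_) h
  congr 1
  have hms : MeasurableSet {v : ℝ | c * |x * (ξ - x)| ≤ |v|} :=
    measurableSet_le measurable_const (by fun_prop)
  rw [← lintegral_indicator hms, ← lintegral_sub_right_eq_self
    (Set.indicator {v : ℝ | c * |x * (ξ - x)| ≤ |v|} _) (x * μ / ξ)]
  congr 1; ext y
  rw [reson_sub hx hX hξ]
  have : ((x, y), (ξ, μ) - (x, y)) ∈ transversal c ↔
      y - x * μ / ξ ∈ {v : ℝ | c * |x * (ξ - x)| ≤ |v|} := by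
    simp only [transversal, mem_ofPred_eq, slopeDiff_sub hx hX hξ, abs_div]
    rw [le_div_iff₀ (abs_pos.2 hp)]
  by_cases h : ((x, y), (ξ, μ) - (x, y)) ∈ transversal c
  · have h' := this.1 h
    simp only [mem_ofPred_eq] at h'
    rw [indicator_of_mem h, indicator_of_mem (by exact h')]; simp
  · have h' := mt this.2 h
    simp only [mem_ofPred_eq] at h'
    rw [indicator_of_notMem h, indicator_of_notMem (by exact h')]; simp

lemma ae_ne_real (a : ℝ) : ∀ᵐ x : ℝ, x ≠ a := by simp [ae_iff]

lemma bform_transversal_sq_le {c K : ℝ} (hc : 0 < c) (hK : 0 < K) (hf : Measurable f)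
    (hg : Measurable g) (hH : Measurable H)
    (hHK : ∀ r s, H (r, s) ≠ 0 → K ≤ |r.1| ∧ |r.1| ≤ 32 * K) :
    bform (transversal c) f g H ^ 2 ≤ ofReal (64 / c) *
      ((∫⁻ p, f p ^ 2) * (∫⁻ p, g p ^ 2) * ∫⁻ z, H z ^ 2) := by
  have hS := measurableSet_transversal c
  have hmeas : Measurable (Function.uncurry fun p q : ℝ² =>
      (transversal c).indicator (1 : ℝ⁴ → ℝ≥0∞) (p, q) * (f p * g q * H (p + q, reson p q))) :=
    measurable_bform_integrand hS hf hg hH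
  have hI : Measurable ((transversal c).indicator (1 : ℝ⁴ → ℝ≥0∞)) := measurable_one.indicator hS
  obtain ⟨G, hG⟩ : ∃ G : ℝ² → ℝ² → ℝ≥0∞, ∀ r p, G r p =
      (transversal c).indicator 1 (p, r - p) * (f p * g (r - p) * H (r, reson p (r - p))) :=
    ⟨_, fun _ _ => rfl⟩
  have hGm : Measurable (Function.uncurry G) := by simp only [hG, Function.uncurry_def]; fun_prop
  set Q : ℝ → ℝ≥0∞ := fun ξ => ∫⁻ μ, ∫⁻ s, H ((ξ, μ), s) ^ 2 with hQ
  have hQm : Measurable Q := by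
    have h1 : Measurable fun z : ℝ² × ℝ => H ((z.1.1, z.1.2), z.2) ^ 2 := by
      exact (hH.comp measurable_id).pow_const 2
    exact (h1.lintegral_prod_right').lintegral_prod_right'
  set a : ℝ → ℝ≥0∞ := fun x => ∫⁻ y, f (x, y) ^ 2 with ha
  have ham : Measurable a := (hf.pow_const 2).lintegral_prod_right'
  set b : ℝ → ℝ≥0∞ := fun x => ∫⁻ y, g (x, y) ^ 2 with hb
  have hbm : Measurable b := (hg.pow_const 2).lintegral_prod_right'
  set A := ∫⁻ p, f p ^ 2 with hA
  set B := ∫⁻ p, g p ^ 2 with hB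
  have hAa : A = ∫⁻ x, a x := by rw [hA, lintegral_prod₂ (hf.pow_const 2)]
  have hBb : B = ∫⁻ x, b x := by rw [hB, lintegral_prod₂ (hg.pow_const 2)]
  have hQQ : ∫⁻ z, H z ^ 2 = ∫⁻ ξ, Q ξ := by
    rw [lintegral_prod₂ (hH.pow_const 2), lintegral_prod₂ (hH.pow_const 2).lintegral_prod_right']
  set D : ℝ≥0∞ := ofReal (c * K)⁻¹ with hD
  -- the bound for fixed first coordinates
  have step1 : ∀ ξ x : ℝ, K ≤ |ξ| → x ≠ 0 → ξ - x ≠ 0 →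
      (∫⁻ μ, ∫⁻ y, G (ξ, μ) (x, y)) ^ 2 ≤ (a x * b (ξ - x)) * (D * Q ξ) := by
    intro ξ x hξ hx hX
    have hξ0 : ξ ≠ 0 := fun h => by rw [h, abs_zero] at hξ; linarith
    have h1 : Measurable fun z : ℝ² => G (ξ, z.1) (x, z.2) :=
      hGm.comp (by fun_prop : Measurable fun z : ℝ² => ((ξ, z.1), (x, z.2)))
    have hm1 : Measurable fun z : ℝ² => f (x, z.2) ^ 2 * g (ξ - x, z.1 - z.2) ^ 2 := by fun_prop
    have hm2 : Measurable fun z : ℝ² => (transversal c).indicator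
        (1 : ℝ⁴ → ℝ≥0∞) ((x, z.2), (ξ, z.1) - (x, z.2)) *
        H ((ξ, z.1), reson (x, z.2) ((ξ, z.1) - (x, z.2))) ^ 2 := by
      fun_prop
    have h2 : (∫⁻ z : ℝ², G (ξ, z.1) (x, z.2)) ^ 2 ≤
        (∫⁻ z : ℝ², f (x, z.2) ^ 2 * g (ξ - x, z.1 - z.2) ^ 2) *
        ∫⁻ z : ℝ², (transversal c).indicator 1 ((x, z.2), (ξ, z.1) - (x, z.2)) *
          H ((ξ, z.1), reson (x, z.2) ((ξ, z.1) - (x, z.2))) ^ 2 := by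
      refine lintegral_sq_le hm1.aemeasurable hm2.aemeasurable (.of_forall fun z => ?_)
      simp only [hG, Prod.mk_sub_mk]
      by_cases h : ((x, z.2), (ξ - x, z.1 - z.2)) ∈ transversal c
      · rw [indicator_of_mem h]; simp only [Pi.one_apply, one_mul]; rw [mul_pow, mul_pow]
      · rw [indicator_of_notMem h]; simp
    have h3 : ∫⁻ z : ℝ², f (x, z.2) ^ 2 * g (ξ - x, z.1 - z.2) ^ 2 = a x * b (ξ - x) := by
      rw [lintegral_prod_symm₂ hm1]
      have : ∀ y, ∫⁻ μ, f (x, y) ^ 2 * g (ξ - x, μ - y) ^ 2 = f (x, y) ^ 2 * b (ξ - x) := by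
        intro y
        have hm : Measurable fun z : ℝ => g (ξ - x, z - y) ^ 2 := by fun_prop
        rw [lintegral_const_mul _ hm]
        congr 1
        exact lintegral_sub_right_eq_self (fun μ => g (ξ - x, μ) ^ 2) y
      simp only [this]
      rw [lintegral_mul_const]
      exact (hf.comp (by fun_prop : Measurable fun z : ℝ => (x, z))).pow_const 2
    have h4 : ∫⁻ z : ℝ², (transversal c).indicator 1 ((x, z.2), (ξ, z.1) - (x, z.2)) *
          H ((ξ, z.1), reson (x, z.2) ((ξ, z.1) - (x, z.2))) ^ 2 ≤ D * Q ξ := by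
      rw [lintegral_prod₂ hm2, hQ]
      simp only
      rw [← lintegral_const_mul' _ _ ofReal_ne_top]
      refine lintegral_mono fun μ => ?_
      simp only
      have h5 := lintegral_transversal_slice (μ := μ) hc hx hX hξ0 (fun s => H ((ξ, μ), s) ^ 2)
      refine le_ofReal_inv_mul (by positivity) (le_trans ?_ h5)
      gcongr
    rw [lintegral_prod₂ h1] at h2
    refine h2.trans ?_
    rw [h3]; gcongr
  have hzero : ∀ ξ μ p, ¬ (K ≤ |ξ| ∧ |ξ| ≤ 32 * K) → G (ξ, μ) p = 0 := by
    intro ξ μ p h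
    have : H ((ξ, μ), reson p ((ξ, μ) - p)) = 0 := by by_contra h'; exact h (hHK _ _ h')
    simp [hG, this]
  have step2 : ∀ ξ : ℝ, (∫⁻ x, ∫⁻ μ, ∫⁻ y, G (ξ, μ) (x, y)) ^ 2 ≤
      (Icc (-(32 * K)) (32 * K)).indicator 1 ξ * (A * B * (D * Q ξ)) := by
    intro ξ
    by_cases hξ : K ≤ |ξ| ∧ |ξ| ≤ 32 * K
    · rw [indicator_of_mem (s := Icc (-(32 * K)) (32 * K)) (abs_le.1 hξ.2), Pi.one_apply, one_mul]
      have h6 : (∫⁻ x, ∫⁻ μ, ∫⁻ y, G (ξ, μ) (x, y)) ^ 2 ≤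
          (∫⁻ x, a x) * ∫⁻ x, b (ξ - x) * (D * Q ξ) := by
        refine lintegral_sq_le ham.aemeasurable
          (by fun_prop : Measurable fun x : ℝ => b (ξ - x) * (D * Q ξ)).aemeasurable ?_
        filter_upwards [ae_ne_real 0, ae_ne_real ξ] with x hx hx'
        rw [← mul_assoc]
        exact step1 ξ x hξ.1 hx (sub_ne_zero.2 hx'.symm)
      rw [lintegral_mul_const _ (by fun_prop : Measurable fun x : ℝ => b (ξ - x)),
        lintegral_sub_left_eq_self b ξ, ← hAa, ← hBb, ← mul_assoc] at h6
      exact h6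
    · simp only [hzero ξ _ _ hξ]; simp
  have hre : bform (transversal c) f g H = ∫⁻ ξ, ∫⁻ x, ∫⁻ μ, ∫⁻ y, G (ξ, μ) (x, y) := by
    have hGm4 : Measurable fun z : (ℝ² × ℝ) × ℝ => G (z.1.1.1, z.1.2) (z.1.1.2, z.2) :=
      hGm.comp (by fun_prop : Measurable fun z : (ℝ² × ℝ) × ℝ =>
        ((z.1.1.1, z.1.2), (z.1.1.2, z.2)))
    rw [bform_eq hS hf hg hH]
    simp only [← hG]
    rw [lintegral_prod₂ (F := fun r => ∫⁻ p, G r p) hGm.lintegral_prod_right']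
    congr 1; ext ξ
    have h7 := hGm4.lintegral_prod_right' (ν := (volume : Measure ℝ))
    rw [lintegral_lintegral_swap (f := fun x μ => ∫⁻ y, G (ξ, μ) (x, y))
      (h7.comp (by fun_prop : Measurable fun z : ℝ² => ((ξ, z.1), z.2))).aemeasurable]
    congr 1; ext μ
    exact lintegral_prod₂ (hGm.comp (by fun_prop : Measurable fun z : ℝ² => ((ξ, μ), z)))
  rw [hre]
  have h8 := lintegral_sq_le (m := volume) (X := fun ξ => ∫⁻ x, ∫⁻ μ, ∫⁻ y, G (ξ, μ) (x, y))
    (A := (Icc (-(32 * K)) (32 * K)).indicator 1) (B := fun ξ => A * B * (D * Q ξ))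
    (measurable_one.indicator measurableSet_Icc).aemeasurable
    ((hQm.const_mul D).const_mul (A * B)).aemeasurable (.of_forall step2)
  refine h8.trans (le_of_eq ?_)
  rw [lintegral_const_mul _ (hQm.const_mul D), lintegral_const_mul _ hQm, ← hQQ,
    lintegral_indicator measurableSet_Icc]
  simp only [Pi.one_apply, lintegral_one, restrict_apply_univ, Real.volume_Icc]
  rw [show ofReal (64 / c) = ofReal (32 * K - -(32 * K)) * D by
    rw [hD, ← ofReal_mul (by linarith)]; congr 1; field_simp; ring]
  ring

/-! ### Interactions of frequencies of the same sign -/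

lemma lintegral_annulus_le {ξ μ : ℝ} (hξ : ξ ≠ 0) {F : ℝ → ℝ≥0∞} (hF : Measurable F) :
    ∫⁻ p : ℝ², {p : ℝ² | 0 < p.1 * (ξ - p.1)}.indicator 1 p *
      F (reson p ((ξ, μ) - p)) ≤ 3 * ∫⁻ s, F s := by
  set W : ℝ → ℝ → ℝ≥0∞ := fun D v => F (-3 * ξ ^ 3 / 4 + 3 * ξ / 4 * (D ^ 2 + v ^ 2)) with hW
  have hWm : Measurable (Function.uncurry W) := hF.comp (by fun_prop)
  have slice : ∀ x : ℝ, ∫⁻ y, {p : ℝ² | 0 < p.1 * (ξ - p.1)}.indicator 1 (x, y) *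
      F (reson (x, y) ((ξ, μ) - (x, y))) ≤ ofReal (|ξ| / 2) * ∫⁻ v, W (2 * x - ξ) v := by
    intro x
    by_cases hx : 0 < x * (ξ - x)
    · have hx0 : x ≠ 0 := fun h => by simp [h] at hx
      have hX0 : ξ - x ≠ 0 := fun h => by simp [h] at hx
      have hind : ∀ y, {p : ℝ² | 0 < p.1 * (ξ - p.1)}.indicator
          (1 : ℝ² → ℝ≥0∞) (x, y) = 1 := fun y => indicator_of_mem (by exact hx) _
      simp only [hind, one_mul, reson_sub hx0 hX0 hξ]
      rw [lintegral_sub_right_eq_self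
        (fun ν => F (-3 * (x * (ξ - x)) * ξ + ξ / (x * (ξ - x)) * ν ^ 2)) (x * μ / ξ)]
      have hsq : 0 < √(3 * (x * (ξ - x))) / 2 := by positivity
      rw [lintegral_scale_left hsq.ne']
      rw [abs_of_pos hsq]
      gcongr
      · have h1 : 3 * (x * (ξ - x)) ≤ |ξ| ^ 2 := by
          rw [sq_abs]; nlinarith [sq_nonneg (2 * x - ξ), sq_nonneg ξ]
        have := Real.sqrt_le_sqrt h1
        rwa [Real.sqrt_sq (abs_nonneg ξ)] at this
      · refine le_of_eq ?_
        simp only [hW]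
        congr 1
        rw [mul_pow, div_pow, sq_sqrt (by positivity)]
        field_simp
        ring
    · have hind : ∀ y, {p : ℝ² | 0 < p.1 * (ξ - p.1)}.indicator
          (1 : ℝ² → ℝ≥0∞) (x, y) = 0 := fun y => indicator_of_notMem (by exact hx) _
      simp [hind]
  have hI : Measurable ({p : ℝ² | 0 < p.1 * (ξ - p.1)}.indicator (1 : ℝ² → ℝ≥0∞)) :=
    measurable_one.indicator (measurableSet_lt measurable_const (by fun_prop))
  have hm : Measurable fun p : ℝ² => {p : ℝ² | 0 < p.1 * (ξ - p.1)}.indicator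
      (1 : ℝ² → ℝ≥0∞) p * F (reson p ((ξ, μ) - p)) := by
    exact hI.mul (by fun_prop)
  have polar : ∫⁻ D, ∫⁻ v, W D v ≤ ofReal (2 * π) * (ofReal (3 * |ξ| / 2)⁻¹ * ∫⁻ s, F s) := by
    have e1 : ∫⁻ D, ∫⁻ v, W D v = ∫⁻ z : ℝ², W z.1 z.2 := by exact (lintegral_prod₂ hWm).symm
    rw [e1, ← lintegral_comp_polarCoord_symm]
    have e2 : ∀ z : ℝ², W (polarCoord.symm z).1 (polarCoord.symm z).2 =
        F (-3 * ξ ^ 3 / 4 + 3 * ξ / 4 * z.1 ^ 2) := by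
      intro z
      rw [hW]; simp only [polarCoord_symm_apply]
      congr 3
      rw [mul_pow, mul_pow, ← mul_add, Real.cos_sq_add_sin_sq, mul_one]
    simp only [e2, polarCoord_target, smul_eq_mul]
    rw [volume_eq_prod, ← Measure.prod_restrict, lintegral_prod _ (by
      apply Measurable.aemeasurable
      exact (by fun_prop : Measurable fun z : ℝ² => ofReal z.1).mul (hF.comp (by fun_prop)))]
    simp only [lintegral_const, restrict_apply_univ, Real.volume_Ioo]
    rw [lintegral_mul_const']
    swap; · exact ofReal_ne_top
    rw [mul_comm, show π - -π = 2 * π by ring]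
    gcongr
    refine le_ofReal_inv_mul (by positivity) ?_
    rw [← lintegral_const_mul' _ _ ofReal_ne_top]
    refine le_trans (le_of_eq ?_) (lintegral_comp_le_of_le_deriv (s := Ioi (0 : ℝ))
      (f := fun t => -3 * ξ ^ 3 / 4 + 3 * ξ / 4 * t ^ 2) (f' := fun t => 3 * ξ / 4 * (2 * t))
      (w := fun t => 3 * |ξ| / 2 * t) measurableSet_Ioi ?_ ?_ ?_ F)
    · refine setLIntegral_congr_fun measurableSet_Ioi fun t ht => ?_
      rw [ofReal_mul (by positivity), mul_assoc]
    · intro t _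
      have := ((hasDerivAt_pow 2 t).const_mul (3 * ξ / 4)).const_add (-3 * ξ ^ 3 / 4)
      simpa using this
    · intro s hs t ht h
      simp only at h
      have h' : s ^ 2 = t ^ 2 := mul_left_cancel₀ (mul_ne_zero (by norm_num) hξ :
        3 / 4 * ξ ≠ 0) (by linarith)
      exact (pow_left_inj₀ (le_of_lt hs) (le_of_lt ht) two_ne_zero).1 h'
    · intro t ht
      have ht' : 0 < t := ht
      rw [abs_mul, abs_div, abs_mul, abs_of_pos (by positivity : 0 < 2 * t)]
      norm_num
      linarith
  rw [lintegral_prod₂ hm]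
  calc _ ≤ ∫⁻ x, ofReal (|ξ| / 2) * ∫⁻ v, W (2 * x - ξ) v := lintegral_mono slice
    _ = ofReal (|ξ| / 2) * ∫⁻ x, ∫⁻ v, W (2 * x - ξ) v := lintegral_const_mul' _ _ ofReal_ne_top
    _ ≤ ofReal (|ξ| / 2) * ∫⁻ D, ∫⁻ v, W D v := by
        refine mul_le_mul_right ?_ _
        rw [← lintegral_sub_right_eq_self (fun D => ∫⁻ v, W D v) ξ,
          lintegral_scale_left (two_ne_zero) (fun D => ∫⁻ v, W (D - ξ) v)]
        calc ∫⁻ x, ∫⁻ v, W (2 * x - ξ) v = 1 * ∫⁻ x, ∫⁻ v, W (2 * x - ξ) v := by rw [one_mul]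
          _ ≤ _ := by gcongr; rw [abs_two]; norm_num
    _ ≤ ofReal (|ξ| / 2) * (ofReal (2 * π) * (ofReal (3 * |ξ| / 2)⁻¹ * ∫⁻ s, F s)) := by gcongr
    _ ≤ 3 * ∫⁻ s, F s := by
        rw [← mul_assoc, ← mul_assoc, ← ofReal_mul (by positivity), ← ofReal_mul (by positivity)]
        gcongr
        rw [show |ξ| / 2 * (2 * π) * (3 * |ξ| / 2)⁻¹ = 2 * π / 3 by
          have := abs_ne_zero.2 hξ; field_simp]
        rw [show (3 : ℝ≥0∞) = ofReal 3 by simp]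
        apply ofReal_le_ofReal
        have := Real.pi_lt_d2
        linarith

/-- The set of interactions of frequencies of the same sign. -/
def sameSign : Set ℝ⁴ := {z | 0 < z.1.1 * z.2.1}

lemma measurableSet_sameSign : MeasurableSet sameSign :=
  measurableSet_lt measurable_const (by fun_prop)

lemma ae_prod_fst_ne (a : ℝ) : ∀ᵐ r : ℝ², r.1 ≠ a := by
  rw [volume_eq_prod]
  exact Measure.quasiMeasurePreserving_fst.ae (ae_ne_real a)

lemma bform_sameSign_sq_le (hf : Measurable f) (hg : Measurable g) (hH : Measurable H) :
    bform sameSign f g H ^ 2 ≤ 3 * ((∫⁻ p, f p ^ 2) * (∫⁻ p, g p ^ 2) * ∫⁻ z, H z ^ 2) := by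
  rw [bform_eq measurableSet_sameSign hf hg hH]
  have hm1 : Measurable fun z : ℝ⁴ => f z.2 ^ 2 * g (z.1 - z.2) ^ 2 :=
    ((hf.comp measurable_snd).pow_const 2).mul
      ((hg.comp (measurable_fst.sub measurable_snd)).pow_const 2)
  have hQm : Measurable fun r : ℝ² => ∫⁻ s, H (r, s) ^ 2 := (hH.pow_const 2).lintegral_prod_right'
  have key : ∀ r : ℝ², r.1 ≠ 0 → (∫⁻ p, sameSign.indicator 1 (p, r - p) *
      (f p * g (r - p) * H (r, reson p (r - p)))) ^ 2 ≤
      (∫⁻ p, f p ^ 2 * g (r - p) ^ 2) * (3 * ∫⁻ s, H (r, s) ^ 2) := by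
    intro r hr
    have e : Measurable fun p : ℝ² => (p, r - p) :=
      measurable_id.prodMk (measurable_const.sub measurable_id)
    refine (lintegral_sq_le (B := fun p => sameSign.indicator 1 (p, r - p) *
      H (r, reson p (r - p)) ^ 2) (A := fun p => f p ^ 2 * g (r - p) ^ 2)
      (hm1.comp (f := fun p => (r, p)) (by fun_prop)).aemeasurable ?_
      (.of_forall fun p => ?_)).trans ?_
    · exact (((measurable_one.indicator measurableSet_sameSign).comp e).mul
        ((hH.comp (measurable_const.prodMk (measurable_reson.comp e))).pow_const 2)).aemeasurable
    · by_cases h : (p, r - p) ∈ sameSign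
      · simp only [indicator_of_mem h, Pi.one_apply, one_mul]; rw [mul_pow, mul_pow]
      · simp [indicator_of_notMem h]
    · gcongr
      exact lintegral_annulus_le (μ := r.2) hr (F := fun s => H (r, s) ^ 2)
        ((hH.comp (by fun_prop : Measurable fun s : ℝ => (r, s))).pow_const 2)
  refine (lintegral_sq_le hm1.lintegral_prod_right'.aemeasurable (hQm.const_mul 3).aemeasurable
    ((ae_prod_fst_ne 0).mono key)).trans (le_of_eq ?_)
  rw [lintegral_const_mul _ hQm]
  have e1 : ∫⁻ r, ∫⁻ p, f p ^ 2 * g (r - p) ^ 2 = (∫⁻ p, f p ^ 2) * ∫⁻ p, g p ^ 2 := by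
    have hm2 : Measurable (Function.uncurry fun p q : ℝ² => f p ^ 2 * g q ^ 2) := by
      unfold Function.uncurry; fun_prop
    rw [← lintegral_lintegral_add_comm volume hm2]
    simp only [lintegral_const_mul _ (hg.pow_const 2)]
    rw [lintegral_mul_const _ (hf.pow_const 2)]
  have e2 : ∫⁻ z, H z ^ 2 = ∫⁻ r, ∫⁻ s, H (r, s) ^ 2 := by exact lintegral_prod₂ (hH.pow_const 2)
  rw [e1, e2]; ring

/-! ### Interactions along a family of parallel slopes -/

variable {f g : ℝ² → ℝ≥0∞} {H : ℝ² × ℝ → ℝ≥0∞} {S : Set ℝ⁴}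

/-- The point of first coordinate `x` on the curve `μ = ξ (b ξ + β)`. -/
def curve (b β x : ℝ) : ℝ² := (x, x * (b * x + β))

@[fun_prop]
lemma measurable_curve (b : ℝ) : Measurable fun z : ℝ² => curve b z.1 z.2 := by
  unfold curve; fun_prop

lemma slopeDiff_curve {b β x ξ μ : ℝ} (hx : x ≠ 0) (hX : ξ - x ≠ 0) (hξ : ξ ≠ 0) :
    slopeDiff (curve b β x) ((ξ, μ) - curve b β x) = (b * x + β - μ / ξ) / (ξ - x) := by
  simp only [slopeDiff, curve, Prod.mk_sub_mk]
  rw [show x + (ξ - x) = ξ by ring]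
  field_simp
  ring

lemma hasDerivAt_reson_curve {b β x ξ μ : ℝ} (hx : x ≠ 0) (hX : ξ - x ≠ 0) (hξ : ξ ≠ 0) :
    HasDerivAt (fun x => reson (curve b β x) ((ξ, μ) - curve b β x))
      (ξ * (x * (3 + slopeDiff (curve b β x) ((ξ, μ) - curve b β x) ^ 2 +
          2 * b * slopeDiff (curve b β x) ((ξ, μ) - curve b β x)) +
        (ξ - x) * (slopeDiff (curve b β x) ((ξ, μ) - curve b β x) ^ 2 - 3))) x := by
  have e : (fun x => reson (curve b β x) ((ξ, μ) - curve b β x)) = fun x =>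
      x ^ 3 + x * (b * x + β) ^ 2 + (ξ - x) ^ 3 + (μ - x * (b * x + β)) ^ 2 / (ξ - x) -
        omega ξ μ := by
    funext x
    simp only [reson, curve, Prod.mk_sub_mk]
    rw [show x + (ξ - x) = ξ by ring, show x * (b * x + β) + (μ - x * (b * x + β)) = μ by ring]
    have : (x * (b * x + β)) ^ 2 / x = x * (b * x + β) ^ 2 := by
      rcases eq_or_ne x 0 with h | h
      · simp [h]
      · field_simp
    simp only [omega, this]
    ring
  rw [e, slopeDiff_curve hx hX hξ]
  have h1 : HasDerivAt (fun x : ℝ => b * x + β) b x := by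
    simpa using ((hasDerivAt_id x).const_mul b).add_const β
  have h2 : HasDerivAt (fun x : ℝ => ξ - x) (-1) x := by simpa using (hasDerivAt_id x).const_sub ξ
  have h3 := (hasDerivAt_id x).mul h1
  have h4 := ((((hasDerivAt_id x).pow 3).add ((hasDerivAt_id x).mul (h1.pow 2))).add
    (h2.pow 3)).add (((h3.const_sub μ).pow 2).div h2 hX)
  have h5 := h4.sub_const (omega ξ μ)
  refine (h5.congr_deriv ?_).congr_of_eventuallyEq (.of_forall fun y => ?_)
  · simp only [id, Pi.mul_apply, Pi.pow_apply]
    field_simp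
    ring
  · simp [Pi.add_apply, Pi.mul_apply, Pi.pow_apply, Pi.div_apply]

lemma reson_curve_sub {b β x y ξ μ : ℝ} (hx : x ≠ 0) (hX : ξ - x ≠ 0) (hy : y ≠ 0)
    (hY : ξ - y ≠ 0) (hξ : ξ ≠ 0) {d e : ℝ}
    (hd : d = slopeDiff (curve b β x) ((ξ, μ) - curve b β x))
    (he : e = slopeDiff (curve b β y) ((ξ, μ) - curve b β y)) :
    reson (curve b β x) ((ξ, μ) - curve b β x) - reson (curve b β y) ((ξ, μ) - curve b β y) =
      ξ * (x - y) * ((ξ - x) * d ^ 2 + y * b * d + y * e * (b + d) + 3 * (x + y - ξ)) := by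
  have r : ∀ x : ℝ, x ≠ 0 → ξ - x ≠ 0 →
      reson (curve b β x) ((ξ, μ) - curve b β x) = x * (ξ - x) * ξ *
        (slopeDiff (curve b β x) ((ξ, μ) - curve b β x) ^ 2 - 3) := by
    intro x hx hX
    have h := reson_eq (p := curve b β x) (q := (ξ, μ) - curve b β x) hx hX (by simp [curve, hξ])
    rw [h]
    simp [curve]
  rw [r x hx hX, r y hy hY, ← hd, ← he]
  rw [slopeDiff_curve hx hX hξ] at hd
  rw [slopeDiff_curve hy hY hξ] at he
  have hd' : d * (ξ - x) = b * x + β - μ / ξ := by rw [hd]; field_simp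
  have he' : e * (ξ - y) = b * y + β - μ / ξ := by rw [he]; field_simp
  have hde : (d - e) * (ξ - y) = (b + d) * (x - y) := by linear_combination hd' - he'
  have hde' : d * (ξ - x) - e * (ξ - y) = b * (x - y) := by linear_combination hd' - he'
  linear_combination ξ * y * d * hde' + ξ * y * e * hde

lemma bform_slope_sq_le (hS : MeasurableSet S) (b : ℝ) {r W : ℝ → ℝ≥0∞} (hr : Measurable r)
    (hW : Measurable W) {c : ℝ} (hc : 0 < c)
    (hne : ∀ p q, (p, q) ∈ S → p.1 ≠ 0 ∧ q.1 ≠ 0 ∧ p.1 + q.1 ≠ 0)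
    (hJ : ∀ p q, (p, q) ∈ S → c * |p.1| ≤ |(p.1 + q.1) * (p.1 * (3 + slopeDiff p q ^ 2 +
      2 * b * slopeDiff p q) + q.1 * (slopeDiff p q ^ 2 - 3))|)
    (hinj : ∀ β ξ μ, InjOn (fun x => reson (curve b β x) ((ξ, μ) - curve b β x))
      {x | (curve b β x, (ξ, μ) - curve b β x) ∈ S})
    (hrW : ∀ p q, (p, q) ∈ S → 1 ≤ r ((p.1 + q.1) * (slopeDiff p q - b)) * W (reson p q))
    (hf : Measurable f) (hg : Measurable g) (hH : Measurable H) :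
    bform S f g H ^ 2 ≤ ofReal c⁻¹ * (∫⁻ s, r s ^ 2) *
      ((∫⁻ p, f p ^ 2) * (∫⁻ p, g p ^ 2) * ∫⁻ z, (W z.2 * H z) ^ 2) := by
  have hI : Measurable (S.indicator (1 : ℝ⁴ → ℝ≥0∞)) := measurable_one.indicator hS
  set β₂ : ℝ² → ℝ := fun q => q.2 / q.1 + b * q.1 with hβ₂
  have hβm : Measurable β₂ := by simp only [hβ₂]; fun_prop
  set Z : ℝ² × ℝ → ℝ≥0∞ := fun z => (W z.2 * H z) ^ 2 with hZ
  have hZm : Measurable Z := by simp only [hZ]; fun_prop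
  obtain ⟨E, hE⟩ : ∃ E : ℝ² → ℝ² → ℝ≥0∞, ∀ p q, E p q =
      S.indicator 1 (p, q) * (f p * g q * (r (p.2 / p.1 - b * p.1 - β₂ q) *
        (W (reson p q) * H (p + q, reson p q)))) := ⟨_, fun _ _ => rfl⟩
  have hEm : Measurable (Function.uncurry E) := by simp only [hE, Function.uncurry_def]; fun_prop
  have hle : bform S f g H ≤ ∫⁻ p, ∫⁻ q, E p q := by
    unfold bform
    refine lintegral_mono fun p => lintegral_mono fun q => ?_
    simp only [hE]
    by_cases h : (p, q) ∈ S
    · have h1 := hrW p q h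
      obtain ⟨hp, hq, hpq⟩ := hne p q h
      rw [show (p.1 + q.1) * (slopeDiff p q - b) = p.2 / p.1 - b * p.1 - β₂ q by
        simp only [slopeDiff, hβ₂]; field_simp; ring] at h1
      gcongr
      calc H (p + q, reson p q) = 1 * H (p + q, reson p q) := by rw [one_mul]
        _ ≤ _ := by rw [← mul_assoc]; gcongr
    · simp [indicator_of_notMem h]
  have hsub : ∀ x : ℝ, x ≠ 0 → ∫⁻ y, ∫⁻ q, E (x, y) q =
      ∫⁻ β, ofReal |x| * ∫⁻ q, E (curve b β x) q := by
    intro x hx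
    rw [lintegral_const_mul' _ _ ofReal_ne_top, lintegral_scale_left hx (fun y => ∫⁻ q, E (x, y) q)]
    congr 1
    rw [← lintegral_add_right_eq_self (fun v => ∫⁻ q, E (x, x * v) q) (b * x)]
    refine lintegral_congr fun β => ?_
    rw [add_comm β]; rfl
  have hre : ∫⁻ p, ∫⁻ q, E p q = ∫⁻ β, ∫⁻ z : ℝ³, ofReal |z.1| * E (curve b β z.1) z.2 := by
    have hm1 : Measurable fun z : ℝ⁴ =>
        ofReal |z.1.1| * E (curve b z.1.2 z.1.1) z.2 := by
      have := hEm.comp (by fun_prop : Measurable fun z : ℝ⁴ =>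
        (curve b z.1.2 z.1.1, z.2))
      simp only [Function.comp_def, Function.uncurry_def] at this
      fun_prop
    have hm2 : Measurable fun z : ℝ × ℝ³ =>
        ofReal |z.2.1| * E (curve b z.1 z.2.1) z.2.2 :=
      hm1.comp (by fun_prop : Measurable fun z : ℝ × ℝ³ => ((z.2.1, z.1), z.2.2))
    rw [lintegral_prod₂ (F := fun p => ∫⁻ q, E p q) hEm.lintegral_prod_right']
    have h1 : ∀ᵐ x : ℝ, ∫⁻ y, ∫⁻ q, E (x, y) q = ∫⁻ β, ∫⁻ q, ofReal |x| * E (curve b β x) q :=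
      (ae_ne_real 0).mono fun x hx => by
        rw [hsub x hx]; simp only [lintegral_const_mul' _ _ ofReal_ne_top]
    rw [lintegral_congr_ae h1, lintegral_lintegral_swap (f := fun x β =>
      ∫⁻ q, ofReal |x| * E (curve b β x) q) hm1.lintegral_prod_right'.aemeasurable]
    refine lintegral_congr fun β => ?_
    exact (lintegral_prod₂ (hm2.comp (by fun_prop : Measurable fun z : ℝ³ => (β, z)))).symm
  set a : ℝ → ℝ≥0∞ := fun β => ∫⁻ x, ofReal |x| * f (curve b β x) ^ 2 with ha
  set B : ℝ → ℝ≥0∞ := fun β => ∫⁻ q, g q ^ 2 * r (β - β₂ q) ^ 2 with hB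
  have ham2 : Measurable fun z : ℝ² => ofReal |z.2| * f (curve b z.1 z.2) ^ 2 := by fun_prop
  have ham : Measurable a := ham2.lintegral_prod_right'
  have hBm2 : Measurable fun z : ℝ³ => g z.2 ^ 2 * r (z.1 - β₂ z.2) ^ 2 := by fun_prop
  have hBm : Measurable B := hBm2.lintegral_prod_right'
  have hcurve : ∀ β, Measurable fun x => curve b β x := fun β => by unfold curve; fun_prop
  have hcs : ∀ β, (∫⁻ z : ℝ³, ofReal |z.1| * E (curve b β z.1) z.2) ^ 2 ≤
      (a β) * (B β * (ofReal c⁻¹ * ∫⁻ z, Z z)) := by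
    intro β
    have hcβ := hcurve β
    have hm3 : Measurable fun z : ℝ³ =>
        (ofReal |z.1| * f (curve b β z.1) ^ 2) * (g z.2 ^ 2 * r (β - β₂ z.2) ^ 2) := by
      fun_prop
    have hm4 : Measurable fun z : ℝ³ => ofReal |z.1| * (S.indicator 1 (curve b β z.1, z.2) *
          Z (curve b β z.1 + z.2, reson (curve b β z.1) z.2)) := by
      fun_prop
    have h1 := lintegral_sq_le (m := (volume : Measure ℝ³))
      (X := fun z => ofReal |z.1| * E (curve b β z.1) z.2)
      hm3.aemeasurable hm4.aemeasurable (by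
        have : ∀ᵐ z : ℝ³, z.1 ≠ 0 := by
          rw [volume_eq_prod]
          exact Measure.quasiMeasurePreserving_fst.ae (ae_ne_real 0)
        filter_upwards [this] with z hz
        simp only [hE, hZ]
        by_cases h : (curve b β z.1, z.2) ∈ S
        · rw [indicator_of_mem h, Pi.one_apply, one_mul, one_mul]
          have e1 : (curve b β z.1).2 / (curve b β z.1).1 -
              b * (curve b β z.1).1 - β₂ z.2 = β - β₂ z.2 := by
            simp only [curve]; field_simp; ring
          rw [e1]
          apply le_of_eq
          ring
        · simp [indicator_of_notMem h])
    refine h1.trans ?_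
    have h2 : ∫⁻ z : ℝ³, (ofReal |z.1| * f (curve b β z.1) ^ 2) *
        (g z.2 ^ 2 * r (β - β₂ z.2) ^ 2) = a β * B β := by
      rw [lintegral_prod₂ hm3]
      have hm5 : Measurable fun q => g q ^ 2 * r (β - β₂ q) ^ 2 := by fun_prop
      simp only [lintegral_const_mul _ hm5]
      rw [lintegral_mul_const _ (by fun_prop)]
    rw [h2, mul_assoc]
    gcongr
    rw [lintegral_prod₂ hm4]
    have hm6 : Measurable fun z : ℝ³ => ofReal |z.1| *
        (S.indicator 1 (curve b β z.1, z.2 - curve b β z.1) *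
          Z (z.2, reson (curve b β z.1) (z.2 - curve b β z.1))) := by
      fun_prop
    have h3 : ∀ x, ∫⁻ q, ofReal |x| * (S.indicator 1 (curve b β x, q) *
          Z (curve b β x + q, reson (curve b β x) q)) =
        ∫⁻ ρ, ofReal |x| * (S.indicator 1 (curve b β x, ρ - curve b β x) *
          Z (ρ, reson (curve b β x) (ρ - curve b β x))) := by
      intro x
      rw [← lintegral_sub_right_eq_self (fun q => ofReal |x| * (S.indicator 1 (curve b β x, q) *
          Z (curve b β x + q, reson (curve b β x) q))) (curve b β x)]
      simp only [add_sub_cancel]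
    simp only [h3]
    rw [lintegral_lintegral_swap (f := fun x ρ => ofReal |x| *
      (S.indicator 1 (curve b β x, ρ - curve b β x) *
          Z (ρ, reson (curve b β x) (ρ - curve b β x)))) hm6.aemeasurable,
      lintegral_prod₂ hZm, ← lintegral_const_mul' _ _ ofReal_ne_top]
    refine lintegral_mono fun ρ => ?_
    refine le_ofReal_inv_mul hc ?_
    set T : Set ℝ := {x | (curve b β x, ρ - curve b β x) ∈ S} with hT
    have hTm : MeasurableSet T := by
      have : Measurable fun x => (curve b β x, ρ - curve b β x) := by fun_prop
      exact this hS
    rw [← lintegral_const_mul' _ _ ofReal_ne_top]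
    refine le_trans (le_of_eq ?_) (lintegral_comp_le_of_le_deriv (s := T)
      (f := fun x => reson (curve b β x) (ρ - curve b β x))
      (f' := fun x => ρ.1 * (x * (3 + slopeDiff (curve b β x) (ρ - curve b β x) ^ 2 +
          2 * b * slopeDiff (curve b β x) (ρ - curve b β x)) +
        (ρ.1 - x) * (slopeDiff (curve b β x) (ρ - curve b β x) ^ 2 - 3)))
      (w := fun x => c * |x|) hTm ?_ ?_ ?_ (fun s => Z (ρ, s)))
    · rw [← lintegral_indicator hTm]
      refine lintegral_congr fun x => ?_
      by_cases h : x ∈ T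
      · have h' : (curve b β x, ρ - curve b β x) ∈ S := h
        rw [indicator_of_mem h, indicator_of_mem h', ofReal_mul hc.le]
        simp only [Pi.one_apply]; ring
      · have h' : (curve b β x, ρ - curve b β x) ∉ S := h
        rw [indicator_of_notMem h, indicator_of_notMem h']
        simp
    · intro x hx
      obtain ⟨h1, h2, h3⟩ := hne _ _ hx
      exact hasDerivAt_reson_curve (ξ := ρ.1) (μ := ρ.2) h1 h2 (by simpa [curve] using h3)
    · exact hinj β ρ.1 ρ.2
    · intro x hx
      have := hJ _ _ hx
      simpa [curve] using this
  have hfin := lintegral_sq_le (m := volume) ham.aemeasurable (hBm.mul_const _).aemeasurable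
    (.of_forall hcs)
  rw [lintegral_mul_const _ hBm] at hfin
  have hAf : ∫⁻ β, a β = ∫⁻ p, f p ^ 2 := by
    have hm7 : Measurable fun z : ℝ² => ofReal |z.1| * f (curve b z.2 z.1) ^ 2 := by fun_prop
    rw [lintegral_prod₂ (hf.pow_const 2), ha]
    simp only
    rw [lintegral_lintegral_swap (f := fun β x => ofReal |x| * f (curve b β x) ^ 2)
      ham2.aemeasurable]
    refine lintegral_congr_ae ((ae_ne_real 0).mono fun x hx => ?_)
    simp only
    rw [lintegral_const_mul' _ _ ofReal_ne_top, lintegral_scale_left hx (fun y => f (x, y) ^ 2)]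
    congr 1
    rw [← lintegral_add_right_eq_self (fun v => f (x, x * v) ^ 2) (b * x)]
    refine lintegral_congr fun β => ?_
    rw [add_comm β]; rfl
  have hBf : ∫⁻ β, B β = (∫⁻ p, g p ^ 2) * ∫⁻ s, r s ^ 2 := by
    rw [hB]; simp only
    rw [lintegral_lintegral_swap (f := fun β q => g q ^ 2 * r (β - β₂ q) ^ 2) hBm2.aemeasurable]
    have : ∀ q, ∫⁻ β, g q ^ 2 * r (β - β₂ q) ^ 2 = g q ^ 2 * ∫⁻ s, r s ^ 2 := by
      intro q
      rw [lintegral_const_mul _ (by fun_prop), lintegral_sub_right_eq_self (fun s => r s ^ 2)]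
    simp only [this]
    rw [lintegral_mul_const _ (hg.pow_const 2)]
  calc bform S f g H ^ 2 ≤ (∫⁻ p, ∫⁻ q, E p q) ^ 2 := by gcongr
    _ ≤ _ := by
      rw [hre]
      refine hfin.trans (le_of_eq ?_)
      rw [hAf, hBf]; ring

variable {f g : ℝ² → ℝ≥0∞} {H : ℝ² × ℝ → ℝ≥0∞} {S : Set ℝ⁴}

/-- Interactions of frequencies of opposite signs (the sign of the first one being that of `e`)
with almost parallel slopes. -/
def oppositeSign (e K : ℝ) : Set ℝ⁴ :=
  {z | 0 < e * z.1.1 ∧ e * z.2.1 < 0 ∧ |slopeDiff z.1 z.2| ≤ 1 ∧ K ≤ |z.1.1 + z.2.1| ∧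
    |z.1.1 + z.2.1| ≤ 32 * K}

lemma measurableSet_oppositeSign (e K : ℝ) : MeasurableSet (oppositeSign e K) := by
  have h1 : Measurable fun z : ℝ⁴ => |slopeDiff z.1 z.2| := by fun_prop
  have h2 : Measurable fun z : ℝ⁴ => |z.1.1 + z.2.1| := by fun_prop
  have h3 : Measurable fun z : ℝ⁴ => e * z.1.1 := by fun_prop
  have h4 : Measurable fun z : ℝ⁴ => e * z.2.1 := by fun_prop
  exact (measurableSet_lt measurable_const h3).inter ((measurableSet_lt h4 measurable_const).inter
    ((measurableSet_le h1 measurable_const).inter ((measurableSet_le measurable_const h2).inter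
      (measurableSet_le h2 measurable_const))))

lemma bform_oppositeSign_sq_le {e K : ℝ} (he : e = 1 ∨ e = -1) (hK : 0 < K) (hf : Measurable f)
    (hg : Measurable g) (hH : Measurable H) :
    bform (oppositeSign e K) f g H ^ 2 ≤ 32 *
      ((∫⁻ p, f p ^ 2) * (∫⁻ p, g p ^ 2) * ∫⁻ z, H z ^ 2) := by
  have hne : ∀ p q, (p, q) ∈ oppositeSign e K → p.1 ≠ 0 ∧ q.1 ≠ 0 ∧ p.1 + q.1 ≠ 0 := by
    rintro p q ⟨h1, h2, -, h4, -⟩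
    refine ⟨fun h => ?_, fun h => ?_, fun h => ?_⟩
    · simp [h] at h1
    · simp [h] at h2
    · simp only [h, abs_zero] at h4; linarith
  have hI : Measurable ((Icc (-(32 * K)) (32 * K)).indicator (1 : ℝ → ℝ≥0∞)) :=
    measurable_one.indicator measurableSet_Icc
  have h := bform_slope_sq_le (measurableSet_oppositeSign e K) 0
    (r := (Icc (-(32 * K)) (32 * K)).indicator 1) (W := fun _ => 1) hI measurable_const
    (c := 2 * K) (by positivity) hne ?_ ?_ ?_ hf hg hH
  · refine h.trans (le_of_eq ?_)
    have e1 : ∀ s : ℝ, (Icc (-(32 * K)) (32 * K)).indicator (1 : ℝ → ℝ≥0∞) s ^ 2 =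
        (Icc (-(32 * K)) (32 * K)).indicator (1 : ℝ → ℝ≥0∞) s := by
      intro s
      by_cases hs : s ∈ Icc (-(32 * K)) (32 * K)
      · simp [indicator_of_mem hs]
      · simp [indicator_of_notMem hs]
    simp only [e1, one_mul, lintegral_indicator measurableSet_Icc]
    simp only [Pi.one_apply, lintegral_one, restrict_apply_univ, Real.volume_Icc]
    rw [← ofReal_mul (by positivity), show (2 * K)⁻¹ * (32 * K - -(32 * K)) = 32 by
      field_simp; norm_num]
    norm_num
  · rintro p q ⟨h1, h2, h3, h4, -⟩
    set d := slopeDiff p q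
    have hd : d ^ 2 ≤ 1 := (sq_le_one_iff_abs_le_one d).2 h3
    rw [abs_mul]
    have e1 : p.1 * (3 + d ^ 2 + 2 * 0 * d) + q.1 * (d ^ 2 - 3) =
      3 * (p.1 - q.1) + (p.1 + q.1) * d ^ 2 := by ring
    rw [e1]
    have h5 : 2 * |p.1| ≤ |3 * (p.1 - q.1) + (p.1 + q.1) * d ^ 2| := by
      have hd0 := sq_nonneg d
      simp only at h1 h2
      rcases he with rfl | rfl
      · have hp : 0 < p.1 := by linarith
        have hq : q.1 < 0 := by linarith
        rw [abs_of_pos hp]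
        refine le_trans ?_ (le_abs_self _)
        nlinarith [mul_nonneg hp.le hd0, mul_nonneg (neg_pos.2 hq).le (sub_nonneg.2 hd)]
      · have hp : p.1 < 0 := by linarith
        have hq : 0 < q.1 := by linarith
        rw [abs_of_neg hp]
        refine le_trans ?_ (neg_abs_le _ |> fun h => neg_le.1 h)
        nlinarith [mul_nonneg (neg_pos.2 hp).le hd0, mul_nonneg hq.le (sub_nonneg.2 hd)]
    simp only at h4
    calc 2 * K * |p.1| = K * (2 * |p.1|) := by ring
      _ ≤ _ := by gcongr
  · intro β ξ μ x hx y hy hxy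
    simp only at hxy
    obtain ⟨hx1, hx2, hx3⟩ := hne _ _ hx
    obtain ⟨hy1, hy2, hy3⟩ := hne _ _ hy
    obtain ⟨a1, a2, a3, a4, -⟩ := hx
    obtain ⟨b1, b2, b3, b4, -⟩ := hy
    simp only [curve, Prod.fst_sub, add_sub_cancel] at hx1 hx2 hx3 hy1 hy2 hy3 a1 a2 b1 b2
    have hsub := reson_curve_sub (μ := μ) (b := 0) (β := β) hx1 hx2 hy1 hy2 hx3 rfl rfl
    simp only at a3 b3
    set d := slopeDiff (curve 0 β x) ((ξ, μ) - curve 0 β x)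
    set d' := slopeDiff (curve 0 β y) ((ξ, μ) - curve 0 β y)
    rw [hxy, sub_self] at hsub
    by_contra hne'
    have h6 := (mul_eq_zero.1 hsub.symm).resolve_left (mul_ne_zero hx3 (sub_ne_zero.2 hne'))
    have k1 : d ^ 2 ≤ 1 := (sq_le_one_iff_abs_le_one d).2 a3
    have k2 : |d' * d| ≤ 1 := by rw [abs_mul]; exact mul_le_one₀ b3 (abs_nonneg _) a3
    rw [abs_le] at k2
    have hd0 := sq_nonneg d
    rcases he with rfl | rfl
    · have hX : ξ - x < 0 := by linarith
      have hy : 0 < y := by linarith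
      nlinarith [mul_nonneg (neg_pos.2 hX).le (sub_nonneg.2 k1), mul_nonneg hy.le
        (by linarith : 0 ≤ d' * d + 1)]
    · have hX : 0 < ξ - x := by linarith
      have hy : y < 0 := by linarith
      nlinarith [mul_nonneg hX.le (sub_nonneg.2 k1), mul_nonneg (neg_pos.2 hy).le
        (by linarith : 0 ≤ d' * d + 1)]
  · rintro p q ⟨-, -, h3, h4, h5⟩
    rw [mul_one, indicator_of_mem]
    · rfl
    · simp only at h3 h5
      rw [sub_zero, mem_Icc, ← abs_le, abs_mul]
      calc |p.1 + q.1| * |slopeDiff p q| ≤ (32 * K) * 1 := by gcongr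
        _ = _ := mul_one _

/-! ### The `L⁴` Strichartz estimate in bilinear form -/

/-- The `L²` norm of a nonnegative function. -/
def l2n {α : Type*} [MeasureSpace α] (f : α → ℝ≥0∞) : ℝ≥0∞ := (∫⁻ x, f x ^ 2) ^ (1 / 2 : ℝ)

lemma l2n_sq {α : Type*} [MeasureSpace α] (f : α → ℝ≥0∞) : l2n f ^ 2 = ∫⁻ x, f x ^ 2 := by
  rw [l2n, ← rpow_natCast, ← rpow_mul]; norm_num

lemma le_of_sq_le_sq {a b : ℝ≥0∞} (h : a ^ 2 ≤ b ^ 2) : a ≤ b :=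
  (ENNReal.pow_le_pow_left_iff two_ne_zero).1 h

lemma bform_mono_add {S : Set ℝ⁴} {n : ℕ} {T : Fin n → Set ℝ⁴} (hT : ∀ i, MeasurableSet (T i))
    (hf : Measurable f) (hg : Measurable g) (hH : Measurable H)
    (h : ∀ p q, p.1 ≠ 0 → q.1 ≠ 0 → p.1 + q.1 ≠ 0 → H (p + q, reson p q) ≠ 0 → (p, q) ∈ S →
      ∃ i, (p, q) ∈ T i) :
    bform S f g H ≤ ∑ i, bform (T i) f g H := by
  have hm := fun i => measurable_bform_integrand (hT i) hf hg hH
  have e : ∑ i, bform (T i) f g H = ∫⁻ p, ∫⁻ q, ∑ i, (T i).indicator 1 (p, q) *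
      (f p * g q * H (p + q, reson p q)) := by
    unfold bform
    rw [← lintegral_finsetSum (f := fun i p => ∫⁻ q, (T i).indicator 1 (p, q) *
      (f p * g q * H (p + q, reson p q))) _ (fun i _ => (hm i).lintegral_prod_right')]
    refine lintegral_congr fun p => ?_
    rw [lintegral_finsetSum]
    intro i _
    exact (hm i).comp (measurable_const.prodMk measurable_id)
  rw [e]
  unfold bform
  refine lintegral_mono_ae ((ae_prod_fst_ne 0).mono fun p hp => ?_)
  refine lintegral_mono_ae ?_
  filter_upwards [ae_prod_fst_ne 0, ae_prod_fst_ne (-p.1)] with q hq hpq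
  by_cases hS : (p, q) ∈ S
  · by_cases hH0 : H (p + q, reson p q) = 0
    · simp [hH0]
    obtain ⟨i, hi⟩ := h p q hp hq (fun h0 => hpq (by linarith)) hH0 hS
    refine le_trans ?_ (Finset.single_le_sum (fun j _ => zero_le) (Finset.mem_univ i))
    rw [indicator_of_mem hS, indicator_of_mem hi]
  · simp [indicator_of_notMem hS]

lemma bform_univ_le {K : ℝ} (hK : 0 < K) (hf : Measurable f) (hg : Measurable g) (hH : Measurable H)
    (hHK : ∀ r s, H (r, s) ≠ 0 → K ≤ |r.1| ∧ |r.1| ≤ 32 * K) :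
    bform univ f g H ≤ 22 * (l2n f * l2n g * l2n H) := by
  set Q := l2n f * l2n g * l2n H with hQ
  have hQ2 : Q ^ 2 = (∫⁻ p, f p ^ 2) * (∫⁻ p, g p ^ 2) * ∫⁻ z, H z ^ 2 := by
    rw [hQ, mul_pow, mul_pow, l2n_sq, l2n_sq, l2n_sq]
  have h1 : bform (transversal 1) f g H ≤ 8 * Q := by
    refine le_of_sq_le_sq ((bform_transversal_sq_le one_pos hK hf hg hH hHK).trans ?_)
    rw [mul_pow, hQ2]; gcongr; norm_num
  have h2 : bform sameSign f g H ≤ 2 * Q := by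
    refine le_of_sq_le_sq ((bform_sameSign_sq_le hf hg hH).trans ?_)
    rw [mul_pow, hQ2]; gcongr; norm_num
  have h3 : ∀ e : ℝ, (e = 1 ∨ e = -1) → bform (oppositeSign e K) f g H ≤ 6 * Q := by
    intro e he
    refine le_of_sq_le_sq ((bform_oppositeSign_sq_le he hK hf hg hH).trans ?_)
    rw [mul_pow, hQ2]; gcongr; norm_num
  have h4 := bform_mono_add (S := univ)
    (T := ![transversal 1, sameSign, oppositeSign 1 K, oppositeSign (-1) K]) (by
      intro i; fin_cases i
      exacts [measurableSet_transversal 1, measurableSet_sameSign, measurableSet_oppositeSign _ _,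
        measurableSet_oppositeSign _ _]) hf hg hH (by
      intro p q hp hq hpq hH0 _
      obtain ⟨k1, k2⟩ := hHK _ _ hH0
      by_cases hd : 1 ≤ |slopeDiff p q|
      · exact ⟨0, hd⟩
      have hd' : |slopeDiff p q| ≤ 1 := (not_le.1 hd).le
      rcases lt_or_gt_of_ne hp with hp | hp <;> rcases lt_or_gt_of_ne hq with hq | hq
      · exact ⟨1, mul_pos_of_neg_of_neg hp hq⟩
      · exact ⟨3, by simpa using hp, by simpa using hq, hd', k1, k2⟩
      · exact ⟨2, by simpa using hp, by simpa using hq, hd', k1, k2⟩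
      · exact ⟨1, mul_pos hp hq⟩)
  refine h4.trans ?_
  simp only [Fin.sum_univ_four, Matrix.cons_val_zero, Matrix.cons_val_one, Matrix.cons_val]
  calc _ ≤ 8 * Q + 2 * Q + 6 * Q + 6 * Q := by
        gcongr
        exacts [h3 1 (Or.inl rfl), h3 (-1) (Or.inr rfl)]
    _ = 22 * Q := by ring

/-! ### Resonant interactions -/

/-- The set of nearly resonant interactions, with slopes differing by about `b ξ`. -/
def resonant (b K₁ K₂ K₃ : ℝ) : Set ℝ⁴ :=
  {z | |slopeDiff z.1 z.2 - b| ≤ 1 / 8 ∧ |z.2.1| ≤ |z.1.1| ∧ K₁ ≤ |z.1.1| ∧ K₂ ≤ |z.2.1| ∧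
    K₃ ≤ |z.1.1 + z.2.1|}

lemma measurableSet_resonant (b K₁ K₂ K₃ : ℝ) : MeasurableSet (resonant b K₁ K₂ K₃) := by
  have h1 : Measurable fun z : ℝ⁴ => |slopeDiff z.1 z.2 - b| := by fun_prop
  have h2 : Measurable fun z : ℝ⁴ => |z.1.1 + z.2.1| := by fun_prop
  have h3 : Measurable fun z : ℝ⁴ => |z.1.1| := by fun_prop
  have h4 : Measurable fun z : ℝ⁴ => |z.2.1| := by fun_prop
  exact (measurableSet_le h1 measurable_const).inter ((measurableSet_le h4 h3).inter
    ((measurableSet_le measurable_const h3).inter ((measurableSet_le measurable_const h4).inter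
    (measurableSet_le measurable_const h2))))

/-- The weight penalizing modulations larger than `R`. -/
def modWeight (R s : ℝ) : ℝ≥0∞ := ofReal √(1 + (s / R) ^ 2)

@[fun_prop]
lemma measurable_modWeight (R : ℝ) : Measurable (modWeight R) := by unfold modWeight; fun_prop

lemma modWeight_sq (R s : ℝ) : modWeight R s ^ 2 = ofReal (1 + (s / R) ^ 2) := by
  rw [modWeight, ← ofReal_pow (sqrt_nonneg _), sq_sqrt (by positivity)]

lemma lintegral_inv_one_add_sq_div {Δ : ℝ} (hΔ : 0 < Δ) :
    ∫⁻ s : ℝ, ofReal (1 + (s / Δ) ^ 2)⁻¹ = ofReal (Δ * π) := by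
  rw [lintegral_scale_left hΔ.ne', abs_of_pos hΔ, ofReal_mul hΔ.le]
  congr 1
  have : ∀ v : ℝ, (1 + (Δ * v / Δ) ^ 2)⁻¹ = (1 + v ^ 2)⁻¹ := fun v => by
    rw [mul_div_cancel_left₀ _ hΔ.ne']
  simp only [this]
  rw [← ofReal_integral_eq_lintegral_ofReal integrable_inv_one_add_sq
    (.of_forall fun v => by positivity), integral_univ_inv_one_add_sq]

lemma bform_resonant_sq_le {b K₁ K₂ K₃ R : ℝ} (hb : b ^ 2 = 3) (hK₁ : 0 < K₁) (hK₂ : 0 < K₂)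
    (hK₃ : 0 < K₃) (hR : 0 < R) (hf : Measurable f) (hg : Measurable g) (hH : Measurable H) :
    bform (resonant b K₁ K₂ K₃) f g H ^ 2 ≤ ofReal (4 * (R / (K₁ * K₂ * K₃))) *
      ((∫⁻ p, f p ^ 2) * (∫⁻ p, g p ^ 2) * ∫⁻ z, (modWeight R z.2 * H z) ^ 2) := by
  have hne : ∀ p q, (p, q) ∈ resonant b K₁ K₂ K₃ → p.1 ≠ 0 ∧ q.1 ≠ 0 ∧ p.1 + q.1 ≠ 0 := by
    rintro p q ⟨-, -, h3, h4, h5⟩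
    simp only at h3 h4 h5
    refine ⟨abs_pos.1 (by linarith), abs_pos.1 (by linarith), abs_pos.1 (by linarith)⟩
  have hb2 : |b| ≤ 7 / 4 := abs_le_of_sq_le_sq (by rw [hb]; norm_num) (by norm_num)
  have hb3 : 3 / 2 ≤ |b| := by
    rw [← abs_of_pos (show (0 : ℝ) < 3 / 2 by norm_num)]; exact sq_le_sq.1 (by rw [hb]; norm_num)
  set Δ := R / (K₁ * K₂) with hΔ
  have hΔ0 : 0 < Δ := by positivity
  have h := bform_slope_sq_le (measurableSet_resonant b K₁ K₂ K₃) b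
    (r := fun s => ofReal √((1 + (s / Δ) ^ 2)⁻¹)) (W := modWeight R) (by fun_prop)
    (by fun_prop) hK₃ hne ?_ ?_ ?_ hf hg hH
  · refine h.trans ?_
    gcongr
    have e1 : ∀ s : ℝ, ofReal √((1 + (s / Δ) ^ 2)⁻¹) ^ 2 = ofReal (1 + (s / Δ) ^ 2)⁻¹ := fun s => by
      rw [← ofReal_pow (sqrt_nonneg _), sq_sqrt (by positivity)]
    simp only [e1]
    rw [lintegral_inv_one_add_sq_div hΔ0, ← ofReal_mul (by positivity)]
    apply ofReal_le_ofReal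
    rw [show K₃⁻¹ * (Δ * π) = π * (R / (K₁ * K₂ * K₃)) by rw [hΔ]; field_simp]
    gcongr
    exact pi_le_four
  · rintro p q ⟨h1, h2, h3, h4, h5⟩
    simp only at h1 h2 h3 h4 h5
    set d := slopeDiff p q
    obtain ⟨e, he⟩ : ∃ e, d = b + e := ⟨d - b, by ring⟩
    rw [he, add_sub_cancel_left] at h1
    have hbe : |b * e| ≤ 7 / 32 := by
      rw [abs_mul]
      calc |b| * |e| ≤ 7 / 4 * (1 / 8) := by gcongr
        _ = _ := by norm_num
    have hee : e ^ 2 ≤ 1 / 64 := by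
      rw [← sq_abs]; calc |e| ^ 2 ≤ (1 / 8) ^ 2 := by gcongr
        _ = _ := by norm_num
    have e1 : p.1 * (3 + d ^ 2 + 2 * b * d) + q.1 * (d ^ 2 - 3) =
        p.1 * (12 + 4 * (b * e) + e ^ 2) + q.1 * (2 * (b * e) + e ^ 2) := by
      rw [he]; linear_combination (3 * p.1 + q.1) * hb
    rw [e1, abs_mul]
    have k0 := sq_nonneg e
    rw [abs_le] at hbe
    have k1 : 11 ≤ |12 + 4 * (b * e) + e ^ 2| := le_trans (by linarith) (le_abs_self _)
    have k2 : |2 * (b * e) + e ^ 2| ≤ 1 := by rw [abs_le]; constructor <;> linarith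
    have k3 : |p.1| ≤ |p.1 * (12 + 4 * (b * e) + e ^ 2) + q.1 * (2 * (b * e) + e ^ 2)| := by
      have := abs_sub_abs_le_abs_sub (p.1 * (12 + 4 * (b * e) + e ^ 2))
        (-(q.1 * (2 * (b * e) + e ^ 2)))
      rw [sub_neg_eq_add, abs_neg, abs_mul, abs_mul] at this
      have k4 : |p.1| * 11 ≤ |p.1| * |12 + 4 * (b * e) + e ^ 2| := by gcongr
      have k5 : |q.1| * |2 * (b * e) + e ^ 2| ≤ |p.1| * 1 := by gcongr
      have := abs_nonneg p.1
      linarith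
    gcongr
  · intro β ξ μ
    have half : ∀ x y, x ∈ {x | (curve b β x, (ξ, μ) - curve b β x) ∈
        resonant b K₁ K₂ K₃} → y ∈ {x | (curve b β x, (ξ, μ) - curve b β x) ∈
        resonant b K₁ K₂ K₃} → |x| ≤ |y| →
        reson (curve b β x) ((ξ, μ) - curve b β x) =
        reson (curve b β y) ((ξ, μ) - curve b β y) → x = y := by
      intro x y hx hy hxy' hxy
      obtain ⟨hx1, hx2, hx3⟩ := hne _ _ hx
      obtain ⟨hy1, hy2, hy3⟩ := hne _ _ hy
      obtain ⟨a1, a2, -⟩ := hx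
      obtain ⟨b1, b2, -⟩ := hy
      simp only [curve, Prod.fst_sub, add_sub_cancel] at hx1 hx2 hx3 hy1 hy2 hy3 a2 b2
      have hsub := reson_curve_sub (μ := μ) (b := b) (β := β) hx1 hx2 hy1 hy2 hx3 rfl rfl
      simp only at a1 b1
      set d := slopeDiff (curve b β x) ((ξ, μ) - curve b β x)
      set d' := slopeDiff (curve b β y) ((ξ, μ) - curve b β y)
      rw [hxy, sub_self] at hsub
      by_contra hne'
      have h6 := (mul_eq_zero.1 hsub.symm).resolve_left (mul_ne_zero hx3 (sub_ne_zero.2 hne'))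
      obtain ⟨e, he⟩ : ∃ e, d = b + e := ⟨d - b, by ring⟩
      obtain ⟨e', he'⟩ : ∃ e', d' = b + e' := ⟨d' - b, by ring⟩
      rw [he, add_sub_cancel_left] at a1
      rw [he', add_sub_cancel_left] at b1
      have hbe : |b * e| ≤ 7 / 32 := by
        rw [abs_mul]
        calc |b| * |e| ≤ 7 / 4 * (1 / 8) := by gcongr
          _ = _ := by norm_num
      have hbe' : |b * e'| ≤ 7 / 32 := by
        rw [abs_mul]
        calc |b| * |e'| ≤ 7 / 4 * (1 / 8) := by gcongr
          _ = _ := by norm_num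
      have hee : |e ^ 2| ≤ 1 / 64 := by
        rw [abs_pow]; calc |e| ^ 2 ≤ (1 / 8) ^ 2 := by gcongr
          _ = _ := by norm_num
      have hee' : |e' * e| ≤ 1 / 64 := by
        rw [abs_mul]; calc |e'| * |e| ≤ (1 / 8) * (1 / 8) := by gcongr
          _ = _ := by norm_num
      have e1 : 12 * y = -((ξ - x) * (2 * (b * e) + e ^ 2) +
          y * (2 * (b * e) + 2 * (b * e') + e' * e)) := by
        rw [he, he'] at h6
        linear_combination h6 - ((ξ - x) + 3 * y) * hb
      have e2 : |2 * (b * e) + e ^ 2| ≤ 1 := by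
        rw [abs_le] at *; constructor <;> linarith [hbe.1, hbe.2, hee.1, hee.2]
      have e3 : |2 * (b * e) + 2 * (b * e') + e' * e| ≤ 1 := by
        rw [abs_le] at *
        constructor <;> linarith [hbe.1, hbe.2, hbe'.1, hbe'.2, hee'.1, hee'.2]
      have e4 : 12 * |y| ≤ 2 * |y| := by
        calc 12 * |y| = |12 * y| := by rw [abs_mul]; norm_num
          _ ≤ |ξ - x| * |2 * (b * e) + e ^ 2| +
              |y| * |2 * (b * e) + 2 * (b * e') + e' * e| := by
            rw [e1, abs_neg, ← abs_mul, ← abs_mul]; exact abs_add_le _ _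
          _ ≤ |y| * 1 + |y| * 1 := add_le_add
            (mul_le_mul (a2.trans hxy') e2 (abs_nonneg _) (abs_nonneg _))
            (mul_le_mul_of_nonneg_left e3 (abs_nonneg _))
          _ = _ := by ring
      have := abs_pos.2 hy1
      linarith
    intro x hx y hy hxy
    rcases le_total |x| |y| with h | h
    · exact half x y hx hy h hxy
    · exact (half y x hy hx h hxy.symm).symm
  · intro p q hpq
    obtain ⟨h0, h00, h000⟩ := hne p q hpq
    obtain ⟨h1, h2, h3, h4, h5⟩ := hpq
    simp only at h1 h2 h3 h4 h5
    rw [modWeight, ← ofReal_mul (sqrt_nonneg _), ← sqrt_mul (by positivity),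
      one_le_ofReal, Real.one_le_sqrt]
    rw [inv_mul_eq_div, one_le_div (by positivity)]
    have h6 : |(p.1 + q.1) * (slopeDiff p q - b) / Δ| ≤ |reson p q / R| := by
      rw [reson_eq h0 h00 h000, ← hb, hΔ]
      set d := slopeDiff p q
      have h7 : 1 ≤ |d + b| := by
        have := abs_sub_abs_le_abs_sub (2 * b) (-(d - b))
        rw [show 2 * b - -(d - b) = d + b by ring, abs_neg, abs_mul] at this
        norm_num at this
        linarith
      rw [abs_div, abs_div, abs_div, abs_of_pos hR, abs_of_pos (mul_pos hK₁ hK₂)]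
      rw [show |(p.1 + q.1) * (d - b)| / (R / (K₁ * K₂)) =
        (K₁ * K₂) * |(p.1 + q.1) * (d - b)| / R by field_simp]
      gcongr
      rw [show p.1 * q.1 * (p.1 + q.1) * (d ^ 2 - b ^ 2) =
        p.1 * q.1 * ((p.1 + q.1) * (d - b)) * (d + b) by ring]
      calc K₁ * K₂ * |(p.1 + q.1) * (d - b)| = K₁ * K₂ * |(p.1 + q.1) * (d - b)| * 1 := by ring
        _ ≤ |p.1| * |q.1| * |(p.1 + q.1) * (d - b)| * |d + b| := by gcongr
        _ = _ := by simp only [abs_mul]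
    have := sq_le_sq.2 h6
    linarith

/-- The trilinear estimate with the gain from resonance and transversality. -/
lemma bform_univ_le_modWeight {K₁ K₂ K₃ R : ℝ} (hK₁ : 0 < K₁) (hK₂ : 0 < K₂) (hK₃ : 0 < K₃)
    (hR : 0 < R) (hf : Measurable f) (hg : Measurable g) (hH : Measurable H)
    (hfK : ∀ p, f p ≠ 0 → K₁ ≤ |p.1|) (hgK : ∀ p, g p ≠ 0 → K₂ ≤ |p.1|)
    (hHK : ∀ r s, H (r, s) ≠ 0 → K₃ ≤ |r.1| ∧ |r.1| ≤ 32 * K₃) :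
    bform univ f g H ≤ 60 * (ofReal √(R / (K₁ * K₂ * K₃)) *
      (l2n f * l2n g * l2n fun z => modWeight R z.2 * H z)) := by
  set WH : ℝ² × ℝ → ℝ≥0∞ := fun z => modWeight R z.2 * H z with hWH
  have hWHm : Measurable WH := by simp only [hWH]; fun_prop
  set D := ofReal √(R / (K₁ * K₂ * K₃)) with hD
  have hD2 : D ^ 2 = ofReal (R / (K₁ * K₂ * K₃)) := by
    rw [hD, ← ofReal_pow (sqrt_nonneg _), sq_sqrt (by positivity)]
  set Q := l2n f * l2n g * l2n WH with hQ
  have hQ2 : Q ^ 2 = (∫⁻ p, f p ^ 2) * (∫⁻ p, g p ^ 2) * ∫⁻ z, WH z ^ 2 := by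
    rw [hQ, mul_pow, mul_pow, l2n_sq, l2n_sq, l2n_sq]
  have hres : ∀ b : ℝ, b ^ 2 = 3 → bform (resonant b K₁ K₂ K₃) f g H ≤ 2 * (D * Q) := by
    intro b hb
    refine le_of_sq_le_sq ((bform_resonant_sq_le hb hK₁ hK₂ hK₃ hR hf hg hH).trans (le_of_eq ?_))
    rw [mul_pow, mul_pow, hQ2, hD2, ofReal_mul (by norm_num)]
    norm_num
    ring
  have hres' : ∀ b : ℝ, b ^ 2 = 3 →
      bform (Prod.swap ⁻¹' resonant b K₂ K₁ K₃) f g H ≤ 2 * (D * Q) := by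
    intro b hb
    rw [← bform_swap (measurableSet_resonant b K₂ K₁ K₃) hg hf hH]
    refine le_of_sq_le_sq ((bform_resonant_sq_le hb hK₂ hK₁ hK₃ hR hg hf hH).trans (le_of_eq ?_))
    rw [mul_pow, mul_pow, hQ2, hD2, ofReal_mul (by norm_num), mul_comm K₂ K₁]
    norm_num
    ring
  set N : Set ℝ⁴ := {z | K₁ * K₂ * K₃ / 8 ≤ |reson z.1 z.2|} with hN
  have hNm : MeasurableSet N := by
    have : Measurable fun z : ℝ⁴ => |reson z.1 z.2| := by fun_prop
    exact measurableSet_le measurable_const this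
  have hnon : bform N f g H ≤ 2 * D * bform univ f g WH := by
    unfold bform
    rw [← lintegral_const_mul' _ _ (by finiteness)]
    refine lintegral_mono fun p => ?_
    rw [← lintegral_const_mul' _ _ (by finiteness)]
    refine lintegral_mono fun q => ?_
    by_cases h : (p, q) ∈ N
    · rw [indicator_of_mem h, indicator_of_mem (mem_univ _), hWH]
      simp only [Pi.one_apply, one_mul]
      have h1 : 1 ≤ 2 * D * modWeight R (reson p q) := by
        refine le_of_sq_le_sq ?_
        rw [mul_pow, mul_pow, hD2, modWeight_sq, one_pow,
          show (2 : ℝ≥0∞) ^ 2 = ofReal 4 by norm_num, ← ofReal_mul (by norm_num),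
          ← ofReal_mul (by positivity), one_le_ofReal]
        have h2 : K₁ * K₂ * K₃ / 8 ≤ |reson p q| := h
        have h3 : (K₁ * K₂ * K₃ / 8 / R) ^ 2 ≤ (reson p q / R) ^ 2 := by
          rw [div_pow _ R, div_pow _ R, ← sq_abs (reson p q)]; gcongr
        have hK : 0 < K₁ * K₂ * K₃ := by positivity
        have h4 : K₁ * K₂ * K₃ / (4 * R) ≤ 1 + (reson p q / R) ^ 2 := by
          have : K₁ * K₂ * K₃ / (4 * R) = 2 * (K₁ * K₂ * K₃ / 8 / R) := by field_simp; norm_num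
          nlinarith [sq_nonneg (K₁ * K₂ * K₃ / 8 / R - 1)]
        calc (1 : ℝ) = 4 * (R / (K₁ * K₂ * K₃)) * (K₁ * K₂ * K₃ / (4 * R)) := by field_simp
          _ ≤ _ := by gcongr
      calc f p * g q * H (p + q, reson p q) = 1 * (f p * g q * H (p + q, reson p q)) := by
            rw [one_mul]
        _ ≤ 2 * D * modWeight R (reson p q) * (f p * g q * H (p + q, reson p q)) := by gcongr
        _ = _ := by ring
    · rw [indicator_of_notMem h]; simp
  have hWHK : ∀ r s, WH (r, s) ≠ 0 → K₃ ≤ |r.1| ∧ |r.1| ≤ 32 * K₃ := by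
    intro r s h
    exact hHK r s (fun h0 => h (by simp [hWH, h0]))
  have hL4 := bform_univ_le hK₃ hf hg hWHm hWHK
  have hs3 : √(3 : ℝ) ^ 2 = 3 := sq_sqrt (by norm_num)
  have hs3' : (-√(3 : ℝ)) ^ 2 = 3 := by rw [neg_sq, hs3]
  set S₀ : Set ℝ⁴ := {z | K₁ ≤ |z.1.1| ∧ K₂ ≤ |z.2.1|} with hS₀
  have hS₀m : MeasurableSet S₀ := by
    have h3 : Measurable fun z : ℝ⁴ => |z.1.1| := by fun_prop
    have h4 : Measurable fun z : ℝ⁴ => |z.2.1| := by fun_prop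
    exact (measurableSet_le measurable_const h3).inter (measurableSet_le measurable_const h4)
  have hred : bform univ f g H = bform S₀ f g H := by
    unfold bform
    refine lintegral_congr fun p => lintegral_congr fun q => ?_
    by_cases h : (p, q) ∈ S₀
    · rw [indicator_of_mem h, indicator_of_mem (mem_univ _)]
    · rw [indicator_of_notMem h, indicator_of_mem (mem_univ _)]
      by_cases hp : f p = 0
      · simp [hp]
      by_cases hq : g q = 0
      · simp [hq]
      exact absurd ⟨hfK p hp, hgK q hq⟩ h
  have h4 := bform_mono_add (S := S₀) (T := ![N, resonant √3 K₁ K₂ K₃, resonant (-√3) K₁ K₂ K₃,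
      Prod.swap ⁻¹' resonant √3 K₂ K₁ K₃, Prod.swap ⁻¹' resonant (-√3) K₂ K₁ K₃]) (by
      intro i; fin_cases i
      exacts [hNm, measurableSet_resonant _ _ _ _, measurableSet_resonant _ _ _ _,
        measurable_swap (measurableSet_resonant _ _ _ _),
        measurable_swap (measurableSet_resonant _ _ _ _)]) hf hg hH (by
      rintro p q hp hq hpq hH0 ⟨hp1, hq1⟩
      have k1 := (hHK _ _ hH0).1
      simp only [Prod.fst_add] at hp1 hq1 k1
      have hswap : slopeDiff q p = -slopeDiff p q := by unfold slopeDiff; rw [add_comm q.1]; ring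
      by_cases a1 : |slopeDiff p q - √3| ≤ 1 / 8
      · rcases le_total |q.1| |p.1| with h | h
        · exact ⟨1, a1, h, hp1, hq1, k1⟩
        · refine ⟨4, ?_, h, hq1, hp1, by simpa [add_comm] using k1⟩
          simp only [Prod.swap]
          rw [hswap, show -slopeDiff p q - -√3 = -(slopeDiff p q - √3) by ring, abs_neg]
          exact a1
      by_cases a2 : |slopeDiff p q + √3| ≤ 1 / 8
      · rcases le_total |q.1| |p.1| with h | h
        · exact ⟨2, by simpa using a2, h, hp1, hq1, k1⟩
        · refine ⟨3, ?_, h, hq1, hp1, by simpa [add_comm] using k1⟩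
          simp only [Prod.swap]
          rw [hswap, show -slopeDiff p q - √3 = -(slopeDiff p q + √3) by ring, abs_neg]
          exact a2
      refine ⟨0, ?_⟩
      change K₁ * K₂ * K₃ / 8 ≤ |reson p q|
      rw [reson_eq hp hq hpq]
      push Not at a1 a2
      have h5 : 1 / 8 ≤ |slopeDiff p q ^ 2 - 3| := by
        have h6 : (1 : ℝ) ≤ √3 := Real.one_le_sqrt.2 (by norm_num)
        rw [show slopeDiff p q ^ 2 - 3 = (slopeDiff p q - √3) * (slopeDiff p q + √3) by
          linear_combination hs3, abs_mul]
        rcases le_total 0 (slopeDiff p q) with h | h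
        · have : 1 ≤ |slopeDiff p q + √3| := le_trans (by linarith) (le_abs_self _)
          nlinarith [abs_nonneg (slopeDiff p q - √3)]
        · have : 1 ≤ |slopeDiff p q - √3| := by
            rw [abs_sub_comm]; exact le_trans (by linarith) (le_abs_self _)
          nlinarith [abs_nonneg (slopeDiff p q + √3)]
      rw [abs_mul, abs_mul, abs_mul]
      calc K₁ * K₂ * K₃ / 8 = K₁ * K₂ * K₃ * (1 / 8) := by ring
        _ ≤ _ := by gcongr)
  rw [hred]
  refine h4.trans ?_
  simp only [Fin.sum_univ_five, Matrix.cons_val_zero, Matrix.cons_val_one, Matrix.cons_val]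
  calc _ ≤ 2 * D * (22 * Q) + 2 * (D * Q) + 2 * (D * Q) + 2 * (D * Q) + 2 * (D * Q) := by
        gcongr
        exacts [hnon.trans (by gcongr), hres _ hs3, hres _ hs3', hres' _ hs3, hres' _ hs3']
    _ = 52 * (D * Q) := by ring
    _ ≤ 60 * (D * Q) := by gcongr; norm_num

/-! ### The trilinear form with modulations -/

/-- The trilinear space-time form: `κ` is the kernel of a time cutoff, `M` a multiplier. -/
def tform (κ : ℝ → ℝ≥0∞) (M : ℝ⁴ → ℝ≥0∞) (V₁ V₂ V₃ : ℝ³ → ℝ≥0∞) : ℝ≥0∞ :=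
  ∫⁻ z : ℝ⁴, ∫⁻ t : ℝ³, M z * (V₁ (t.1, z.1) * V₂ (t.2.1, z.2) *
    V₃ (t.2.2, -(z.1 + z.2)) * κ (t.1 + t.2.1 + t.2.2 + reson z.1 z.2))

section tform

variable {κ : ℝ → ℝ≥0∞} {M : ℝ⁴ → ℝ≥0∞} {V₁ V₂ V₃ : ℝ³ → ℝ≥0∞}

lemma tform_mono {κ' : ℝ → ℝ≥0∞} {M' : ℝ⁴ → ℝ≥0∞}
    {V₁' V₂' V₃' : ℝ³ → ℝ≥0∞} (hκ : ∀ s, κ s ≤ κ' s) (h1 : ∀ x, V₁ x ≤ V₁' x)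
    (h2 : ∀ x, V₂ x ≤ V₂' x) (h3 : ∀ x, V₃ x ≤ V₃' x)
    (hM : ∀ a b c p q, V₁ (a, p) ≠ 0 → V₂ (b, q) ≠ 0 → V₃ (c, -(p + q)) ≠ 0 →
      M (p, q) ≤ M' (p, q)) : tform κ M V₁ V₂ V₃ ≤ tform κ' M' V₁' V₂' V₃' := by
  refine lintegral_mono fun z => lintegral_mono fun t => ?_
  by_cases k1 : V₁ (t.1, z.1) = 0
  · simp [k1]
  by_cases k2 : V₂ (t.2.1, z.2) = 0
  · simp [k2]
  by_cases k3 : V₃ (t.2.2, -(z.1 + z.2)) = 0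
  · simp only [k3, mul_zero, zero_mul, zero_le]
  exact mul_le_mul' (hM _ _ _ _ _ k1 k2 k3)
    (mul_le_mul' (mul_le_mul' (mul_le_mul' (h1 _) (h2 _)) (h3 _)) (hκ _))

lemma lintegral_perm {F : ℝ³ → ℝ≥0∞} (hF : Measurable F) :
    ∫⁻ t, F t = ∫⁻ t : ℝ³, F (t.2.2, (t.2.1, t.1)) := by
  have e1 : ∀ G : ℝ³ → ℝ≥0∞, Measurable G →
      ∫⁻ t, G t = ∫⁻ a, ∫⁻ b, ∫⁻ c, G (a, (b, c)) := fun G hG => by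
    rw [lintegral_prod₂ hG]
    refine lintegral_congr fun a => ?_
    exact lintegral_prod₂ (hG.comp (by fun_prop : Measurable fun z : ℝ² => (a, z)))
  rw [e1 F hF, e1 _ (by fun_prop)]
  have h3 : Measurable fun z : ℝ² × ℝ => F (z.1.1, (z.1.2, z.2)) := by fun_prop
  have h4 : Measurable fun z : ℝ² × ℝ => F (z.2, (z.1.2, z.1.1)) := by fun_prop
  have h5 : Measurable fun z : ℝ² × ℝ => F (z.1.1, (z.2, z.1.2)) := by fun_prop
  calc ∫⁻ a, ∫⁻ b, ∫⁻ c, F (a, (b, c)) = ∫⁻ a, ∫⁻ c, ∫⁻ b, F (a, (b, c)) := by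
        refine lintegral_congr fun a => ?_
        rw [lintegral_lintegral_swap]
        exact (hF.comp (by fun_prop : Measurable fun z : ℝ² => (a, z))).aemeasurable
    _ = ∫⁻ c, ∫⁻ a, ∫⁻ b, F (a, (b, c)) := by
        exact lintegral_lintegral_swap (μ := volume) (ν := volume)
          (f := fun a c => ∫⁻ b, F (a, (b, c)))
          (h5.lintegral_prod_right' (ν := (volume : Measure ℝ))).aemeasurable
    _ = ∫⁻ c, ∫⁻ b, ∫⁻ a, F (a, (b, c)) := by
        refine lintegral_congr fun c => ?_
        rw [lintegral_lintegral_swap]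
        exact (hF.comp (by fun_prop : Measurable fun z : ℝ² => (z.1, (z.2, c)))).aemeasurable

lemma tform_swap (hκ : Measurable κ) (hM : Measurable M) (h1 : Measurable V₁)
    (h2 : Measurable V₂) (h3 : Measurable V₃) :
    tform κ M V₁ V₂ V₃ = tform κ (fun z => M z.swap) V₂ V₁ V₃ := by
  have hz : ∀ F : ℝ⁴ → ℝ≥0∞, Measurable F → ∫⁻ z, F z = ∫⁻ z : ℝ⁴, F z.swap :=
    fun F hF => (lintegral_prod_symm₂ hF).trans
      (lintegral_prod₂ (F := fun z => F z.swap) (by fun_prop)).symm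
  have ht : ∀ F : ℝ³ → ℝ≥0∞, Measurable F → ∫⁻ t, F t = ∫⁻ t : ℝ³, F (t.2.1, (t.1, t.2.2)) := by
    intro F hF
    rw [lintegral_prod₂ hF, lintegral_prod₂ (by fun_prop)]
    have e : ∀ a, ∫⁻ y : ℝ², F (a, y) = ∫⁻ b, ∫⁻ c, F (a, (b, c)) := fun a =>
      lintegral_prod₂ (hF.comp (by fun_prop : Measurable fun z : ℝ² => (a, z)))
    have e' : ∀ a, ∫⁻ y : ℝ², F (y.1, (a, y.2)) = ∫⁻ b, ∫⁻ c, F (b, (a, c)) := fun a =>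
      lintegral_prod₂ (hF.comp (by fun_prop : Measurable fun z : ℝ² => (z.1, (a, z.2))))
    simp only [e, e']
    have h3 : Measurable fun z : ℝ² × ℝ => F (z.1.1, (z.1.2, z.2)) := by fun_prop
    exact lintegral_lintegral_swap (μ := volume) (ν := volume) (f := fun a b => ∫⁻ c, F (a, (b, c)))
      (h3.lintegral_prod_right' (ν := (volume : Measure ℝ))).aemeasurable
  unfold tform
  rw [hz]
  swap
  · refine Measurable.lintegral_prod_right' (f := fun x : ℝ⁴ × ℝ³ =>
      M x.1 * (V₁ (x.2.1, x.1.1) * V₂ (x.2.2.1, x.1.2) *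
      V₃ (x.2.2.2, -(x.1.1 + x.1.2)) * κ (x.2.1 + x.2.2.1 + x.2.2.2 + reson x.1.1 x.1.2))) ?_
    fun_prop
  refine lintegral_congr fun z => ?_
  rw [ht _ (by fun_prop)]
  refine lintegral_congr fun t => ?_
  simp only [Prod.fst_swap, Prod.snd_swap]
  rw [reson_comm z.2 z.1, add_comm z.2 z.1, add_comm t.2.1 t.1]
  ring

lemma reson_neg_add (p q : ℝ²) : reson (-(p + q)) q = reson p q := by
  have ho : ∀ x y, omega (-x) (-y) = -omega x y := fun x y => by unfold omega; rw [div_neg]; ring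
  unfold reson
  simp only [Prod.fst_neg, Prod.snd_neg, Prod.fst_add, Prod.snd_add]
  rw [show -(p.1 + q.1) + q.1 = -p.1 by ring, show -(p.2 + q.2) + q.2 = -p.2 by ring, ho, ho]
  ring

lemma tform_rot (hκ : Measurable κ) (hM : Measurable M) (h1 : Measurable V₁)
    (h2 : Measurable V₂) (h3 : Measurable V₃) :
    tform κ M V₁ V₂ V₃ = tform κ (fun z => M (-(z.1 + z.2), z.2)) V₃ V₂ V₁ := by
  have hz : ∀ F : ℝ⁴ → ℝ≥0∞, Measurable F →
      ∫⁻ z, F z = ∫⁻ z : ℝ⁴, F (-(z.1 + z.2), z.2) := fun F hF => by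
    refine (lintegral_prod_symm₂ hF).trans (Eq.trans ?_
      (lintegral_prod_symm₂ (F := fun z => F (-(z.1 + z.2), z.2)) (by fun_prop)).symm)
    refine lintegral_congr fun q => ?_
    rw [lintegral_add_right_eq_self (fun p => F (-p, q)) q]
    exact (lintegral_neg_eq_self (fun p => F (p, q))).symm
  unfold tform
  rw [hz]
  swap
  · refine Measurable.lintegral_prod_right' (f := fun x : ℝ⁴ × ℝ³ =>
      M x.1 * (V₁ (x.2.1, x.1.1) * V₂ (x.2.2.1, x.1.2) *
      V₃ (x.2.2.2, -(x.1.1 + x.1.2)) * κ (x.2.1 + x.2.2.1 + x.2.2.2 + reson x.1.1 x.1.2))) ?_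
    fun_prop
  refine lintegral_congr fun z => ?_
  rw [lintegral_perm (by fun_prop)]
  refine lintegral_congr fun t => ?_
  simp only
  rw [reson_neg_add, show -(-(z.1 + z.2) + z.2) = z.1 by abel,
    show t.2.2 + t.2.1 + t.1 = t.1 + t.2.1 + t.2.2 by ring]
  ring

lemma tform_tsum {ι : Type*} [Countable ι] {U₁ U₂ U₃ : ι → ℝ³ → ℝ≥0∞}
    (hκ : Measurable κ) (hM : Measurable M) (h1 : ∀ i, Measurable (U₁ i))
    (h2 : ∀ i, Measurable (U₂ i)) (h3 : ∀ i, Measurable (U₃ i)) :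
    tform κ M (fun x => ∑' i, U₁ i x) (fun x => ∑' i, U₂ i x) (fun x => ∑' i, U₃ i x) =
      ∑' i, ∑' j, ∑' k, tform κ M (U₁ i) (U₂ j) (U₃ k) := by
  have e : ∀ (z : ℝ⁴) (t : ℝ³), M z * ((∑' i, U₁ i (t.1, z.1)) * (∑' i, U₂ i (t.2.1, z.2)) *
    (∑' i, U₃ i (t.2.2, -(z.1 + z.2))) * κ (t.1 + t.2.1 + t.2.2 + reson z.1 z.2)) =
      ∑' i, ∑' j, ∑' k, M z * (U₁ i (t.1, z.1) * U₂ j (t.2.1, z.2) *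
    U₃ k (t.2.2, -(z.1 + z.2)) * κ (t.1 + t.2.1 + t.2.2 + reson z.1 z.2)) := by
    intro z t
    simp only [ENNReal.tsum_mul_left, ENNReal.tsum_mul_right]
  unfold tform
  simp only [e]
  have hm : ∀ i j k, Measurable fun x : ℝ⁴ × ℝ³ =>
      M x.1 * (U₁ i (x.2.1, x.1.1) * U₂ j (x.2.2.1, x.1.2) *
      U₃ k (x.2.2.2, -(x.1.1 + x.1.2)) * κ (x.2.1 + x.2.2.1 + x.2.2.2 + reson x.1.1 x.1.2)) := by
    intro i j k
    have := h1 i; have := h2 j; have := h3 k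
    fun_prop
  have hsec : ∀ {G : ℝ⁴ × ℝ³ → ℝ≥0∞} (_ : Measurable G) (z : ℝ⁴), Measurable fun t => G (z, t) :=
    fun hG z => hG.comp (measurable_const.prodMk measurable_id)
  have h5 : ∀ z : ℝ⁴, (∫⁻ t : ℝ³, ∑' i, ∑' j, ∑' k, M z * (U₁ i (t.1, z.1) * U₂ j (t.2.1, z.2) *
    U₃ k (t.2.2, -(z.1 + z.2)) * κ (t.1 + t.2.1 + t.2.2 + reson z.1 z.2))) =
    ∑' i, ∑' j, ∑' k, ∫⁻ t : ℝ³, M z * (U₁ i (t.1, z.1) * U₂ j (t.2.1, z.2) *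
    U₃ k (t.2.2, -(z.1 + z.2)) * κ (t.1 + t.2.1 + t.2.2 + reson z.1 z.2)) := by
    intro z
    rw [lintegral_tsum fun i => (Measurable.tsum fun j => Measurable.tsum
      fun k => hsec (hm i j k) z).aemeasurable]
    refine tsum_congr fun i => ?_
    rw [lintegral_tsum fun j => (Measurable.tsum fun k => hsec (hm i j k) z).aemeasurable]
    refine tsum_congr fun j => ?_
    rw [lintegral_tsum fun k => (hsec (hm i j k) z).aemeasurable]
  simp only [h5]
  have hm' := fun i j k => (hm i j k).lintegral_prod_right' (ν := (volume : Measure ℝ³))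
  rw [lintegral_tsum fun i => (Measurable.tsum fun j => Measurable.tsum
      fun k => hm' i j k).aemeasurable]
  refine tsum_congr fun i => ?_
  rw [lintegral_tsum fun j => (Measurable.tsum fun k => hm' i j k).aemeasurable]
  refine tsum_congr fun j => ?_
  rw [lintegral_tsum fun k => (hm' i j k).aemeasurable]

/-- The convolution of the third function with the kernel. -/
def convKernel (κ : ℝ → ℝ≥0∞) (V : ℝ³ → ℝ≥0∞) (θ : ℝ) (z : ℝ² × ℝ) : ℝ≥0∞ :=
  ∫⁻ c, V (c, -z.1) * κ (θ + c + z.2)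

lemma measurable_convKernel {V : ℝ³ → ℝ≥0∞} (hκ : Measurable κ) (hV : Measurable V)
    (θ : ℝ) : Measurable (convKernel κ V θ) := by
  refine Measurable.lintegral_prod_right' (f := fun x : (ℝ² × ℝ) × ℝ =>
    V (x.2, -x.1.1) * κ (θ + x.2 + x.1.2)) ?_
  fun_prop

lemma tform_one_eq (hκ : Measurable κ) (h1 : Measurable V₁)
    (h2 : Measurable V₂) (h3 : Measurable V₃) :
    tform κ 1 V₁ V₂ V₃ = ∫⁻ a, ∫⁻ b, bform univ (fun p => V₁ (a, p)) (fun q => V₂ (b, q))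
      (convKernel κ V₃ (a + b)) := by
  have hm : Measurable fun x : ℝ⁴ × ℝ³ =>
      (V₁ (x.2.1, x.1.1) * V₂ (x.2.2.1, x.1.2) *
      V₃ (x.2.2.2, -(x.1.1 + x.1.2)) * κ (x.2.1 + x.2.2.1 + x.2.2.2 + reson x.1.1 x.1.2)) := by
    fun_prop
  unfold tform
  simp only [Pi.one_apply, one_mul]
  have e1 : ∀ z : ℝ⁴, ∫⁻ t : ℝ³, V₁ (t.1, z.1) * V₂ (t.2.1, z.2) *
      V₃ (t.2.2, -(z.1 + z.2)) * κ (t.1 + t.2.1 + t.2.2 + reson z.1 z.2) =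
      ∫⁻ a, ∫⁻ b, V₁ (a, z.1) * V₂ (b, z.2) *
        convKernel κ V₃ (a + b) (z.1 + z.2, reson z.1 z.2) := by
    intro z
    rw [lintegral_prod₂ (by fun_prop)]
    refine lintegral_congr fun a => ?_
    rw [lintegral_prod₂ (by fun_prop)]
    refine lintegral_congr fun b => ?_
    simp only [mul_assoc (V₁ (a, z.1) * V₂ (b, z.2))]
    rw [lintegral_const_mul _ (by fun_prop)]
    rfl
  simp only [e1]
  have hmc : Measurable fun x : ℝ² × ℝ⁴ =>
      V₁ (x.1.1, x.2.1) * V₂ (x.1.2, x.2.2) *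
        convKernel κ V₃ (x.1.1 + x.1.2) (x.2.1 + x.2.2, reson x.2.1 x.2.2) := by
    have hc : Measurable fun x : ℝ² × ℝ⁴ =>
        convKernel κ V₃ (x.1.1 + x.1.2) (x.2.1 + x.2.2, reson x.2.1 x.2.2) := by
      refine Measurable.lintegral_prod_right' (f := fun y : (ℝ² × ℝ⁴) × ℝ =>
        V₃ (y.2, -(y.1.2.1 + y.1.2.2)) * κ (y.1.1.1 + y.1.1.2 + y.2 + reson y.1.2.1 y.1.2.2)) ?_
      fun_prop
    fun_prop
  have e2 : ∀ z : ℝ⁴, ∫⁻ a, ∫⁻ b, V₁ (a, z.1) * V₂ (b, z.2) *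
        convKernel κ V₃ (a + b) (z.1 + z.2, reson z.1 z.2) = ∫⁻ t : ℝ²,
        V₁ (t.1, z.1) * V₂ (t.2, z.2) *
        convKernel κ V₃ (t.1 + t.2) (z.1 + z.2, reson z.1 z.2) := fun z =>
    (lintegral_prod₂ (hmc.comp (by fun_prop : Measurable fun t : ℝ² => (t, z)))).symm
  simp only [e2]
  rw [lintegral_lintegral_swap (f := fun (z : ℝ⁴) (t : ℝ²) =>
    V₁ (t.1, z.1) * V₂ (t.2, z.2) * convKernel κ V₃ (t.1 + t.2) (z.1 + z.2, reson z.1 z.2))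
    (hmc.comp measurable_swap).aemeasurable, lintegral_prod₂ hmc.lintegral_prod_right']
  refine lintegral_congr fun a => lintegral_congr fun b => ?_
  have hmz : Measurable fun z : ℝ⁴ => V₁ (a, z.1) * V₂ (b, z.2) *
      convKernel κ V₃ (a + b) (z.1 + z.2, reson z.1 z.2) :=
    hmc.comp (by fun_prop : Measurable fun z : ℝ⁴ => ((a, b), z))
  exact (lintegral_prod₂ hmz).trans (by unfold bform; simp)

end tform

/-! ### Estimates with fixed modulations -/

/-- The time kernel of a smooth cutoff at scale `σ`. -/
def kerI (σ x : ℝ) : ℝ≥0∞ := ofReal (σ / (1 + (σ * x) ^ 2) ^ 2)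

/-- The time kernel of a cutoff with a jump at scale `σ`. -/
def kerB (σ x : ℝ) : ℝ≥0∞ := ofReal (σ / (1 + σ * |x|))

/-- The Cauchy kernel. -/
def kerC (σ x : ℝ) : ℝ≥0∞ := ofReal (σ * (1 + (σ * x) ^ 2)⁻¹)

@[fun_prop] theorem measurable_kerI (σ : ℝ) : Measurable (kerI σ) := by unfold kerI; fun_prop
@[fun_prop] theorem measurable_kerB (σ : ℝ) : Measurable (kerB σ) := by unfold kerB; fun_prop
@[fun_prop] theorem measurable_kerC (σ : ℝ) : Measurable (kerC σ) := by unfold kerC; fun_prop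

lemma kerI_le_kerB {σ : ℝ} (hσ : 0 < σ) (x : ℝ) : kerI σ x ≤ 2 * kerB σ x := by
  rw [kerI, kerB, show (2 : ℝ≥0∞) = ofReal 2 by norm_num,
    ← ofReal_mul (by norm_num), ← mul_div_assoc]
  refine ofReal_le_ofReal ?_
  rw [div_le_div_iff₀ (by positivity) (by positivity), mul_comm 2 σ, mul_assoc σ 2]
  refine mul_le_mul_of_nonneg_left ?_ hσ.le
  have h0 : 0 ≤ σ * |x| := by positivity
  rw [show (σ * x) ^ 2 = (σ * |x|) ^ 2 by rw [mul_pow, mul_pow, sq_abs]]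
  nlinarith [sq_nonneg (σ * |x| - 1), sq_nonneg ((σ * |x|) ^ 2), sq_nonneg (σ * |x|)]

lemma lintegral_kerC {σ : ℝ} (hσ : 0 < σ) : ∫⁻ x, kerC σ x = ofReal π := by
  have h := lintegral_inv_one_add_sq_div (inv_pos.2 hσ)
  simp only [div_inv_eq_mul, mul_comm _ σ] at h
  unfold kerC
  simp only [ofReal_mul hσ.le]
  rw [lintegral_const_mul _ (by fun_prop), h, ← ofReal_mul hσ.le, ← mul_assoc,
    mul_inv_cancel₀ hσ.ne', one_mul]

lemma kerC_le {σ : ℝ} (hσ : 0 < σ) (x : ℝ) : kerC σ x ≤ ofReal σ := by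
  refine ofReal_le_ofReal (mul_le_of_le_one_right hσ.le (inv_le_one_of_one_le₀ ?_))
  nlinarith [sq_nonneg (σ * x)]

lemma kerB_sq_le {σ : ℝ} (hσ : 0 < σ) (x : ℝ) : kerB σ x ^ 2 ≤ ofReal σ * kerC σ x := by
  rw [kerB, kerC, ← ofReal_pow (by positivity), ← ofReal_mul hσ.le]
  refine ofReal_le_ofReal ?_
  rw [div_pow, ← mul_assoc, ← sq, ← div_eq_mul_inv]
  refine div_le_div_of_nonneg_left (by positivity) (by positivity) ?_
  have h0 : 0 ≤ σ * |x| := by positivity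
  rw [show (σ * x) ^ 2 = (σ * |x|) ^ 2 by rw [mul_pow, mul_pow, sq_abs]]
  nlinarith

lemma l2n_mono {α : Type*} [MeasureSpace α] {f g : α → ℝ≥0∞} (h : ∀ x, f x ≤ g x) :
    l2n f ≤ l2n g := by
  unfold l2n
  gcongr
  exact h _

lemma lintegral_sq_const_mul {α : Type*} [MeasureSpace α] {f : α → ℝ≥0∞} (hf : Measurable f)
    (c : ℝ≥0∞) : ∫⁻ x, (c * f x) ^ 2 = c ^ 2 * ∫⁻ x, f x ^ 2 := by
  simp only [mul_pow]
  exact lintegral_const_mul _ (by fun_prop)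

lemma l2n_const_mul {α : Type*} [MeasureSpace α] {f : α → ℝ≥0∞} (hf : Measurable f)
    (c : ℝ≥0∞) : l2n (fun x => c * f x) = c * l2n f := by
  refine le_antisymm ?_ ?_ <;> refine le_of_sq_le_sq ?_ <;>
    rw [mul_pow, l2n_sq, l2n_sq, lintegral_sq_const_mul hf]

lemma l2n_sq_prod {α β : Type*} [MeasureSpace α] [MeasureSpace β]
    [SFinite (volume : Measure α)] [SFinite (volume : Measure β)] {V : α × β → ℝ≥0∞}
    (hV : Measurable V) : ∫⁻ a, l2n (fun p => V (a, p)) ^ 2 = l2n V ^ 2 := by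
  simp only [l2n_sq]
  exact (lintegral_prod₂ (F := fun x => V x ^ 2) (by fun_prop)).symm

lemma measurable_l2n_section {α β : Type*} [MeasureSpace α] [MeasureSpace β]
    [SFinite (volume : Measure β)] {V : α × β → ℝ≥0∞}
    (hV : Measurable V) : Measurable fun a => l2n fun p => V (a, p) := by
  unfold l2n
  have : Measurable fun a => ∫⁻ p, V (a, p) ^ 2 :=
    Measurable.lintegral_prod_right' (f := fun x => V x ^ 2) (by fun_prop)
  fun_prop

lemma lintegral_l2n_le {J : ℝ} (hJ : 0 < J) {V : ℝ³ → ℝ≥0∞} (hV : Measurable V)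
    (hVJ : ∀ a p, V (a, p) ≠ 0 → |a| ≤ 2 * J) :
    ∫⁻ a, l2n (fun p => V (a, p)) ≤ ofReal (2 * √J) * l2n V := by
  refine le_of_sq_le_sq ?_
  have hI : Measurable ((Icc (-(2 * J)) (2 * J)).indicator (1 : ℝ → ℝ≥0∞)) :=
    measurable_one.indicator measurableSet_Icc
  refine (lintegral_sq_le (X := fun a => l2n fun p => V (a, p))
    (A := (Icc (-(2 * J)) (2 * J)).indicator 1) (B := fun a => l2n (fun p => V (a, p)) ^ 2)
    hI.aemeasurable ((measurable_l2n_section hV).pow_const 2).aemeasurable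
    (.of_forall fun a => ?_)).trans ?_
  · by_cases ha : |a| ≤ 2 * J
    · rw [indicator_of_mem (s := Icc _ _) (abs_le.1 ha)]; simp
    · have : ∀ p, V (a, p) = 0 := fun p => by_contra fun h => ha (hVJ a p h)
      simp [l2n, this]
  · rw [l2n_sq_prod hV, lintegral_indicator measurableSet_Icc, Pi.one_def, lintegral_const,
      restrict_apply_univ, Real.volume_Icc, one_mul, mul_pow,
      ← ofReal_pow (by positivity), mul_pow, sq_sqrt hJ.le]
    gcongr
    linarith

lemma l2n_conv_sq_le {k k₁ k₂ : ℝ → ℝ≥0∞} {A : ℝ≥0∞} {J θ : ℝ} {V : ℝ³ → ℝ≥0∞}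
    {H : ℝ² × ℝ → ℝ≥0∞} (hk₁ : Measurable k₁) (hk₂ : Measurable k₂)
    (hV : Measurable V) (hk : ∀ x, k x ^ 2 ≤ k₁ x * k₂ x)
    (hA : ∀ y, ∫⁻ c in Icc (-(2 * J)) (2 * J), k₁ (y + c) ≤ A)
    (hVJ : ∀ a p, V (a, p) ≠ 0 → |a| ≤ 2 * J)
    (hH : ∀ z, H z ≤ ∫⁻ c, V (c, -z.1) * k (θ + c + z.2)) :
    l2n H ^ 2 ≤ A * ((∫⁻ x, k₂ x) * l2n V ^ 2) := by
  have hI : Measurable ((Icc (-(2 * J)) (2 * J)).indicator (1 : ℝ → ℝ≥0∞)) :=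
    measurable_one.indicator measurableSet_Icc
  have hm2 : Measurable fun x : (ℝ² × ℝ) × ℝ =>
      V (x.2, -x.1.1) ^ 2 * k₂ (θ + x.2 + x.1.2) := by fun_prop
  have h1 : ∀ z, H z ^ 2 ≤ A * ∫⁻ c, V (c, -z.1) ^ 2 * k₂ (θ + c + z.2) := by
    intro z
    calc H z ^ 2 ≤ (∫⁻ c, V (c, -z.1) * k (θ + c + z.2)) ^ 2 := by gcongr; exact hH z
      _ ≤ (∫⁻ c, (Icc (-(2 * J)) (2 * J)).indicator 1 c * k₁ (θ + c + z.2)) *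
          ∫⁻ c, V (c, -z.1) ^ 2 * k₂ (θ + c + z.2) := by
        refine lintegral_sq_le (by fun_prop) (by fun_prop) (.of_forall fun c => ?_)
        by_cases hc : |c| ≤ 2 * J
        · rw [indicator_of_mem (s := Icc _ _) (abs_le.1 hc), mul_pow, Pi.one_apply, one_mul]
          calc V (c, -z.1) ^ 2 * k (θ + c + z.2) ^ 2
              ≤ V (c, -z.1) ^ 2 * (k₁ (θ + c + z.2) * k₂ (θ + c + z.2)) := by gcongr; exact hk _
            _ = _ := by ring
        · have : V (c, -z.1) = 0 := by_contra fun h => hc (hVJ c _ h)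
          simp [this]
      _ ≤ _ := by
        gcongr
        refine le_trans (le_of_eq ?_) (hA (θ + z.2))
        rw [← lintegral_indicator measurableSet_Icc]
        refine lintegral_congr fun c => ?_
        by_cases hc : c ∈ Icc (-(2 * J)) (2 * J)
        · simp only [indicator_of_mem hc, Pi.one_apply, one_mul]; ring_nf
        · simp only [indicator_of_notMem hc, zero_mul]
  rw [l2n_sq]
  calc ∫⁻ z, H z ^ 2 ≤ ∫⁻ z : ℝ² × ℝ, A * ∫⁻ c, V (c, -z.1) ^ 2 * k₂ (θ + c + z.2) :=
        lintegral_mono h1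
    _ = A * ∫⁻ z : ℝ² × ℝ, ∫⁻ c, V (c, -z.1) ^ 2 * k₂ (θ + c + z.2) :=
        lintegral_const_mul _ hm2.lintegral_prod_right'
    _ = A * ((∫⁻ x, k₂ x) * l2n V ^ 2) := by
        congr 1
        rw [lintegral_lintegral_swap hm2.aemeasurable]
        have e : ∀ c, ∫⁻ z : ℝ² × ℝ, V (c, -z.1) ^ 2 * k₂ (θ + c + z.2) =
            (∫⁻ x, k₂ x) * ∫⁻ p, V (c, p) ^ 2 := by
          intro c
          rw [lintegral_prod₂ (by fun_prop)]
          have e2 : ∀ p : ℝ², ∫⁻ s, V (c, -p) ^ 2 * k₂ (θ + c + s) =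
              (∫⁻ x, k₂ x) * V (c, -p) ^ 2 := fun p => by
            rw [lintegral_const_mul _ (by fun_prop), lintegral_add_left_eq_self, mul_comm]
          simp only [e2]
          rw [lintegral_const_mul _ (by fun_prop), lintegral_neg_eq_self (fun p => V (c, p) ^ 2)]
        simp only [e]
        have hm3 : Measurable fun c => ∫⁻ p, V (c, p) ^ 2 :=
          Measurable.lintegral_prod_right' (f := fun x => V x ^ 2) (by fun_prop)
        rw [lintegral_const_mul _ hm3, ← l2n_sq_prod hV]
        simp only [l2n_sq]

lemma lintegral_lintegral_l2n_le {V₁ V₂ : ℝ³ → ℝ≥0∞} {J₁ J₂ : ℝ} {D : ℝ≥0∞}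
    {F : ℝ → ℝ → ℝ≥0∞} (hJ₁ : 0 < J₁) (hJ₂ : 0 < J₂) (h1 : Measurable V₁) (h2 : Measurable V₂)
    (hV1 : ∀ a p, V₁ (a, p) ≠ 0 → |a| ≤ 2 * J₁) (hV2 : ∀ a p, V₂ (a, p) ≠ 0 → |a| ≤ 2 * J₂)
    (hF : ∀ a b, |a| ≤ 2 * J₁ → |b| ≤ 2 * J₂ →
      F a b ≤ D * (l2n (fun p => V₁ (a, p)) * l2n (fun p => V₂ (b, p))))
    (hF1 : ∀ a b, (∀ p, V₁ (a, p) = 0) → F a b = 0)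
    (hF2 : ∀ a b, (∀ p, V₂ (b, p) = 0) → F a b = 0) :
    ∫⁻ a, ∫⁻ b, F a b ≤ ofReal (4 * (√J₁ * √J₂)) * (D * (l2n V₁ * l2n V₂)) := by
  have hF' : ∀ a b, F a b ≤ D * (l2n (fun p => V₁ (a, p)) * l2n (fun p => V₂ (b, p))) := by
    intro a b
    by_cases ha : |a| ≤ 2 * J₁
    · by_cases hb : |b| ≤ 2 * J₂
      · exact hF a b ha hb
      · rw [hF2 a b fun p => by_contra fun h => hb (hV2 _ _ h)]; exact zero_le
    · rw [hF1 a b fun p => by_contra fun h => ha (hV1 _ _ h)]; exact zero_le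
  have m1 := measurable_l2n_section h1
  have m2 := measurable_l2n_section h2
  calc ∫⁻ a, ∫⁻ b, F a b
      ≤ ∫⁻ a, ∫⁻ b, D * (l2n (fun p => V₁ (a, p)) * l2n (fun p => V₂ (b, p))) :=
        lintegral_mono fun a => lintegral_mono fun b => hF' a b
    _ = D * ((∫⁻ a, l2n (fun p => V₁ (a, p))) * ∫⁻ b, l2n (fun p => V₂ (b, p))) := by
        simp only [← mul_assoc]
        have e : ∀ a, ∫⁻ b, D * l2n (fun p => V₁ (a, p)) * l2n (fun p => V₂ (b, p)) =
            D * l2n (fun p => V₁ (a, p)) * ∫⁻ b, l2n (fun p => V₂ (b, p)) := fun a =>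
          lintegral_const_mul _ m2
        simp only [e]
        rw [lintegral_mul_const _ (by fun_prop), lintegral_const_mul _ m1]
    _ ≤ D * ((ofReal (2 * √J₁) * l2n V₁) * (ofReal (2 * √J₂) * l2n V₂)) := by
        gcongr
        exacts [lintegral_l2n_le hJ₁ h1 hV1, lintegral_l2n_le hJ₂ h2 hV2]
    _ = _ := by
        rw [show 4 * (√J₁ * √J₂) = (2 * √J₁) * (2 * √J₂) by ring,
          ofReal_mul (by positivity : 0 ≤ 2 * √J₁)]
        ring

lemma bform_zero_left {S : Set ℝ⁴} {f g : ℝ² → ℝ≥0∞}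
    {H : ℝ² × ℝ → ℝ≥0∞} (h : ∀ p, f p = 0) : bform S f g H = 0 := by
  simp [bform, h]

lemma bform_zero_right {S : Set ℝ⁴} {f g : ℝ² → ℝ≥0∞}
    {H : ℝ² × ℝ → ℝ≥0∞} (h : ∀ p, g p = 0) : bform S f g H = 0 := by
  simp [bform, h]

lemma convKernel_ne_zero {κ : ℝ → ℝ≥0∞} {V : ℝ³ → ℝ≥0∞} {θ : ℝ} {z : ℝ² × ℝ}
    (h : convKernel κ V θ z ≠ 0) : ∃ c, V (c, -z.1) ≠ 0 := by
  by_contra! h0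
  exact h (by simp [convKernel, h0])

section fixed

variable {V₁ V₂ V₃ : ℝ³ → ℝ≥0∞}

lemma tform_kerB_fixed_le {σ K J₁ J₂ J₃ : ℝ} (hσ : 0 < σ) (hK : 0 < K) (hJ₁ : 0 < J₁)
    (hJ₂ : 0 < J₂) (hJ₃ : 0 < J₃) (h1 : Measurable V₁) (h2 : Measurable V₂) (h3 : Measurable V₃)
    (hV1 : ∀ a p, V₁ (a, p) ≠ 0 → |a| ≤ 2 * J₁) (hV2 : ∀ a p, V₂ (a, p) ≠ 0 → |a| ≤ 2 * J₂)
    (hV3 : ∀ a p, V₃ (a, p) ≠ 0 → |a| ≤ 2 * J₃)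
    (hK3 : ∀ a p, V₃ (a, p) ≠ 0 → K ≤ |p.1| ∧ |p.1| ≤ 32 * K) :
    tform (kerB σ) 1 V₁ V₂ V₃ ≤
      ofReal (400 * √σ * (√J₁ * √J₂ * √J₃)) * (l2n V₁ * l2n V₂ * l2n V₃) := by
  rw [tform_one_eq (by fun_prop) h1 h2 h3]
  have hc : ∀ θ, l2n (convKernel (kerB σ) V₃ θ) ≤ ofReal (4 * √σ * √J₃) * l2n V₃ := by
    intro θ
    refine le_of_sq_le_sq ?_
    refine (l2n_conv_sq_le (k := kerB σ) (k₁ := 1) (k₂ := fun x => kerB σ x ^ 2)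
      (A := ofReal (4 * J₃)) (J := J₃) (θ := θ) measurable_one (by fun_prop) h3 (by simp)
      (fun y => ?_) hV3 (fun z => le_rfl)).trans ?_
    · rw [Pi.one_def, lintegral_const, restrict_apply_univ, Real.volume_Icc, one_mul]
      exact ofReal_le_ofReal (by linarith)
    · have h : ∫⁻ x, kerB σ x ^ 2 ≤ ofReal (4 * σ) := by
        calc ∫⁻ x, kerB σ x ^ 2 ≤ ∫⁻ x, ofReal σ * kerC σ x :=
              lintegral_mono (kerB_sq_le hσ)
          _ = ofReal (σ * π) := by
              rw [lintegral_const_mul _ (by fun_prop), lintegral_kerC hσ, ← ofReal_mul hσ.le]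
          _ ≤ _ := ofReal_le_ofReal (by nlinarith [pi_le_four])
      rw [mul_pow, ← ofReal_pow (by positivity), ← mul_assoc,
        show (4 * √σ * √J₃) ^ 2 = (4 * J₃) * (4 * σ) by
          rw [mul_pow, mul_pow, sq_sqrt hσ.le, sq_sqrt hJ₃.le]; ring,
        ofReal_mul (by positivity : 0 ≤ 4 * J₃)]
      gcongr
  refine (lintegral_lintegral_l2n_le (D := 22 * (ofReal (4 * √σ * √J₃) * l2n V₃))
    hJ₁ hJ₂ h1 h2 hV1 hV2 (fun a b _ _ => ?_) (fun a b h => bform_zero_left h)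
    (fun a b h => bform_zero_right h)).trans ?_
  · refine (bform_univ_le hK (by fun_prop) (by fun_prop) (measurable_convKernel (by fun_prop) h3 _)
      (fun r s h => ?_)).trans ?_
    · obtain ⟨c, hc⟩ := convKernel_ne_zero h
      simpa using hK3 _ _ hc
    · calc 22 * (l2n (fun p => V₁ (a, p)) * l2n (fun p => V₂ (b, p)) *
            l2n (convKernel (kerB σ) V₃ (a + b)))
          ≤ 22 * (l2n (fun p => V₁ (a, p)) * l2n (fun p => V₂ (b, p)) *
            (ofReal (4 * √σ * √J₃) * l2n V₃)) := by gcongr; exact hc _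
        _ = _ := by ring
  · calc _ = ofReal (4 * (√J₁ * √J₂)) * (22 * ofReal (4 * √σ * √J₃)) *
          (l2n V₁ * l2n V₂ * l2n V₃) := by ring
      _ ≤ _ := by
        gcongr
        rw [show (22 : ℝ≥0∞) = ofReal 22 by norm_num, ← ofReal_mul (by norm_num),
          ← ofReal_mul (by positivity)]
        refine ofReal_le_ofReal ?_
        have : 0 ≤ √σ * (√J₁ * √J₂ * √J₃) := by positivity
        nlinarith

lemma modWeight_mul_kerI_le {σ R x s : ℝ} (hσ : 0 < σ) (hR : 0 < R) (hRσ : 1 ≤ R * σ)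
    (hs : |s - x| ≤ 6 * R) : modWeight R s * kerI σ x ≤ 9 * kerC σ x := by
  rw [modWeight, kerI, kerC, show (9 : ℝ≥0∞) = ofReal 9 by norm_num,
    ← ofReal_mul (sqrt_nonneg _), ← ofReal_mul (by norm_num)]
  refine ofReal_le_ofReal ?_
  set y := σ * x with hy
  have hq : 0 < 1 + y ^ 2 := by positivity
  have h1 : √(1 + (s / R) ^ 2) ≤ 9 * (1 + y ^ 2) := by
    rw [Real.sqrt_le_left (by positivity)]
    have h2 : |s| ≤ |x| + 6 * R := by
      have := abs_add_le (s - x) x; rw [sub_add_cancel] at this; linarith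
    have h3 : |s / R| ≤ |y| + 6 := by
      rw [abs_div, abs_of_pos hR, div_le_iff₀ hR, hy, abs_mul, abs_of_pos hσ]
      have := mul_le_mul_of_nonneg_right hRσ (abs_nonneg x)
      nlinarith
    have h4 : (s / R) ^ 2 ≤ (|y| + 6) ^ 2 := by rw [← sq_abs (s / R)]; gcongr
    have h5 : (|y| + 6) ^ 2 ≤ 2 * y ^ 2 + 72 := by rw [← sq_abs y]; nlinarith [sq_nonneg (|y| - 6)]
    nlinarith [sq_nonneg (y ^ 2), sq_nonneg y]
  calc √(1 + (s / R) ^ 2) * (σ / (1 + y ^ 2) ^ 2) ≤ 9 * (1 + y ^ 2) * (σ / (1 + y ^ 2) ^ 2) := by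
        gcongr
    _ = 9 * (σ * (1 + y ^ 2)⁻¹) := by field_simp

lemma tform_kerI_fixed_le {σ K₁ K₂ K₃ J₁ J₂ J₃ : ℝ} (hσ : 0 < σ) (hK₁ : 0 < K₁) (hK₂ : 0 < K₂)
    (hK₃ : 0 < K₃) (hJ₁ : 0 < J₁) (hJ₂ : 0 < J₂) (hJ₃ : 0 < J₃) (hJ13 : J₁ ≤ J₃) (hJ23 : J₂ ≤ J₃)
    (h1 : Measurable V₁) (h2 : Measurable V₂) (h3 : Measurable V₃)
    (hV1 : ∀ a p, V₁ (a, p) ≠ 0 → |a| ≤ 2 * J₁) (hV2 : ∀ a p, V₂ (a, p) ≠ 0 → |a| ≤ 2 * J₂)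
    (hV3 : ∀ a p, V₃ (a, p) ≠ 0 → |a| ≤ 2 * J₃)
    (hk1 : ∀ a p, V₁ (a, p) ≠ 0 → K₁ ≤ |p.1|) (hk2 : ∀ a p, V₂ (a, p) ≠ 0 → K₂ ≤ |p.1|)
    (hk3 : ∀ a p, V₃ (a, p) ≠ 0 → K₃ ≤ |p.1| ∧ |p.1| ≤ 32 * K₃) :
    tform (kerI σ) 1 V₁ V₂ V₃ ≤ ofReal (8640 * (√(K₁ * K₂ * K₃))⁻¹ * (√J₁ * √J₂ * √J₃)) *
        (l2n V₁ * l2n V₂ * l2n V₃) := by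
  rw [tform_one_eq (by fun_prop) h1 h2 h3]
  set R := max J₃ σ⁻¹ with hRdef
  have hJR : J₃ ≤ R := le_max_left _ _
  have hR : 0 < R := hJ₃.trans_le hJR
  have hRσ : 1 ≤ R * σ := by
    rw [← inv_mul_cancel₀ hσ.ne']
    exact mul_le_mul_of_nonneg_right (le_max_right _ _) hσ.le
  have hmc := fun θ => measurable_convKernel (measurable_kerI σ) h3 θ
  have hc : ∀ θ, |θ| ≤ 4 * J₃ → l2n (fun z => modWeight R z.2 * convKernel (kerI σ) V₃ θ z) ≤
      ofReal (36 * √(J₃ / R)) * l2n V₃ := by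
    intro θ hθ
    have e : l2n (fun z : ℝ² × ℝ => ∫⁻ c, V₃ (c, -z.1) * kerC σ (θ + c + z.2)) ≤
        ofReal (4 * √(J₃ / R)) * l2n V₃ := by
      refine le_of_sq_le_sq ?_
      refine (l2n_conv_sq_le (k := kerC σ) (k₁ := kerC σ) (k₂ := kerC σ)
        (A := ofReal (4 * (J₃ / R))) (J := J₃) (θ := θ) (by fun_prop) (by fun_prop) h3
        (fun x => (sq _).le) (fun y => ?_) hV3 (fun z => le_rfl)).trans ?_
      · rcases max_choice J₃ σ⁻¹ with h | h
        · rw [← hRdef] at h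
          rw [h, div_self hJ₃.ne', mul_one]
          refine (setLIntegral_le_lintegral _ _).trans ?_
          rw [lintegral_add_left_eq_self (kerC σ) y, lintegral_kerC hσ]
          exact ofReal_le_ofReal pi_le_four
        · rw [← hRdef] at h
          calc ∫⁻ c in Icc (-(2 * J₃)) (2 * J₃), kerC σ (y + c)
              ≤ ∫⁻ c in Icc (-(2 * J₃)) (2 * J₃), ofReal σ := lintegral_mono fun c => kerC_le hσ _
            _ = _ := by
              rw [lintegral_const, restrict_apply_univ, Real.volume_Icc,
                ← ofReal_mul hσ.le, h, div_inv_eq_mul]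
              congr 1; ring
      · rw [lintegral_kerC hσ, mul_pow, ← ofReal_pow (by positivity), ← mul_assoc,
          ← ofReal_mul (by positivity)]
        gcongr
        rw [mul_pow, sq_sqrt (by positivity)]
        have : 0 ≤ J₃ / R := by positivity
        nlinarith [pi_le_four]
    calc l2n (fun z => modWeight R z.2 * convKernel (kerI σ) V₃ θ z)
        ≤ l2n (fun z : ℝ² × ℝ => 9 * ∫⁻ c, V₃ (c, -z.1) * kerC σ (θ + c + z.2)) := by
          refine l2n_mono fun z => ?_
          rw [convKernel, ← lintegral_const_mul _ (by fun_prop),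
            ← lintegral_const_mul _ (by fun_prop)]
          refine lintegral_mono fun c => ?_
          by_cases hc0 : V₃ (c, -z.1) = 0
          · simp [hc0]
          have := hV3 _ _ hc0
          have hm := modWeight_mul_kerI_le (x := θ + c + z.2) (s := z.2) hσ hR hRσ (by
            rw [show z.2 - (θ + c + z.2) = -(θ + c) by ring, abs_neg]
            have := abs_add_le θ c
            linarith)
          calc modWeight R z.2 * (V₃ (c, -z.1) * kerI σ (θ + c + z.2))
              = V₃ (c, -z.1) * (modWeight R z.2 * kerI σ (θ + c + z.2)) := by ring
            _ ≤ V₃ (c, -z.1) * (9 * kerC σ (θ + c + z.2)) := by gcongr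
            _ = _ := by ring
      _ = 9 * l2n (fun z : ℝ² × ℝ => ∫⁻ c, V₃ (c, -z.1) * kerC σ (θ + c + z.2)) :=
          l2n_const_mul (measurable_convKernel (measurable_kerC σ) h3 θ) 9
      _ ≤ 9 * (ofReal (4 * √(J₃ / R)) * l2n V₃) := by gcongr
      _ = _ := by
          rw [← mul_assoc, show (9 : ℝ≥0∞) = ofReal 9 by norm_num, ← ofReal_mul (by norm_num)]
          congr 2; ring
  refine (lintegral_lintegral_l2n_le (D := 60 * (ofReal √(R / (K₁ * K₂ * K₃)) *
      (ofReal (36 * √(J₃ / R)) * l2n V₃)))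
    hJ₁ hJ₂ h1 h2 hV1 hV2 (fun a b ha hb => ?_) (fun a b h => bform_zero_left h)
    (fun a b h => bform_zero_right h)).trans ?_
  · refine (bform_univ_le_modWeight hK₁ hK₂ hK₃ hR (by fun_prop) (by fun_prop) (hmc _)
      (hk1 a) (hk2 b) (fun r s h => ?_)).trans ?_
    · obtain ⟨c, hc⟩ := convKernel_ne_zero h
      simpa using hk3 _ _ hc
    · have := hc (a + b) (by have := abs_add_le a b; linarith)
      calc _ ≤ 60 * (ofReal √(R / (K₁ * K₂ * K₃)) *
            (l2n (fun p => V₁ (a, p)) * l2n (fun p => V₂ (b, p)) *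
              (ofReal (36 * √(J₃ / R)) * l2n V₃))) := by gcongr
        _ = _ := by ring
  · have e : √(R / (K₁ * K₂ * K₃)) * √(J₃ / R) = (√(K₁ * K₂ * K₃))⁻¹ * √J₃ := by
      rw [← sqrt_mul (by positivity), ← Real.sqrt_inv, ← sqrt_mul (by positivity)]
      congr 1
      field_simp
    calc _ = ofReal (4 * (√J₁ * √J₂)) * (60 * (ofReal √(R / (K₁ * K₂ * K₃)) *
          ofReal (36 * √(J₃ / R)))) * (l2n V₁ * l2n V₂ * l2n V₃) := by ring
      _ ≤ _ := by
        gcongr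
        rw [show (60 : ℝ≥0∞) = ofReal 60 by norm_num,
          ← ofReal_mul (sqrt_nonneg _), ← ofReal_mul (by norm_num),
          ← ofReal_mul (by positivity)]
        refine ofReal_le_ofReal (le_of_eq ?_)
        calc _ = 8640 * (√(R / (K₁ * K₂ * K₃)) * √(J₃ / R)) * (√J₁ * √J₂) := by ring
          _ = _ := by rw [e]; ring

end fixed

/-! ### The dyadic partition of unity -/

section cutoff

variable (η : Cutoff)

lemma Cutoff.eq_zero {x : ℝ} (hx : 8 / 5 < |x|) : η.toFun x = 0 := by
  by_contra h
  exact absurd (abs_le.2 (η.support_subset h)) (not_le.2 hx)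

lemma Cutoff.eq_one' {x : ℝ} (hx : |x| ≤ 5 / 4) : η.toFun x = 1 := η.eq_one x (abs_le.1 hx)

lemma Cutoff.dyadic_succ_eq_zero_or {k : ℕ} {x : ℝ} (h : η.dyadic (k + 1) x ≠ 0) :
    5 / 4 * 2 ^ k ≤ |x| := by
  by_contra! hx
  have h2 : (0 : ℝ) < 2 ^ k := by positivity
  apply h
  have e1 : η.toFun (x / 2 ^ k) = 1 := η.eq_one' (by
    rw [abs_div, abs_of_pos h2, div_le_iff₀ h2]; exact hx.le)
  have e2 : η.toFun (x / 2 ^ (k + 1)) = 1 := η.eq_one' (by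
    have h3 : (0 : ℝ) < 2 ^ (k + 1) := by positivity
    rw [abs_div, abs_of_pos h3, div_le_iff₀ h3, pow_succ]; linarith)
  simp [Cutoff.dyadic, e1, e2]

lemma Cutoff.abs_le_of_dyadic_ne_zero {k : ℕ} {x : ℝ} (h : η.dyadic k x ≠ 0) :
    |x| ≤ 8 / 5 * 2 ^ k := by
  by_contra! hx
  apply h
  have h2 : (0 : ℝ) < 2 ^ k := by positivity
  cases k with
  | zero => exact η.eq_zero (by simpa using hx)
  | succ k =>
    have h3 : (0 : ℝ) < 2 ^ k := by positivity
    have e1 : η.toFun (x / 2 ^ k) = 0 := η.eq_zero (by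
      rw [abs_div, abs_of_pos h3, lt_div_iff₀ h3]; rw [pow_succ] at hx; linarith)
    have e2 : η.toFun (x / 2 ^ (k + 1)) = 0 := η.eq_zero (by
      rw [abs_div, abs_of_pos h2, lt_div_iff₀ h2]; exact hx)
    simp [Cutoff.dyadic, e1, e2]

lemma Cutoff.le_abs_of_dyadic_ne_zero {k : ℕ} (hk : 1 ≤ k) {x : ℝ} (h : η.dyadic k x ≠ 0) :
    5 / 8 * 2 ^ k ≤ |x| := by
  obtain ⟨k, rfl⟩ := Nat.exists_eq_add_of_le' hk
  have := η.dyadic_succ_eq_zero_or h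
  rw [pow_succ]; linarith

lemma Cutoff.dyadic_nonneg (k : ℕ) (x : ℝ) : 0 ≤ η.dyadic k x := by
  cases k with
  | zero => exact (η.mem_Icc x).1
  | succ k =>
    by_cases hx : |x| ≤ 8 / 5 * 2 ^ k
    · have h3 : (0 : ℝ) < 2 ^ (k + 1) := by positivity
      have e2 : η.toFun (x / 2 ^ (k + 1)) = 1 := η.eq_one' (by
        rw [abs_div, abs_of_pos h3, div_le_iff₀ h3, pow_succ]
        have : (0 : ℝ) < 2 ^ k := by positivity
        linarith)
      simp only [Cutoff.dyadic, e2]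
      linarith [(η.mem_Icc (x / 2 ^ k)).2]
    · have h3 : (0 : ℝ) < 2 ^ k := by positivity
      have e1 : η.toFun (x / 2 ^ k) = 0 := η.eq_zero (by
        rw [abs_div, abs_of_pos h3, lt_div_iff₀ h3]; exact not_le.1 hx)
      simp only [Cutoff.dyadic, e1, sub_zero]
      exact (η.mem_Icc _).1

lemma Cutoff.dyadic_le_one (k : ℕ) (x : ℝ) : η.dyadic k x ≤ 1 :=
  (le_abs_self _).trans (η.norm_dyadic_le k x)

lemma Cutoff.dyadic_neg (k : ℕ) (x : ℝ) : η.dyadic k (-x) = η.dyadic k x := by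
  cases k <;> simp [Cutoff.dyadic, neg_div, η.even]

lemma Cutoff.sum_range_dyadic (n : ℕ) (x : ℝ) :
    ∑ k ∈ Finset.range (n + 1), η.dyadic k x = η.toFun (x / 2 ^ n) := by
  induction n with
  | zero => simp [Cutoff.dyadic]
  | succ n ih => rw [Finset.sum_range_succ, ih]; simp [Cutoff.dyadic]

lemma Cutoff.hasSum_dyadic (x : ℝ) : HasSum (fun k => η.dyadic k x) 1 := by
  rw [hasSum_iff_tendsto_nat_of_nonneg fun k => η.dyadic_nonneg k x]
  refine (tendsto_add_atTop_iff_nat 1).1 ?_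
  simp only [η.sum_range_dyadic]
  refine tendsto_const_nhds.congr' ?_
  have h : Tendsto (fun n : ℕ => |x| / 2 ^ n) atTop (𝓝 0) :=
    tendsto_const_nhds.div_atTop (tendsto_pow_atTop_atTop_of_one_lt one_lt_two)
  filter_upwards [h.eventually (eventually_le_nhds (by norm_num : (0 : ℝ) < 5 / 4))] with n hn
  refine (η.eq_one' ?_).symm
  rwa [abs_div, abs_of_pos (by positivity : (0 : ℝ) < 2 ^ n)]

lemma Cutoff.tsum_ofReal_dyadic (x : ℝ) : ∑' k, ofReal (η.dyadic k x) = 1 := by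
  rw [← ofReal_tsum_of_nonneg (fun k => η.dyadic_nonneg k x) (η.hasSum_dyadic x).summable,
    (η.hasSum_dyadic x).tsum_eq, ofReal_one]

@[fun_prop]
lemma Cutoff.measurable_dyadic (k : ℕ) : Measurable (η.dyadic k) :=
  (η.continuous_dyadic k).measurable

/-! ### The norm with weights in the modulation -/

/-- The norm `∑_j 2^(j/2) ‖η_j(θ) V(θ, p)‖_{L²}`. -/
def xn (V : ℝ³ → ℝ≥0∞) : ℝ≥0∞ :=
  ∑' j : ℕ, ofReal √(2 ^ j) * l2n fun x => ofReal (η.dyadic j x.1) * V x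

lemma xn_mono {V W : ℝ³ → ℝ≥0∞} (h : ∀ x, V x ≤ W x) : xn η V ≤ xn η W := by
  refine tsum_le_tsum fun j => ?_
  gcongr
  exact l2n_mono fun x => by gcongr; exact h x

end cutoff

section

variable {κ : ℝ → ℝ≥0∞} {M : ℝ⁴ → ℝ≥0∞} {V₁ V₂ V₃ : ℝ³ → ℝ≥0∞}

lemma measurable_tform (hκ : Measurable κ) (hM : Measurable M) (h1 : Measurable V₁)
    (h2 : Measurable V₂) (h3 : Measurable V₃) :
    Measurable fun x : ℝ⁴ × ℝ³ =>
      M x.1 * (V₁ (x.2.1, x.1.1) * V₂ (x.2.2.1, x.1.2) *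
      V₃ (x.2.2.2, -(x.1.1 + x.1.2)) * κ (x.2.1 + x.2.2.1 + x.2.2.2 + reson x.1.1 x.1.2)) := by
  fun_prop

lemma tform_const (c : ℝ≥0∞) (hκ : Measurable κ) (h1 : Measurable V₁)
    (h2 : Measurable V₂) (h3 : Measurable V₃) :
    tform κ (fun _ => c) V₁ V₂ V₃ = c * tform κ 1 V₁ V₂ V₃ := by
  have hm := measurable_tform hκ (M := fun _ => 1) measurable_const h1 h2 h3
  unfold tform
  simp only [one_mul] at hm
  simp only [Pi.one_apply, one_mul]
  rw [← lintegral_const_mul _ hm.lintegral_prod_right']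
  refine lintegral_congr fun z => ?_
  rw [lintegral_const_mul _ (by fun_prop)]

lemma tform_const_kernel (c : ℝ≥0∞) (hκ : Measurable κ) (hM : Measurable M) (h1 : Measurable V₁)
    (h2 : Measurable V₂) (h3 : Measurable V₃) :
    tform (fun x => c * κ x) M V₁ V₂ V₃ = c * tform κ M V₁ V₂ V₃ := by
  have hm := measurable_tform hκ hM h1 h2 h3
  unfold tform
  rw [← lintegral_const_mul _ hm.lintegral_prod_right']
  refine lintegral_congr fun z => ?_
  rw [← lintegral_const_mul _ (by fun_prop)]
  refine lintegral_congr fun t => ?_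
  ring

lemma tform_le_tsum {M' : ℕ → ℝ⁴ → ℝ≥0∞} {W : ℕ → ℝ³ → ℝ≥0∞}
    (hκ : Measurable κ) (hM' : ∀ n, Measurable (M' n)) (hW : ∀ n, Measurable (W n))
    (h2 : Measurable V₂) (h3 : Measurable V₃)
    (h : ∀ a p q, M (p, q) * V₁ (a, p) ≤ ∑' n, M' n (p, q) * W n (a, p)) :
    tform κ M V₁ V₂ V₃ ≤ ∑' n, tform κ (M' n) (W n) V₂ V₃ := by
  have hm := fun n => measurable_tform hκ (hM' n) (hW n) h2 h3
  unfold tform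
  rw [← lintegral_tsum fun n =>
    ((hm n).lintegral_prod_right' (ν := (volume : Measure ℝ³))).aemeasurable]
  refine lintegral_mono fun z => ?_
  have hms : ∀ n, Measurable fun t : ℝ³ => M' n z * (W n (t.1, z.1) * V₂ (t.2.1, z.2) *
      V₃ (t.2.2, -(z.1 + z.2)) * κ (t.1 + t.2.1 + t.2.2 + reson z.1 z.2)) := fun n => by
    have := hW n
    fun_prop
  simp only
  rw [← lintegral_tsum fun n => (hms n).aemeasurable]
  refine lintegral_mono fun t => ?_
  simp only
  calc M z * (V₁ (t.1, z.1) * V₂ (t.2.1, z.2) * V₃ (t.2.2, -(z.1 + z.2)) *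
        κ (t.1 + t.2.1 + t.2.2 + reson z.1 z.2))
      = (M z * V₁ (t.1, z.1)) * (V₂ (t.2.1, z.2) * V₃ (t.2.2, -(z.1 + z.2)) *
        κ (t.1 + t.2.1 + t.2.2 + reson z.1 z.2)) := by ring
    _ ≤ (∑' n, M' n z * W n (t.1, z.1)) * (V₂ (t.2.1, z.2) * V₃ (t.2.2, -(z.1 + z.2)) *
        κ (t.1 + t.2.1 + t.2.2 + reson z.1 z.2)) := by gcongr; exact h _ _ _
    _ = _ := by
        rw [← ENNReal.tsum_mul_right]
        exact tsum_congr fun n => by ring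

/-- Summation over the modulations. -/
lemma tform_one_le_xn (η : Cutoff) {D : ℝ≥0∞} (hκ : Measurable κ) (h1 : Measurable V₁)
    (h2 : Measurable V₂) (h3 : Measurable V₃)
    (h : ∀ (J₁ J₂ J₃ : ℝ) (U₁ U₂ U₃ : ℝ³ → ℝ≥0∞), 0 < J₁ → 0 < J₂ → 0 < J₃ →
      Measurable U₁ → Measurable U₂ → Measurable U₃ →
      (∀ a p, U₁ (a, p) ≠ 0 → |a| ≤ 2 * J₁ ∧ V₁ (a, p) ≠ 0) →
      (∀ a p, U₂ (a, p) ≠ 0 → |a| ≤ 2 * J₂ ∧ V₂ (a, p) ≠ 0) →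
      (∀ a p, U₃ (a, p) ≠ 0 → |a| ≤ 2 * J₃ ∧ V₃ (a, p) ≠ 0) →
      tform κ 1 U₁ U₂ U₃ ≤ D * ofReal (√J₁ * √J₂ * √J₃) * (l2n U₁ * l2n U₂ * l2n U₃)) :
    tform κ 1 V₁ V₂ V₃ ≤ D * (xn η V₁ * xn η V₂ * xn η V₃) := by
  set U : (ℝ³ → ℝ≥0∞) → ℕ → ℝ³ → ℝ≥0∞ := fun V j x => ofReal (η.dyadic j x.1) * V x with hU
  have hUs : ∀ V, (fun x => ∑' j, U V j x) = V := fun V => by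
    funext x
    simp only [hU, ENNReal.tsum_mul_right, η.tsum_ofReal_dyadic, one_mul]
  have hUm : ∀ V, Measurable V → ∀ j, Measurable (U V j) := fun V hV j => by
    simp only [hU]; fun_prop
  have hUsupp : ∀ V j a p, U V j (a, p) ≠ 0 → |a| ≤ 2 * 2 ^ j ∧ V (a, p) ≠ 0 := by
    intro V j a p h0
    refine ⟨?_, right_ne_zero_of_mul h0⟩
    have h1 : η.dyadic j a ≠ 0 := fun h => left_ne_zero_of_mul h0 (by simp [h])
    have := η.abs_le_of_dyadic_ne_zero h1
    have h2 : (0 : ℝ) < 2 ^ j := by positivity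
    linarith
  calc tform κ 1 V₁ V₂ V₃
      = tform κ 1 (fun x => ∑' j, U V₁ j x) (fun x => ∑' j, U V₂ j x) (fun x => ∑' j, U V₃ j x) := by
        rw [hUs, hUs, hUs]
    _ = ∑' i, ∑' j, ∑' k, tform κ 1 (U V₁ i) (U V₂ j) (U V₃ k) :=
        tform_tsum hκ measurable_one (hUm _ h1) (hUm _ h2) (hUm _ h3)
    _ ≤ ∑' i : ℕ, ∑' j : ℕ, ∑' k : ℕ, D * ((ofReal √(2 ^ i) * l2n (U V₁ i)) *
          (ofReal √(2 ^ j) * l2n (U V₂ j)) * (ofReal √(2 ^ k) * l2n (U V₃ k))) := by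
        refine tsum_le_tsum fun i => tsum_le_tsum fun j =>
          tsum_le_tsum fun k => ?_
        refine (h (2 ^ i) (2 ^ j) (2 ^ k) _ _ _ (by positivity) (by positivity) (by positivity)
          (hUm _ h1 i) (hUm _ h2 j) (hUm _ h3 k) (hUsupp _ _) (hUsupp _ _) (hUsupp _ _)).trans
          (le_of_eq ?_)
        rw [ofReal_mul (by positivity), ofReal_mul (by positivity)]
        ring
    _ = _ := by
        simp only [ENNReal.tsum_mul_left, ENNReal.tsum_mul_right]
        rfl

lemma tform_kerB_le (η : Cutoff) {σ K : ℝ} (hσ : 0 < σ) (hK : 0 < K)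
    (h1 : Measurable V₁) (h2 : Measurable V₂) (h3 : Measurable V₃)
    (hK3 : ∀ a p, V₃ (a, p) ≠ 0 → K ≤ |p.1| ∧ |p.1| ≤ 32 * K) :
    tform (kerB σ) 1 V₁ V₂ V₃ ≤ ofReal (400 * √σ) * (xn η V₁ * xn η V₂ * xn η V₃) := by
  refine tform_one_le_xn η (by fun_prop) h1 h2 h3 ?_
  intro J₁ J₂ J₃ U₁ U₂ U₃ hJ₁ hJ₂ hJ₃ m1 m2 m3 s1 s2 s3
  rw [← ofReal_mul (by positivity)]
  exact tform_kerB_fixed_le hσ hK hJ₁ hJ₂ hJ₃ m1 m2 m3 (fun a p h => (s1 a p h).1)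
    (fun a p h => (s2 a p h).1) (fun a p h => (s3 a p h).1) (fun a p h => hK3 a p (s3 a p h).2)

lemma tform_kerI_le (η : Cutoff) {σ K₁ K₂ K₃ : ℝ} (hσ : 0 < σ) (hK₁ : 0 < K₁)
    (hK₂ : 0 < K₂) (hK₃ : 0 < K₃) (h1 : Measurable V₁) (h2 : Measurable V₂) (h3 : Measurable V₃)
    (hk1 : ∀ a p, V₁ (a, p) ≠ 0 → K₁ ≤ |p.1| ∧ |p.1| ≤ 32 * K₁)
    (hk2 : ∀ a p, V₂ (a, p) ≠ 0 → K₂ ≤ |p.1| ∧ |p.1| ≤ 32 * K₂)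
    (hk3 : ∀ a p, V₃ (a, p) ≠ 0 → K₃ ≤ |p.1| ∧ |p.1| ≤ 32 * K₃) :
    tform (kerI σ) 1 V₁ V₂ V₃ ≤
      ofReal (8640 * (√(K₁ * K₂ * K₃))⁻¹) * (xn η V₁ * xn η V₂ * xn η V₃) := by
  refine tform_one_le_xn η (by fun_prop) h1 h2 h3 ?_
  intro J₁ J₂ J₃ U₁ U₂ U₃ hJ₁ hJ₂ hJ₃ m1 m2 m3 s1 s2 s3
  rw [← ofReal_mul (by positivity)]
  have t1 := fun a p h => (s1 a p h).1
  have t2 := fun a p h => (s2 a p h).1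
  have t3 := fun a p h => (s3 a p h).1
  have q1 := fun a p h => hk1 a p (s1 a p h).2
  have q2 := fun a p h => hk2 a p (s2 a p h).2
  have q3 := fun a p h => hk3 a p (s3 a p h).2
  have e1 : (1 : ℝ⁴ → ℝ≥0∞) = fun _ => 1 := rfl
  by_cases h13 : J₁ ≤ J₃ ∧ J₂ ≤ J₃
  · exact tform_kerI_fixed_le hσ hK₁ hK₂ hK₃ hJ₁ hJ₂ hJ₃ h13.1 h13.2 m1 m2 m3 t1 t2 t3
      (fun a p h => (q1 a p h).1) (fun a p h => (q2 a p h).1) q3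
  by_cases h31 : J₃ ≤ J₁ ∧ J₂ ≤ J₁
  · have e : tform (kerI σ) 1 U₁ U₂ U₃ = tform (kerI σ) 1 U₃ U₂ U₁ := by
      rw [tform_rot (by fun_prop) measurable_one m1 m2 m3]; rfl
    rw [e]
    refine (tform_kerI_fixed_le hσ hK₃ hK₂ hK₁ hJ₃ hJ₂ hJ₁ h31.1 h31.2 m3 m2 m1 t3 t2 t1
      (fun a p h => (q3 a p h).1) (fun a p h => (q2 a p h).1) q1).trans (le_of_eq ?_)
    rw [show K₃ * K₂ * K₁ = K₁ * K₂ * K₃ by ring, show √J₃ * √J₂ * √J₁ = √J₁ * √J₂ * √J₃ by ring]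
    ring
  · have h32 : J₃ ≤ J₂ ∧ J₁ ≤ J₂ := by
      rcases le_total J₁ J₂ with h | h <;> rcases le_total J₁ J₃ with h' | h' <;>
        rcases le_total J₂ J₃ with h'' | h'' <;> grind
    have e : tform (kerI σ) 1 U₁ U₂ U₃ = tform (kerI σ) 1 U₃ U₁ U₂ := by
      rw [tform_swap (by fun_prop) measurable_one m1 m2 m3]
      exact tform_rot (by fun_prop) measurable_one m2 m1 m3
    rw [e]
    refine (tform_kerI_fixed_le hσ hK₃ hK₁ hK₂ hJ₃ hJ₁ hJ₂ h32.1 h32.2 m3 m1 m2 t3 t1 t2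
      (fun a p h => (q3 a p h).1) (fun a p h => (q1 a p h).1) q2).trans (le_of_eq ?_)
    rw [show K₃ * K₁ * K₂ = K₁ * K₂ * K₃ by ring, show √J₃ * √J₁ * √J₂ = √J₁ * √J₂ * √J₃ by ring]
    ring

/-- The gain for a low frequency factor interacting with two high frequency factors. -/
lemma tform_kerI_low_le (η : Cutoff) {σ Λ₁ Λ : ℝ} (hσ : 0 < σ) (hΛ₁ : 0 < Λ₁)
    (hΛ : 0 < Λ) (h1 : Measurable V₁) (h2 : Measurable V₂) (h3 : Measurable V₃)
    (hM : ∀ z, M z ≤ ofReal |z.1.1|)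
    (hk1 : ∀ a p, V₁ (a, p) ≠ 0 → |p.1| ≤ Λ₁)
    (hk2 : ∀ a p, V₂ (a, p) ≠ 0 → Λ ≤ |p.1| ∧ |p.1| ≤ 32 * Λ)
    (hk3 : ∀ a p, V₃ (a, p) ≠ 0 → Λ ≤ |p.1| ∧ |p.1| ≤ 32 * Λ) :
    tform (kerI σ) M V₁ V₂ V₃ ≤ ofReal (70000 * (√Λ₁ / Λ)) * (xn η V₁ * xn η V₂ * xn η V₃) := by
  set S : ℕ → Set ℝ³ := fun n =>
    {x | Λ₁ * (1 / 2) ^ n / 2 ≤ |x.2.1| ∧ |x.2.1| ≤ Λ₁ * (1 / 2) ^ n} with hS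
  have hSm : ∀ n, MeasurableSet (S n) := fun n => by
    have hx : Measurable fun x : ℝ³ => |x.2.1| := by fun_prop
    exact (measurableSet_le measurable_const hx).inter (measurableSet_le hx measurable_const)
  set W : ℕ → ℝ³ → ℝ≥0∞ := fun n => (S n).indicator V₁ with hW
  have hWm : ∀ n, Measurable (W n) := fun n => h1.indicator (hSm n)
  have hWV : ∀ n x, W n x ≤ V₁ x := fun n x => indicator_le_self _ _ x
  refine (tform_le_tsum (M' := fun n _ => ofReal (Λ₁ * (1 / 2) ^ n)) (W := W)
    (by fun_prop) (fun n => measurable_const) hWm h2 h3 ?_).trans ?_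
  · intro a p q
    by_cases hp : p.1 = 0
    · have := hM (p, q)
      simp only [hp, abs_zero, ENNReal.ofReal_zero, nonpos_iff_eq_zero] at this
      simp [this]
    by_cases hV : V₁ (a, p) = 0
    · simp [hV]
    have hp0 := abs_pos.2 hp
    obtain ⟨n, hn1, hn2⟩ := exists_nat_pow_near_of_lt_one (x := |p.1| / Λ₁) (y := 1 / 2)
      (by positivity) ((div_le_one hΛ₁).2 (hk1 a p hV)) (by norm_num) (by norm_num)
    rw [lt_div_iff₀ hΛ₁] at hn1
    rw [div_le_iff₀ hΛ₁] at hn2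
    refine le_trans ?_ (ENNReal.le_tsum n)
    have hmem : (a, p) ∈ S n := by
      refine ⟨?_, ?_⟩ <;> simp only
      · rw [pow_succ] at hn1; linarith
      · linarith
    simp only [hW, indicator_of_mem hmem]
    gcongr
    refine (hM (p, q)).trans (ofReal_le_ofReal ?_)
    simp only; linarith
  · have hb : ∀ n, tform (kerI σ) (fun _ => ofReal (Λ₁ * (1 / 2) ^ n)) (W n) V₂ V₃ ≤
        ofReal (3 / 4) ^ n * (ofReal (17280 * (√Λ₁ / Λ)) * (xn η V₁ * xn η V₂ * xn η V₃)) := by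
      intro n
      have hpn : (0 : ℝ) < (1 / 2) ^ n := by positivity
      rw [tform_const _ (by fun_prop) (hWm n) h2 h3]
      refine (mul_le_mul_right (tform_kerI_le η hσ (K₁ := Λ₁ * (1 / 2) ^ n / 2) (K₂ := Λ)
        (K₃ := Λ) (by positivity) hΛ hΛ (hWm n) h2 h3 (fun a p h => ?_) hk2 hk3) _).trans ?_
      · have hmem : (a, p) ∈ S n := by
          by_contra h0
          exact h (indicator_of_notMem h0 _)
        refine ⟨hmem.1, hmem.2.trans ?_⟩
        have : 0 < Λ₁ * (1 / 2) ^ n := by positivity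
        linarith
      · rw [← mul_assoc, ← mul_assoc (ofReal _ ^ n), ← ofReal_mul (by positivity),
          ← ofReal_pow (by norm_num), ← ofReal_mul (by positivity)]
        refine mul_le_mul' (ofReal_le_ofReal ?_) ?_
        · set L := Λ₁ * (1 / 2) ^ n with hL
          have hL0 : 0 < L := by positivity
          have e1 : √(L / 2 * Λ * Λ) = √(L / 2) * Λ := by
            rw [mul_assoc, sqrt_mul (by positivity), Real.sqrt_mul_self hΛ.le]
          have e2 : L ≤ 2 * √L * √(L / 2) := by
            have h4 : √L / 2 ≤ √(L / 2) := by
              refine Real.le_sqrt_of_sq_le ?_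
              rw [div_pow, sq_sqrt hL0.le]
              linarith
            have h5 := mul_le_mul_of_nonneg_left h4 (sqrt_nonneg L)
            nlinarith [Real.mul_self_sqrt hL0.le]
          have e3 : √L ≤ √Λ₁ * (3 / 4) ^ n := by
            rw [hL, sqrt_mul hΛ₁.le]
            gcongr
            rw [Real.sqrt_le_left (by positivity), ← pow_mul, mul_comm n 2, pow_mul]
            gcongr; norm_num
          have hs : 0 < √(L / 2) := Real.sqrt_pos.2 (by positivity)
          rw [e1]
          calc L * (8640 * (√(L / 2) * Λ)⁻¹) ≤ (2 * √L * √(L / 2)) * (8640 * (√(L / 2) * Λ)⁻¹) := by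
                gcongr
            _ = 17280 * (√L / Λ) := by field_simp; ring
            _ ≤ 17280 * ((√Λ₁ * (3 / 4) ^ n) / Λ) := by gcongr
            _ = _ := by ring
        · gcongr
          exact xn_mono η (hWV n)
    refine (tsum_le_tsum hb).trans ?_
    rw [ENNReal.tsum_mul_right, ENNReal.tsum_geometric, ← mul_assoc]
    gcongr
    have : (1 - ofReal (3 / 4))⁻¹ = ofReal 4 := by
      rw [← ofReal_one, ← ENNReal.ofReal_sub _ (by norm_num),
        ← ENNReal.ofReal_inv_of_pos (by norm_num)]
      norm_num
    rw [this, ← ofReal_mul (by norm_num)]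
    refine ofReal_le_ofReal ?_
    have : 0 ≤ √Λ₁ / Λ := by positivity
    linarith

end

/-! ### Jointly measurable representatives -/

lemma exists_measurable_rep {f : ℝ → L2} (hf : Continuous f) :
    ∃ F : ℝ × Plane → ℂ, Measurable F ∧ ∀ t, (fun z => F (t, z)) =ᵐ[volume] f t := by
  classical
  have hex : ∀ (n : ℕ) (t : ℝ), ∃ i : ℕ, ‖f (TopologicalSpace.denseSeq ℝ i) - f t‖ <
      (1 / 2 : ℝ) ^ n / 2 := by
    intro n t
    have h1 : ∀ᶠ s in 𝓝 t, ‖f s - f t‖ < (1 / 2 : ℝ) ^ n / 2 := by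
      have := (hf.tendsto t).sub (tendsto_const_nhds (x := f t))
      rw [sub_self] at this
      have := this.norm
      rw [norm_zero] at this
      exact this.eventually (gt_mem_nhds (by positivity))
    obtain ⟨U, hU, hUo, htU⟩ := mem_nhds_iff.1 h1
    obtain ⟨i, hx⟩ := (TopologicalSpace.denseRange_denseSeq ℝ).exists_mem_open hUo ⟨t, htU⟩
    exact ⟨i, hU hx⟩
  set N : ℕ → ℝ → ℕ := fun n t => Nat.find (hex n t) with hN
  have hNm : ∀ n, Measurable (N n) := fun n => by
    refine measurable_find _ fun k => ?_
    refine measurableSet_lt ?_ measurable_const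
    exact (continuous_const.sub hf).norm.measurable
  have hNs : ∀ n t, ‖f (TopologicalSpace.denseSeq ℝ (N n t)) - f t‖ < (1 / 2 : ℝ) ^ n / 2 :=
    fun n t => Nat.find_spec (hex n t)
  set F : ℕ → ℝ × Plane → ℂ := fun n x => f (TopologicalSpace.denseSeq ℝ (N n x.1)) x.2 with hF
  have hFm : ∀ n, Measurable (F n) := fun n => by
    have h1 : Measurable fun x : ℕ × Plane => f (TopologicalSpace.denseSeq ℝ x.1) x.2 :=
      measurable_from_prod_countable_right fun i =>
        (Lp.stronglyMeasurable (f (TopologicalSpace.denseSeq ℝ i))).measurable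
    exact h1.comp (((hNm n).comp measurable_fst).prodMk measurable_snd)
  refine ⟨fun x => limUnder atTop fun n => F n x,
    (StronglyMeasurable.limUnder fun n => (hFm n).stronglyMeasurable).measurable, fun t => ?_⟩
  set G : ℕ → L2 := fun n => f (TopologicalSpace.denseSeq ℝ (N n t)) with hG
  have hGt : Tendsto G atTop (𝓝 (f t)) := by
    rw [tendsto_iff_norm_sub_tendsto_zero]
    refine squeeze_zero (fun n => norm_nonneg _) (fun n => (hNs n t).le) ?_
    have := (tendsto_pow_atTop_nhds_zero_of_lt_one (r := (1 / 2 : ℝ)) (by norm_num)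
      (by norm_num)).div_const 2
    simpa using this
  obtain ⟨ns, hns, hae⟩ := (tendstoInMeasure_of_tendsto_Lp hGt).exists_seq_tendsto_ae
  have hconv := Lp.ae_tendsto_of_cauchy_eLpNorm (μ := (volume : Measure Plane)) (p := 2)
    (f := fun n => (G n : Plane → ℂ)) (fun n => Lp.aestronglyMeasurable _) (by norm_num)
    (B := fun n => ofReal ((1 / 2) ^ n)) (by
      rw [← ofReal_tsum_of_nonneg (fun n => by positivity)
        (summable_geometric_of_lt_one (by norm_num) (by norm_num))]
      exact ofReal_ne_top) (fun M n m hn hm => by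
      rw [← eLpNorm_congr_ae (Lp.coeFn_sub _ _), ← Lp.enorm_def, ← ofReal_norm]
      rw [ENNReal.ofReal_lt_ofReal_iff (by positivity)]
      have a1 : (1 / 2 : ℝ) ^ n ≤ (1 / 2) ^ M := pow_le_pow_of_le_one (by norm_num) (by norm_num) hn
      have a2 : (1 / 2 : ℝ) ^ m ≤ (1 / 2) ^ M := pow_le_pow_of_le_one (by norm_num) (by norm_num) hm
      calc ‖G n - G m‖ = ‖(G n - f t) - (G m - f t)‖ := by congr 1; abel
        _ ≤ ‖G n - f t‖ + ‖G m - f t‖ := norm_sub_le _ _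
        _ < _ := by linarith [hNs n t, hNs m t])
  filter_upwards [hae, hconv] with z hz1 ⟨l, hl⟩
  have : l = f t z := tendsto_nhds_unique (hl.comp hns.tendsto_atTop) hz1
  rw [← this]
  exact hl.limUnder_eq

/-! ### Fourier inversion almost everywhere on the line -/

lemma ae_eq_fourierInv_fourier {f : ℝ → ℂ} (hf : Integrable f) (hf' : Integrable (𝓕 f)) :
    ∀ᵐ t, f t = 𝓕⁻ (𝓕 f) t := by
  have hc : Continuous (𝓕⁻ (𝓕 f)) := by
    rw [Real.fourierInv_eq_fourier_comp_neg]
    exact VectorFourier.fourierIntegral_continuous Real.continuous_fourierChar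
      (by exact continuous_inner) hf'.comp_neg
  refine ae_eq_of_integral_contDiff_smul_eq hf.locallyIntegrable hc.locallyIntegrable
    fun g hg hgc => ?_
  have hgc' : HasCompactSupport fun x => (g x : ℂ) := hgc.comp_left Complex.ofReal_zero
  have hg' : ContDiff ℝ ∞ fun x => (g x : ℂ) := ofRealCLM.contDiff.comp hg
  set S : SchwartzMap ℝ ℂ := hgc'.toSchwartzMap hg' with hS
  have hSg : ∀ x, S x = g x := fun x => rfl
  have flip : ∀ u v : ℝ → ℂ, Integrable u → Integrable v → ∫ x, 𝓕 u x * v x = ∫ x, u x * 𝓕 v x := by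
    intro u v hu hv
    have := VectorFourier.integral_fourierIntegral_smul_eq_flip (L := innerₗ ℝ)
      Real.continuous_fourierChar continuous_inner hu hv
    simpa using! this
  obtain ⟨R, hR⟩ : ∃ R : SchwartzMap ℝ ℂ, R = 𝓕⁻ S := ⟨_, rfl⟩
  have hinv : ∀ x, 𝓕 (R : ℝ → ℂ) x = g x := fun x => by
    rw [← fourier_coe, hR, FourierTransform.fourier_fourierInv_eq, hSg]
  have e1 : ∫ x, g x • f x = ∫ x, 𝓕 f x * R x := by
    rw [flip f _ hf R.integrable]
    simp only [hinv]
    exact integral_congr_ae (.of_forall fun x => by simp [mul_comm])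
  rw [e1, ← integral_neg_eq_self]
  have e2 : ∀ x, R (-x) = 𝓕 (S : ℝ → ℂ) x := fun x => by
    rw [hR, fourierInv_coe, Real.fourierInv_eq_fourier_neg, neg_neg]
  simp only [e2]
  have := flip S (fun x => 𝓕 f (-x)) S.integrable hf'.comp_neg
  rw [Real.fourierInv_eq_fourier_comp_neg]
  calc _ = ∫ x, 𝓕 (S : ℝ → ℂ) x * 𝓕 f (-x) := by simp only [mul_comm]
    _ = _ := this
    _ = _ := integral_congr_ae (.of_forall fun x => by simp [hSg])

/-! ### Minkowski's inequality and integration in the modulation -/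

lemma l2n_add_le {α : Type*} [MeasureSpace α] {f g : α → ℝ≥0∞} (hf : Measurable f)
    (hg : Measurable g) : l2n (fun x => f x + g x) ≤ l2n f + l2n g := by
  have := ENNReal.lintegral_Lp_add_le (μ := (volume : Measure α)) (p := 2) hf.aemeasurable
    hg.aemeasurable (by norm_num)
  simpa [l2n] using this

lemma l2n_sum_le {α : Type*} [MeasureSpace α] {f : ℕ → α → ℝ≥0∞} (hf : ∀ n, Measurable (f n))
    (n : ℕ) : l2n (fun x => ∑ i ∈ Finset.range n, f i x) ≤ ∑ i ∈ Finset.range n, l2n (f i) := by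
  induction n with
  | zero => simp [l2n]
  | succ n ih =>
    simp only [Finset.sum_range_succ]
    exact (l2n_add_le (by fun_prop) (hf n)).trans (by gcongr)

lemma l2n_tsum_le {α : Type*} [MeasureSpace α] {f : ℕ → α → ℝ≥0∞}
    (hf : ∀ n, Measurable (f n)) : l2n (fun x => ∑' i, f i x) ≤ ∑' i, l2n (f i) := by
  refine le_of_sq_le_sq ?_
  rw [l2n_sq]
  have h1 : ∀ x, (∑' i, f i x) ^ 2 =
      liminf (fun n => (∑ i ∈ Finset.range n, f i x) ^ 2) atTop := fun x =>
    (((ENNReal.continuous_pow 2).tendsto _).comp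
      (ENNReal.tendsto_nat_tsum fun i => f i x)).liminf_eq.symm
  simp only [h1]
  refine (lintegral_liminf_le fun n => by fun_prop).trans ?_
  refine (liminf_le_liminf (v := fun _ => (∑' i, l2n (f i)) ^ 2)
    (.of_forall fun n => ?_)).trans (by simp)
  rw [← l2n_sq]
  gcongr
  exact (l2n_sum_le hf n).trans (ENNReal.sum_le_tsum _)

lemma l2n_lintegral_le (η : Cutoff) {V : ℝ³ → ℝ≥0∞} (hV : Measurable V) :
    l2n (fun p => ∫⁻ θ, V (θ, p)) ≤ 2 * xn η V := by
  have e : ∀ p, ∫⁻ θ, V (θ, p) = ∑' j, ∫⁻ θ, ofReal (η.dyadic j θ) * V (θ, p) := by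
    intro p
    rw [← lintegral_tsum fun j => by fun_prop]
    simp only [ENNReal.tsum_mul_right, η.tsum_ofReal_dyadic, one_mul]
  simp only [e]
  have hm : ∀ j, Measurable fun p => ∫⁻ θ, ofReal (η.dyadic j θ) * V (θ, p) := fun j =>
    Measurable.lintegral_prod_left' (f := fun x : ℝ³ =>
      ofReal (η.dyadic j x.1) * V x) (by fun_prop)
  refine (l2n_tsum_le hm).trans ?_
  rw [xn, ← ENNReal.tsum_mul_left]
  refine tsum_le_tsum fun j => ?_
  set I : Set ℝ := Icc (-(2 * 2 ^ j)) (2 * 2 ^ j) with hI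
  have hIm : Measurable (I.indicator (1 : ℝ → ℝ≥0∞)) := measurable_one.indicator measurableSet_Icc
  refine le_of_sq_le_sq ?_
  rw [← mul_assoc, mul_pow, l2n_sq, l2n_sq]
  have h2 : ∀ p, (∫⁻ θ, ofReal (η.dyadic j θ) * V (θ, p)) ^ 2 ≤
      (2 * ofReal √(2 ^ j)) ^ 2 * ∫⁻ θ, (ofReal (η.dyadic j θ) * V (θ, p)) ^ 2 := by
    intro p
    refine (lintegral_sq_le (A := I.indicator 1)
      (B := fun θ => (ofReal (η.dyadic j θ) * V (θ, p)) ^ 2) hIm.aemeasurable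
      (by fun_prop) (.of_forall fun θ => ?_)).trans ?_
    · by_cases h : η.dyadic j θ = 0
      · simp [h]
      · have h1 := η.abs_le_of_dyadic_ne_zero h
        have h3 : (0 : ℝ) < 2 ^ j := by positivity
        rw [indicator_of_mem (s := I) (abs_le.1 (by linarith))]
        simp
    · gcongr
      rw [lintegral_indicator measurableSet_Icc, Pi.one_def, lintegral_const,
        restrict_apply_univ, Real.volume_Icc, one_mul, mul_pow,
        ← ofReal_pow (by positivity), sq_sqrt (by positivity),
        show (2 : ℝ≥0∞) ^ 2 = ofReal 4 by norm_num, ← ofReal_mul (by norm_num)]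
      exact ofReal_le_ofReal (by linarith)
  refine (lintegral_mono h2).trans (le_of_eq ?_)
  have hm2 : Measurable fun x : ℝ³ => (ofReal (η.dyadic j x.1) * V x) ^ 2 := by fun_prop
  rw [lintegral_const_mul _ hm2.lintegral_prod_left', lintegral_prod_symm₂ hm2]

/-! ### Angular frequency coordinates -/

/-- The point of the frequency plane with angular coordinates `(ξ, μ)`. -/
def toPlane (p : ℝ²) : Plane := WithLp.toLp 2 ![p.1 / (2 * π), p.2 / (2 * π)]

@[simp] theorem freqX_toPlane (p : ℝ²) : freqX (toPlane p) = p.1 := by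
  simp only [freqX, toPlane, PiLp.toLp_apply, Matrix.cons_val_zero]
  field_simp

@[simp] theorem freqY_toPlane (p : ℝ²) : freqY (toPlane p) = p.2 := by
  simp only [freqY, toPlane, PiLp.toLp_apply, Matrix.cons_val_one]
  simp only [Matrix.cons_val_fin_one]
  field_simp

/-- The angular coordinates as a measurable equivalence. -/
def planeEquiv : Plane ≃ᵐ ℝ² :=
  ((MeasurableEquiv.toLp 2 (Fin 2 → ℝ)).symm.trans MeasurableEquiv.finTwoArrow).trans
    (Homeomorph.smulOfNeZero (2 * π) (by positivity)).toMeasurableEquiv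

lemma planeEquiv_apply (ζ : Plane) : planeEquiv ζ = (freqX ζ, freqY ζ) := rfl

lemma planeEquiv_toPlane (p : ℝ²) : planeEquiv (toPlane p) = p := by
  rw [planeEquiv_apply, freqX_toPlane, freqY_toPlane]

lemma toPlane_eq : toPlane = planeEquiv.symm :=
  funext fun p => by rw [MeasurableEquiv.eq_symm_apply, planeEquiv_toPlane]

lemma toPlane_planeEquiv (ζ : Plane) : toPlane (planeEquiv ζ) = ζ := by
  rw [toPlane_eq, MeasurableEquiv.symm_apply_apply]

@[fun_prop]
lemma measurable_toPlane : Measurable toPlane := by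
  rw [toPlane_eq]; exact planeEquiv.symm.measurable

lemma toPlane_add (p q : ℝ²) : toPlane (p + q) = toPlane p + toPlane q := by
  ext i
  fin_cases i <;> simp [toPlane, add_div]

lemma toPlane_neg (p : ℝ²) : toPlane (-p) = -toPlane p := by
  ext i
  fin_cases i <;> simp [toPlane, neg_div]

lemma map_planeEquiv : (volume : Measure Plane).map planeEquiv =
    ofReal (((2 * π) ^ 2)⁻¹) • volume := by
  have h1 : (volume : Measure Plane).map
      ((MeasurableEquiv.toLp 2 (Fin 2 → ℝ)).symm.trans MeasurableEquiv.finTwoArrow) = volume :=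
    ((PiLp.volume_preserving_ofLp (Fin 2)).trans (volume_preserving_finTwoArrow ℝ)).map_eq
  have h2 : ⇑planeEquiv = (fun x : ℝ² => (2 * π) • x) ∘
    ((MeasurableEquiv.toLp 2 (Fin 2 → ℝ)).symm.trans MeasurableEquiv.finTwoArrow) := rfl
  rw [h2, ← Measure.map_map (by fun_prop) (MeasurableEquiv.measurable _), h1,
    Measure.map_addHaar_smul volume (by positivity)]
  simp [abs_of_pos pi_pos]

/-- The Jacobian of the passage to angular coordinates. -/
def jac : ℝ := ((2 * π) ^ 2)⁻¹

lemma jac_pos : 0 < jac := by unfold jac; positivity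

lemma lintegral_toPlane (F : Plane → ℝ≥0∞) : ∫⁻ ζ, F ζ = ofReal jac * ∫⁻ p, F (toPlane p) := by
  calc ∫⁻ ζ, F ζ = ∫⁻ ζ, F (toPlane (planeEquiv ζ)) := by simp only [toPlane_planeEquiv]
    _ = ∫⁻ p, F (toPlane p) ∂((volume : Measure Plane).map planeEquiv) :=
        (lintegral_map_equiv (fun p => F (toPlane p)) planeEquiv).symm
    _ = _ := by rw [map_planeEquiv, lintegral_smul_measure]; rfl

lemma integral_toPlane {E : Type*} [NormedAddCommGroup E] [NormedSpace ℝ E] (F : Plane → E) :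
    ∫ ζ, F ζ = jac • ∫ p, F (toPlane p) := by
  calc ∫ ζ, F ζ = ∫ ζ, F (toPlane (planeEquiv ζ)) := by simp only [toPlane_planeEquiv]
    _ = ∫ p, F (toPlane p) ∂((volume : Measure Plane).map planeEquiv) :=
        (integral_map_equiv planeEquiv fun p => F (toPlane p)).symm
    _ = _ := by
        rw [map_planeEquiv, integral_smul_measure, ENNReal.toReal_ofReal (by positivity)]; rfl

lemma ae_toPlane {P : Plane → Prop} (h : ∀ᵐ ζ, P ζ) : ∀ᵐ p, P (toPlane p) := by
  have h1 : ∀ᵐ p ∂((volume : Measure Plane).map planeEquiv), P (toPlane p) := by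
    rw [planeEquiv.measurableEmbedding.ae_map_iff]
    simpa only [toPlane_planeEquiv] using h
  rw [map_planeEquiv] at h1
  exact (Measure.ae_ennreal_smul_measure_iff
    (by simpa using (by positivity : (0 : ℝ) < 2 * π))).1 h1

/-! ### Profiles of time-localized functions -/

lemma lintegral_enorm_sq (φ : L2) : ∫⁻ ζ, ‖φ ζ‖ₑ ^ 2 = ‖φ‖ₑ ^ 2 := by
  rw [Lp.enorm_def, eLpNorm_eq_lintegral_rpow_enorm_toReal (by norm_num) (by norm_num)]
  simp only [ENNReal.toReal_ofNat, ENNReal.rpow_ofNat]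
  rw [← rpow_natCast, ← rpow_mul]
  norm_num

lemma le_one_add_sq (a : ℝ≥0∞) : a ≤ 1 + a ^ 2 := by
  rcases le_total a 1 with h | h
  · exact h.trans le_self_add
  · exact (le_self_pow₀ h two_ne_zero).trans le_add_self

lemma integrable_of_lintegral_sq {α : Type*} [MeasurableSpace α] {ν : Measure α} {F : α → ℂ}
    {S : Set α} (hS : MeasurableSet S) (hSf : ν S ≠ ⊤) (hF : Measurable F)
    (hFS : ∀ x, x ∉ S → F x = 0) (h2 : ∫⁻ x, ‖F x‖ₑ ^ 2 ∂ν ≠ ⊤) : Integrable F ν := by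
  refine ⟨hF.aestronglyMeasurable, ?_⟩
  rw [hasFiniteIntegral_iff_enorm]
  calc ∫⁻ x, ‖F x‖ₑ ∂ν ≤ ∫⁻ x, (S.indicator 1 x + ‖F x‖ₑ ^ 2) ∂ν := by
        refine lintegral_mono fun x => ?_
        by_cases hx : x ∈ S
        · simpa [hx] using le_one_add_sq ‖F x‖ₑ
        · simp [hx, hFS]
    _ = ν S + ∫⁻ x, ‖F x‖ₑ ^ 2 ∂ν := by
        rw [lintegral_add_left (measurable_one.indicator hS), lintegral_indicator_one hS]
    _ < ⊤ := by finiteness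

lemma exists_supported_rep {h : ℝ → L2} (hc : Continuous h) (hs : HasCompactSupport h) :
    ∃ (H : ℝ × Plane → ℂ) (R : ℝ), Measurable H ∧ (∀ t, (fun ζ => H (t, ζ)) =ᵐ[volume] h t) ∧
      (∀ t ζ, t ∉ Icc (-R) R → H (t, ζ) = 0) ∧ ∫⁻ ζ, ∫⁻ t, ‖H (t, ζ)‖ₑ ^ 2 ≠ ⊤ := by
  obtain ⟨F, hF, hFh⟩ := exists_measurable_rep hc
  obtain ⟨R, hR⟩ := hs.isCompact.isBounded.subset_closedBall 0
  rw [Real.closedBall_eq_Icc, zero_sub, zero_add] at hR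
  have h0 : ∀ t, t ∉ Icc (-R) R → h t = 0 := fun t ht =>
    by_contra fun hne => ht (hR (subset_tsupport _ hne))
  set H : ℝ × Plane → ℂ := fun x => (Icc (-R) R).indicator (fun _ => F x) x.1 with hH
  have hHm : Measurable H := by
    have : H = (Prod.fst ⁻¹' Icc (-R) R).indicator F := by
      funext x; simp only [hH, indicator, mem_preimage]
    rw [this]
    exact hF.indicator (measurable_fst measurableSet_Icc)
  have hHh : ∀ t, (fun ζ => H (t, ζ)) =ᵐ[volume] h t := by
    intro t
    by_cases ht : t ∈ Icc (-R) R
    · simpa only [hH, indicator_of_mem ht] using hFh t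
    · rw [h0 t ht]
      filter_upwards [Lp.coeFn_zero (E := ℂ) (p := 2) (μ := (volume : Measure Plane))] with ζ hζ
      rw [hζ]
      simp only [hH, indicator_of_notMem ht, Pi.zero_apply]
  refine ⟨H, R, hHm, hHh, fun t ζ ht => indicator_of_notMem ht _, ?_⟩
  have hm2 : Measurable fun x : ℝ × Plane => ‖H x‖ₑ ^ 2 := by fun_prop
  rw [← lintegral_prod_symm₂ hm2, lintegral_prod₂ hm2]
  have e : ∀ t, ∫⁻ ζ, ‖H (t, ζ)‖ₑ ^ 2 = ‖h t‖ₑ ^ 2 := fun t => by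
    rw [← lintegral_enorm_sq]
    exact lintegral_congr_ae ((hHh t).mono fun ζ hζ => by simp only [← hζ])
  simp only [e]
  have hcs : HasCompactSupport fun t => ‖h t‖ ^ 2 := (hs.norm).comp_left (g := fun x => x ^ 2)
    (by simp)
  have hint : Integrable fun t => ‖h t‖ ^ 2 := (hc.norm.pow 2).integrable_of_hasCompactSupport hcs
  have := hint.2
  rw [hasFiniteIntegral_iff_enorm] at this
  refine ne_of_lt (lt_of_le_of_lt (le_of_eq (lintegral_congr fun t => ?_)) this)
  simp [enorm_pow]

/-- The pointwise Fourier transform in time represents the vector-valued one. -/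
lemma fourier_section_ae_eq {h : ℝ → L2} (hi : Integrable h) {H : ℝ × Plane → ℂ} {R : ℝ}
    (hH : Measurable H) (hHh : ∀ t, (fun ζ => H (t, ζ)) =ᵐ[volume] h t)
    (hHR : ∀ t ζ, t ∉ Icc (-R) R → H (t, ζ) = 0) (hH2 : ∫⁻ ζ, ∫⁻ t, ‖H (t, ζ)‖ₑ ^ 2 ≠ ⊤) (τ : ℝ) :
    (fun ζ => 𝓕 (fun t => H (t, ζ)) τ) =ᵐ[volume] (𝓕 h τ : L2) := by
  have hm2 : Measurable fun x : ℝ × Plane => ‖H x‖ₑ ^ 2 := by fun_prop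
  have hGi : ∀ S : Set Plane, volume S < ⊤ → Integrable
      (fun x : ℝ × Plane => fourierChar (-(x.1 * τ)) • H x)
      ((volume : Measure ℝ).prod (volume.restrict S)) := by
    intro S hS
    have h1 : Integrable H ((volume : Measure ℝ).prod (volume.restrict S)) := by
      refine integrable_of_lintegral_sq (S := Icc (-R) R ×ˢ univ)
        (measurableSet_Icc.prod MeasurableSet.univ) ?_ hH (fun x hx => ?_) ?_
      · rw [Measure.prod_prod, Real.volume_Icc, restrict_apply_univ]
        exact mul_ne_top ofReal_ne_top hS.ne
      · exact hHR x.1 x.2 fun hx1 => hx ⟨hx1, mem_univ _⟩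
      · rw [lintegral_prod_symm _ hm2.aemeasurable]
        exact ne_top_of_le_ne_top hH2 (setLIntegral_le_lintegral _ _)
    refine h1.mono ?_ (.of_forall fun x => by simp)
    have hcont : Continuous fun x : ℝ × Plane => fourierChar (-(x.1 * τ)) :=
      Real.continuous_fourierChar.comp (by fun_prop)
    exact hcont.aestronglyMeasurable.smul h1.1
  have hGS : ∀ S : Set Plane, volume S < ⊤ → IntegrableOn (fun ζ => 𝓕 (fun t => H (t, ζ)) τ) S := by
    intro S hS
    simp only [fourier_real_eq]
    exact (hGi S hS).integral_prod_right
  refine ae_eq_of_forall_setIntegral_eq_of_sigmaFinite (fun S hSm hS => hGS S hS)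
    (fun S hSm hS => integrableOn_Lp_of_measure_ne_top _ (by norm_num) hS.ne)
    (fun S hSm hS => ?_)
  have e1 : ∀ φ : L2, ∫ ζ in S, φ ζ = innerSL ℂ (indicatorConstLp 2 hSm hS.ne (1 : ℂ)) φ :=
    fun φ => (L2.inner_indicatorConstLp_one hSm hS.ne φ).symm
  rw [e1, fourier_real_eq, ← ContinuousLinearMap.integral_comp_comm]
  · simp only [fourier_real_eq]
    rw [← integral_integral_swap (f := fun t ζ => fourierChar (-(t * τ)) • H (t, ζ)) (hGi S hS)]
    refine integral_congr_ae (.of_forall fun t => ?_)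
    simp only [Circle.smul_def]
    rw [ContinuousLinearMap.map_smul, ← e1, integral_smul]
    congr 1
    exact integral_congr_ae (ae_restrict_of_ae (hHh t))
  · refine hi.mono ?_ (.of_forall fun x => by simp)
    have hcont : Continuous fun v : ℝ => fourierChar (-(v * τ)) :=
      Real.continuous_fourierChar.comp (by fun_prop)
    exact (continuous_subtype_val.comp hcont).aestronglyMeasurable.smul hi.1

lemma xn_profile (η : Cutoff) {G : ℝ × Plane → ℂ} (hG : Measurable G) {F : ℝ → L2}
    (hGF : ∀ τ, (fun ζ => G (τ, ζ)) =ᵐ[volume] F τ) :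
    xn η (fun x => ‖((2 * π)⁻¹ : ℂ) * G ((x.1 + omega x.2.1 x.2.2) / (2 * π),
      toPlane x.2)‖ₑ) ≤ 3 * xNorm η F := by
  rw [xn, xNorm, ← ENNReal.tsum_mul_left]
  refine tsum_le_tsum fun j => ?_
  have ej : ofReal √(2 ^ j) = (2 : ℝ≥0∞) ^ ((j : ℝ) / 2) := by
    rw [Real.sqrt_eq_rpow, ← ENNReal.ofReal_rpow_of_nonneg (by positivity) (by norm_num),
      ofReal_pow (by norm_num), ofReal_ofNat, ← rpow_natCast,
      ← rpow_mul]
    congr 1; ring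
  rw [ej, mul_left_comm]
  refine mul_le_mul_right ?_ _
  refine le_of_sq_le_sq ?_
  have hpi : (0 : ℝ) < 2 * π := by positivity
  set K : ℝ≥0∞ := ∫⁻ τ, ∫⁻ ζ, ‖η.dyadic j (2 * π * τ - omega (freqX ζ) (freqY ζ)) •
    F τ ζ‖ₑ ^ (2 : ℝ) with hK
  have hom : Measurable fun p : ℝ² => omega p.1 p.2 := by fun_prop
  obtain ⟨Φ, hΦ⟩ : ∃ Φ : ℝ → ℝ² → ℝ≥0∞, ∀ τ p, Φ τ p =
    ‖η.dyadic j (2 * π * τ - omega p.1 p.2) • G (τ, toPlane p)‖ₑ ^ 2 := ⟨_, fun _ _ => rfl⟩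
  have hΦm : Measurable fun x : ℝ³ => Φ x.1 x.2 := by
    simp only [hΦ]
    fun_prop
  have hK' : K = ofReal jac * ∫⁻ τ, ∫⁻ p, Φ τ p := by
    have h1 : ∀ τ, ∫⁻ ζ, ‖η.dyadic j (2 * π * τ - omega (freqX ζ) (freqY ζ)) •
        F τ ζ‖ₑ ^ (2 : ℝ) = ofReal jac * ∫⁻ p, Φ τ p := by
      intro τ
      rw [lintegral_toPlane]
      congr 1
      refine lintegral_congr_ae ((ae_toPlane (hGF τ)).mono fun p hp => ?_)
      simp only [freqX_toPlane, freqY_toPlane, hΦ, ENNReal.rpow_ofNat, hp]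
    rw [hK]
    simp only [h1]
    exact lintegral_const_mul _ hΦm.lintegral_prod_right'
  rw [l2n_sq, mul_pow, ← rpow_natCast (K ^ (1 / 2 : ℝ)), ← rpow_mul]
  norm_num only
  rw [ENNReal.rpow_one, hK']
  calc ∫⁻ x : ℝ³, (ofReal (η.dyadic j x.1) * ‖((2 * π)⁻¹ : ℂ) *
        G ((x.1 + omega x.2.1 x.2.2) / (2 * π), toPlane x.2)‖ₑ) ^ 2
      = ∫⁻ p : ℝ², ∫⁻ θ : ℝ, ofReal ((2 * π)⁻¹ ^ 2) * Φ ((θ + omega p.1 p.2) / (2 * π)) p := by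
        rw [lintegral_prod_symm₂ (by fun_prop)]
        refine lintegral_congr fun p => lintegral_congr fun θ => ?_
        rw [hΦ, mul_div_cancel₀ _ hpi.ne', add_sub_cancel_right, enorm_mul, enorm_smul,
          Real.enorm_of_nonneg (η.dyadic_nonneg j θ)]
        have : ‖((2 * π)⁻¹ : ℂ)‖ₑ = ofReal (2 * π)⁻¹ := by
          rw [← ofReal_norm, norm_inv, norm_mul]
          simp [abs_of_pos pi_pos]
        rw [this, ofReal_pow (by positivity)]
        ring
    _ = ∫⁻ p : ℝ², ofReal (2 * π)⁻¹ * ∫⁻ τ : ℝ, Φ τ p := by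
        refine lintegral_congr fun p => ?_
        rw [lintegral_add_right_eq_self (fun θ => ofReal ((2 * π)⁻¹ ^ 2) *
          Φ (θ / (2 * π)) p), lintegral_scale_left hpi.ne',
          abs_of_pos hpi]
        simp only [mul_div_cancel_left₀ _ hpi.ne']
        rw [lintegral_const_mul _ (by fun_prop), ← mul_assoc, ← ofReal_mul hpi.le]
        congr 2
        field_simp
    _ = ofReal (2 * π)⁻¹ * ∫⁻ τ : ℝ, ∫⁻ p : ℝ², Φ τ p := by
        rw [lintegral_const_mul _ hΦm.lintegral_prod_left',
          ← lintegral_prod_symm₂ hΦm, lintegral_prod₂ hΦm]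
    _ ≤ 9 * (ofReal jac * ∫⁻ τ : ℝ, ∫⁻ p : ℝ², Φ τ p) := by
        rw [← mul_assoc]
        gcongr
        rw [show (9 : ℝ≥0∞) = ofReal 9 by norm_num, ← ofReal_mul (by norm_num)]
        refine ofReal_le_ofReal ?_
        rw [jac, inv_le_iff_one_le_mul₀ hpi]
        have : 2 * π * (9 * ((2 * π) ^ 2)⁻¹) = 9 / (2 * π) := by field_simp
        rw [mul_comm, this, le_div_iff₀ hpi]
        linarith [pi_le_four]

lemma exists_profile (η : Cutoff) {h : ℝ → L2} (hc : Continuous h) (hs : HasCompactSupport h)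
    (hx : xNorm η (𝓕 h) ≠ ⊤) : ∃ H V : ℝ³ → ℂ, Measurable H ∧ Measurable V ∧
      (∀ t, ∀ᵐ p, H (t, p) = h t (toPlane p)) ∧
      (∀ᵐ p : ℝ², ∀ᵐ t : ℝ, H (t, p) = ∫ θ, V (θ, p) * exp (I * (t * (θ + omega p.1 p.2)))) ∧
      xn η (fun x => ‖V x‖ₑ) ≤ 3 * xNorm η (𝓕 h) := by
  obtain ⟨H, R, hH, hHh, hHR, hH2⟩ := exists_supported_rep hc hs
  have hpi : (0 : ℝ) < 2 * π := by positivity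
  obtain ⟨G, hG⟩ : ∃ G : ℝ × Plane → ℂ, ∀ x, G x = 𝓕 (fun t => H (t, x.2)) x.1 := ⟨_, fun _ => rfl⟩
  have hGm : Measurable G := by
    have e : G = fun x => ∫ t, fourierChar (-(t * x.1)) • H (t, x.2) := by
      funext x; rw [hG, fourier_real_eq]
    rw [e]
    have hcont : Continuous fun x : (ℝ × Plane) × ℝ => fourierChar (-(x.2 * x.1.1)) :=
      Real.continuous_fourierChar.comp (by fun_prop)
    have hm : Measurable fun x : (ℝ × Plane) × ℝ =>
        fourierChar (-(x.2 * x.1.1)) • H (x.2, x.1.2) := by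
      simp only [Circle.smul_def]
      exact (continuous_subtype_val.comp hcont).measurable.smul (by fun_prop)
    exact hm.stronglyMeasurable.integral_prod_right'.measurable
  have hi : Integrable h := hc.integrable_of_hasCompactSupport hs
  have hGF : ∀ τ, (fun ζ => G (τ, ζ)) =ᵐ[volume] (𝓕 h τ : L2) := fun τ => by
    simp only [hG]
    exact fourier_section_ae_eq hi hH hHh hHR hH2 τ
  obtain ⟨V, hV⟩ : ∃ V : ℝ³ → ℂ, ∀ x, V x = ((2 * π)⁻¹ : ℂ) *
    G ((x.1 + omega x.2.1 x.2.2) / (2 * π), toPlane x.2) := ⟨_, fun _ => rfl⟩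
  have hVm : Measurable V := by
    have : V = fun x => ((2 * π)⁻¹ : ℂ) *
      G ((x.1 + omega x.2.1 x.2.2) / (2 * π), toPlane x.2) := funext hV
    rw [this]; fun_prop
  have hxn : xn η (fun x => ‖V x‖ₑ) ≤ 3 * xNorm η (𝓕 h) := by
    simp only [hV]
    exact xn_profile η hGm hGF
  refine ⟨fun x => H (x.1, toPlane x.2), V, by fun_prop, hVm, fun t => ae_toPlane (hHh t), ?_, hxn⟩
  have hfin : ∀ᵐ p : ℝ², ∫⁻ θ, ‖V (θ, p)‖ₑ < ⊤ := by
    have h1 := l2n_lintegral_le η (V := fun x => ‖V x‖ₑ) (by fun_prop)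
    have h2 : l2n (fun p => ∫⁻ θ, ‖V (θ, p)‖ₑ) ^ 2 ≠ ⊤ := by
      refine ENNReal.pow_ne_top (ne_top_of_le_ne_top ?_ (h1.trans (mul_le_mul_right hxn 2)))
      finiteness
    rw [l2n_sq] at h2
    have hm : Measurable fun p => ∫⁻ θ, ‖V (θ, p)‖ₑ :=
      Measurable.lintegral_prod_left' (f := fun x : ℝ³ => ‖V x‖ₑ) (by fun_prop)
    filter_upwards [ae_lt_top (by fun_prop) h2] with p hp
    exact (ENNReal.pow_lt_top_iff.1 hp).resolve_right two_ne_zero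
  have hH2' : ∀ᵐ p : ℝ², ∫⁻ t, ‖H (t, toPlane p)‖ₑ ^ 2 < ⊤ := by
    refine ae_toPlane (P := fun ζ => ∫⁻ t, ‖H (t, ζ)‖ₑ ^ 2 < ⊤) (ae_lt_top ?_ hH2)
    exact Measurable.lintegral_prod_left' (f := fun x : ℝ × Plane => ‖H x‖ₑ ^ 2) (by fun_prop)
  filter_upwards [hfin, hH2'] with p hp hp2
  set w := omega p.1 p.2 with hw
  have hVG : ∀ θ, V (θ, p) = ((2 * π)⁻¹ : ℂ) * G ((θ + w) / (2 * π), toPlane p) := fun θ => hV _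
  have hHi : Integrable fun t => H (t, toPlane p) :=
    integrable_of_lintegral_sq (S := Icc (-R) R) measurableSet_Icc (by simp) (by fun_prop)
      (fun t ht => hHR t _ ht) hp2.ne
  have hGi : Integrable fun τ => G (τ, toPlane p) := by
    have hVi : Integrable fun θ => V (θ, p) :=
      ⟨(by fun_prop : Measurable fun θ => V (θ, p)).aestronglyMeasurable, hp⟩
    have h3 := (((hVi.comp_sub_right w).comp_mul_left' hpi.ne').const_mul (2 * π : ℂ))
    refine h3.congr (.of_forall fun τ => ?_)
    simp only [hVG, sub_add_cancel, mul_div_cancel_left₀ _ hpi.ne']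
    rw [← mul_assoc, mul_inv_cancel₀ (by exact_mod_cast hpi.ne'), one_mul]
  have hGe : (fun τ => G (τ, toPlane p)) = 𝓕 (fun t => H (t, toPlane p)) := by funext τ; rw [hG]
  have := ae_eq_fourierInv_fourier hHi (by rw [← hGe]; exact hGi)
  filter_upwards [this] with t ht
  rw [ht, ← hGe, Real.fourierInv_eq']
  set Φ : ℝ → ℂ := fun τ => exp (I * (t * (2 * π * τ))) * G (τ, toPlane p) with hΦ
  have e1 : ∀ θ : ℝ, V (θ, p) * exp (I * (t * (θ + w))) =
      ((2 * π)⁻¹ : ℂ) * Φ ((θ + w) / (2 * π)) := fun θ => by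
    rw [hVG, hΦ]
    simp only
    have : (2 * π * (((θ + w) / (2 * π) : ℝ) : ℂ)) = θ + w := by push_cast; field_simp
    rw [this]; ring
  simp only [e1]
  rw [integral_const_mul, integral_add_right_eq_self (fun θ => Φ (θ / (2 * π))) w,
    Measure.integral_comp_div, abs_of_pos hpi, real_smul, ← mul_assoc]
  push_cast
  rw [inv_mul_cancel₀ (by exact_mod_cast hpi.ne'), one_mul]
  refine integral_congr_ae (.of_forall fun τ => ?_)
  simp only [hΦ, smul_eq_mul]
  congr 2
  simp
  ring

/-! ### The representation of space-time integrals -/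

lemma lintegral_rot {F : ℝ⁴ → ℝ≥0∞} (hF : Measurable F) :
    ∫⁻ z, F z = ∫⁻ z : ℝ⁴, F (-(z.1 + z.2), z.2) := by
  refine (lintegral_prod_symm₂ hF).trans (Eq.trans ?_
    (lintegral_prod_symm₂ (F := fun z => F (-(z.1 + z.2), z.2)) (by fun_prop)).symm)
  refine lintegral_congr fun q => ?_
  rw [lintegral_add_right_eq_self (fun p => F (-p, q)) q]
  exact (lintegral_neg_eq_self (fun p => F (p, q))).symm

lemma lintegral_trilinear_le {W₁ W₂ U : ℝ² → ℝ≥0∞} (h1 : Measurable W₁) (h2 : Measurable W₂)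
    (hU : Measurable U) : ∫⁻ z : ℝ⁴, W₁ z.1 * W₂ z.2 * U (-(z.1 + z.2)) ≤
      (∫⁻ r, U r) * (l2n W₁ * l2n W₂) := by
  rw [lintegral_rot (by fun_prop), lintegral_prod₂ (by fun_prop), ← lintegral_mul_const _ hU]
  refine lintegral_mono fun r => ?_
  have e : ∀ q, W₁ (-(r + q)) * W₂ q * U (-(-(r + q) + q)) = U r * (W₁ (-(r + q)) * W₂ q) :=
    fun q => by rw [show -(-(r + q) + q) = r by abel]; ring
  simp only [e]
  rw [lintegral_const_mul _ (by fun_prop)]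
  gcongr
  refine le_of_sq_le_sq ((lintegral_mul_sq_le (by fun_prop) (by fun_prop)).trans ?_)
  rw [mul_pow, l2n_sq, l2n_sq]
  refine mul_le_mul' ?_ le_rfl
  exact ((lintegral_add_left_eq_self (fun x => W₁ (-x) ^ 2) r).trans
    (lintegral_neg_eq_self (μ := volume) (fun x => W₁ x ^ 2))).le

lemma lintegral_indicator_le_l2n {U : ℝ² → ℝ≥0∞} (hU : Measurable U) {B : Set ℝ²}
    (hB : MeasurableSet B) : ∫⁻ r, B.indicator U r ≤ volume B ^ (1 / 2 : ℝ) * l2n U := by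
  have hI : Measurable (B.indicator (1 : ℝ² → ℝ≥0∞)) := measurable_one.indicator hB
  refine le_of_sq_le_sq ((lintegral_sq_le (A := B.indicator 1) (B := fun r => U r ^ 2)
    hI.aemeasurable (by fun_prop) (.of_forall fun r => ?_)).trans ?_)
  · by_cases h : r ∈ B <;> simp [h]
  · rw [lintegral_indicator_one hB, mul_pow, l2n_sq, ← rpow_natCast (volume B ^ (1 / 2 : ℝ)),
      ← rpow_mul]
    norm_num

/-- `H` is the superposition of the free solutions with modulations `θ` and profiles `V(θ)`. -/
def IsSuperposition (H V : ℝ³ → ℂ) : Prop := ∀ᵐ p : ℝ², ∀ᵐ t : ℝ, H (t, p) =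
    ∫ θ, V (θ, p) * exp (I * (t * (θ + omega p.1 p.2)))

lemma IsSuperposition.swap {H V : ℝ³ → ℂ} (hH : Measurable H) (hV : Measurable V)
    (h : IsSuperposition H V) : ∀ᵐ t : ℝ, ∀ᵐ p : ℝ², H (t, p) =
      ∫ θ, V (θ, p) * exp (I * (t * (θ + omega p.1 p.2))) := by
  have hm : Measurable fun x : ℝ² × ℝ => ∫ θ, V (θ, x.1) *
      exp (I * (x.2 * (θ + omega x.1.1 x.1.2))) := by
    have : Measurable fun y : (ℝ² × ℝ) × ℝ => V (y.2, y.1.1) *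
      exp (I * (y.1.2 * (y.2 + omega y.1.1.1 y.1.1.2))) := by fun_prop
    exact this.stronglyMeasurable.integral_prod_right'.measurable
  exact (Measure.ae_ae_comm (p := fun (p : ℝ²) (t : ℝ) => H (t, p) =
    ∫ θ, V (θ, p) * exp (I * (t * (θ + omega p.1 p.2))))
    (measurableSet_eq_fun (by fun_prop) hm)).1 h

lemma ae_fst {P : ℝ² → Prop} (h : ∀ᵐ p, P p) : ∀ᵐ z : ℝ⁴, P z.1 :=
  Measure.quasiMeasurePreserving_fst.ae h

lemma ae_snd {P : ℝ² → Prop} (h : ∀ᵐ p, P p) : ∀ᵐ z : ℝ⁴, P z.2 :=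
  Measure.quasiMeasurePreserving_snd.ae h

lemma ae_neg_add {P : ℝ² → Prop} (h : ∀ᵐ p, P p) : ∀ᵐ z : ℝ⁴, P (-(z.1 + z.2)) := by
  have h1 := ae_snd (((quasiMeasurePreserving_neg (volume : Measure ℝ²)).ae h))
  exact (measurePreserving_prod_add (volume : Measure ℝ²) volume).quasiMeasurePreserving.ae h1

/-- The representation of a space-time integral by the trilinear form of the profiles. -/
lemma enorm_integral_le_tform {η : Cutoff} {H₁ H₂ H₃ V₁ V₂ V₃ : ℝ³ → ℂ}
    (hH1 : Measurable H₁) (hH2 : Measurable H₂) (hH3 : Measurable H₃)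
    (hV1 : Measurable V₁) (hV2 : Measurable V₂) (hV3 : Measurable V₃)
    (s1 : IsSuperposition H₁ V₁) (s2 : IsSuperposition H₂ V₂) (s3 : IsSuperposition H₃ V₃)
    (x1 : xn η (fun x => ‖V₁ x‖ₑ) ≠ ⊤) (x2 : xn η (fun x => ‖V₂ x‖ₑ) ≠ ⊤)
    (x3 : xn η (fun x => ‖V₃ x‖ₑ) ≠ ⊤) {e : ℝ → ℂ} (he : Integrable e) (hem : Measurable e)
    {κ : ℝ → ℝ≥0∞} (hκm : Measurable κ) (hκ : ∀ x : ℝ, ‖∫ t, e t * exp (I * (t * x))‖ₑ ≤ κ x)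
    {m : ℝ⁴ → ℂ} (hm : Measurable m) {C : ℝ≥0} (hmC : ∀ z, ‖m z‖ₑ ≤ C)
    {B : Set ℝ²} (hB : MeasurableSet B) (hBf : volume B ≠ ⊤)
    (hmB : ∀ z, m z ≠ 0 → -(z.1 + z.2) ∈ B) :
    Integrable (fun t => e t * ∫ z : ℝ⁴, m z *
      (H₁ (t, z.1) * (H₂ (t, z.2) * H₃ (t, -(z.1 + z.2))))) ∧ ‖∫ t, e t * ∫ z : ℝ⁴, m z *
      (H₁ (t, z.1) * (H₂ (t, z.2) * H₃ (t, -(z.1 + z.2))))‖ₑ ≤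
      tform κ (fun z => ‖m z‖ₑ) (fun x => ‖V₁ x‖ₑ) (fun x => ‖V₂ x‖ₑ) (fun x => ‖V₃ x‖ₑ) := by
  obtain ⟨A, hA⟩ : ∃ A : ℝ⁴ × ℝ³ → ℂ, ∀ x, A x = m x.1 *
    (V₁ (x.2.1, x.1.1) * (V₂ (x.2.2.1, x.1.2) * V₃ (x.2.2.2, -(x.1.1 + x.1.2)))) :=
    ⟨_, fun _ => rfl⟩
  have hAm : Measurable A := by
    have : A = fun x => m x.1 *
      (V₁ (x.2.1, x.1.1) * (V₂ (x.2.2.1, x.1.2) * V₃ (x.2.2.2, -(x.1.1 + x.1.2)))) := funext hA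
    rw [this]; fun_prop
  obtain ⟨ph, hph⟩ : ∃ ph : ℝ⁴ × ℝ³ → ℝ, ∀ x, ph x =
    x.2.1 + x.2.2.1 + x.2.2.2 + reson x.1.1 x.1.2 := ⟨_, fun _ => rfl⟩
  have hphm : Measurable ph := by
    have : ph = fun x => x.2.1 + x.2.2.1 + x.2.2.2 + reson x.1.1 x.1.2 := funext hph
    rw [this]; fun_prop
  have hAi : Integrable A := by
    refine ⟨hAm.aestronglyMeasurable, ?_⟩
    rw [hasFiniteIntegral_iff_enorm]
    obtain ⟨W, hW⟩ : ∃ W : (ℝ³ → ℂ) → ℝ² → ℝ≥0∞, ∀ V p, W V p = ∫⁻ θ, ‖V (θ, p)‖ₑ :=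
      ⟨_, fun _ _ => rfl⟩
    have hWm : ∀ V, Measurable V → Measurable (W V) := fun V hV => by
      rw [funext (hW V)]
      exact Measurable.lintegral_prod_left' (f := fun x : ℝ³ => ‖V x‖ₑ) (by fun_prop)
    have hWf : ∀ V, Measurable V → xn η (fun x => ‖V x‖ₑ) ≠ ⊤ → l2n (W V) ≠ ⊤ := by
      intro V hV hx
      rw [funext (hW V)]
      exact ne_top_of_le_ne_top (by finiteness) (l2n_lintegral_le η (V := fun x => ‖V x‖ₑ)
        (by fun_prop))
    have w1 := hWm _ hV1
    have w2 := hWm _ hV2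
    have w3 := hWm _ hV3
    calc ∫⁻ x, ‖A x‖ₑ = ∫⁻ z, ∫⁻ t, ‖A (z, t)‖ₑ := lintegral_prod₂ (by fun_prop)
      _ = ∫⁻ z : ℝ⁴, ‖m z‖ₑ * (W V₁ z.1 * W V₂ z.2 * W V₃ (-(z.1 + z.2))) := by
        refine lintegral_congr fun z => ?_
        simp only [hA, enorm_mul]
        rw [lintegral_const_mul _ (by fun_prop), lintegral_prod₂ (by fun_prop)]
        congr 1
        have e1 : ∀ a, ∫⁻ y : ℝ², ‖V₁ (a, z.1)‖ₑ * (‖V₂ (y.1, z.2)‖ₑ * ‖V₃ (y.2, -(z.1 + z.2))‖ₑ) =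
            ‖V₁ (a, z.1)‖ₑ * (W V₂ z.2 * W V₃ (-(z.1 + z.2))) := by
          intro a
          rw [lintegral_const_mul _ (by fun_prop), lintegral_prod₂ (by fun_prop)]
          congr 1
          have e2 : ∀ b, ∫⁻ c : ℝ, ‖V₂ (b, z.2)‖ₑ * ‖V₃ (c, -(z.1 + z.2))‖ₑ =
              ‖V₂ (b, z.2)‖ₑ * W V₃ (-(z.1 + z.2)) := fun b => by
            rw [lintegral_const_mul _ (by fun_prop), hW]
          simp only [e2]
          rw [lintegral_mul_const _ (by fun_prop), ← hW V₂]
        simp only [e1]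
        rw [lintegral_mul_const _ (by fun_prop), ← hW V₁, mul_assoc]
      _ ≤ ∫⁻ z : ℝ⁴, C * (W V₁ z.1 * W V₂ z.2 * B.indicator (W V₃) (-(z.1 + z.2))) := by
        refine lintegral_mono fun z => ?_
        by_cases hz : m z = 0
        · simp [hz]
        · rw [indicator_of_mem (hmB z hz)]
          gcongr
          exact hmC z
      _ ≤ C * ((volume B ^ (1 / 2 : ℝ) * l2n (W V₃)) * (l2n (W V₁) * l2n (W V₂))) := by
        have w3' := w3.indicator hB
        rw [lintegral_const_mul _ (by fun_prop)]
        gcongr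
        refine (lintegral_trilinear_le w1 w2 w3').trans ?_
        gcongr
        exact lintegral_indicator_le_l2n w3 hB
      _ < ⊤ := by
        have f1 := hWf _ hV1 x1
        have f2 := hWf _ hV2 x2
        have f3 := hWf _ hV3 x3
        have : volume B ^ (1 / 2 : ℝ) ≠ ⊤ := rpow_ne_top_of_nonneg (by norm_num) hBf
        finiteness
  obtain ⟨Φ, hΦ⟩ : ∃ Φ : ℝ × (ℝ⁴ × ℝ³) → ℂ, ∀ x, Φ x =
    e x.1 * (A x.2 * exp (I * (x.1 * ph x.2))) := ⟨_, fun _ => rfl⟩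
  have hexp : ∀ t x : ℝ, ‖exp (I * (t * x))‖ = 1 := fun t x => by
    rw [mul_comm, ← Complex.ofReal_mul, Complex.norm_exp_ofReal_mul_I]
  have hΦi : Integrable Φ (volume.prod volume) := by
    refine (he.mul_prod hAi).mono ?_ (.of_forall fun x => ?_)
    · have : Measurable Φ := by rw [funext hΦ]; fun_prop
      exact this.aestronglyMeasurable
    · rw [hΦ, norm_mul, norm_mul, norm_mul, hexp, mul_one]
  have key : ∀ᵐ t : ℝ, e t * ∫ z : ℝ⁴, m z *
      (H₁ (t, z.1) * (H₂ (t, z.2) * H₃ (t, -(z.1 + z.2)))) = ∫ x, Φ (t, x) := by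
    filter_upwards [s1.swap hH1 hV1, s2.swap hH2 hV2, s3.swap hH3 hV3] with t t1 t2 t3
    simp only [hΦ]
    rw [integral_const_mul]
    congr 1
    have hi : Integrable (fun x => A x * exp (I * (t * ph x)))
        ((volume : Measure ℝ⁴).prod (volume : Measure ℝ³)) := by
      refine hAi.mono ?_ (.of_forall fun x => ?_)
      · exact (by fun_prop : Measurable fun x => A x * exp (I * (t * ph x))).aestronglyMeasurable
      · rw [norm_mul, hexp, mul_one]
    refine Eq.trans ?_ (integral_prod _ hi).symm
    refine integral_congr_ae ?_
    filter_upwards [ae_fst t1, ae_snd t2, ae_neg_add t3] with z z1 z2 z3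
    rw [z1, z2, z3]
    have o1 : ∀ (f g h : ℝ → ℂ), ∫ x : ℝ³, f x.1 * (g x.2.1 * h x.2.2) =
        (∫ a, f a) * ((∫ b, g b) * ∫ c, h c) := fun f g h => by
      have i1 := integral_prod_mul (μ := (volume : Measure ℝ)) (ν := (volume : Measure ℝ²))
        f (fun y : ℝ² => g y.1 * h y.2)
      have i2 := integral_prod_mul (μ := (volume : Measure ℝ)) (ν := (volume : Measure ℝ)) g h
      rw [← i2]; exact i1
    rw [← o1, ← integral_const_mul]
    refine integral_congr_ae (.of_forall fun x => ?_)
    simp only [hA]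
    have ho : omega (-(z.1 + z.2)).1 (-(z.1 + z.2)).2 = -omega (z.1.1 + z.2.1) (z.1.2 + z.2.2) := by
      simp only [omega, Prod.fst_neg, Prod.snd_neg, Prod.fst_add, Prod.snd_add]
      rw [div_neg]; ring
    have : exp (I * (t * ph (z, x))) = exp (I * (t * (x.1 + omega z.1.1 z.1.2))) *
        (exp (I * (t * (x.2.1 + omega z.2.1 z.2.2))) *
        exp (I * (t * (x.2.2 + omega (-(z.1 + z.2)).1 (-(z.1 + z.2)).2)))) := by
      rw [← Complex.exp_add, ← Complex.exp_add, hph, ho, reson]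
      push_cast
      congr 1; ring
    rw [this]; ring
  refine ⟨hΦi.integral_prod_left.congr (key.mono fun t ht => ht.symm), ?_⟩
  rw [integral_congr_ae key]
  rw [integral_integral_swap (f := fun t x => Φ (t, x)) hΦi]
  refine (enorm_integral_le_lintegral_enorm _).trans ?_
  calc ∫⁻ x, ‖∫ t, Φ (t, x)‖ₑ ≤ ∫⁻ x, ‖A x‖ₑ * κ (ph x) := by
        refine lintegral_mono fun x => ?_
        simp only [hΦ]
        have : ∀ t : ℝ, e t * (A x * exp (I * (t * ph x))) =
          A x * (e t * exp (I * (t * ph x))) := fun t => by ring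
        simp only [this]
        rw [integral_const_mul, enorm_mul]
        gcongr
        exact hκ _
    _ = _ := by
        rw [tform, lintegral_prod₂ (by fun_prop)]
        refine lintegral_congr fun z => lintegral_congr fun t => ?_
        simp only [hA, hph, enorm_mul]
        ring

/-! ### Time cutoffs -/

/-- The angular Fourier transform of a time cutoff. -/
def timeFourier (φ : ℝ → ℂ) (w : ℝ) : ℂ := ∫ y, φ y * exp (I * (y * w))

/-- A smooth bump with integer translates summing to the difference of two smooth steps. -/
def stepBump (y : ℝ) : ℂ := ((smoothTransition y - smoothTransition (y - 1) : ℝ) : ℂ)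

/-- A cutoff on `[0, 1]` with a jump at the left endpoint. -/
def stepLeft : ℝ → ℂ := (Icc (0 : ℝ) 1).indicator fun y => ((1 - smoothTransition y : ℝ) : ℂ)

/-- A cutoff on `[0, 1]` with a jump at the right endpoint. -/
def stepRight : ℝ → ℂ := (Icc (0 : ℝ) 1).indicator fun y => ((smoothTransition y : ℝ) : ℂ)

lemma contDiff_stepBump : ContDiff ℝ ∞ stepBump := by
  have h : ContDiff ℝ ∞ smoothTransition := smoothTransition.contDiff
  exact ofRealCLM.contDiff.comp (h.sub (h.comp (contDiff_id.sub contDiff_const)))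

lemma stepBump_support {y : ℝ} (h : stepBump y ≠ 0) : y ∈ Icc (0 : ℝ) 2 := by
  by_contra hy
  rw [mem_Icc, not_and_or, not_le, not_le] at hy
  apply h
  rcases hy with hy | hy
  · simp [stepBump, smoothTransition.zero_of_nonpos hy.le,
      smoothTransition.zero_of_nonpos (show y - 1 ≤ 0 by linarith)]
  · simp [stepBump, smoothTransition.one_of_one_le (show 1 ≤ y by linarith),
      smoothTransition.one_of_one_le (show 1 ≤ y - 1 by linarith)]

lemma stepLeft_support {y : ℝ} (h : stepLeft y ≠ 0) : y ∈ Icc (0 : ℝ) 1 :=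
  by_contra fun hy => h (indicator_of_notMem hy _)

lemma stepRight_support {y : ℝ} (h : stepRight y ≠ 0) : y ∈ Icc (0 : ℝ) 1 :=
  by_contra fun hy => h (indicator_of_notMem hy _)

lemma hasCompactSupport_stepBump : HasCompactSupport stepBump :=
  HasCompactSupport.of_support_subset_isCompact isCompact_Icc fun _ h => stepBump_support h

lemma sum_stepBump (N : ℕ) (y : ℝ) : ∑ n ∈ Finset.range N, stepBump (y - n) =
    ((smoothTransition y - smoothTransition (y - N) : ℝ) : ℂ) := by
  induction N with
  | zero => simp
  | succ N ih =>
    rw [Finset.sum_range_succ, ih, stepBump]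
    push_cast
    rw [sub_sub y (N : ℝ) 1]
    ring

/-- The decomposition of the indicator function of `[0, N + 1]`. -/
lemma stepLeft_add_sum_add_stepRight (N : ℕ) (y : ℝ) :
    stepLeft y + ∑ n ∈ Finset.range N, stepBump (y - n) + stepRight (y - N) =
      (Icc (0 : ℝ) (N + 1)).indicator 1 y := by
  rw [sum_stepBump]
  have hN : (0 : ℝ) ≤ N := Nat.cast_nonneg N
  have s0 : ∀ x : ℝ, x ≤ 0 → smoothTransition x = 0 := fun x hx =>
    smoothTransition.zero_of_nonpos hx
  have s1 : ∀ x : ℝ, 1 ≤ x → smoothTransition x = 1 := fun x hx =>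
    smoothTransition.one_of_one_le hx
  have hL : stepLeft y = (if y < 0 then 0 else ((1 - smoothTransition y : ℝ) : ℂ)) := by
    unfold stepLeft
    by_cases h0 : y < 0
    · rw [if_pos h0, indicator_of_notMem fun h => absurd h.1 (not_le.2 h0)]
    · rw [if_neg h0]
      by_cases h1 : y ≤ 1
      · rw [indicator_of_mem (s := Icc _ _) ⟨not_lt.1 h0, h1⟩]
      · rw [indicator_of_notMem fun h => h1 h.2, s1 y (not_le.1 h1).le]; simp
  have hR : stepRight (y - N) = (if N + 1 < y then 0 else
      ((smoothTransition (y - N) : ℝ) : ℂ)) := by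
    unfold stepRight
    by_cases h0 : N + 1 < y
    · rw [if_pos h0, indicator_of_notMem fun h => by have := h.2; linarith]
    · rw [if_neg h0]
      by_cases h1 : 0 ≤ y - N
      · rw [indicator_of_mem (s := Icc _ _) ⟨h1, by linarith⟩]
      · rw [indicator_of_notMem fun h => h1 h.1, s0 _ (not_le.1 h1).le]; simp
  rw [hL, hR]
  by_cases h0 : y < 0
  · rw [if_pos h0, if_neg (by linarith), indicator_of_notMem fun h => absurd h.1 (not_le.2 h0),
      s0 y h0.le, s0 (y - N) (by linarith)]
    simp
  by_cases h1 : N + 1 < y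
  · rw [if_neg h0, if_pos h1, indicator_of_notMem fun h => absurd h.2 (not_le.2 h1),
      s1 y (by linarith), s1 (y - N) (by linarith)]
    simp
  · rw [if_neg h0, if_neg h1, indicator_of_mem (s := Icc _ _) ⟨not_lt.1 h0, not_lt.1 h1⟩]
    push_cast
    simp

lemma exists_timeFourier_stepBump_le :
    ∃ C : ℝ≥0, ∀ w, ‖timeFourier stepBump w‖ₑ ≤ C * kerI 1 w := by
  set S : SchwartzMap ℝ ℂ := hasCompactSupport_stepBump.toSchwartzMap contDiff_stepBump with hS
  obtain ⟨R, hR⟩ : ∃ R : SchwartzMap ℝ ℂ, R = 𝓕 S := ⟨_, rfl⟩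
  have e : ∀ w, timeFourier stepBump w = R (-(w / (2 * π))) := by
    intro w
    rw [hR, fourier_coe, Real.fourier_real_eq_integral_exp_smul, timeFourier]
    refine integral_congr_ae (.of_forall fun y => ?_)
    simp only [smul_eq_mul]
    rw [mul_comm]
    congr 2
    push_cast
    have : (π : ℂ) ≠ 0 := by exact_mod_cast Real.pi_ne_zero
    field_simp
  obtain ⟨C0, hC0⟩ := R.decay 0 0
  obtain ⟨C4, hC4⟩ := R.decay 4 0
  have b0 : ∀ x, ‖R x‖ ≤ C0 := fun x => by simpa using hC0.2 x
  have b4 : ∀ x, |x| ^ 4 * ‖R x‖ ≤ C4 := fun x => by simpa using hC4.2 x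
  refine ⟨(2 * C0 + 2 * (2 * π) ^ 4 * C4).toNNReal, fun w => ?_⟩
  have hC : 0 ≤ 2 * C0 + 2 * (2 * π) ^ 4 * C4 := by have := hC0.1; have := hC4.1; positivity
  rw [e, kerI, ← ofReal_norm, ← ofReal, ← ofReal_mul hC]
  refine ofReal_le_ofReal ?_
  rw [one_mul, mul_one_div, le_div_iff₀ (by positivity)]
  have k0 := b0 (-(w / (2 * π)))
  have k4 := b4 (-(w / (2 * π)))
  set r := ‖R (-(w / (2 * π)))‖ with hr
  have hr0 : 0 ≤ r := norm_nonneg _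
  have hw4 : |-(w / (2 * π))| ^ 4 * (2 * π) ^ 4 = w ^ 4 := by
    rw [abs_neg, abs_div, abs_of_pos (by positivity : (0 : ℝ) < 2 * π), div_pow,
      div_mul_cancel₀ _ (by positivity), ← abs_pow, abs_of_nonneg (by positivity)]
  have k5 : w ^ 4 * r ≤ (2 * π) ^ 4 * C4 := by
    rw [← hw4]
    have := mul_le_mul_of_nonneg_left k4 (by positivity : 0 ≤ (2 * π) ^ 4)
    linarith
  have : (1 + w ^ 2) ^ 2 ≤ 2 + 2 * w ^ 4 := by nlinarith [sq_nonneg (w ^ 2 - 1)]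
  nlinarith [mul_le_mul_of_nonneg_left this hr0]

lemma exists_timeFourier_indicator_le {f : ℝ → ℝ} (hf : ContDiff ℝ 1 f) :
    ∃ C : ℝ≥0, ∀ w, ‖timeFourier ((Icc (0 : ℝ) 1).indicator fun y => (f y : ℂ)) w‖ₑ ≤
      C * kerB 1 w := by
  have hfc : Continuous fun y => (f y : ℂ) := continuous_ofReal.comp hf.continuous
  have hf'c : Continuous fun y => ((deriv f y : ℝ) : ℂ) :=
    continuous_ofReal.comp (hf.continuous_deriv le_rfl)
  obtain ⟨A, hA⟩ := isCompact_Icc.exists_bound_of_continuousOn (s := Icc (0 : ℝ) 1) hfc.continuousOn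
  obtain ⟨A', hA'⟩ := isCompact_Icc.exists_bound_of_continuousOn (s := Icc (0 : ℝ) 1)
    hf'c.continuousOn
  have hA0 : 0 ≤ A := (norm_nonneg _).trans (hA 0 (by simp))
  have hA'0 : 0 ≤ A' := (norm_nonneg _).trans (hA' 0 (by simp))
  have e : ∀ w, timeFourier ((Icc (0 : ℝ) 1).indicator fun y => (f y : ℂ)) w =
      ∫ y in (0 : ℝ)..1, (f y : ℂ) * exp (I * (y * w)) := by
    intro w
    rw [timeFourier, intervalIntegral.integral_of_le zero_le_one, ← integral_Icc_eq_integral_Ioc,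
      ← integral_indicator measurableSet_Icc]
    refine integral_congr_ae (.of_forall fun y => ?_)
    by_cases hy : y ∈ Icc (0 : ℝ) 1
    · simp only [indicator_of_mem hy]
    · simp only [indicator_of_notMem hy, zero_mul]
  have hn : ∀ y w : ℝ, ‖exp (I * (y * w))‖ = 1 := fun y w => by
    rw [mul_comm, ← Complex.ofReal_mul, Complex.norm_exp_ofReal_mul_I]
  have b0 : ∀ w : ℝ, ‖∫ y in (0 : ℝ)..1, (f y : ℂ) * exp (I * (y * w))‖ ≤ A := by
    intro w
    have := intervalIntegral.norm_integral_le_of_norm_le_const (a := (0 : ℝ)) (b := 1) (C := A)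
      (f := fun y : ℝ => (f y : ℂ) * exp (I * (y * w))) (fun y hy => by
        rw [norm_mul, hn, mul_one]
        rw [uIoc_of_le zero_le_one] at hy
        exact hA y ⟨hy.1.le, hy.2⟩)
    simpa using this
  have b1 : ∀ w : ℝ, |w| * ‖∫ y in (0 : ℝ)..1, (f y : ℂ) * exp (I * (y * w))‖ ≤ 2 * A + A' := by
    intro w
    have hd : ∀ y : ℝ, HasDerivAt (fun y : ℝ => exp (I * (y * w)))
        (exp (I * (y * w)) * (I * w)) y := fun y => by
      have h1 : HasDerivAt (fun y : ℝ => I * ((y : ℂ) * w)) (I * w) y := by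
        have := ((ofRealCLM.hasDerivAt (x := y)).mul_const (w : ℂ)).const_mul I
        simpa using this
      exact h1.cexp
    have hfd : ∀ y : ℝ, HasDerivAt (fun y => (f y : ℂ)) ((deriv f y : ℝ) : ℂ) y := fun y =>
      ((hf.differentiable one_ne_zero) y).hasDerivAt.ofReal_comp
    have hp := intervalIntegral.integral_mul_deriv_eq_deriv_mul (a := (0 : ℝ)) (b := 1)
      (fun y _ => hfd y) (fun y _ => hd y) (hf'c.intervalIntegrable 0 1)
      ((by fun_prop : Continuous fun y : ℝ =>
        exp (I * (y * w)) * (I * w)).intervalIntegrable 0 1)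
    have hl : ∫ y in (0 : ℝ)..1, (f y : ℂ) * (exp (I * (y * w)) * (I * w)) =
        (I * w) * ∫ y in (0 : ℝ)..1, (f y : ℂ) * exp (I * (y * w)) := by
      rw [← intervalIntegral.integral_const_mul]
      refine intervalIntegral.integral_congr fun y _ => ?_
      ring
    have hw : |w| * ‖∫ y in (0 : ℝ)..1, (f y : ℂ) * exp (I * (y * w))‖ =
        ‖(I * w) * ∫ y in (0 : ℝ)..1, (f y : ℂ) * exp (I * (y * w))‖ := by
      simp
    rw [hw, ← hl, hp]
    have i1 := intervalIntegral.norm_integral_le_of_norm_le_const (a := (0 : ℝ)) (b := 1) (C := A')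
      (f := fun y : ℝ => ((deriv f y : ℝ) : ℂ) * exp (I * (y * w))) (fun y hy => by
        rw [norm_mul, hn, mul_one]
        rw [uIoc_of_le zero_le_one] at hy
        exact hA' y ⟨hy.1.le, hy.2⟩)
    have i2 := hA 0 (by simp)
    have i3 := hA 1 (by simp)
    refine (norm_sub_le _ _).trans (add_le_add ((norm_sub_le _ _).trans ?_) (by simpa using i1))
    rw [norm_mul, norm_mul, hn, hn]
    linarith
  refine ⟨(3 * A + A').toNNReal, fun w => ?_⟩
  rw [e, kerB, ← ofReal_norm, ← ofReal, ← ofReal_mul (by positivity)]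
  refine ofReal_le_ofReal ?_
  rw [one_mul, mul_one_div, le_div_iff₀ (by positivity)]
  have := b0 w
  have := b1 w
  nlinarith

lemma exists_timeFourier_steps_le : ∃ C : ℝ≥0, (∀ w, ‖timeFourier stepBump w‖ₑ ≤ C * kerI 1 w) ∧
    (∀ w, ‖timeFourier stepLeft w‖ₑ ≤ C * kerB 1 w) ∧
    (∀ w, ‖timeFourier stepRight w‖ₑ ≤ C * kerB 1 w) := by
  have h : ContDiff ℝ 1 smoothTransition := smoothTransition.contDiff
  obtain ⟨C1, h1⟩ := exists_timeFourier_stepBump_le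
  obtain ⟨C2, h2⟩ := exists_timeFourier_indicator_le (contDiff_const (c := (1 : ℝ)).sub h)
  obtain ⟨C3, h3⟩ := exists_timeFourier_indicator_le h
  refine ⟨C1 + C2 + C3, fun w => (h1 w).trans ?_, fun w => (h2 w).trans ?_,
    fun w => (h3 w).trans ?_⟩ <;> gcongr <;> push_cast
  · rw [add_assoc]; exact le_self_add
  · rw [add_right_comm]; exact le_add_self
  · exact le_add_self

lemma timeFourier_scale {φ : ℝ → ℂ} {σ : ℝ} (hσ : 0 < σ) (a x : ℝ) :
    ‖∫ t : ℝ, φ ((t - a) / σ) * exp (I * (t * x))‖ₑ = ofReal σ * ‖timeFourier φ (σ * x)‖ₑ := by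
  have e1 : ∫ t : ℝ, φ ((t - a) / σ) * exp (I * (t * x)) =
      exp (I * (a * x)) * (σ * timeFourier φ (σ * x)) := by
    rw [← integral_add_right_eq_self _ a]
    have := Measure.integral_comp_div (fun y : ℝ => φ y * exp (I * (y * (σ * x)))) σ
    rw [abs_of_pos hσ, real_smul] at this
    rw [timeFourier]
    push_cast
    rw [← this, ← integral_const_mul]
    refine integral_congr_ae (.of_forall fun t => ?_)
    simp only [add_sub_cancel_right]
    have hσ' : (σ : ℂ) ≠ 0 := by exact_mod_cast hσ.ne'
    have e3 : exp (I * (((t + a : ℝ) : ℂ) * x)) =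
        exp (I * (a * x)) * exp (I * (((t / σ : ℝ) : ℂ) * (σ * x))) := by
      rw [← Complex.exp_add]
      congr 1
      push_cast
      field_simp
      ring
    push_cast at e3 ⊢
    rw [e3]; ring
  have e2 : ‖exp (I * (a * x))‖ₑ = 1 := by
    rw [← ofReal_norm, mul_comm, ← Complex.ofReal_mul, Complex.norm_exp_ofReal_mul_I, ofReal_one]
  rw [e1, enorm_mul, enorm_mul, e2, one_mul, ← ofReal_norm (σ : ℂ), norm_real, norm_of_nonneg hσ.le]

lemma ofReal_mul_kerI {σ : ℝ} (hσ : 0 < σ) (x : ℝ) : ofReal σ * kerI 1 (σ * x) = kerI σ x := by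
  rw [kerI, kerI, ← ofReal_mul hσ.le]
  congr 1
  rw [one_mul, mul_one_div]

lemma ofReal_mul_kerB {σ : ℝ} (hσ : 0 < σ) (x : ℝ) : ofReal σ * kerB 1 (σ * x) = kerB σ x := by
  rw [kerB, kerB, ← ofReal_mul hσ.le]
  congr 1
  rw [one_mul, mul_one_div, abs_mul, abs_of_pos hσ]

lemma spaceTimeFourier_eq {f : ℝ → L2} (hf : Integrable f) :
    spaceTimeFourier f = 𝓕 fun t => (𝓕 (f t) : L2) := by
  funext τ
  rw [spaceTimeFourier, fourier_real_eq, fourier_real_eq]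
  have hcont : Continuous fun v : ℝ => fourierChar (-(v * τ)) :=
    Real.continuous_fourierChar.comp (by fun_prop)
  have hi : Integrable fun t => fourierChar (-(t * τ)) • f t := by
    refine hf.mono ?_ (.of_forall fun x => by simp)
    exact (continuous_subtype_val.comp hcont).aestronglyMeasurable.smul hf.1
  have := (Lp.fourierTransformₗᵢ Plane ℂ).toContinuousLinearEquiv.toContinuousLinearMap.integral_comp_comm
    hi
  refine Eq.trans this.symm (integral_congr_ae (.of_forall fun t => ?_))
  exact (Lp.fourierTransformₗᵢ Plane ℂ).map_smul _ _

/-- The frequency localized function. -/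
def locU (η : Cutoff) (k : ℕ) (U : ℝ³ → ℂ) (x : ℝ³) : ℂ := (η.dyadic k x.2.1 : ℂ) * U x

/-- The trilinear expression with multiplier `m`. -/
def tri (m : ℝ⁴ → ℂ) (f₁ f₂ f₃ : ℝ³ → ℂ) (t : ℝ) : ℂ :=
  ∫ z : ℝ⁴, m z * (f₁ (t, z.1) * (f₂ (t, z.2) * f₃ (t, -(z.1 + z.2))))

local notation "triLoc⟦" m ", " η ", " k ", " U "⟧" =>
  tri m (locU η (k 0) U) (locU η (k 1) U) (locU η (k 2) U)

lemma tri_congr {m : ℝ⁴ → ℂ} {f₁ f₂ f₃ g₁ g₂ g₃ : ℝ³ → ℂ} {t : ℝ}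
    (h1 : ∀ᵐ p, f₁ (t, p) = g₁ (t, p)) (h2 : ∀ᵐ p, f₂ (t, p) = g₂ (t, p))
    (h3 : ∀ᵐ p, f₃ (t, p) = g₃ (t, p)) : tri m f₁ f₂ f₃ t = tri m g₁ g₂ g₃ t := by
  refine integral_congr_ae ?_
  filter_upwards [ae_fst h1, ae_snd h2, ae_neg_add h3] with z z1 z2 z3
  rw [z1, z2, z3]

/-- Admissible multipliers: bounded, and supported where the third frequency is in a fixed set of
finite measure. -/
structure IsMultiplier (m : ℝ⁴ → ℂ) : Prop where
  measurable : Measurable m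
  bounded : ∃ C : ℝ≥0, ∀ z, ‖m z‖ₑ ≤ C
  support : ∃ B : Set ℝ², MeasurableSet B ∧ volume B ≠ ⊤ ∧ ∀ z, m z ≠ 0 → -(z.1 + z.2) ∈ B

lemma exists_piece (η : Cutoff) {k : Fin 3 → ℕ} {g : Fin 3 → ℝ → L2}
    (hg : ∀ i, Continuous (g i)) (hfk : ∀ i, fkNorm η (k i) (g i) ≠ ⊤) {U : ℝ³ → ℂ}
    {J : Set ℝ} (hgU : ∀ i, ∀ t ∈ J, ∀ᵐ p, (𝓕 (g i t) : L2) (toPlane p) = locU η (k i) U (t, p))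
    {φ : ℝ → ℂ} (hφm : Measurable φ) (hφ : Integrable φ) {σ a b : ℝ} (hσ : 0 < σ)
    (hφJ : ∀ t, φ ((t - a) / σ) ≠ 0 → t ∈ J ∧ ∀ i, |2 ^ k i * (t - b)| ≤ 5 / 4)
    {κ : ℝ → ℝ≥0∞} (hκm : Measurable κ) (hκ : ∀ w, ‖timeFourier φ w‖ₑ ≤ κ w) :
    ∃ V : Fin 3 → ℝ³ → ℝ≥0∞, (∀ i, Measurable (V i) ∧ xn η (V i) ≤ 3 * fkNorm η (k i) (g i)) ∧
      ∀ m : ℝ⁴ → ℂ, IsMultiplier m → Integrable (fun t => φ ((t - a) / σ) * triLoc⟦m, η, k, U⟧ t) ∧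
        ‖∫ t, φ ((t - a) / σ) * triLoc⟦m, η, k, U⟧ t‖ₑ ≤
          tform (fun x => ofReal σ * κ (σ * x)) (fun z => ‖m z‖ₑ) (V 0) (V 1) (V 2) := by
  have hηc : ∀ i, Continuous fun t : ℝ => η.toFun (2 ^ k i * (t - b)) := fun i =>
    η.smooth.continuous.comp (by fun_prop)
  have hηs : ∀ i, HasCompactSupport fun t : ℝ => η.toFun (2 ^ k i * (t - b)) := by
    intro i
    refine HasCompactSupport.of_support_subset_isCompact
      (isCompact_Icc (a := b - 2) (b := b + 2)) fun t ht => ?_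
    have h1 := abs_le.2 (η.support_subset ht)
    have h2 : (1 : ℝ) ≤ 2 ^ k i := one_le_pow₀ (by norm_num)
    rw [abs_mul, abs_of_pos (by positivity)] at h1
    have h3 : |t - b| ≤ 2 := by nlinarith [abs_nonneg (t - b)]
    have := abs_le.1 h3
    exact ⟨by linarith, by linarith⟩
  set f : Fin 3 → ℝ → L2 := fun i t => η.toFun (2 ^ k i * (t - b)) • g i t with hf
  have hfc : ∀ i, Continuous (f i) := fun i => (hηc i).smul (hg i)
  have hfs : ∀ i, HasCompactSupport (f i) := fun i => (hηs i).smul_right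
  set h : Fin 3 → ℝ → L2 := fun i t => 𝓕 (f i t) with hh
  have hFc : Continuous fun φ : L2 => (𝓕 φ : L2) := (Lp.fourierTransformₗᵢ Plane ℂ).continuous
  have hhc : ∀ i, Continuous (h i) := fun i => hFc.comp (hfc i)
  have hhs : ∀ i, HasCompactSupport (h i) := fun i =>
    (hfs i).comp_left (g := fun φ : L2 => (𝓕 φ : L2)) (Lp.fourierTransformₗᵢ Plane ℂ).map_zero
  have hx : ∀ i, xNorm η (𝓕 (h i)) ≤ fkNorm η (k i) (g i) := fun i => by
    rw [hh, ← spaceTimeFourier_eq ((hfc i).integrable_of_hasCompactSupport (hfs i))]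
    exact le_iSup (fun tk => xNorm η
      (spaceTimeFourier fun t => η.toFun (2 ^ k i * (t - tk)) • g i t)) b
  have hx' : ∀ i, xNorm η (𝓕 (h i)) ≠ ⊤ := fun i => ne_top_of_le_ne_top (hfk i) (hx i)
  choose H V hHm hVm hHh hHV hxV using fun i => exists_profile η (hhc i) (hhs i) (hx' i)
  refine ⟨fun i x => ‖V i x‖ₑ, fun i => ⟨by have := hVm i; fun_prop, (hxV i).trans ?_⟩, ?_⟩
  · gcongr; exact hx i
  intro m hm
  obtain ⟨C, hC⟩ := hm.bounded
  obtain ⟨B, hB, hBf, hmB⟩ := hm.support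
  have hxt : ∀ i, xn η (fun x => ‖V i x‖ₑ) ≠ ⊤ := fun i =>
    ne_top_of_le_ne_top (by have := hx' i; finiteness) (hxV i)
  have he : Integrable fun t => φ ((t - a) / σ) := (hφ.comp_div hσ.ne').comp_sub_right a
  have hHU : ∀ t, φ ((t - a) / σ) ≠ 0 → ∀ i, ∀ᵐ p, H i (t, p) = locU η (k i) U (t, p) := by
    intro t ht i
    obtain ⟨htJ, hti⟩ := hφJ t ht
    filter_upwards [hHh i t, hgU i t htJ] with p hp hp'
    rw [hp, ← hp']
    simp only [hh, hf, η.eq_one' (hti i), one_smul]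
  have hcongr : ∀ t, φ ((t - a) / σ) * tri m (H 0) (H 1) (H 2) t = φ ((t - a) / σ) *
      triLoc⟦m, η, k, U⟧ t := by
    intro t
    by_cases ht : φ ((t - a) / σ) = 0
    · rw [ht, zero_mul, zero_mul]
    · rw [tri_congr (hHU t ht 0) (hHU t ht 1) (hHU t ht 2)]
  have main := enorm_integral_le_tform (η := η) (hHm 0) (hHm 1) (hHm 2) (hVm 0) (hVm 1) (hVm 2)
    (hHV 0) (hHV 1) (hHV 2) (hxt 0) (hxt 1) (hxt 2) he (by fun_prop)
    (κ := fun x => ofReal σ * κ (σ * x)) (by fun_prop) (fun x => by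
      rw [timeFourier_scale hσ]
      gcongr
      exact hκ _) hm.measurable hC hB hBf hmB
  have e : (fun t => φ ((t - a) / σ) * tri m (H 0) (H 1) (H 2) t) = fun t => φ ((t - a) / σ) *
      triLoc⟦m, η, k, U⟧ t := funext hcongr
  have main' : Integrable (fun t => φ ((t - a) / σ) * tri m (H 0) (H 1) (H 2) t) ∧
    ‖∫ t, φ ((t - a) / σ) * tri m (H 0) (H 1) (H 2) t‖ₑ ≤ _ := main
  rw [e] at main'
  exact main'

/-- The space-time integral over a time interval is controlled by the trilinear forms of the
profiles on time intervals of length comparable to `2 ^ (-n)`. -/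
lemma exists_pieces (η : Cutoff) : ∃ C : ℝ≥0, ∀ (k : Fin 3 → ℕ) (n : ℕ) (_ : ∀ i, k i ≤ n)
    (g : Fin 3 → ℝ → L2) (_ : ∀ i, Continuous (g i)) (_ : ∀ i, fkNorm η (k i) (g i) ≠ ⊤)
    (U : ℝ³ → ℂ) (α β : ℝ) (_ : α < β) (_ : β - α ≤ 1)
    (_ : ∀ i, ∀ t ∈ Icc α β, ∀ᵐ p, (𝓕 (g i t) : L2) (toPlane p) = locU η (k i) U (t, p)),
    ∃ (σ : ℝ) (N : ℕ) (V : ℕ → Fin 3 → ℝ³ → ℝ≥0∞) (W W' : Fin 3 → ℝ³ → ℝ≥0∞),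
      0 < σ ∧ σ ≤ (2 ^ n)⁻¹ ∧ N ≤ 2 ^ n ∧
      (∀ l i, Measurable (V l i) ∧ xn η (V l i) ≤ 3 * fkNorm η (k i) (g i)) ∧
      (∀ i, Measurable (W i) ∧ xn η (W i) ≤ 3 * fkNorm η (k i) (g i)) ∧
      (∀ i, Measurable (W' i) ∧ xn η (W' i) ≤ 3 * fkNorm η (k i) (g i)) ∧
      ∀ m : ℝ⁴ → ℂ, IsMultiplier m → IntegrableOn (triLoc⟦m, η, k, U⟧) (Icc α β) ∧
        ‖∫ t in Icc α β, triLoc⟦m, η, k, U⟧ t‖ₑ ≤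
          C * (tform (kerB σ) (fun z => ‖m z‖ₑ) (W 0) (W 1) (W 2) +
            (∑ l ∈ Finset.range N, tform (kerI σ) (fun z => ‖m z‖ₑ) (V l 0) (V l 1) (V l 2)) +
            tform (kerB σ) (fun z => ‖m z‖ₑ) (W' 0) (W' 1) (W' 2)) := by
  obtain ⟨C, cI, cL, cR⟩ := exists_timeFourier_steps_le
  refine ⟨C, fun k n hkn g hg hfk U α β hαβ hβα hgU => ?_⟩
  set L := β - α with hL
  have hL0 : 0 < L := sub_pos.2 hαβ
  set N' := ⌈L * 2 ^ n⌉₊ with hN'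
  have hN'0 : 0 < N' := Nat.ceil_pos.2 (by positivity)
  obtain ⟨N, hN⟩ : ∃ N, N' = N + 1 := Nat.exists_eq_succ_of_ne_zero hN'0.ne'
  have hN'n : N' ≤ 2 ^ n := by
    rw [hN', Nat.ceil_le]
    push_cast
    exact mul_le_of_le_one_left (by positivity) hβα
  set σ := L / (N + 1) with hσdef
  have hN1 : (0 : ℝ) < N + 1 := by positivity
  have hσ : 0 < σ := by positivity
  have hσN : σ * (N + 1) = L := by rw [hσdef]; field_simp
  have hσn : σ ≤ (2 ^ n)⁻¹ := by
    rw [hσdef, div_le_iff₀ hN1, inv_mul_eq_div, le_div_iff₀ (by positivity)]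
    have := Nat.le_ceil (L * 2 ^ n)
    rw [← hN', hN] at this
    exact_mod_cast this
  have hclose : ∀ t b, |t - b| ≤ σ → ∀ i, |2 ^ k i * (t - b)| ≤ 5 / 4 := by
    intro t b htb i
    rw [abs_mul, abs_of_pos (by positivity)]
    have h1 : (2 : ℝ) ^ k i ≤ 2 ^ n := pow_le_pow_right₀ (by norm_num) (hkn i)
    calc (2 : ℝ) ^ k i * |t - b| ≤ 2 ^ n * (2 ^ n)⁻¹ :=
          mul_le_mul h1 (htb.trans hσn) (abs_nonneg _) (by positivity)
      _ = 1 := mul_inv_cancel₀ (by positivity)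
      _ ≤ 5 / 4 := by norm_num
  have msm : Measurable smoothTransition := smoothTransition.continuous.measurable
  have mB : Measurable stepBump := contDiff_stepBump.continuous.measurable
  have iB : Integrable stepBump :=
    contDiff_stepBump.continuous.integrable_of_hasCompactSupport hasCompactSupport_stepBump
  have mL : Measurable stepLeft := Measurable.indicator (by fun_prop) measurableSet_Icc
  have mR : Measurable stepRight := Measurable.indicator (by fun_prop) measurableSet_Icc
  have iL : Integrable stepLeft := by
    refine (integrable_indicator_iff measurableSet_Icc).2 (Continuous.integrableOn_Icc ?_)
    exact continuous_ofReal.comp (continuous_const.sub smoothTransition.continuous)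
  have iR : Integrable stepRight := by
    refine (integrable_indicator_iff measurableSet_Icc).2 (Continuous.integrableOn_Icc ?_)
    exact continuous_ofReal.comp smoothTransition.continuous
  have kI : ∀ x, ofReal σ * (C * kerI 1 (σ * x)) = C * kerI σ x := fun x => by
    rw [mul_left_comm, ofReal_mul_kerI hσ]
  have kB : ∀ x, ofReal σ * (C * kerB 1 (σ * x)) = C * kerB σ x := fun x => by
    rw [mul_left_comm, ofReal_mul_kerB hσ]
  have piece : ∀ l : ℕ, l < N → ∃ V : Fin 3 → ℝ³ → ℝ≥0∞,
      (∀ i, Measurable (V i) ∧ xn η (V i) ≤ 3 * fkNorm η (k i) (g i)) ∧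
      ∀ m : ℝ⁴ → ℂ, IsMultiplier m → Integrable (fun t => stepBump ((t - (α + l * σ)) / σ) *
          triLoc⟦m, η, k, U⟧ t) ∧
        ‖∫ t, stepBump ((t - (α + l * σ)) / σ) * triLoc⟦m, η, k, U⟧ t‖ₑ ≤
          tform (fun x => C * kerI σ x) (fun z => ‖m z‖ₑ) (V 0) (V 1) (V 2) := by
    intro l hl
    have := exists_piece η hg hfk hgU mB iB (a := α + l * σ) (b := α + l * σ + σ) hσ
      (fun t ht => ?_) (κ := fun x => C * kerI 1 x) (by fun_prop) cI
    · simpa only [kI] using this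
    · have h1 := stepBump_support ht
      have h2 : 0 ≤ t - (α + l * σ) := by
        have := mul_nonneg h1.1 hσ.le; rwa [div_mul_cancel₀ _ hσ.ne'] at this
      have h3 : t - (α + l * σ) ≤ 2 * σ := by
        have := mul_le_mul_of_nonneg_right h1.2 hσ.le; rwa [div_mul_cancel₀ _ hσ.ne'] at this
      have hl' : (l : ℝ) + 1 ≤ N := by exact_mod_cast hl
      have hl0 : 0 ≤ (l : ℝ) * σ := by positivity
      refine ⟨⟨by linarith, ?_⟩, hclose t _ (abs_le.2 ⟨by linarith, by linarith⟩)⟩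
      have := mul_le_mul_of_nonneg_right hl' hσ.le
      have e1 : σ * (N + 1) = β - α := hσN
      nlinarith
  have pieceL := exists_piece η hg hfk hgU mL iL (a := α) (b := α) hσ (fun t ht => by
      have h1 := stepLeft_support ht
      have h2 : 0 ≤ t - α := by
        have := mul_nonneg h1.1 hσ.le; rwa [div_mul_cancel₀ _ hσ.ne'] at this
      have h3 : t - α ≤ 1 * σ := by
        have := mul_le_mul_of_nonneg_right h1.2 hσ.le; rwa [div_mul_cancel₀ _ hσ.ne'] at this
      have e1 : σ * (N + 1) = β - α := hσN
      have e2 : 0 ≤ σ * N := by positivity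
      exact ⟨⟨by linarith, by linarith⟩, hclose t _ (abs_le.2 ⟨by linarith, by linarith⟩)⟩)
    (κ := fun x => C * kerB 1 x) (by fun_prop) cL
  have pieceR := exists_piece η hg hfk hgU mR iR (a := α + N * σ) (b := α + N * σ) hσ
    (fun t ht => by
      have h1 := stepRight_support ht
      have h2 : 0 ≤ t - (α + N * σ) := by
        have := mul_nonneg h1.1 hσ.le; rwa [div_mul_cancel₀ _ hσ.ne'] at this
      have h3 : t - (α + N * σ) ≤ 1 * σ := by
        have := mul_le_mul_of_nonneg_right h1.2 hσ.le; rwa [div_mul_cancel₀ _ hσ.ne'] at this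
      have e1 : σ * (N + 1) = β - α := hσN
      have e2 : 0 ≤ (N : ℝ) * σ := by positivity
      exact ⟨⟨by linarith, by linarith⟩, hclose t _ (abs_le.2 ⟨by linarith, by linarith⟩)⟩)
    (κ := fun x => C * kerB 1 x) (by fun_prop) cR
  simp only [kB] at pieceL pieceR
  obtain ⟨W, hW, hWm⟩ := pieceL
  obtain ⟨W', hW', hWm'⟩ := pieceR
  choose! V hV hVm using piece
  refine ⟨σ, N, fun l => if l < N then V l else W, W, W', hσ, hσn, by omega, fun l => ?_, hW, hW',
    fun m hm => ?_⟩
  · by_cases hl : l < N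
    · simpa only [if_pos hl] using hV l hl
    · simpa only [if_neg hl] using hW
  obtain ⟨I, hI⟩ : ∃ I : ℝ → ℂ, ∀ t, I t = triLoc⟦m, η, k, U⟧ t := ⟨_, fun _ => rfl⟩
  have hIe : triLoc⟦m, η, k, U⟧ = I := by funext t; rw [hI]
  have hL' := hWm m hm
  have hR' := hWm' m hm
  have hV' := fun l hl => hVm l hl m hm
  simp only [hIe] at hL' hR' hV' ⊢
  have hdec : (Icc α β).indicator I = fun t => stepLeft ((t - α) / σ) * I t +
      (∑ l ∈ Finset.range N, stepBump ((t - (α + l * σ)) / σ) * I t) +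
      stepRight ((t - (α + N * σ)) / σ) * I t := by
    funext t
    have h1 := stepLeft_add_sum_add_stepRight N ((t - α) / σ)
    have e1 : ∀ l : ℕ, (t - (α + l * σ)) / σ = (t - α) / σ - l := fun l => by field_simp; ring
    simp only [e1, ← Finset.sum_mul, ← add_mul, h1]
    have e2 : (t - α) / σ ∈ Icc (0 : ℝ) (N + 1) ↔ t ∈ Icc α β := by
      rw [mem_Icc, mem_Icc, le_div_iff₀ hσ, div_le_iff₀ hσ, mul_comm (N + 1 : ℝ) σ, hσN, zero_mul, hL]
      constructor <;> intro h <;> constructor <;> linarith [h.1, h.2]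
    by_cases ht : t ∈ Icc α β
    · rw [indicator_of_mem ht, indicator_of_mem (e2.2 ht)]; simp
    · rw [indicator_of_notMem ht, indicator_of_notMem fun h => ht (e2.1 h), zero_mul]
  have iS : Integrable fun t => ∑ l ∈ Finset.range N, stepBump ((t - (α + l * σ)) / σ) * I t :=
    integrable_finsetSum _ fun l hl => (hV' l (Finset.mem_range.1 hl)).1
  have hint : Integrable ((Icc α β).indicator I) := by
    rw [hdec]
    exact (hL'.1.add iS).add hR'.1
  refine ⟨(integrable_indicator_iff measurableSet_Icc).1 hint, ?_⟩
  have hsum : ∫ t in Icc α β, I t = (∫ t, stepLeft ((t - α) / σ) * I t) +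
      (∑ l ∈ Finset.range N, ∫ t, stepBump ((t - (α + l * σ)) / σ) * I t) +
      ∫ t, stepRight ((t - (α + N * σ)) / σ) * I t := by
    rw [← integral_indicator measurableSet_Icc, hdec,
      ← integral_finsetSum _ fun l hl => (hV' l (Finset.mem_range.1 hl)).1,
      ← integral_add hL'.1 iS]
    exact integral_add (hL'.1.add iS) hR'.1
  rw [hsum]
  have hmm : Measurable fun z => ‖m z‖ₑ := by have := hm.measurable; fun_prop
  refine (enorm_add_le _ _).trans ?_
  rw [mul_add, mul_add]
  refine add_le_add ((enorm_add_le _ _).trans (add_le_add ?_ ?_)) ?_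
  · exact hL'.2.trans (tform_const_kernel _ (by fun_prop) hmm (hW 0).1 (hW 1).1 (hW 2).1).le
  · refine (enorm_sum_le _ _).trans ?_
    rw [Finset.mul_sum]
    refine Finset.sum_le_sum fun l hl => ?_
    have hl' := Finset.mem_range.1 hl
    simp only [if_pos hl']
    refine (hV' l hl').2.trans (tform_const_kernel _ (by fun_prop) hmm (hV l hl' 0).1
      (hV l hl' 1).1 (hV l hl' 2).1).le
  · exact hR'.2.trans (tform_const_kernel _ (by fun_prop) hmm (hW' 0).1 (hW' 1).1 (hW' 2).1).le

lemma tform_mono_of_integrand {κ : ℝ → ℝ≥0∞} {M M' : ℝ⁴ → ℝ≥0∞} {V₁ V₂ V₃ V₁' V₂' V₃' : ℝ³ → ℝ≥0∞}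
    (h : ∀ a b c p q, M (p, q) * (V₁ (a, p) * V₂ (b, q) * V₃ (c, -(p + q))) ≤
      M' (p, q) * (V₁' (a, p) * V₂' (b, q) * V₃' (c, -(p + q)))) :
    tform κ M V₁ V₂ V₃ ≤ tform κ M' V₁' V₂' V₃' := by
  unfold tform
  refine lintegral_mono fun z => lintegral_mono fun t => ?_
  simp only [← mul_assoc]
  refine mul_le_mul' ?_ le_rfl
  have := h t.1 t.2.1 t.2.2 z.1 z.2
  simpa only [← mul_assoc] using this

lemma lintegral_const_mul_add_add {α : Type*} [MeasurableSpace α] {m : Measure α}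
    {f g h : α → ℝ≥0∞} (c : ℝ≥0∞) (hf : Measurable f) (hg : Measurable g) (hh : Measurable h) :
    ∫⁻ x, c * (f x + g x + h x) ∂m = c * (∫⁻ x, f x ∂m + ∫⁻ x, g x ∂m + ∫⁻ x, h x ∂m) := by
  rw [lintegral_const_mul _ (by fun_prop), lintegral_add_left (by fun_prop), lintegral_add_left hf]

lemma tform_add_const_mul {κ : ℝ → ℝ≥0∞} {M M' M'' : ℝ⁴ → ℝ≥0∞}
    {V₁ V₂ V₃ : ℝ³ → ℝ≥0∞} (c : ℝ≥0∞) (hκ : Measurable κ) (hM : Measurable M)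
    (hM' : Measurable M') (hM'' : Measurable M'') (h1 : Measurable V₁) (h2 : Measurable V₂)
    (h3 : Measurable V₃) :
    tform κ (fun z => c * (M z + M' z + M'' z)) V₁ V₂ V₃ =
      c * (tform κ M V₁ V₂ V₃ + tform κ M' V₁ V₂ V₃ + tform κ M'' V₁ V₂ V₃) := by
  have e := measurable_tform hκ hM h1 h2 h3
  have e' := measurable_tform hκ hM' h1 h2 h3
  have e'' := measurable_tform hκ hM'' h1 h2 h3
  have e3 := measurable_tform hκ
    (by fun_prop : Measurable fun z => c * (M z + M' z + M'' z)) h1 h2 h3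
  unfold tform
  rw [← lintegral_prod₂ e, ← lintegral_prod₂ e', ← lintegral_prod₂ e'',
    ← lintegral_prod₂ e3, ← lintegral_const_mul_add_add c e e' e'']
  refine lintegral_congr fun x => ?_
  ring

/-- The loss in a frequency interaction in which the frequencies of the last two factors are
comparable to `2 ^ n`. -/
def lowWeight (n a b c : ℕ) : ℝ≥0∞ := if n ≤ b + 2 ∧ n ≤ c + 2 then ofReal (√(2 ^ a)) else 0

/-- The multiplier `|ξ₁|` restricted to the frequencies with `|ξ₂|` and `|ξ₃|` comparable
to `2 ^ n`. -/
def lowMult (n a b c : ℕ) (x y z : ℝ) : ℝ≥0∞ :=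
  {x : ℝ | |x| ≤ 8 / 5 * 2 ^ a}.indicator (fun x => ofReal |x|) x *
  {x : ℝ | 5 / 16 * 2 ^ n ≤ |x| ∧ |x| ≤ 8 / 5 * 2 ^ b}.indicator 1 y *
  {x : ℝ | 5 / 16 * 2 ^ n ≤ |x| ∧ |x| ≤ 8 / 5 * 2 ^ c}.indicator 1 z

@[fun_prop]
lemma measurable_lowMult (n a b c : ℕ) :
    Measurable fun x : ℝ³ => lowMult n a b c x.1 x.2.1 x.2.2 := by
  have hs : ∀ b : ℕ, MeasurableSet {x : ℝ | 5 / 16 * 2 ^ n ≤ |x| ∧ |x| ≤ 8 / 5 * 2 ^ b} :=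
    fun b => (by fun_prop : Measurable fun x : ℝ => |x|) measurableSet_Icc
  have h1 : Measurable ({x : ℝ | |x| ≤ 8 / 5 * 2 ^ a}.indicator fun x => ofReal |x|) :=
    Measurable.indicator (by fun_prop) (measurableSet_le (by fun_prop) (by fun_prop))
  have h2 : ∀ b : ℕ, Measurable ({x : ℝ | 5 / 16 * 2 ^ n ≤ |x| ∧ |x| ≤ 8 / 5 * 2 ^ b}.indicator
    (1 : ℝ → ℝ≥0∞)) := fun b => measurable_one.indicator (hs b)
  have := h2 b; have := h2 c
  unfold lowMult
  fun_prop

lemma lowMult_eq_zero {n a b c : ℕ} (h : ¬(n ≤ b + 2 ∧ n ≤ c + 2)) (x y z : ℝ) :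
    lowMult n a b c x y z = 0 := by
  have key : ∀ b : ℕ, ¬ n ≤ b + 2 → ∀ y : ℝ,
      {x : ℝ | 5 / 16 * 2 ^ n ≤ |x| ∧ |x| ≤ 8 / 5 * 2 ^ b}.indicator (1 : ℝ → ℝ≥0∞) y = 0 := by
    intro b hb y
    refine indicator_of_notMem (fun hy => ?_) _
    have h1 : (5 / 16 : ℝ) * 2 ^ n ≤ 8 / 5 * 2 ^ b := hy.1.trans hy.2
    have h2 : (2 : ℝ) ^ (b + 3) ≤ 2 ^ n := pow_le_pow_right₀ (by norm_num) (by omega)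
    rw [pow_add] at h2
    have h3 : (0 : ℝ) < 2 ^ b := by positivity
    linarith
  unfold lowMult
  rw [not_and_or] at h
  rcases h with h | h
  · rw [key b h, mul_zero, zero_mul]
  · rw [key c h, mul_zero]

/-- Low frequency multiplied estimates, at the boundary and in the interior. -/
lemma tform_lowMult_le (η : Cutoff) {σ : ℝ} {n a b c : ℕ} (hσ : 0 < σ) (hσn : σ ≤ (2 ^ n)⁻¹)
    (ha : a ≤ n) (hb : b ≤ n) (hc : c ≤ n) {V₁ V₂ V₃ : ℝ³ → ℝ≥0∞}
    (h1 : Measurable V₁) (h2 : Measurable V₂) (h3 : Measurable V₃) :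
    tform (kerB σ) (fun z => lowMult n a b c z.1.1 z.2.1 (-(z.1 + z.2)).1) V₁ V₂ V₃ ≤
      300000 * lowWeight n a b c * (xn η V₁ * xn η V₂ * xn η V₃) ∧
    2 ^ n * tform (kerI σ) (fun z => lowMult n a b c z.1.1 z.2.1 (-(z.1 + z.2)).1) V₁ V₂ V₃ ≤
      300000 * lowWeight n a b c * (xn η V₁ * xn η V₂ * xn η V₃) := by
  by_cases hbc : n ≤ b + 2 ∧ n ≤ c + 2
  swap
  · simp only [lowMult_eq_zero hbc]
    simp [tform]
  rw [lowWeight, if_pos hbc]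
  set A : Set ℝ³ := {x | |x.2.1| ≤ 8 / 5 * 2 ^ a} with hA
  set S : Set ℝ³ := {x | 5 / 16 * 2 ^ n ≤ |x.2.1| ∧ |x.2.1| ≤ 32 * (5 / 16 * 2 ^ n)} with hS
  have mA : MeasurableSet A := measurableSet_le (by fun_prop) (by fun_prop)
  have mS : MeasurableSet S := (by fun_prop : Measurable fun x : ℝ³ => |x.2.1|) measurableSet_Icc
  have hpow : ∀ b, b ≤ n → (8 / 5 : ℝ) * 2 ^ b ≤ 32 * (5 / 16 * 2 ^ n) := fun b hb => by
    have h2 : (2 : ℝ) ^ b ≤ 2 ^ n := pow_le_pow_right₀ (by norm_num) hb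
    have h3 : (0 : ℝ) < 2 ^ b := by positivity
    linarith
  have m1 := h1.indicator mA
  have m2 := h2.indicator mS
  have m3 := h3.indicator mS
  have hle : ∀ κ : ℝ → ℝ≥0∞,
      tform κ (fun z => lowMult n a b c z.1.1 z.2.1 (-(z.1 + z.2)).1) V₁ V₂ V₃ ≤
      tform κ (fun z => ofReal |z.1.1|) (A.indicator V₁) (S.indicator V₂) (S.indicator V₃) := by
    intro κ
    refine tform_mono_of_integrand fun t₁ t₂ t₃ p q => ?_
    by_cases hx : |p.1| ≤ 8 / 5 * 2 ^ a
    swap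
    · have : lowMult n a b c p.1 q.1 (-(p + q)).1 = 0 := by
        unfold lowMult; rw [indicator_of_notMem (by exact hx), zero_mul, zero_mul]
      simp only [this, zero_mul]; exact zero_le
    by_cases hy : 5 / 16 * 2 ^ n ≤ |q.1| ∧ |q.1| ≤ 8 / 5 * 2 ^ b
    swap
    · have : lowMult n a b c p.1 q.1 (-(p + q)).1 = 0 := by
        unfold lowMult
        rw [indicator_of_notMem (s := {x : ℝ | 5 / 16 * 2 ^ n ≤ |x| ∧ |x| ≤ 8 / 5 * 2 ^ b})
          (by exact hy), mul_zero, zero_mul]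
      simp only [this, zero_mul]; exact zero_le
    by_cases hz : 5 / 16 * 2 ^ n ≤ |(-(p + q)).1| ∧ |(-(p + q)).1| ≤ 8 / 5 * 2 ^ c
    swap
    · have : lowMult n a b c p.1 q.1 (-(p + q)).1 = 0 := by
        unfold lowMult
        rw [indicator_of_notMem (s := {x : ℝ | 5 / 16 * 2 ^ n ≤ |x| ∧ |x| ≤ 8 / 5 * 2 ^ c})
          (by exact hz), mul_zero]
      simp only [this, zero_mul]; exact zero_le
    rw [indicator_of_mem (s := A) (by exact hx),
      indicator_of_mem (s := S) (f := V₂) (by exact ⟨hy.1, hy.2.trans (hpow b hb)⟩),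
      indicator_of_mem (s := S) (f := V₃) (by exact ⟨hz.1, hz.2.trans (hpow c hc)⟩)]
    refine mul_le_mul' ?_ le_rfl
    unfold lowMult
    rw [indicator_of_mem (s := {x : ℝ | |x| ≤ 8 / 5 * 2 ^ a}) (by exact hx),
      indicator_of_mem (s := {x : ℝ | 5 / 16 * 2 ^ n ≤ |x| ∧ |x| ≤ 8 / 5 * 2 ^ b}) (by exact hy),
      indicator_of_mem (s := {x : ℝ | 5 / 16 * 2 ^ n ≤ |x| ∧ |x| ≤ 8 / 5 * 2 ^ c}) (by exact hz)]
    simp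
  have hx1 : xn η (A.indicator V₁) ≤ xn η V₁ := xn_mono η fun x => indicator_le_self _ _ _
  have hx2 : xn η (S.indicator V₂) ≤ xn η V₂ := xn_mono η fun x => indicator_le_self _ _ _
  have hx3 : xn η (S.indicator V₃) ≤ xn η V₃ := xn_mono η fun x => indicator_le_self _ _ _
  have hxn : xn η (A.indicator V₁) * xn η (S.indicator V₂) * xn η (S.indicator V₃) ≤
    xn η V₁ * xn η V₂ * xn η V₃ := by gcongr
  have s1 : ∀ t p, A.indicator V₁ (t, p) ≠ 0 → |p.1| ≤ 8 / 5 * 2 ^ a := fun t p h =>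
    mem_of_indicator_ne_zero (s := A) h
  have s2 : ∀ V : ℝ³ → ℝ≥0∞, ∀ t p, S.indicator V (t, p) ≠ 0 →
    5 / 16 * 2 ^ n ≤ |p.1| ∧ |p.1| ≤ 32 * (5 / 16 * 2 ^ n) := fun V t p h =>
    mem_of_indicator_ne_zero (s := S) h
  have hsq : √(2 ^ a : ℝ) * √(2 ^ a) = 2 ^ a := Real.mul_self_sqrt (by positivity)
  have h300 : (300000 : ℝ≥0∞) * ofReal √(2 ^ a) = ofReal (300000 * √(2 ^ a)) := by
    rw [ofReal_mul (by norm_num)]; norm_num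
  rw [h300]
  have mκB : Measurable (kerB σ) := by fun_prop
  constructor
  · refine (hle _).trans ?_
    have hmono : tform (kerB σ) (fun z => ofReal |z.1.1|) (A.indicator V₁) (S.indicator V₂)
        (S.indicator V₃) ≤ tform (kerB σ) (fun _ => ofReal (8 / 5 * 2 ^ a))
        (A.indicator V₁) (S.indicator V₂) (S.indicator V₃) :=
      tform_mono (fun _ => le_rfl) (fun _ => le_rfl) (fun _ => le_rfl) (fun _ => le_rfl)
        fun t _ _ p q h _ _ => ofReal_le_ofReal (s1 t p h)
    refine hmono.trans ?_
    rw [tform_const _ mκB m1 m2 m3]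
    refine (mul_le_mul' le_rfl (tform_kerB_le η hσ (by positivity) m1 m2 m3 (s2 V₃))).trans ?_
    rw [← mul_assoc, ← ofReal_mul (by positivity)]
    refine mul_le_mul' (ofReal_le_ofReal ?_) hxn
    have h4 : √σ * √(2 ^ a) ≤ 1 := by
      rw [← sqrt_mul hσ.le, Real.sqrt_le_one]
      have : (2 : ℝ) ^ a ≤ 2 ^ n := pow_le_pow_right₀ (by norm_num) ha
      calc σ * 2 ^ a ≤ (2 ^ n)⁻¹ * 2 ^ n := by gcongr
        _ = 1 := inv_mul_cancel₀ (by positivity)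
    have h5 : (0 : ℝ) ≤ √(2 ^ a) := sqrt_nonneg _
    have h6 : 8 / 5 * 2 ^ a * (400 * √σ) = 640 * (√σ * √(2 ^ a)) * √(2 ^ a) := by
      linear_combination (-640 * √σ) * hsq
    rw [h6]
    have h7 := mul_le_mul_of_nonneg_right h4 h5
    linarith
  · refine (mul_le_mul' le_rfl ((hle _).trans (tform_kerI_low_le η hσ
      (by positivity : (0 : ℝ) < 8 / 5 * 2 ^ a) (by positivity : (0 : ℝ) < 5 / 16 * 2 ^ n) m1 m2 m3
      (fun _ => le_rfl) s1 (s2 V₂) (s2 V₃)))).trans ?_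
    rw [← mul_assoc]
    refine mul_le_mul' ?_ hxn
    rw [show (2 : ℝ≥0∞) ^ n = ofReal (2 ^ n) by
      rw [ofReal_pow (by norm_num)]; norm_num, ← ofReal_mul (by positivity)]
    refine ofReal_le_ofReal ?_
    rw [sqrt_mul (by norm_num)]
    have h6 : √(8 / 5 : ℝ) ≤ 1.3 := Real.sqrt_le_iff.2 ⟨by norm_num, by norm_num⟩
    have h5 : (0 : ℝ) ≤ √(2 ^ a) := sqrt_nonneg _
    calc (2 : ℝ) ^ n * (70000 * (√(8 / 5) * √(2 ^ a) / (5 / 16 * 2 ^ n)))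
        = 224000 * (√(8 / 5) * √(2 ^ a)) := by field_simp; norm_num
      _ ≤ 224000 * (1.3 * √(2 ^ a)) := by gcongr
      _ ≤ 300000 * √(2 ^ a) := by linarith

/-- The total loss of a frequency interaction. -/
def tripleWeight (n a b c : ℕ) : ℝ≥0∞ := lowWeight n a b c + lowWeight n b a c + lowWeight n c b a

lemma le_lowMult {n a b c : ℕ} (ha : a ≤ n) (hb : b ≤ n) (hc : c ≤ n) {x y z : ℝ}
    (h : x + y + z = 0) (hx : |x| ≤ 8 / 5 * 2 ^ a) (hy : |y| ≤ 8 / 5 * 2 ^ b)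
    (hz : |z| ≤ 8 / 5 * 2 ^ c) (hn : 5 / 8 * 2 ^ n ≤ |x| ∨ 5 / 8 * 2 ^ n ≤ |y| ∨ 5 / 8 * 2 ^ n ≤ |z|)
    {A : ℝ≥0∞} {D : ℝ≥0∞} (h1 : A ≤ D * ofReal |x|) (h2 : A ≤ D * ofReal |y|)
    (h3 : A ≤ D * ofReal |z|) :
    A ≤ D * (lowMult n a b c x y z + lowMult n b a c y x z + lowMult n c b a z y x) := by
  have hxz : |x| ≤ |y| + |z| := by rw [show x = -(y + z) by linarith, abs_neg]; exact abs_add_le _ _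
  have hyz : |y| ≤ |x| + |z| := by rw [show y = -(x + z) by linarith, abs_neg]; exact abs_add_le _ _
  have hzz : |z| ≤ |x| + |y| := by rw [show z = -(x + y) by linarith, abs_neg]; exact abs_add_le _ _
  have key : ∀ {a b c : ℕ} {x y z : ℝ}, |x| ≤ 8 / 5 * 2 ^ a → |y| ≤ 8 / 5 * 2 ^ b →
      |z| ≤ 8 / 5 * 2 ^ c → 5 / 16 * 2 ^ n ≤ |y| → 5 / 16 * 2 ^ n ≤ |z| →
      ofReal |x| ≤ lowMult n a b c x y z := by
    intro a b c x y z hx hy hz hy' hz'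
    unfold lowMult
    rw [indicator_of_mem (s := {x : ℝ | |x| ≤ 8 / 5 * 2 ^ a}) (by exact hx),
      indicator_of_mem (s := {x : ℝ | 5 / 16 * 2 ^ n ≤ |x| ∧ |x| ≤ 8 / 5 * 2 ^ b})
        (by exact ⟨hy', hy⟩),
      indicator_of_mem (s := {x : ℝ | 5 / 16 * 2 ^ n ≤ |x| ∧ |x| ≤ 8 / 5 * 2 ^ c})
        (by exact ⟨hz', hz⟩)]
    simp
  have hmax : ∀ {x y z : ℝ}, |x| ≤ |y| → |x| ≤ |z| → |y| ≤ |x| + |z| → |z| ≤ |x| + |y| →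
      (5 / 8 * 2 ^ n ≤ |x| ∨ 5 / 8 * 2 ^ n ≤ |y| ∨ 5 / 8 * 2 ^ n ≤ |z|) →
      5 / 16 * 2 ^ n ≤ |y| ∧ 5 / 16 * 2 ^ n ≤ |z| := by
    intro x y z h1 h2 h3 h4 h5
    have : (0 : ℝ) < 2 ^ n := by positivity
    rcases h5 with h5 | h5 | h5 <;> constructor <;> linarith
  rcases le_total |x| |y| with hxy | hxy
  · rcases le_total |x| |z| with hxz' | hxz'
    · obtain ⟨e1, e2⟩ := hmax hxy hxz' hyz hzz hn
      refine h1.trans (mul_le_mul' le_rfl ?_)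
      exact ((key hx hy hz e1 e2).trans le_self_add).trans le_self_add
    · obtain ⟨e1, e2⟩ := hmax (x := z) (y := y) (z := x) (hxz'.trans hxy) hxz' (by linarith)
        (by linarith) (by tauto)
      refine h3.trans (mul_le_mul' le_rfl ?_)
      exact (key hz hy hx e1 e2).trans le_add_self
  · rcases le_total |y| |z| with hyz' | hyz'
    · obtain ⟨e1, e2⟩ := hmax (x := y) (y := x) (z := z) hxy hyz' (by linarith) (by linarith)
        (by tauto)
      refine h2.trans (mul_le_mul' le_rfl ?_)
      exact ((key hy hx hz e1 e2).trans le_add_self).trans le_self_add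
    · obtain ⟨e1, e2⟩ := hmax (x := z) (y := y) (z := x) hyz' (hyz'.trans hxy) (by linarith)
        (by linarith) (by tauto)
      refine h3.trans (mul_le_mul' le_rfl ?_)
      exact (key hz hy hx e1 e2).trans le_add_self

/-- Estimates for multipliers dominated by the smallest frequency. -/
lemma tform_le_tripleWeight (η : Cutoff) {σ : ℝ} {n a b c : ℕ} (hσ : 0 < σ)
    (hσn : σ ≤ (2 ^ n)⁻¹) (ha : a ≤ n) (hb : b ≤ n) (hc : c ≤ n)
    {V₁ V₂ V₃ : ℝ³ → ℝ≥0∞} (h1 : Measurable V₁) (h2 : Measurable V₂) (h3 : Measurable V₃)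
    {M : ℝ⁴ → ℝ≥0∞} {D : ℝ≥0∞}
    (hM : ∀ z, M z ≤ D * (lowMult n a b c z.1.1 z.2.1 (-(z.1 + z.2)).1 +
      lowMult n b a c z.2.1 z.1.1 (-(z.1 + z.2)).1 +
      lowMult n c b a (-(z.1 + z.2)).1 z.2.1 z.1.1)) :
    tform (kerB σ) M V₁ V₂ V₃ ≤ 300000 * D * tripleWeight n a b c * (xn η V₁ * xn η V₂ * xn η V₃) ∧
    2 ^ n * tform (kerI σ) M V₁ V₂ V₃ ≤
      300000 * D * tripleWeight n a b c * (xn η V₁ * xn η V₂ * xn η V₃) := by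
  have hmB : Measurable (kerB σ) := by fun_prop
  have hmI : Measurable (kerI σ) := by fun_prop
  have m1 : Measurable fun z : ℝ⁴ =>
      lowMult n a b c z.1.1 z.2.1 (-(z.1 + z.2)).1 :=
    (measurable_lowMult n a b c).comp
      (by fun_prop : Measurable fun z : ℝ⁴ => (z.1.1, (z.2.1, (-(z.1 + z.2)).1)))
  have m2 : Measurable fun z : ℝ⁴ =>
      lowMult n b a c z.2.1 z.1.1 (-(z.1 + z.2)).1 :=
    (measurable_lowMult n b a c).comp
      (by fun_prop : Measurable fun z : ℝ⁴ => (z.2.1, (z.1.1, (-(z.1 + z.2)).1)))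
  have m3 : Measurable fun z : ℝ⁴ =>
      lowMult n c b a (-(z.1 + z.2)).1 z.2.1 z.1.1 :=
    (measurable_lowMult n c b a).comp
      (by fun_prop : Measurable fun z : ℝ⁴ => ((-(z.1 + z.2)).1, (z.2.1, z.1.1)))
  have split : ∀ κ : ℝ → ℝ≥0∞, Measurable κ → tform κ M V₁ V₂ V₃ ≤ D *
      (tform κ (fun z => lowMult n a b c z.1.1 z.2.1 (-(z.1 + z.2)).1) V₁ V₂ V₃ +
       tform κ (fun z => lowMult n b a c z.1.1 z.2.1 (-(z.1 + z.2)).1) V₂ V₁ V₃ +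
       tform κ (fun z => lowMult n c b a z.1.1 z.2.1 (-(z.1 + z.2)).1) V₃ V₂ V₁) := by
    intro κ hκ
    refine (tform_mono (M' := fun z => D * (lowMult n a b c z.1.1 z.2.1 (-(z.1 + z.2)).1 +
      lowMult n b a c z.2.1 z.1.1 (-(z.1 + z.2)).1 +
      lowMult n c b a (-(z.1 + z.2)).1 z.2.1 z.1.1)) (fun _ => le_rfl) (fun _ => le_rfl) (fun _ => le_rfl) (fun _ => le_rfl)
      fun _ _ _ p q _ _ _ => hM (p, q)).trans ?_
    rw [tform_add_const_mul D hκ m1 m2 m3 h1 h2 h3, tform_swap hκ m2 h1 h2 h3,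
      tform_rot hκ m3 h1 h2 h3]
    refine le_of_eq ?_
    simp only [Prod.fst_swap, Prod.snd_swap, neg_add_rev, neg_neg]
    congr! 7 <;> ext z <;> simp <;> ring_nf
  have b1 := tform_lowMult_le η hσ hσn ha hb hc h1 h2 h3
  have b2 := tform_lowMult_le η hσ hσn hb ha hc h2 h1 h3
  have b3 := tform_lowMult_le η hσ hσn hc hb ha h3 h2 h1
  constructor
  · refine (split _ hmB).trans ((mul_le_mul' le_rfl
      (add_le_add (add_le_add b1.1 b2.1) b3.1)).trans (le_of_eq ?_))
    unfold tripleWeight; ring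
  · refine (mul_le_mul' le_rfl (split _ hmI)).trans ?_
    rw [mul_left_comm, mul_add (2 ^ n), mul_add (2 ^ n)]
    refine (mul_le_mul' le_rfl (add_le_add (add_le_add b1.2 b2.2) b3.2)).trans (le_of_eq ?_)
    unfold tripleWeight; ring

lemma fourier_proj (η : Cutoff) (k : ℕ) (φ : L2) : ∀ᵐ ζ : Plane,
    (𝓕 (proj η k φ) : L2) ζ = (η.dyadic k (freqX ζ) : ℂ) * (𝓕 φ : L2) ζ := by
  have : (𝓕 (proj η k φ) : L2) = (memLp_symbol_smul (η.dyadicBCF k) (𝓕 φ)).toLp _ :=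
    FourierTransform.fourier_fourierInv_eq _
  rw [this]
  filter_upwards [(memLp_symbol_smul (η.dyadicBCF k) (𝓕 φ)).coeFn_toLp] with ζ hζ
  rw [hζ, ← real_smul]
  rfl

/-- `U` represents the Fourier transform of `u` on `[-T, T]` in angular frequencies. -/
def IsFourierRep (T : ℝ) (u : ℝ → L2) (U : ℝ³ → ℂ) : Prop :=
  ∀ t ∈ Icc (-T) T, ∀ᵐ p, (𝓕 (u t) : L2) (toPlane p) = U (t, p)

lemma le_mul_of_forall_lt {L c : ℝ≥0∞} (hc : c ≠ ⊤) {a : Fin 3 → ℝ≥0∞} (ha : ∀ i, a i ≠ ⊤)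
    (h : ∀ b : Fin 3 → ℝ≥0∞, (∀ i, b i ≠ ⊤) → (∀ i, a i < b i) → L ≤ c * (b 0 * b 1 * b 2)) :
    L ≤ c * (a 0 * a 1 * a 2) := by
  have hδ : Tendsto (fun n : ℕ => ((n : ℝ≥0∞) + 1)⁻¹) atTop (𝓝 0) := by
    have := ENNReal.tendsto_inv_nat_nhds_zero.comp (tendsto_add_atTop_nat 1)
    refine this.congr fun n => ?_
    simp
  have hb : ∀ i, Tendsto (fun n : ℕ => a i + ((n : ℝ≥0∞) + 1)⁻¹) atTop (𝓝 (a i)) := fun i => by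
    simpa using tendsto_const_nhds.add hδ
  have h2 := ENNReal.Tendsto.mul (ENNReal.Tendsto.mul (hb 0) (Or.inr (ha 1)) (hb 1)
    (Or.inr (ha 0))) (Or.inr (ha 2)) (hb 2) (Or.inr (mul_ne_top (ha 0) (ha 1)))
  refine ge_of_tendsto' (ENNReal.Tendsto.const_mul h2 (Or.inr hc)) fun n => ?_
  refine h (fun i => a i + ((n : ℝ≥0∞) + 1)⁻¹) (fun i => ?_) (fun i => ?_)
  · have := ha i
    have : ((n : ℝ≥0∞) + 1)⁻¹ ≠ ⊤ := ENNReal.inv_ne_top.2 (by positivity)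
    finiteness
  · exact ENNReal.lt_add_right (ha i) (ENNReal.inv_ne_zero.2 (by finiteness))

section pieces

variable {η : Cutoff} {C : ℝ≥0} {T α β : ℝ} {u : ℝ → L2} {U : ℝ³ → ℂ} {k : Fin 3 → ℕ} {n : ℕ}

/-- A decomposition of the time interval `[α, β]` into pieces of length comparable to `2 ^ (-n)`
on which the trilinear integral is controlled by the trilinear forms of profiles of norms at
most `3 * b i`. -/
def HasPieces (η : Cutoff) (C : ℝ≥0) (k : Fin 3 → ℕ) (n : ℕ) (U : ℝ³ → ℂ) (α β : ℝ)
    (b : Fin 3 → ℝ≥0∞) : Prop :=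
  ∃ (σ : ℝ) (N : ℕ) (V : ℕ → Fin 3 → ℝ³ → ℝ≥0∞) (W W' : Fin 3 → ℝ³ → ℝ≥0∞),
      0 < σ ∧ σ ≤ (2 ^ n)⁻¹ ∧ N ≤ 2 ^ n ∧
      (∀ l i, Measurable (V l i) ∧ xn η (V l i) ≤ 3 * b i) ∧
      (∀ i, Measurable (W i) ∧ xn η (W i) ≤ 3 * b i) ∧
      (∀ i, Measurable (W' i) ∧ xn η (W' i) ≤ 3 * b i) ∧
      ∀ m : ℝ⁴ → ℂ, IsMultiplier m → ‖∫ t in Icc α β, triLoc⟦m, η, k, U⟧ t‖ₑ ≤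
          C * (tform (kerB σ) (fun z => ‖m z‖ₑ) (W 0) (W 1) (W 2) +
            (∑ l ∈ Finset.range N, tform (kerI σ) (fun z => ‖m z‖ₑ) (V l 0) (V l 1) (V l 2)) +
            tform (kerB σ) (fun z => ‖m z‖ₑ) (W' 0) (W' 1) (W' 2))

lemma exists_hasPieces (η : Cutoff) : ∃ C : ℝ≥0, ∀ (k : Fin 3 → ℕ) (n : ℕ) (_ : ∀ i, k i ≤ n)
    (T : ℝ) (u : ℝ → L2) (U : ℝ³ → ℂ) (_ : IsFourierRep T u U)
    (α β : ℝ) (_ : α < β) (_ : β - α ≤ 1) (_ : Icc α β ⊆ Icc (-T) T)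
    (b : Fin 3 → ℝ≥0∞) (_ : ∀ i, fkNormOn η (k i) T (fun t => proj η (k i) (u t)) < b i),
    HasPieces η C k n U α β b := by
  obtain ⟨C, hC⟩ := exists_pieces η
  refine ⟨C, fun k n hkn T u U hU α β hαβ hβα hT b hb => ?_⟩
  have hg : ∀ i, ∃ g : ℝ → L2, Continuous g ∧ EqOn g (fun t => proj η (k i) (u t)) (Icc (-T) T) ∧
      fkNorm η (k i) g < b i := by
    intro i
    have := hb i
    simp only [fkNormOn, iInf_lt_iff] at this
    obtain ⟨g, h1, h2, h3⟩ := this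
    exact ⟨g, h1, h2, h3⟩
  choose g hgc hge hgb using hg
  obtain ⟨σ, N, V, W, W', h1, h2, h3, hV, hW, hW', hm⟩ := hC k n hkn g hgc
    (fun i => (hgb i).ne_top) U α β hαβ hβα (fun i t ht => by
      rw [hge i (hT ht)]
      filter_upwards [ae_toPlane (fourier_proj η (k i) (u t)), hU t (hT ht)] with p hp hp'
      rw [hp, hp', freqX_toPlane, locU])
  have hle : ∀ {x : ℝ≥0∞} {i}, x ≤ 3 * fkNorm η (k i) (g i) → x ≤ 3 * b i := fun h =>
    h.trans (mul_le_mul' le_rfl (hgb _).le)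
  exact ⟨σ, N, V, W, W', h1, h2, h3, fun l i => ⟨(hV l i).1, hle (hV l i).2⟩,
    fun i => ⟨(hW i).1, hle (hW i).2⟩, fun i => ⟨(hW' i).1, hle (hW' i).2⟩, fun m hm' => (hm m hm').2⟩

lemma prod_le_of_le {x b : Fin 3 → ℝ≥0∞} (h : ∀ i, x i ≤ 3 * b i) :
    x 0 * x 1 * x 2 ≤ 27 * (b 0 * b 1 * b 2) := by
  refine (mul_le_mul' (mul_le_mul' (h 0) (h 1)) (h 2)).trans (le_of_eq ?_)
  ring

lemma two_pow_eq_ofReal (n : ℕ) : (2 : ℝ≥0∞) ^ n = ofReal (2 ^ n) := by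
  rw [ofReal_pow (by norm_num)]; norm_num

lemma HasPieces.le_tripleWeight {b : Fin 3 → ℝ≥0∞} (h : HasPieces η C k n U α β b)
    (hkn : ∀ i, k i ≤ n) {m : ℝ⁴ → ℂ} (hm : IsMultiplier m) {D : ℝ≥0∞}
    (hmD : ∀ z, ‖m z‖ₑ ≤ D * (lowMult n (k 0) (k 1) (k 2) z.1.1 z.2.1 (-(z.1 + z.2)).1 +
      lowMult n (k 1) (k 0) (k 2) z.2.1 z.1.1 (-(z.1 + z.2)).1 +
      lowMult n (k 2) (k 1) (k 0) (-(z.1 + z.2)).1 z.2.1 z.1.1)) :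
    ‖∫ t in Icc α β, triLoc⟦m, η, k, U⟧ t‖ₑ ≤
      C * (24300000 * D * tripleWeight n (k 0) (k 1) (k 2)) * (b 0 * b 1 * b 2) := by
  obtain ⟨σ, N, V, W, W', hσ, hσn, hN, hV, hW, hW', h⟩ := h
  set Q := 300000 * D * tripleWeight n (k 0) (k 1) (k 2) * (27 * (b 0 * b 1 * b 2)) with hQ
  have est : ∀ V : Fin 3 → ℝ³ → ℝ≥0∞, (∀ i, Measurable (V i) ∧ xn η (V i) ≤ 3 * b i) →
      tform (kerB σ) (fun z => ‖m z‖ₑ) (V 0) (V 1) (V 2) ≤ Q ∧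
      2 ^ n * tform (kerI σ) (fun z => ‖m z‖ₑ) (V 0) (V 1) (V 2) ≤ Q := by
    intro V hV
    have h1 := tform_le_tripleWeight η hσ hσn (hkn 0) (hkn 1) (hkn 2) (hV 0).1 (hV 1).1 (hV 2).1 hmD
    have h2 := prod_le_of_le fun i => (hV i).2
    exact ⟨h1.1.trans (mul_le_mul' le_rfl h2), h1.2.trans (mul_le_mul' le_rfl h2)⟩
  refine (h m hm).trans ?_
  have hsum : ∑ l ∈ Finset.range N, tform (kerI σ) (fun z => ‖m z‖ₑ) (V l 0) (V l 1) (V l 2) ≤ Q := by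
    calc ∑ l ∈ Finset.range N, tform (kerI σ) (fun z => ‖m z‖ₑ) (V l 0) (V l 1) (V l 2)
        ≤ ∑ l ∈ Finset.range N, (2 ^ n)⁻¹ * Q := by
          refine Finset.sum_le_sum fun l _ => ?_
          have h0 : (2 : ℝ≥0∞) ^ n ≠ 0 := by positivity
          have h1 : (2 : ℝ≥0∞) ^ n ≠ ⊤ := by finiteness
          have := (est (V l) (hV l)).2
          rw [mul_comm] at this
          rw [mul_comm, ← div_eq_mul_inv, ENNReal.le_div_iff_mul_le (Or.inl h0) (Or.inl h1)]
          exact this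
      _ = N * ((2 ^ n)⁻¹ * Q) := by rw [Finset.sum_const, Finset.card_range, nsmul_eq_mul]
      _ ≤ 2 ^ n * ((2 ^ n)⁻¹ * Q) := by gcongr; exact_mod_cast hN
      _ = Q := by rw [← mul_assoc, ENNReal.mul_inv_cancel (by positivity) (by finiteness), one_mul]
  refine (mul_le_mul' le_rfl (add_le_add (add_le_add (est W hW).1 hsum) (est W' hW').1)).trans
    (le_of_eq ?_)
  rw [hQ]
  ring

lemma tform_kerB_shell_le (η : Cutoff) {σ K : ℝ} (hσ : 0 < σ) (hK : 0 < K)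
    {V₁ V₂ V₃ : ℝ³ → ℝ≥0∞} (h1 : Measurable V₁) (h2 : Measurable V₂) (h3 : Measurable V₃)
    {M : ℝ⁴ → ℝ≥0∞} {D : ℝ≥0∞} (hM : ∀ z, M z ≤ D)
    (hMK : ∀ z, M z ≠ 0 → K ≤ |(-(z.1 + z.2)).1| ∧ |(-(z.1 + z.2)).1| ≤ 32 * K) :
    tform (kerB σ) M V₁ V₂ V₃ ≤ D * ofReal (400 * √σ) * (xn η V₁ * xn η V₂ * xn η V₃) := by
  set S : Set ℝ³ := {x | K ≤ |x.2.1| ∧ |x.2.1| ≤ 32 * K} with hS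
  have mS : MeasurableSet S := (by fun_prop : Measurable fun x : ℝ³ => |x.2.1|) measurableSet_Icc
  have m3 := h3.indicator mS
  have hκ : Measurable (kerB σ) := by fun_prop
  have h : tform (kerB σ) M V₁ V₂ V₃ ≤ tform (kerB σ) (fun _ => D) V₁ V₂ (S.indicator V₃) := by
    refine tform_mono_of_integrand fun a b c p q => ?_
    by_cases hz : M (p, q) = 0
    · rw [hz, zero_mul]; exact zero_le
    · rw [indicator_of_mem (s := S) (by exact hMK _ hz)]
      exact mul_le_mul' (hM _) le_rfl
  refine h.trans ?_
  rw [tform_const _ hκ h1 h2 m3, mul_assoc]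
  refine mul_le_mul' le_rfl ((tform_kerB_le η hσ hK h1 h2 m3
    fun a p hp => mem_of_indicator_ne_zero (s := S) hp).trans (mul_le_mul' le_rfl ?_))
  exact mul_le_mul' le_rfl (xn_mono η fun x => indicator_le_self _ _ _)

lemma HasPieces.le_sqrt {b : Fin 3 → ℝ≥0∞} (h : HasPieces η C k n U α β b)
    {m : ℝ⁴ → ℂ} (hm : IsMultiplier m) {D : ℝ≥0∞} {K : ℝ} (hK : 0 < K)
    (hmD : ∀ z, ‖m z‖ₑ ≤ D)
    (hmK : ∀ z, m z ≠ 0 → K ≤ |(-(z.1 + z.2)).1| ∧ |(-(z.1 + z.2)).1| ≤ 32 * K) :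
    ‖∫ t in Icc α β, triLoc⟦m, η, k, U⟧ t‖ₑ ≤
      C * (43200 * D * ofReal √(2 ^ n)) * (b 0 * b 1 * b 2) := by
  obtain ⟨σ, N, V, W, W', hσ, hσn, hN, hV, hW, hW', h⟩ := h
  set Q := D * ofReal (400 * √σ) * (27 * (b 0 * b 1 * b 2)) with hQ
  have hσ1 : √σ ≤ √(2 ^ n) := by
    refine Real.sqrt_le_sqrt (hσn.trans ((inv_le_one_of_one_le₀ ?_).trans ?_)) <;>
    exact one_le_pow₀ (by norm_num)
  have hσ2 : 2 ^ n * √σ ≤ √(2 ^ n) := by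
    have h1 : √(2 ^ n : ℝ) * √(2 ^ n) = 2 ^ n := Real.mul_self_sqrt (by positivity)
    have h2 : √(2 ^ n : ℝ) * √σ ≤ 1 := by
      rw [← sqrt_mul (by positivity), Real.sqrt_le_one]
      calc (2 : ℝ) ^ n * σ ≤ 2 ^ n * (2 ^ n)⁻¹ := by gcongr
        _ = 1 := mul_inv_cancel₀ (by positivity)
    have h3 := mul_le_mul_of_nonneg_left h2 (sqrt_nonneg (2 ^ n))
    rw [← mul_assoc, h1, mul_one] at h3
    exact h3
  have est : ∀ V : Fin 3 → ℝ³ → ℝ≥0∞, (∀ i, Measurable (V i) ∧ xn η (V i) ≤ 3 * b i) →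
      tform (kerB σ) (fun z => ‖m z‖ₑ) (V 0) (V 1) (V 2) ≤ Q := by
    intro V hV
    refine (tform_kerB_shell_le η hσ hK (hV 0).1 (hV 1).1 (hV 2).1 hmD
      fun z hz => hmK z (by simpa using hz)).trans ?_
    exact mul_le_mul' le_rfl (prod_le_of_le fun i => (hV i).2)
  refine (h m hm).trans ?_
  have hmm : Measurable fun z => ‖m z‖ₑ := by have := hm.measurable; fun_prop
  have hκ : Measurable (kerB σ) := by fun_prop
  have hsum : ∑ l ∈ Finset.range N, tform (kerI σ) (fun z => ‖m z‖ₑ) (V l 0) (V l 1) (V l 2) ≤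
      2 ^ n * (2 * Q) := by
    calc ∑ l ∈ Finset.range N, tform (kerI σ) (fun z => ‖m z‖ₑ) (V l 0) (V l 1) (V l 2)
        ≤ ∑ l ∈ Finset.range N, 2 * Q := by
          refine Finset.sum_le_sum fun l _ => ?_
          refine (tform_mono (kerI_le_kerB hσ) (fun _ => le_rfl) (fun _ => le_rfl)
            (fun _ => le_rfl) fun _ _ _ p q _ _ _ => le_rfl).trans ?_
          rw [tform_const_kernel 2 hκ hmm (hV l 0).1 (hV l 1).1 (hV l 2).1]
          exact mul_le_mul' le_rfl (est _ (hV l))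
      _ = N * (2 * Q) := by rw [Finset.sum_const, Finset.card_range, nsmul_eq_mul]
      _ ≤ 2 ^ n * (2 * Q) := by gcongr; exact_mod_cast hN
  have hQ1 : Q ≤ 10800 * D * ofReal √(2 ^ n) * (b 0 * b 1 * b 2) := by
    calc Q ≤ D * ofReal (400 * √(2 ^ n)) * (27 * (b 0 * b 1 * b 2)) := by
          rw [hQ]; gcongr
      _ = _ := by rw [ofReal_mul (by norm_num), ofReal_ofNat]; ring
  have hQ2 : 2 ^ n * Q ≤ 10800 * D * ofReal √(2 ^ n) * (b 0 * b 1 * b 2) := by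
    calc 2 ^ n * Q = D * (ofReal (2 ^ n) * ofReal (400 * √σ)) *
          (27 * (b 0 * b 1 * b 2)) := by rw [hQ, two_pow_eq_ofReal]; ring
      _ ≤ D * ofReal (400 * √(2 ^ n)) * (27 * (b 0 * b 1 * b 2)) := by
          rw [← ofReal_mul (by positivity)]
          gcongr D * ofReal ?_ * _
          linarith
      _ = _ := by rw [ofReal_mul (by norm_num), ofReal_ofNat]; ring
  calc _ ≤ C * (Q + 2 ^ n * (2 * Q) + Q) := by
        gcongr
        · exact est W hW
        · exact est W' hW'
    _ = C * (Q + 2 * (2 ^ n * Q) + Q) := by ring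
    _ ≤ _ := by
        refine (mul_le_mul' le_rfl (add_le_add (add_le_add hQ1 (mul_le_mul' le_rfl hQ2))
          hQ1)).trans (le_of_eq ?_)
        ring

lemma tendsto_tform_zero {κ : ℝ → ℝ≥0∞} (hκ : Measurable κ)
    {M : ℕ → ℝ⁴ → ℝ≥0∞} (hM : ∀ j, Measurable (M j))
    {M' : ℝ⁴ → ℝ≥0∞} (hM' : Measurable M')
    {V₁ V₂ V₃ : ℝ³ → ℝ≥0∞} (h1 : Measurable V₁) (h2 : Measurable V₂)
    (h3 : Measurable V₃) (hMM : ∀ j z, M j z ≤ M' z) (hfin : tform κ M' V₁ V₂ V₃ ≠ ⊤)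
    (h0 : ∀ z, ∀ᶠ j in atTop, M j z = 0) :
    Tendsto (fun j => tform κ (M j) V₁ V₂ V₃) atTop (𝓝 0) := by
  have e : ∀ j, tform κ (M j) V₁ V₂ V₃ = _ := fun j =>
    (lintegral_prod₂ (measurable_tform hκ (hM j) h1 h2 h3)).symm
  have e' : tform κ M' V₁ V₂ V₃ = _ := (lintegral_prod₂ (measurable_tform hκ hM' h1 h2 h3)).symm
  rw [e'] at hfin
  simp only [e]
  rw [← lintegral_zero]
  refine tendsto_lintegral_of_dominated_convergence _ (fun j => measurable_tform hκ (hM j) h1 h2 h3)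
    (fun j => .of_forall fun x => mul_le_mul' (hMM j _) le_rfl) hfin
    (.of_forall fun x => ?_)
  refine tendsto_const_nhds.congr' ?_
  filter_upwards [h0 x.1] with j hj
  rw [hj, zero_mul]

lemma HasPieces.tendsto_zero {b : Fin 3 → ℝ≥0∞} (h : HasPieces η C k n U α β b)
    (hb : ∀ i, b i ≠ ⊤) {m : ℕ → ℝ⁴ → ℂ} (hm : ∀ j, IsMultiplier (m j)) {D : ℝ≥0∞}
    (hD : D ≠ ⊤) {K : ℝ} (hK : 0 < K) (hmD : ∀ j z, ‖m j z‖ₑ ≤ D)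
    (hmK : ∀ j z, m j z ≠ 0 → K ≤ |(-(z.1 + z.2)).1| ∧ |(-(z.1 + z.2)).1| ≤ 32 * K)
    (hm0 : ∀ z, ∀ᶠ j in atTop, m j z = 0) :
    Tendsto (fun j => ‖∫ t in Icc α β, triLoc⟦m j, η, k, U⟧ t‖ₑ) atTop (𝓝 0) := by
  obtain ⟨σ, N, V, W, W', hσ, hσn, hN, hV, hW, hW', h⟩ := h
  have hκ : Measurable (kerB σ) := by fun_prop
  have hκI : Measurable (kerI σ) := by fun_prop
  set S : Set ℝ⁴ := {z | K ≤ |(-(z.1 + z.2)).1| ∧ |(-(z.1 + z.2)).1| ≤ 32 * K} with hS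
  have mS : MeasurableSet S :=
    (by fun_prop : Measurable fun z : ℝ⁴ => |(-(z.1 + z.2)).1|) measurableSet_Icc
  have mM' : Measurable (S.indicator fun _ => D) := measurable_const.indicator mS
  have hmm : ∀ j, Measurable fun z => ‖m j z‖ₑ := fun j => by have := (hm j).measurable; fun_prop
  have hle : ∀ j z, ‖m j z‖ₑ ≤ S.indicator (fun _ => D) z := fun j z => by
    by_cases hz : m j z = 0
    · rw [hz, enorm_zero]; exact zero_le
    · rw [indicator_of_mem (s := S) (by exact hmK j z hz)]; exact hmD j z
  have fin : ∀ V : Fin 3 → ℝ³ → ℝ≥0∞, (∀ i, Measurable (V i) ∧ xn η (V i) ≤ 3 * b i) →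
      tform (kerB σ) (S.indicator fun _ => D) (V 0) (V 1) (V 2) ≠ ⊤ := by
    intro V hV
    refine ne_top_of_le_ne_top ?_ (tform_kerB_shell_le η hσ hK (hV 0).1 (hV 1).1 (hV 2).1
      (fun z => indicator_le_self S (fun _ => D) z)
      fun z hz => mem_of_indicator_ne_zero (s := S) hz)
    have hx : ∀ i, xn η (V i) ≠ ⊤ := fun i =>
      ne_top_of_le_ne_top (mul_ne_top (by norm_num) (hb i)) (hV i).2
    have h0 := hx 0
    have h1 := hx 1
    have h2 := hx 2
    finiteness
  have tB : ∀ V : Fin 3 → ℝ³ → ℝ≥0∞, (∀ i, Measurable (V i) ∧ xn η (V i) ≤ 3 * b i) →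
      Tendsto (fun j => tform (kerB σ) (fun z => ‖m j z‖ₑ) (V 0) (V 1) (V 2)) atTop (𝓝 0) :=
    fun V hV => tendsto_tform_zero hκ hmm mM' (hV 0).1 (hV 1).1 (hV 2).1 hle (fin V hV)
      fun z => (hm0 z).mono fun j hj => by rw [hj, enorm_zero]
  have tI : ∀ V : Fin 3 → ℝ³ → ℝ≥0∞, (∀ i, Measurable (V i) ∧ xn η (V i) ≤ 3 * b i) →
      Tendsto (fun j => tform (kerI σ) (fun z => ‖m j z‖ₑ) (V 0) (V 1) (V 2)) atTop (𝓝 0) := by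
    intro V hV
    refine tendsto_tform_zero hκI hmm mM' (hV 0).1 (hV 1).1 (hV 2).1 hle ?_
      fun z => (hm0 z).mono fun j hj => by rw [hj, enorm_zero]
    refine ne_top_of_le_ne_top ?_ (tform_mono (kerI_le_kerB hσ) (fun _ => le_rfl)
      (fun _ => le_rfl) (fun _ => le_rfl) fun _ _ _ p q _ _ _ => le_rfl)
    rw [tform_const_kernel 2 hκ mM' (hV 0).1 (hV 1).1 (hV 2).1]
    exact mul_ne_top (by norm_num) (fin V hV)
  have tS := tendsto_finsetSum (Finset.range N) fun l _ => tI (V l) (hV l)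
  have key := ENNReal.Tendsto.const_mul (a := (C : ℝ≥0∞)) (((tB W hW).add tS).add (tB W' hW'))
    (Or.inr ENNReal.coe_ne_top)
  simp only [Finset.sum_const_zero, add_zero, mul_zero] at key
  exact tendsto_of_tendsto_of_tendsto_of_le_of_le tendsto_const_nhds key (fun _ => zero_le)
    fun j => h (m j) (hm j)

end pieces

/-- The energy symbol `ξ χ_k(ξ)²`. -/
def energySymbol (η : Cutoff) (k : ℕ) (x : ℝ) : ℝ := x * η.dyadic k x ^ 2

@[fun_prop]
lemma measurable_energySymbol (η : Cutoff) (k : ℕ) : Measurable (energySymbol η k) := by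
  unfold energySymbol; fun_prop

lemma abs_energySymbol_le (η : Cutoff) (k : ℕ) (x : ℝ) :
    |energySymbol η k x| ≤ 8 / 5 * 2 ^ k := by
  unfold energySymbol
  by_cases h : η.dyadic k x = 0
  · rw [h]; simp only [ne_eq, OfNat.ofNat_ne_zero, not_false_eq_true, zero_pow, mul_zero, abs_zero]
    positivity
  rw [abs_mul, abs_of_nonneg (sq_nonneg (η.dyadic k x))]
  have h1 := η.abs_le_of_dyadic_ne_zero h
  have h2 : η.dyadic k x ^ 2 ≤ 1 := pow_le_one₀ (η.dyadic_nonneg k x) (η.dyadic_le_one k x)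
  nlinarith [abs_nonneg x, sq_nonneg (η.dyadic k x)]

lemma exists_lipschitz_energySymbol (η : Cutoff) : ∃ L : ℝ≥0, ∀ k : ℕ, ∀ x y : ℝ,
    |energySymbol η (k + 1) x - energySymbol η (k + 1) y| ≤ L * |x - y| := by
  have hs := η.smooth
  have hsm : ContDiff ℝ 1 fun x : ℝ => x * (η.toFun (x / 2) - η.toFun x) ^ 2 := by
    have h1 : ContDiff ℝ 1 η.toFun := hs.of_le (by norm_cast)
    have h2 : ContDiff ℝ 1 fun x : ℝ => η.toFun (x / 2) := h1.comp (by fun_prop)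
    fun_prop
  have hc : HasCompactSupport fun x : ℝ => x * (η.toFun (x / 2) - η.toFun x) ^ 2 := by
    refine HasCompactSupport.of_support_subset_isCompact
      (isCompact_Icc (a := (-4 : ℝ)) (b := 4)) fun x hx => ?_
    by_contra h
    have h' : 4 < |x| := by
      by_contra h''
      exact h (abs_le.1 (not_lt.1 h''))
    refine hx ?_
    simp only
    rw [η.eq_zero (x := x) (by linarith), η.eq_zero (x := x / 2)
      (by rw [abs_div, abs_two]; linarith)]
    simp
  obtain ⟨L, hL⟩ := hsm.lipschitzWith_of_hasCompactSupport hc (by norm_num)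
  refine ⟨L, fun k x y => ?_⟩
  have e : ∀ x, energySymbol η (k + 1) x =
      2 ^ k * ((x / 2 ^ k) * (η.toFun (x / 2 ^ k / 2) - η.toFun (x / 2 ^ k)) ^ 2) := by
    intro x
    have h2 : (2 : ℝ) ^ k ≠ 0 := by positivity
    simp only [energySymbol, Cutoff.dyadic]
    rw [div_div, ← pow_succ]
    field_simp
  have h := hL.dist_le_mul (x / 2 ^ k) (y / 2 ^ k)
  rw [Real.dist_eq, Real.dist_eq, ← sub_div, abs_div, abs_of_pos (by positivity : (0 : ℝ) < 2 ^ k)] at h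
  rw [e, e, ← mul_sub, abs_mul, abs_of_pos (by positivity : (0 : ℝ) < 2 ^ k)]
  calc (2 : ℝ) ^ k * |_| ≤ 2 ^ k * (L * (|x - y| / 2 ^ k)) := by gcongr
    _ = L * |x - y| := by field_simp

lemma energySymbol_neg (η : Cutoff) (k : ℕ) (x : ℝ) :
    energySymbol η k (-x) = -energySymbol η k x := by
  simp only [energySymbol, Cutoff.dyadic_neg]; ring

/-- The symmetrized energy symbol is controlled by the smallest frequency. -/
lemma exists_symmetrized_symbol_le (η : Cutoff) : ∃ D : ℝ≥0, ∀ k : ℕ, ∀ x y z : ℝ,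
    x + y + z = 0 → |energySymbol η (k + 1) x + energySymbol η (k + 1) y +
      energySymbol η (k + 1) z| ≤ D * |x| := by
  obtain ⟨L, hL⟩ := exists_lipschitz_energySymbol η
  refine ⟨2 * L, fun k x y z h => ?_⟩
  have h0 : energySymbol η (k + 1) 0 = 0 := by simp [energySymbol]
  have h1 := hL k x 0
  rw [h0, sub_zero, sub_zero] at h1
  have h2 := hL k y (-z)
  rw [energySymbol_neg, sub_neg_eq_add, sub_neg_eq_add, show y + z = -x by linarith, abs_neg] at h2
  rw [add_assoc]
  refine (abs_add_le _ _).trans ?_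
  push_cast
  linarith

/-! ### Decomposition of trilinear integrals -/

/-- The product of the three values of `U` at frequencies of sum zero. -/
def triProd (U : ℝ³ → ℂ) (x : ℝ × ℝ⁴) : ℂ :=
  U (x.1, x.2.1) * (U (x.1, x.2.2) * U (x.1, -(x.2.1 + x.2.2)))

@[fun_prop]
lemma measurable_triProd {U : ℝ³ → ℂ} (hU : Measurable U) : Measurable (triProd U) := by
  unfold triProd; fun_prop

lemma lintegral_triProd_le {U : ℝ³ → ℂ} (hU : Measurable U) {B : Set ℝ²}
    (hB : MeasurableSet B) {R : ℝ≥0∞} {t : ℝ} (hR : l2n (fun p => ‖U (t, p)‖ₑ) ≤ R) :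
    ∫⁻ z, B.indicator 1 (-(z.1 + z.2)) * ‖triProd U (t, z)‖ₑ ≤
      volume B ^ (1 / 2 : ℝ) * R * (R * R) := by
  have hUt : Measurable fun p => ‖U (t, p)‖ₑ := by fun_prop
  have h1 : ∀ z : ℝ⁴, B.indicator 1 (-(z.1 + z.2)) * ‖triProd U (t, z)‖ₑ =
      ‖U (t, z.1)‖ₑ * ‖U (t, z.2)‖ₑ * B.indicator (fun p => ‖U (t, p)‖ₑ) (-(z.1 + z.2)) := by
    intro z
    simp only [triProd, enorm_mul]
    by_cases hz : -(z.1 + z.2) ∈ B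
    · rw [indicator_of_mem hz, indicator_of_mem hz, Pi.one_apply, one_mul, mul_assoc]
    · rw [indicator_of_notMem hz, indicator_of_notMem hz, zero_mul, mul_zero]
  simp only [h1]
  refine (lintegral_trilinear_le hUt hUt (hUt.indicator hB)).trans ?_
  refine mul_le_mul' ((lintegral_indicator_le_l2n hUt hB).trans (mul_le_mul' le_rfl hR)) ?_
  exact mul_le_mul' hR hR

/-- The measure on time and pairs of frequencies. -/
def timeFreq (α β : ℝ) : Measure (ℝ × ℝ⁴) := (volume.restrict (Icc α β)).prod volume

lemma integrable_mul_triProd {U : ℝ³ → ℂ} (hU : Measurable U) {R : ℝ≥0∞} (hR : R ≠ ⊤)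
    {α β : ℝ} (hUR : ∀ t ∈ Icc α β, l2n (fun p => ‖U (t, p)‖ₑ) ≤ R)
    {m : ℝ⁴ → ℂ} (hm : IsMultiplier m) :
    Integrable (fun x => m x.2 * triProd U x) (timeFreq α β) := by
  obtain ⟨C, hC⟩ := hm.bounded
  obtain ⟨B, hB, hBf, hmB⟩ := hm.support
  have hmm := hm.measurable
  have hBm : Measurable fun z : ℝ⁴ => B.indicator (1 : ℝ² → ℝ≥0∞) (-(z.1 + z.2)) :=
    (measurable_one.indicator hB).comp (by fun_prop)
  refine ⟨(by fun_prop : Measurable fun x : ℝ × ℝ⁴ =>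
    m x.2 * triProd U x).aestronglyMeasurable, ?_⟩
  rw [hasFiniteIntegral_iff_enorm, timeFreq, lintegral_prod _ (by fun_prop)]
  have hle : ∀ t ∈ Icc α β, ∫⁻ z, ‖m z * triProd U (t, z)‖ₑ ≤
      C * (volume B ^ (1 / 2 : ℝ) * R * (R * R)) := by
    intro t ht
    refine le_trans ?_ (mul_le_mul' le_rfl (lintegral_triProd_le hU hB (hUR t ht)))
    rw [← lintegral_const_mul _ (by fun_prop)]
    refine lintegral_mono fun z => ?_
    rw [enorm_mul]
    by_cases hz : m z = 0
    · rw [hz, enorm_zero, zero_mul]; exact zero_le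
    · rw [indicator_of_mem (hmB z hz), Pi.one_apply, one_mul]
      exact mul_le_mul' (hC z) le_rfl
  refine lt_of_le_of_lt (setLIntegral_mono measurable_const hle) ?_
  rw [setLIntegral_const]
  have : volume B ^ (1 / 2 : ℝ) ≠ ⊤ := rpow_ne_top_of_nonneg (by norm_num) hBf
  have : volume (Icc α β) ≠ ⊤ := measure_Icc_lt_top.ne
  exact (by finiteness : _ ≠ ⊤).lt_top

/-- The product of the frequency localizations. -/
def triCut (η : Cutoff) (k : ℕ × ℕ × ℕ) (z : ℝ⁴) : ℝ :=
  η.dyadic k.1 z.1.1 * (η.dyadic k.2.1 z.2.1 * η.dyadic k.2.2 (-(z.1 + z.2)).1)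

@[fun_prop]
lemma measurable_triCut (η : Cutoff) (k : ℕ × ℕ × ℕ) : Measurable (triCut η k) := by
  unfold triCut; fun_prop

lemma triCut_nonneg (η : Cutoff) (k : ℕ × ℕ × ℕ) (z : ℝ⁴) : 0 ≤ triCut η k z :=
  mul_nonneg (η.dyadic_nonneg _ _) (mul_nonneg (η.dyadic_nonneg _ _) (η.dyadic_nonneg _ _))

lemma hasSum_triCut (η : Cutoff) (z : ℝ⁴) : HasSum (fun k => triCut η k z) 1 := by
  have h1 := η.hasSum_dyadic z.1.1
  have h2 := η.hasSum_dyadic z.2.1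
  have h3 := η.hasSum_dyadic (-(z.1 + z.2)).1
  have h23 := h2.mul h3 (h2.summable.mul_of_nonneg h3.summable (fun k => η.dyadic_nonneg k _)
    fun k => η.dyadic_nonneg k _)
  have h := h1.mul h23 (h1.summable.mul_of_nonneg h23.summable (fun k => η.dyadic_nonneg k _)
    fun k => mul_nonneg (η.dyadic_nonneg _ _) (η.dyadic_nonneg _ _))
  simpa [triCut] using h

/-- A multiplier restricted to the support of the frequency localizations. -/
def cutMult (η : Cutoff) (k : ℕ × ℕ × ℕ) (m : ℝ⁴ → ℂ) : ℝ⁴ → ℂ := {z | triCut η k z ≠ 0}.indicator m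

lemma integral_triCut (η : Cutoff) (k : ℕ × ℕ × ℕ) {U : ℝ³ → ℂ} {α β : ℝ}
    {m : ℝ⁴ → ℂ} (hm : Measurable m) (hU : Measurable U)
    (hi : Integrable (fun x => m x.2 * triProd U x) (timeFreq α β)) :
    ∫ x, (triCut η k x.2 : ℂ) * (m x.2 * triProd U x) ∂timeFreq α β =
      ∫ t in Icc α β, tri (cutMult η k m) (locU η k.1 U) (locU η k.2.1 U) (locU η k.2.2 U) t := by
  have hi' : Integrable (fun x => (triCut η k x.2 : ℂ) * (m x.2 * triProd U x)) (timeFreq α β) := by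
    refine hi.mono (by fun_prop : Measurable _).aestronglyMeasurable (.of_forall fun x => ?_)
    rw [norm_mul, norm_real, norm_eq_abs, abs_of_nonneg (triCut_nonneg η k _)]
    refine mul_le_of_le_one_left (norm_nonneg _) ?_
    unfold triCut
    have h := fun j y => η.dyadic_le_one j y
    have h' := fun j y => η.dyadic_nonneg j y
    exact mul_le_one₀ (h _ _) (mul_nonneg (h' _ _) (h' _ _)) (mul_le_one₀ (h _ _) (h' _ _) (h _ _))
  rw [timeFreq, integral_prod _ hi']
  refine integral_congr_ae (.of_forall fun t => integral_congr_ae (.of_forall fun z => ?_))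
  simp only [cutMult, locU, triProd]
  by_cases hz : triCut η k z = 0
  · rw [indicator_of_notMem (by simpa using hz), hz]; simp
  · rw [indicator_of_mem (by exact hz), triCut]
    push_cast
    ring

lemma enorm_integral_le_tsum_triCut (η : Cutoff) {U : ℝ³ → ℂ} {α β : ℝ}
    {m : ℝ⁴ → ℂ} (hm : Measurable m) (hU : Measurable U)
    (hi : Integrable (fun x => m x.2 * triProd U x) (timeFreq α β)) :
    ‖∫ x, m x.2 * triProd U x ∂timeFreq α β‖ₑ ≤ ∑' k : ℕ × ℕ × ℕ,
      ‖∫ t in Icc α β, tri (cutMult η k m) (locU η k.1 U) (locU η k.2.1 U) (locU η k.2.2 U) t‖ₑ := by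
  have hF : ∀ k : ℕ × ℕ × ℕ, Measurable fun x => (triCut η k x.2 : ℂ) * (m x.2 * triProd U x) :=
    fun k => by fun_prop
  have hsum : ∑' k : ℕ × ℕ × ℕ, ∫⁻ x, ‖(triCut η k x.2 : ℂ) * (m x.2 * triProd U x)‖ₑ
      ∂timeFreq α β = ∫⁻ x, ‖m x.2 * triProd U x‖ₑ ∂timeFreq α β := by
    rw [← lintegral_tsum fun k => (hF k).enorm.aemeasurable]
    refine lintegral_congr fun x => ?_
    have e : ∀ k : ℕ × ℕ × ℕ, ‖(triCut η k x.2 : ℂ) * (m x.2 * triProd U x)‖ₑ =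
        ofReal (triCut η k x.2) * ‖m x.2 * triProd U x‖ₑ := fun k => by
      rw [enorm_mul, ← ofReal_norm (triCut η k x.2 : ℂ), norm_real,
        norm_eq_abs, abs_of_nonneg (triCut_nonneg η k _)]
    have h1 := hasSum_triCut η x.2
    simp only [e, ENNReal.tsum_mul_right]
    rw [← ofReal_tsum_of_nonneg (fun k => triCut_nonneg η k _) h1.summable, h1.tsum_eq,
      ofReal_one, one_mul]
  have h := integral_tsum (fun k => (hF k).aestronglyMeasurable) (by rw [hsum]; exact hi.2.ne)
  have e : ∀ x : ℝ × ℝ⁴, ∑' k : ℕ × ℕ × ℕ,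
      (triCut η k x.2 : ℂ) * (m x.2 * triProd U x) = m x.2 * triProd U x := fun x => by
    have h1 := Complex.hasSum_ofReal.2 (hasSum_triCut η x.2)
    rw [tsum_mul_right, h1.tsum_eq, Complex.ofReal_one, one_mul]
  simp only [e] at h
  rw [h]
  refine enorm_tsum_le_tsum_enorm.trans (le_of_eq (tsum_congr fun k => ?_))
  rw [integral_triCut η k hm hU hi]

lemma measurePreserving_rot : MeasurePreserving fun z : ℝ⁴ => ((-(z.1 + z.2), z.2) : ℝ⁴) := by
  refine ⟨by fun_prop, Measure.ext fun s hs => ?_⟩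
  rw [Measure.map_apply (by fun_prop) hs, ← lintegral_indicator_one hs,
    lintegral_rot (measurable_one.indicator hs), ← lintegral_indicator_one
    ((by fun_prop : Measurable fun z : ℝ⁴ =>
      ((-(z.1 + z.2), z.2) : ℝ⁴)) hs)]
  rfl

lemma measurePreserving_rot' : MeasurePreserving fun z : ℝ⁴ => ((z.1, -(z.1 + z.2)) : ℝ⁴) := by
  have hs : MeasurePreserving (Prod.swap : ℝ⁴ → ℝ⁴) := Measure.measurePreserving_swap
  have := hs.comp (measurePreserving_rot.comp hs)
  convert this using 2 with z
  simp [add_comm]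

lemma integral_timeFreq_comp {S : ℝ⁴ → ℝ⁴}
    (hS : MeasurePreserving S) {α β : ℝ} {G : ℝ × ℝ⁴ → ℂ} (hG : Measurable G) :
    ∫ x, G (x.1, S x.2) ∂timeFreq α β = ∫ x, G x ∂timeFreq α β ∧
    (Integrable G (timeFreq α β) → Integrable (fun x => G (x.1, S x.2)) (timeFreq α β)) := by
  have h : MeasurePreserving (Prod.map id S) (timeFreq α β) (timeFreq α β) :=
    (MeasurePreserving.id _).prod hS
  constructor
  · have := integral_map h.measurable.aemeasurable (hG.aestronglyMeasurable (μ := (timeFreq α β).map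
      (Prod.map id S)))
    rw [h.map_eq] at this
    exact this.symm
  · intro hi
    exact h.integrable_comp_of_integrable hi

/-- The truncation of all three frequencies in `y`. -/
def truncSet (A : ℕ) : Set ℝ⁴ := {z | |z.1.2| ≤ A ∧ |z.2.2| ≤ A ∧ |(-(z.1 + z.2)).2| ≤ A}

lemma measurableSet_truncSet (A : ℕ) : MeasurableSet (truncSet A) :=
  ((by fun_prop : Measurable fun z : ℝ⁴ => |z.1.2|) measurableSet_Iic).inter
    (((by fun_prop : Measurable fun z : ℝ⁴ => |z.2.2|) measurableSet_Iic).inter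
    ((by fun_prop : Measurable fun z : ℝ⁴ => |(-(z.1 + z.2)).2|) measurableSet_Iic))

/-- The multiplier of the truncated energy. -/
def energyMult (η : Cutoff) (k A : ℕ) (z : ℝ⁴) : ℂ :=
  {p : ℝ² | |p.2| ≤ A}.indicator (fun p => (energySymbol η k p.1 : ℂ)) (-(z.1 + z.2))

/-- The multiplier of the energy with all frequencies truncated. -/
def truncMult (η : Cutoff) (k A : ℕ) : ℝ⁴ → ℂ :=
  (truncSet A).indicator fun z => (energySymbol η k (-(z.1 + z.2)).1 : ℂ)

/-- The symmetrization of `truncMult`. -/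
def energyMultSym (η : Cutoff) (k A : ℕ) : ℝ⁴ → ℂ :=
  (truncSet A).indicator fun z => ((energySymbol η k z.1.1 + energySymbol η k z.2.1 +
    energySymbol η k (-(z.1 + z.2)).1 : ℝ) : ℂ)

lemma enorm_ofReal_le {x y : ℝ} (h : |x| ≤ y) : ‖(x : ℂ)‖ₑ ≤ ofReal y := by
  rw [← ofReal_norm, norm_real, norm_eq_abs]
  exact ofReal_le_ofReal h

lemma energySymbol_ne_zero {η : Cutoff} {k : ℕ} {x : ℝ} (h : energySymbol η k x ≠ 0) :
    η.dyadic k x ≠ 0 := fun h' => h (by simp [energySymbol, h'])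

lemma volume_box_ne_top (a b : ℝ) : volume {p : ℝ² | |p.1| ≤ a ∧ |p.2| ≤ b} ≠ ⊤ := by
  have h : {p : ℝ² | |p.1| ≤ a ∧ |p.2| ≤ b} ⊆ Icc (-a) a ×ˢ Icc (-b) b := fun p hp =>
    ⟨abs_le.1 hp.1, abs_le.1 hp.2⟩
  exact ((measure_mono h).trans_lt (by
    rw [volume_eq_prod, Measure.prod_prod]
    exact ENNReal.mul_lt_top measure_Icc_lt_top measure_Icc_lt_top)).ne

lemma measurableSet_box (a b : ℝ) : MeasurableSet {p : ℝ² | |p.1| ≤ a ∧ |p.2| ≤ b} :=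
  ((by fun_prop : Measurable fun z : ℝ² => |z.1|) measurableSet_Iic).inter
    ((by fun_prop : Measurable fun z : ℝ² => |z.2|) measurableSet_Iic)

lemma measurable_energyMult (η : Cutoff) (k A : ℕ) : Measurable (energyMult η k A) := by
  have : Measurable ({p : ℝ² | |p.2| ≤ A}.indicator fun p => (energySymbol η k p.1 : ℂ)) :=
    Measurable.indicator (by fun_prop)
      ((by fun_prop : Measurable fun p : ℝ² => |p.2|) measurableSet_Iic)
  exact this.comp (by fun_prop)

lemma measurable_truncMult (η : Cutoff) (k A : ℕ) : Measurable (truncMult η k A) :=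
  Measurable.indicator (by fun_prop) (measurableSet_truncSet A)

lemma measurable_energyMultSym (η : Cutoff) (k A : ℕ) : Measurable (energyMultSym η k A) :=
  Measurable.indicator (by fun_prop) (measurableSet_truncSet A)

lemma enorm_energyMult_le (η : Cutoff) (k A : ℕ) (z : ℝ⁴) :
    ‖energyMult η k A z‖ₑ ≤ ofReal (8 / 5 * 2 ^ k) := by
  unfold energyMult
  refine (enorm_indicator_le_enorm_self _ _).trans (enorm_ofReal_le (abs_energySymbol_le η k _))

lemma enorm_truncMult_le (η : Cutoff) (k A : ℕ) (z : ℝ⁴) :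
    ‖truncMult η k A z‖ₑ ≤ ofReal (8 / 5 * 2 ^ k) := by
  unfold truncMult
  refine (enorm_indicator_le_enorm_self _ _).trans (enorm_ofReal_le (abs_energySymbol_le η k _))

lemma energyMult_support {η : Cutoff} {k A : ℕ} {z : ℝ⁴}
    (h : energyMult η k A z ≠ 0) : η.dyadic k (-(z.1 + z.2)).1 ≠ 0 ∧ |(-(z.1 + z.2)).2| ≤ A := by
  unfold energyMult at h
  have h1 := mem_of_indicator_ne_zero h
  rw [indicator_of_mem h1] at h
  exact ⟨energySymbol_ne_zero (by exact_mod_cast h), h1⟩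

lemma truncMult_support {η : Cutoff} {k A : ℕ} {z : ℝ⁴} (h : truncMult η k A z ≠ 0) :
    η.dyadic k (-(z.1 + z.2)).1 ≠ 0 ∧ |(-(z.1 + z.2)).2| ≤ A := by
  unfold truncMult at h
  have h1 := mem_of_indicator_ne_zero h
  rw [indicator_of_mem h1] at h
  exact ⟨energySymbol_ne_zero (by exact_mod_cast h), h1.2.2⟩

lemma isMultiplier_energyMult (η : Cutoff) (k A : ℕ) : IsMultiplier (energyMult η k A) where
  measurable := measurable_energyMult η k A
  bounded := ⟨_, enorm_energyMult_le η k A⟩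
  support := ⟨_, measurableSet_box (8 / 5 * 2 ^ k) A, volume_box_ne_top _ _, fun _ hz =>
    ⟨η.abs_le_of_dyadic_ne_zero (energyMult_support hz).1, (energyMult_support hz).2⟩⟩

lemma isMultiplier_truncMult (η : Cutoff) (k A : ℕ) : IsMultiplier (truncMult η k A) where
  measurable := measurable_truncMult η k A
  bounded := ⟨_, enorm_truncMult_le η k A⟩
  support := ⟨_, measurableSet_box (8 / 5 * 2 ^ k) A, volume_box_ne_top _ _, fun _ hz =>
    ⟨η.abs_le_of_dyadic_ne_zero (truncMult_support hz).1, (truncMult_support hz).2⟩⟩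

lemma triCut_ne_zero {η : Cutoff} {κ : ℕ × ℕ × ℕ} {z : ℝ⁴}
    (h : triCut η κ z ≠ 0) : η.dyadic κ.1 z.1.1 ≠ 0 ∧ η.dyadic κ.2.1 z.2.1 ≠ 0 ∧
      η.dyadic κ.2.2 (-(z.1 + z.2)).1 ≠ 0 := by
  unfold triCut at h
  exact ⟨left_ne_zero_of_mul h, left_ne_zero_of_mul (right_ne_zero_of_mul h),
    right_ne_zero_of_mul (right_ne_zero_of_mul h)⟩

lemma measurable_cutMult (η : Cutoff) (κ : ℕ × ℕ × ℕ) {m : ℝ⁴ → ℂ}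
    (hm : Measurable m) : Measurable (cutMult η κ m) :=
  hm.indicator (measurable_triCut η κ (measurableSet_singleton 0).compl)

lemma cutMult_support {η : Cutoff} {κ : ℕ × ℕ × ℕ} {m : ℝ⁴ → ℂ}
    {z : ℝ⁴} (h : cutMult η κ m z ≠ 0) : triCut η κ z ≠ 0 ∧ m z ≠ 0 := by
  unfold cutMult at h
  have h1 := mem_of_indicator_ne_zero h
  rw [indicator_of_mem h1] at h
  exact ⟨h1, h⟩

lemma IsMultiplier.cutMult {η : Cutoff} {m : ℝ⁴ → ℂ} (hm : IsMultiplier m)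
    (κ : ℕ × ℕ × ℕ) : IsMultiplier (cutMult η κ m) where
  measurable := measurable_cutMult η κ hm.measurable
  bounded := hm.bounded.imp fun _ hC z => (enorm_indicator_le_enorm_self _ _).trans (hC z)
  support := by
    obtain ⟨B, h1, h2, h3⟩ := hm.support
    exact ⟨B, h1, h2, fun z hz => h3 z (cutMult_support hz).2⟩

lemma energyMultSym_support {η : Cutoff} {k A : ℕ} {z : ℝ⁴}
    (h : energyMultSym η k A z ≠ 0) : z ∈ truncSet A ∧ (η.dyadic k z.1.1 ≠ 0 ∨
      η.dyadic k z.2.1 ≠ 0 ∨ η.dyadic k (-(z.1 + z.2)).1 ≠ 0) := by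
  unfold energyMultSym at h
  have h1 := mem_of_indicator_ne_zero h
  rw [indicator_of_mem h1] at h
  refine ⟨h1, ?_⟩
  by_contra! hc
  exact h (by rw [energySymbol, energySymbol, energySymbol, hc.1, hc.2.1, hc.2.2]; simp)

lemma isMultiplier_cutMult_energyMultSym (η : Cutoff) (k A : ℕ) (κ : ℕ × ℕ × ℕ) :
    IsMultiplier (cutMult η κ (energyMultSym η k A)) where
  measurable := measurable_cutMult η κ (measurable_energyMultSym η k A)
  bounded := by
    refine ⟨Real.toNNReal (3 * (8 / 5 * 2 ^ k)), fun z => (enorm_indicator_le_enorm_self _ _).trans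
      ((enorm_indicator_le_enorm_self _ _).trans (enorm_ofReal_le ?_))⟩
    refine (abs_add_three _ _ _).trans ?_
    linarith [abs_energySymbol_le η k z.1.1, abs_energySymbol_le η k z.2.1,
      abs_energySymbol_le η k (-(z.1 + z.2)).1]
  support := ⟨_, measurableSet_box (8 / 5 * 2 ^ κ.2.2) A, volume_box_ne_top _ _, fun _ hz =>
    ⟨η.abs_le_of_dyadic_ne_zero (triCut_ne_zero (cutMult_support hz).1).2.2,
      (energyMultSym_support (cutMult_support hz).2).1.2.2⟩⟩

/-- The largest of three indices. -/
def maxIndex (κ : ℕ × ℕ × ℕ) : ℕ := max κ.1 (max κ.2.1 κ.2.2)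

lemma le_abs_of_cut {η : Cutoff} {k : ℕ} {κ : ℕ × ℕ × ℕ} {x y z : ℝ}
    (hx : η.dyadic κ.1 x ≠ 0) (hy : η.dyadic κ.2.1 y ≠ 0) (hz : η.dyadic κ.2.2 z ≠ 0)
    (h : η.dyadic (k + 1) x ≠ 0 ∨ η.dyadic (k + 1) y ≠ 0 ∨ η.dyadic (k + 1) z ≠ 0) :
    k ≤ maxIndex κ ∧ (5 / 8 * 2 ^ maxIndex κ ≤ |x| ∨ 5 / 8 * 2 ^ maxIndex κ ≤ |y| ∨
      5 / 8 * 2 ^ maxIndex κ ≤ |z|) := by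
  have e1 : κ.1 ≤ maxIndex κ := le_max_left _ _
  have e2 : κ.2.1 ≤ maxIndex κ := (le_max_left _ _).trans (le_max_right _ _)
  have e3 : κ.2.2 ≤ maxIndex κ := (le_max_right _ _).trans (le_max_right _ _)
  have key : ∀ {j : ℕ} {x : ℝ}, j ≤ maxIndex κ → η.dyadic j x ≠ 0 → η.dyadic (k + 1) x ≠ 0 →
      k ≤ maxIndex κ ∧ (5 / 8 : ℝ) ≤ |x| := by
    intro j x hj h1 h2
    have h3 := η.abs_le_of_dyadic_ne_zero h1
    have h4 := η.le_abs_of_dyadic_ne_zero (by omega) h2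
    have h5 : (1 : ℝ) ≤ 2 ^ (k + 1) := one_le_pow₀ (by norm_num)
    refine ⟨?_, by linarith⟩
    by_contra! hk
    have h6 : (2 : ℝ) ^ (j + 2) ≤ 2 ^ (k + 1) := pow_le_pow_right₀ (by norm_num) (by omega)
    have h7 : (0 : ℝ) < 2 ^ j := by positivity
    rw [pow_add] at h6
    linarith
  refine ⟨by rcases h with h | h | h <;> [exact (key e1 hx h).1; exact (key e2 hy h).1;
    exact (key e3 hz h).1], ?_⟩
  by_cases h0 : maxIndex κ = 0
  · rw [h0, pow_zero, mul_one]
    rcases h with h | h | h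
    · exact Or.inl (key e1 hx h).2
    · exact Or.inr (Or.inl (key e2 hy h).2)
    · exact Or.inr (Or.inr (key e3 hz h).2)
  · have h1 : 1 ≤ maxIndex κ := by omega
    rcases (by unfold maxIndex; omega : κ.1 = maxIndex κ ∨ κ.2.1 = maxIndex κ ∨ κ.2.2 = maxIndex κ)
      with e | e | e
    · rw [e] at hx; exact Or.inl (η.le_abs_of_dyadic_ne_zero h1 hx)
    · rw [e] at hy; exact Or.inr (Or.inl (η.le_abs_of_dyadic_ne_zero h1 hy))
    · rw [e] at hz; exact Or.inr (Or.inr (η.le_abs_of_dyadic_ne_zero h1 hz))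

lemma exists_cutMult_energyMultSym_le (η : Cutoff) : ∃ D : ℝ≥0, ∀ (k A : ℕ) (κ : ℕ × ℕ × ℕ)
    (z : ℝ⁴), ‖cutMult η κ (energyMultSym η (k + 1) A) z‖ₑ ≤
      (if k ≤ maxIndex κ then (D : ℝ≥0∞) else 0) *
      (lowMult (maxIndex κ) κ.1 κ.2.1 κ.2.2 z.1.1 z.2.1 (-(z.1 + z.2)).1 +
      lowMult (maxIndex κ) κ.2.1 κ.1 κ.2.2 z.2.1 z.1.1 (-(z.1 + z.2)).1 +
      lowMult (maxIndex κ) κ.2.2 κ.2.1 κ.1 (-(z.1 + z.2)).1 z.2.1 z.1.1) := by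
  obtain ⟨D, hD⟩ := exists_symmetrized_symbol_le η
  refine ⟨D, fun k A κ z => ?_⟩
  by_cases hz : cutMult η κ (energyMultSym η (k + 1) A) z = 0
  · rw [hz, enorm_zero]; exact zero_le
  obtain ⟨h1, h2⟩ := cutMult_support hz
  obtain ⟨hx, hy, hw⟩ := triCut_ne_zero h1
  obtain ⟨h3, h4⟩ := le_abs_of_cut hx hy hw (energyMultSym_support h2).2
  have hsum : z.1.1 + z.2.1 + (-(z.1 + z.2)).1 = 0 := by
    simp only [Prod.fst_neg, Prod.fst_add]; ring
  have hle : ∀ x : ℝ, |energySymbol η (k + 1) z.1.1 + energySymbol η (k + 1) z.2.1 +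
      energySymbol η (k + 1) (-(z.1 + z.2)).1| ≤ D * |x| →
      ‖cutMult η κ (energyMultSym η (k + 1) A) z‖ₑ ≤ D * ofReal |x| := by
    intro x hx
    refine (enorm_indicator_le_enorm_self _ _).trans
      ((enorm_indicator_le_enorm_self _ _).trans ((enorm_ofReal_le hx).trans (le_of_eq ?_)))
    rw [ofReal_mul D.coe_nonneg, ENNReal.ofReal_coe_nnreal]
  rw [if_pos h3]
  refine le_lowMult (le_max_left _ _) ((le_max_left _ _).trans (le_max_right _ _))
    ((le_max_right _ _).trans (le_max_right _ _)) hsum (η.abs_le_of_dyadic_ne_zero hx)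
    (η.abs_le_of_dyadic_ne_zero hy) (η.abs_le_of_dyadic_ne_zero hw) h4 (hle _ ?_) (hle _ ?_)
    (hle _ ?_)
  · exact hD k _ _ _ hsum
  · have := hD k z.2.1 z.1.1 (-(z.1 + z.2)).1 (by linarith)
    rwa [add_comm (energySymbol η (k + 1) z.2.1)] at this
  · have := hD k (-(z.1 + z.2)).1 z.1.1 z.2.1 (by linarith)
    rwa [add_assoc, add_comm] at this

lemma integral_truncMult (η : Cutoff) (k A : ℕ) {U : ℝ³ → ℂ} (hU : Measurable U)
    {α β : ℝ} (hi : Integrable (fun x => truncMult η k A x.2 * triProd U x) (timeFreq α β)) :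
    Integrable (fun x => energyMultSym η k A x.2 * triProd U x) (timeFreq α β) ∧
    ∫ x, energyMultSym η k A x.2 * triProd U x ∂timeFreq α β =
      3 * ∫ x, truncMult η k A x.2 * triProd U x ∂timeFreq α β := by
  have hm := measurable_truncMult η k A
  have hG : Measurable fun x : ℝ × ℝ⁴ => truncMult η k A x.2 * triProd U x := by fun_prop
  obtain ⟨e1, i1⟩ := integral_timeFreq_comp measurePreserving_rot (α := α) (β := β) hG
  obtain ⟨e2, i2⟩ := integral_timeFreq_comp measurePreserving_rot' (α := α) (β := β) hG
  have e : (fun x => energyMultSym η k A x.2 * triProd U x) = fun x =>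
      truncMult η k A (-(x.2.1 + x.2.2), x.2.2) * triProd U (x.1, (-(x.2.1 + x.2.2), x.2.2)) +
      truncMult η k A (x.2.1, -(x.2.1 + x.2.2)) * triProd U (x.1, (x.2.1, -(x.2.1 + x.2.2))) +
      truncMult η k A x.2 * triProd U x := by
    funext x
    have r1 : -(-(x.2.1 + x.2.2) + x.2.2) = x.2.1 := by abel
    have r2 : -(x.2.1 + -(x.2.1 + x.2.2)) = x.2.2 := by abel
    have t1 : triProd U (x.1, (-(x.2.1 + x.2.2), x.2.2)) = triProd U x := by
      simp only [triProd, r1]; ring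
    have t2 : triProd U (x.1, (x.2.1, -(x.2.1 + x.2.2))) = triProd U x := by
      simp only [triProd, r2]; ring
    rw [t1, t2, ← add_mul, ← add_mul]
    congr 1
    simp only [truncMult, energyMultSym]
    have m1 : ((-(x.2.1 + x.2.2), x.2.2) : ℝ⁴) ∈ truncSet A ↔ x.2 ∈ truncSet A := by
      simp only [truncSet, mem_ofPred_eq, r1]; tauto
    have m2 : ((x.2.1, -(x.2.1 + x.2.2)) : ℝ⁴) ∈ truncSet A ↔ x.2 ∈ truncSet A := by
      simp only [truncSet, mem_ofPred_eq, r2]; tauto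
    by_cases hx : x.2 ∈ truncSet A
    · rw [indicator_of_mem hx, indicator_of_mem hx, indicator_of_mem (m1.2 hx),
        indicator_of_mem (m2.2 hx)]
      simp only [r1, r2]
      push_cast
      rfl
    · rw [indicator_of_notMem hx, indicator_of_notMem hx, indicator_of_notMem (mt m1.1 hx),
        indicator_of_notMem (mt m2.1 hx)]
      simp
  rw [e]
  refine ⟨((i1 hi).add (i2 hi)).add hi, ?_⟩
  have s1 := integral_add ((i1 hi).add (i2 hi)) hi
  have s2 := integral_add (i1 hi) (i2 hi)
  simp only [Pi.add_apply] at s1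
  rw [s1, s2, e1, e2]
  ring

/-- The product of the short-time norms of three frequency pieces. -/
def tripleNorm (a : ℕ → ℝ≥0∞) (κ : ℕ × ℕ × ℕ) : ℝ≥0∞ := a κ.1 * a κ.2.1 * a κ.2.2

/-- The bound for the contribution of all frequency interactions to the energy at frequency
`2 ^ (k + 1)`. -/
def energySum (a : ℕ → ℝ≥0∞) (k : ℕ) : ℝ≥0∞ := ∑' κ : ℕ × ℕ × ℕ, (if k ≤ maxIndex κ then 1 else 0) *
    (tripleWeight (maxIndex κ) κ.1 κ.2.1 κ.2.2 * tripleNorm a κ)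

lemma tsum_prod_prod (f : ℕ → ℝ≥0∞) :
    ∑' κ : ℕ × ℕ × ℕ, f κ.1 * f κ.2.1 * f κ.2.2 = (∑' k, f k) ^ 3 := by
  rw [ENNReal.tsum_prod' (f := fun κ : ℕ × ℕ × ℕ => f κ.1 * f κ.2.1 * f κ.2.2)]
  have h : ∀ i, ∑' κ : ℕ × ℕ, f i * f κ.1 * f κ.2 = f i * (∑' k, f k) ^ 2 := fun i => by
    rw [ENNReal.tsum_prod' (f := fun κ : ℕ × ℕ => f i * f κ.1 * f κ.2)]
    simp only [ENNReal.tsum_mul_left, ENNReal.tsum_mul_right]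
    ring
  simp only [h, ENNReal.tsum_mul_right]
  ring

lemma sqrt_two_pow_max_le (κ : ℕ × ℕ × ℕ) : ofReal √(2 ^ maxIndex κ) ≤
    ofReal √(2 ^ κ.1) * ofReal √(2 ^ κ.2.1) * ofReal √(2 ^ κ.2.2) := by
  rw [← ofReal_mul (sqrt_nonneg _), ← ofReal_mul (by positivity),
    ← sqrt_mul (by positivity), ← sqrt_mul (by positivity), ← pow_add, ← pow_add]
  refine ofReal_le_ofReal (Real.sqrt_le_sqrt (pow_le_pow_right₀ (by norm_num) ?_))
  unfold maxIndex
  omega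

lemma tendsto_tsum_zero {ι : Type*} [Countable ι] {f : ℕ → ι → ℝ≥0∞} {g : ι → ℝ≥0∞}
    (hfg : ∀ j i, f j i ≤ g i) (hg : ∑' i, g i ≠ ⊤) (hf : ∀ i, Tendsto (fun j => f j i) atTop (𝓝 0)) :
    Tendsto (fun j => ∑' i, f j i) atTop (𝓝 0) := by
  letI : MeasurableSpace ι := ⊤
  haveI : MeasurableSingletonClass ι := ⟨fun _ => trivial⟩
  simp only [← lintegral_count] at hg ⊢
  rw [← lintegral_zero (μ := Measure.count (α := ι))]
  exact tendsto_lintegral_of_dominated_convergence g (fun j => measurable_from_top)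
    (fun j => .of_forall fun i => hfg j i) hg (.of_forall hf)

/-- The trilinear contribution to the truncated energy at frequency `2 ^ (k + 1)`, up to an error
that vanishes as the truncation is removed. -/
lemma exists_energyMult_le (η : Cutoff) : ∃ C : ℝ≥0, ∀ (T : ℝ) (u : ℝ → L2)
    (U : ℝ³ → ℂ) (_ : IsFourierRep T u U) (_ : Measurable U) (R : ℝ≥0∞) (_ : R ≠ ⊤)
    (α β : ℝ) (_ : α < β) (_ : β - α ≤ 1) (_ : Icc α β ⊆ Icc (-T) T)
    (_ : ∀ t ∈ Icc α β, l2n (fun p => ‖U (t, p)‖ₑ) ≤ R)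
    (a : ℕ → ℝ≥0∞) (_ : ∀ k, a k = fkNormOn η k T (fun t => proj η k (u t)))
    (_ : ∀ k, a k ≠ ⊤) (_ : ∑' k, ofReal √(2 ^ k) * a k ≠ ⊤) (k : ℕ),
    ∃ err : ℕ → ℝ≥0∞, Tendsto err atTop (𝓝 0) ∧ ∀ A : ℕ,
      ‖∫ x, energyMult η (k + 1) A x.2 * triProd U x ∂timeFreq α β‖ₑ ≤
        C * energySum a k + err A := by
  obtain ⟨C, hC⟩ := exists_hasPieces η
  obtain ⟨D, hD⟩ := exists_cutMult_energyMultSym_le η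
  refine ⟨C * (24300000 * D), fun T u U hUu hU R hR α β hαβ hβα hT hUR a ha hat hsum k => ?_⟩
  have hmax : ∀ κ : ℕ × ℕ × ℕ, ∀ i, ![κ.1, κ.2.1, κ.2.2] i ≤ maxIndex κ := by
    intro κ i
    unfold maxIndex
    fin_cases i <;> simp
  have hP : ∀ (κ : ℕ × ℕ × ℕ) (b : Fin 3 → ℝ≥0∞),
      (∀ i, (![a κ.1, a κ.2.1, a κ.2.2] : Fin 3 → ℝ≥0∞) i < b i) →
      HasPieces η C ![κ.1, κ.2.1, κ.2.2] (maxIndex κ) U α β b := by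
    intro κ b hb
    refine hC _ _ (hmax κ) T u U hUu α β hαβ hβα hT b fun i => ?_
    have := hb i
    fin_cases i <;> simpa [ha] using this
  have hat' : ∀ (κ : ℕ × ℕ × ℕ) i, (![a κ.1, a κ.2.1, a κ.2.2] : Fin 3 → ℝ≥0∞) i ≠ ⊤ := by
    intro κ i
    fin_cases i <;> simp [hat]
  set E : ℕ → ℝ⁴ → ℂ := fun A z =>
    energyMult η (k + 1) A z - truncMult η (k + 1) A z with hE
  have hEle : ∀ A z, ‖E A z‖ₑ ≤ ofReal (8 / 5 * 2 ^ (k + 1)) ∧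
      (E A z ≠ 0 → η.dyadic (k + 1) (-(z.1 + z.2)).1 ≠ 0 ∧ |(-(z.1 + z.2)).2| ≤ A) := by
    intro A z
    by_cases hz : z ∈ truncSet A
    · have h1 : E A z = 0 := by
        simp only [hE, energyMult, truncMult]
        rw [indicator_of_mem hz, indicator_of_mem (by exact hz.2.2), sub_self]
      rw [h1]; simp
    · have h1 : E A z = energyMult η (k + 1) A z := by
        simp only [hE, truncMult]
        rw [indicator_of_notMem hz, sub_zero]
      rw [h1]
      exact ⟨enorm_energyMult_le _ _ _ _, energyMult_support⟩
  have hE0 : ∀ z, ∀ᶠ A in atTop, E A z = 0 := by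
    intro z
    obtain ⟨N, hN⟩ := exists_nat_ge (max |z.1.2| (max |z.2.2| |(-(z.1 + z.2)).2|))
    filter_upwards [eventually_ge_atTop N] with A hA
    have hNA : (N : ℝ) ≤ A := by exact_mod_cast hA
    have h3 := hN.trans hNA
    have hz : z ∈ truncSet A := ⟨(le_max_left _ _).trans h3,
      ((le_max_left _ _).trans (le_max_right _ _)).trans h3,
      ((le_max_right _ _).trans (le_max_right _ _)).trans h3⟩
    simp only [hE, energyMult, truncMult]
    rw [indicator_of_mem hz, indicator_of_mem (by exact hz.2.2), sub_self]
  have hEm : ∀ A, IsMultiplier (E A) := fun A =>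
    { measurable := (measurable_energyMult _ _ _).sub (measurable_truncMult _ _ _)
      bounded := ⟨_, fun z => (hEle A z).1⟩
      support := ⟨_, measurableSet_box (8 / 5 * 2 ^ (k + 1)) A, volume_box_ne_top _ _, fun z hz =>
        ⟨η.abs_le_of_dyadic_ne_zero ((hEle A z).2 hz).1, ((hEle A z).2 hz).2⟩⟩ }
  set K : ℝ := 5 / 8 * 2 ^ (k + 1) with hK
  have hK0 : 0 < K := by positivity
  have hEK : ∀ A z, E A z ≠ 0 → K ≤ |(-(z.1 + z.2)).1| ∧ |(-(z.1 + z.2)).1| ≤ 32 * K := by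
    intro A z hz
    have h1 := ((hEle A z).2 hz).1
    have h2 := η.abs_le_of_dyadic_ne_zero h1
    exact ⟨η.le_abs_of_dyadic_ne_zero (by omega) h1, by
      have : (0 : ℝ) < 2 ^ (k + 1) := by positivity
      linarith⟩
  have hcut : ∀ A κ z, ‖cutMult η κ (E A) z‖ₑ ≤ ofReal (8 / 5 * 2 ^ (k + 1)) := fun A κ z =>
    (enorm_indicator_le_enorm_self _ _).trans (hEle A z).1
  have hcutK : ∀ A κ z, cutMult η κ (E A) z ≠ 0 → K ≤ |(-(z.1 + z.2)).1| ∧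
      |(-(z.1 + z.2)).1| ≤ 32 * K := fun A κ z hz => hEK A z (cutMult_support hz).2
  obtain ⟨I, hI⟩ : ∃ I : (ℝ⁴ → ℂ) → ℕ × ℕ × ℕ → ℝ≥0∞, ∀ m κ, I m κ =
    ‖∫ t in Icc α β, tri (cutMult η κ m) (locU η κ.1 U) (locU η κ.2.1 U) (locU η κ.2.2 U) t‖ₑ :=
    ⟨_, fun _ _ => rfl⟩
  refine ⟨fun A => ∑' κ, I (E A) κ, ?_, fun A => ?_⟩
  · refine tendsto_tsum_zero (g := fun κ => C * (43200 * ofReal (8 / 5 * 2 ^ (k + 1))) *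
      ((ofReal √(2 ^ κ.1) * a κ.1) * (ofReal √(2 ^ κ.2.1) * a κ.2.1) *
      (ofReal √(2 ^ κ.2.2) * a κ.2.2))) (fun A κ => ?_) ?_ fun κ => ?_
    · rw [hI]
      have h1 := le_mul_of_forall_lt (c := C * (43200 * ofReal (8 / 5 * 2 ^ (k + 1)) *
        ofReal √(2 ^ maxIndex κ))) (by finiteness) (hat' κ) fun b _ hb =>
        (hP κ b hb).le_sqrt ((hEm A).cutMult κ) hK0 (hcut A κ) (hcutK A κ)
      refine h1.trans ?_
      have h2 := sqrt_two_pow_max_le κ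
      simp only [Matrix.cons_val_zero, Matrix.cons_val_one, Matrix.cons_val]
      calc _ ≤ C * (43200 * ofReal (8 / 5 * 2 ^ (k + 1)) * (ofReal √(2 ^ κ.1) *
            ofReal √(2 ^ κ.2.1) * ofReal √(2 ^ κ.2.2))) *
            (a κ.1 * a κ.2.1 * a κ.2.2) := by gcongr
        _ = _ := by ring
    · rw [ENNReal.tsum_mul_left, tsum_prod_prod fun j => ofReal √(2 ^ j) * a j]
      finiteness
    · simp only [hI]
      have hb : ∀ i, (![a κ.1, a κ.2.1, a κ.2.2] : Fin 3 → ℝ≥0∞) i <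
          (![a κ.1, a κ.2.1, a κ.2.2] : Fin 3 → ℝ≥0∞) i + 1 := fun i =>
        ENNReal.lt_add_right (hat' κ i) one_ne_zero
      refine (hP κ _ hb).tendsto_zero (fun i => add_ne_top.2 ⟨hat' κ i, ENNReal.one_ne_top⟩)
        (m := fun A => cutMult η κ (E A)) (fun A => (hEm A).cutMult κ)
        ofReal_ne_top hK0 (fun A => hcut A κ) (fun A => hcutK A κ) fun z => ?_
      filter_upwards [hE0 z] with A hA
      by_contra h
      exact (cutMult_support h).2 hA
  · have i1 := integrable_mul_triProd hU hR hUR (isMultiplier_truncMult η (k + 1) A)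
    have i2 := integrable_mul_triProd hU hR hUR (hEm A)
    obtain ⟨i3, e3⟩ := integral_truncMult η (k + 1) A hU i1
    have hsplit : ∫ x, energyMult η (k + 1) A x.2 * triProd U x ∂timeFreq α β =
        (∫ x, truncMult η (k + 1) A x.2 * triProd U x ∂timeFreq α β) +
        ∫ x, E A x.2 * triProd U x ∂timeFreq α β := by
      rw [← integral_add i1 i2]
      refine integral_congr_ae (.of_forall fun x => ?_)
      simp only [hE]; ring
    rw [hsplit]
    refine (enorm_add_le _ _).trans (add_le_add ?_ ?_)
    · have h3 : ‖∫ x, truncMult η (k + 1) A x.2 * triProd U x ∂timeFreq α β‖ₑ ≤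
          ‖∫ x, energyMultSym η (k + 1) A x.2 * triProd U x ∂timeFreq α β‖ₑ := by
        rw [e3, enorm_mul]
        refine le_mul_of_one_le_left' ?_
        rw [← ofReal_norm]
        simp
      refine h3.trans ((enorm_integral_le_tsum_triCut η (measurable_energyMultSym _ _ _) hU i3).trans
        ?_)
      rw [energySum, ← ENNReal.tsum_mul_left]
      refine tsum_le_tsum fun κ => ?_
      have hDk : (if k ≤ maxIndex κ then (D : ℝ≥0∞) else 0) ≠ ⊤ := by split_ifs <;> finiteness
      have hwt : ∀ n a b c, lowWeight n a b c ≠ ⊤ := fun n a b c => by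
        unfold lowWeight; split_ifs <;> finiteness
      have hw : tripleWeight (maxIndex κ) κ.1 κ.2.1 κ.2.2 ≠ ⊤ := by
        unfold tripleWeight
        exact add_ne_top.2 ⟨add_ne_top.2 ⟨hwt _ _ _ _, hwt _ _ _ _⟩, hwt _ _ _ _⟩
      have h1 := le_mul_of_forall_lt (c := C * (24300000 *
        (if k ≤ maxIndex κ then (D : ℝ≥0∞) else 0) *
        tripleWeight (maxIndex κ) κ.1 κ.2.1 κ.2.2)) (by finiteness) (hat' κ) fun b _ hb =>
        (hP κ b hb).le_tripleWeight (hmax κ) (isMultiplier_cutMult_energyMultSym η (k + 1) A κ)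
          (hD k A κ)
      refine h1.trans (le_of_eq ?_)
      simp only [Matrix.cons_val_zero, Matrix.cons_val_one, Matrix.cons_val, tripleNorm]
      push_cast
      split_ifs <;> ring
    · refine (enorm_integral_le_tsum_triCut η (hEm A).measurable hU i2).trans (le_of_eq ?_)
      exact tsum_congr fun κ => (hI _ _).symm

lemma mul_le_sq_add_sq (x y : ℝ≥0∞) : x * y ≤ x ^ 2 + y ^ 2 := by
  rcases le_total x y with h | h
  · exact ((mul_le_mul' h le_rfl).trans (le_of_eq (sq y).symm)).trans le_add_self
  · exact ((mul_le_mul' le_rfl h).trans (le_of_eq (sq x).symm)).trans le_self_add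

lemma sq_rpow_half (y : ℝ≥0∞) : (y ^ (1 / 2 : ℝ)) ^ 2 = y := by
  rw [← rpow_natCast, ← rpow_mul]; norm_num

/-- The indicator of comparable dyadic indices. -/
def near (b c : ℕ) : ℝ≥0∞ := if b ≤ c + 2 ∧ c ≤ b + 2 then 1 else 0

lemma tsum_near_le (b : ℕ) : ∑' c : ℕ, near b c ≤ 5 := by
  unfold near
  rw [tsum_eq_sum (s := Finset.Icc (b - 2) (b + 2)) fun c hc => ?_]
  · calc ∑ c ∈ Finset.Icc (b - 2) (b + 2), (if b ≤ c + 2 ∧ c ≤ b + 2 then 1 else 0 : ℝ≥0∞)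
        ≤ ∑ c ∈ Finset.Icc (b - 2) (b + 2), 1 := Finset.sum_le_sum fun c _ => by split_ifs <;> simp
      _ = ((b + 2 + 1 - (b - 2) : ℕ) : ℝ≥0∞) := by simp
      _ ≤ 5 := by exact_mod_cast (by omega : b + 2 + 1 - (b - 2) ≤ 5)
  · rw [Finset.mem_Icc] at hc
    rw [if_neg (by omega)]

lemma tsum_near_mul_le (f : ℕ → ℝ≥0∞) : ∑' b : ℕ, ∑' c : ℕ, near b c * (f b * f c) ≤
      10 * ∑' b, f b ^ 2 := by
  have h1 : ∑' b : ℕ, ∑' c : ℕ, near b c * f b ^ 2 ≤ 5 * ∑' b, f b ^ 2 := by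
    rw [← ENNReal.tsum_mul_left]
    refine tsum_le_tsum fun b => ?_
    rw [ENNReal.tsum_mul_right]
    exact mul_le_mul' (tsum_near_le b) le_rfl
  have h2 : ∑' b : ℕ, ∑' c : ℕ, near b c * f c ^ 2 ≤ 5 * ∑' b, f b ^ 2 := by
    rw [ENNReal.tsum_comm]
    refine le_trans (le_of_eq ?_) h1
    refine tsum_congr fun b => tsum_congr fun c => ?_
    simp only [near, and_comm]
  calc _ ≤ ∑' b : ℕ, ∑' c : ℕ, (near b c * f b ^ 2 +
        near b c * f c ^ 2) := by
        refine tsum_le_tsum fun b => tsum_le_tsum fun c => ?_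
        rw [← mul_add]
        exact mul_le_mul' le_rfl (mul_le_sq_add_sq _ _)
    _ = _ := by simp only [ENNReal.tsum_add]
    _ ≤ 5 * ∑' b, f b ^ 2 + 5 * ∑' b, f b ^ 2 := add_le_add h1 h2
    _ = _ := by ring

lemma tsum_pow_le {r : ℝ≥0∞} (hr : 2 ≤ r) (n : ℕ) :
    ∑' k : ℕ, r ^ (k + 1) * (if k ≤ n then 1 else 0) ≤ 2 * r ^ (n + 1) := by
  rw [tsum_eq_sum (s := Finset.range (n + 1)) fun c hc => by
    rw [Finset.mem_range] at hc; rw [if_neg (by omega), mul_zero]]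
  have h : ∀ n : ℕ, ∑ k ∈ Finset.range (n + 1), r ^ (k + 1) ≤ 2 * r ^ (n + 1) := by
    intro n
    induction n with
    | zero => simp only [zero_add, Finset.range_one, Finset.sum_singleton, pow_one]
              exact le_mul_of_one_le_left' (by norm_num)
    | succ n ih =>
      rw [Finset.sum_range_succ, two_mul (r ^ (n + 1 + 1))]
      refine add_le_add (ih.trans ?_) le_rfl
      rw [pow_succ r (n + 1), mul_comm]
      exact mul_le_mul' le_rfl hr
  refine le_trans (Finset.sum_le_sum fun k _ => ?_) (h n)
  split_ifs <;> simp

/-- The sum over all frequency interactions in which the first frequency is the low one. -/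
lemma tsum_lowWeight_le {ρ : ℝ≥0∞} (hρ : 1 ≤ ρ) (a : ℕ → ℝ≥0∞) :
    ∑' κ : ℕ × ℕ × ℕ, (ρ ^ 2) ^ (maxIndex κ) * (lowWeight (maxIndex κ) κ.1 κ.2.1 κ.2.2 *
      tripleNorm a κ) ≤
      10 * ρ ^ 4 * ((∑' k, ofReal √(2 ^ k) * a k) * ∑' k, (ρ ^ 2) ^ k * a k ^ 2) := by
  have hle : ∀ κ : ℕ × ℕ × ℕ, (ρ ^ 2) ^ (maxIndex κ) *
      (lowWeight (maxIndex κ) κ.1 κ.2.1 κ.2.2 * tripleNorm a κ) ≤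
      ρ ^ 4 * ((ofReal √(2 ^ κ.1) * a κ.1) * (near κ.2.1 κ.2.2 *
          ((ρ ^ κ.2.1 * a κ.2.1) * (ρ ^ κ.2.2 * a κ.2.2)))) := by
    intro κ
    unfold lowWeight
    by_cases h : maxIndex κ ≤ κ.2.1 + 2 ∧ maxIndex κ ≤ κ.2.2 + 2
    · have h1 : κ.2.1 ≤ κ.2.2 + 2 ∧ κ.2.2 ≤ κ.2.1 + 2 := by unfold maxIndex at h; omega
      rw [if_pos h, near, if_pos h1, tripleNorm]
      have h2 : (ρ ^ 2) ^ maxIndex κ ≤ ρ ^ (κ.2.1 + 2) * ρ ^ (κ.2.2 + 2) := by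
        rw [← pow_mul, two_mul, pow_add]
        exact mul_le_mul' (pow_le_pow_right₀ hρ h.1) (pow_le_pow_right₀ hρ h.2)
      refine (mul_le_mul' h2 le_rfl).trans (le_of_eq ?_)
      ring
    · rw [if_neg h]; simp
  refine (tsum_le_tsum hle).trans ?_
  rw [ENNReal.tsum_mul_left, ENNReal.tsum_prod' (f := fun κ : ℕ × ℕ × ℕ =>
    (ofReal √(2 ^ κ.1) * a κ.1) * (near κ.2.1 κ.2.2 *
          ((ρ ^ κ.2.1 * a κ.2.1) * (ρ ^ κ.2.2 * a κ.2.2))))]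
  simp only [ENNReal.tsum_mul_left, ENNReal.tsum_mul_right]
  rw [ENNReal.tsum_prod' (f := fun κ : ℕ × ℕ =>
    near κ.1 κ.2 * ((ρ ^ κ.1 * a κ.1) * (ρ ^ κ.2 * a κ.2)))]
  refine (mul_le_mul' le_rfl (mul_le_mul' le_rfl
    (tsum_near_mul_le fun b => ρ ^ b * a b))).trans (le_of_eq ?_)
  simp only [mul_pow, ← pow_mul, mul_comm 2]
  ring

/-- The sum of all trilinear contributions. -/
lemma tsum_energySum_le {ρ : ℝ≥0∞} (hρ1 : 1 ≤ ρ) (hρ : 2 ≤ ρ ^ 2) (a : ℕ → ℝ≥0∞) :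
    ∑' k : ℕ, (ρ ^ 2) ^ (k + 1) * energySum a k ≤
      60 * ρ ^ 6 * ((∑' k, ofReal √(2 ^ k) * a k) * ∑' k, (ρ ^ 2) ^ k * a k ^ 2) := by
  set Q := 10 * ρ ^ 4 * ((∑' k, ofReal √(2 ^ k) * a k) * ∑' k, (ρ ^ 2) ^ k * a k ^ 2) with hQ
  have h1 : ∑' k : ℕ, (ρ ^ 2) ^ (k + 1) * energySum a k ≤ 2 * ρ ^ 2 * ∑' κ : ℕ × ℕ × ℕ,
      (ρ ^ 2) ^ (maxIndex κ) *
      (tripleWeight (maxIndex κ) κ.1 κ.2.1 κ.2.2 * tripleNorm a κ) := by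
    simp only [energySum, ← ENNReal.tsum_mul_left]
    rw [ENNReal.tsum_comm]
    refine tsum_le_tsum fun κ => ?_
    simp only [← mul_assoc]
    simp only [ENNReal.tsum_mul_right]
    refine mul_le_mul' (mul_le_mul' ((tsum_pow_le hρ _).trans (le_of_eq ?_)) le_rfl) le_rfl
    ring
  have s1 := tsum_lowWeight_le hρ1 a
  have s2 : ∑' κ : ℕ × ℕ × ℕ, (ρ ^ 2) ^ (maxIndex κ) * (lowWeight (maxIndex κ) κ.2.1 κ.1 κ.2.2 *
      tripleNorm a κ) ≤ Q := by
    refine le_trans (le_of_eq ?_) s1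
    rw [← Equiv.tsum_eq (⟨fun κ => (κ.2.1, κ.1, κ.2.2), fun κ => (κ.2.1, κ.1, κ.2.2),
      fun _ => rfl, fun _ => rfl⟩ : ℕ × ℕ × ℕ ≃ ℕ × ℕ × ℕ)]
    refine tsum_congr fun κ => ?_
    have e : maxIndex (κ.2.1, κ.1, κ.2.2) = maxIndex κ   := by simp only [maxIndex]; omega
    simp only [Equiv.coe_fn_mk, e, tripleNorm]
    ring
  have s3 : ∑' κ : ℕ × ℕ × ℕ, (ρ ^ 2) ^ (maxIndex κ) * (lowWeight (maxIndex κ) κ.2.2 κ.2.1 κ.1 *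
      tripleNorm a κ) ≤ Q := by
    refine le_trans (le_of_eq ?_) s1
    rw [← Equiv.tsum_eq (⟨fun κ => (κ.2.2, κ.2.1, κ.1), fun κ => (κ.2.2, κ.2.1, κ.1),
      fun _ => rfl, fun _ => rfl⟩ : ℕ × ℕ × ℕ ≃ ℕ × ℕ × ℕ)]
    refine tsum_congr fun κ => ?_
    have e : maxIndex (κ.2.2, κ.2.1, κ.1) = maxIndex κ   := by simp only [maxIndex]; omega
    simp only [Equiv.coe_fn_mk, e, tripleNorm]
    ring
  refine h1.trans ?_
  simp only [tripleWeight, add_mul, mul_add, ENNReal.tsum_add]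
  refine (add_le_add (add_le_add (mul_le_mul' le_rfl s1) (mul_le_mul' le_rfl s2))
    (mul_le_mul' le_rfl s3)).trans (le_of_eq ?_)
  rw [hQ]
  ring

lemma tsum_mul_sq_le (f g : ℕ → ℝ≥0∞) :
    (∑' k, f k * g k) ^ 2 ≤ (∑' k, f k ^ 2) * ∑' k, g k ^ 2 := by
  simp only [← lintegral_count]
  exact lintegral_mul_sq_le (measurable_from_top.aemeasurable) (measurable_from_top.aemeasurable)

/-- The low regularity norm controls the weighted sum of the dyadic norms. -/
lemma exists_tsum_sqrt_le {ε : ℝ} (hε : 0 < ε) : ∃ C : ℝ≥0, ∀ a : ℕ → ℝ≥0∞,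
    ∑' k, ofReal √(2 ^ k) * a k ≤
      C * (∑' k : ℕ, (2 : ℝ≥0∞) ^ (2 * (1 / 2 + ε) * (k : ℝ)) * a k ^ (2 : ℝ)) ^ (1 / 2 : ℝ) := by
  set q : ℝ≥0∞ := 2 ^ (-(2 * ε)) with hq
  have hq1 : q < 1 := ENNReal.rpow_lt_one_of_one_lt_of_neg (by norm_num) (by linarith)
  have hG : ∑' k : ℕ, q ^ k ≠ ⊤ := by
    rw [ENNReal.tsum_geometric]
    exact ENNReal.inv_ne_top.2 (tsub_pos_of_lt hq1).ne'
  have hG' : (∑' k : ℕ, q ^ k) ^ (1 / 2 : ℝ) ≠ ⊤ := rpow_ne_top_of_nonneg (by norm_num) hG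
  refine ⟨((∑' k : ℕ, q ^ k) ^ (1 / 2 : ℝ)).toNNReal, fun a => ?_⟩
  rw [ENNReal.coe_toNNReal hG']
  refine le_of_sq_le_sq ?_
  rw [mul_pow, sq_rpow_half, sq_rpow_half]
  have e : ∀ k : ℕ, ofReal √(2 ^ k) * a k = 2 ^ (-ε * (k : ℝ)) *
      (2 ^ ((1 / 2 + ε) * (k : ℝ)) * a k) := by
    intro k
    rw [← mul_assoc, ← ENNReal.rpow_add _ _ (by norm_num) (by norm_num), ← ofReal_ofNat,
      ENNReal.ofReal_rpow_of_pos (by norm_num), Real.sqrt_eq_rpow, ← Real.rpow_natCast,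
      ← Real.rpow_mul (by norm_num)]
    congr 3
    ring
  simp only [e]
  refine (tsum_mul_sq_le _ _).trans (le_of_eq ?_)
  congr 1
  · refine tsum_congr fun k => ?_
    rw [hq, ← rpow_natCast, ← rpow_natCast, ← rpow_mul, ← rpow_mul]
    congr 1
    push_cast; ring
  · refine tsum_congr fun k => ?_
    rw [mul_pow, rpow_two, ← rpow_natCast, ← rpow_mul]
    congr 2
    push_cast; ring

/-! ### Dyadic pieces and Sobolev norms -/

lemma enorm_proj_sq (η : Cutoff) (k : ℕ) (φ : L2) : ‖proj η k φ‖ₑ ^ 2 =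
    ∫⁻ ζ, ofReal (η.dyadic k (freqX ζ) ^ 2) * ‖(𝓕 φ : L2) ζ‖ₑ ^ 2 := by
  have h : ‖proj η k φ‖ₑ = ‖(𝓕 (proj η k φ) : L2)‖ₑ := by
    rw [← ofReal_norm, ← ofReal_norm, Lp.norm_fourier_eq]
  rw [h, ← lintegral_enorm_sq]
  refine lintegral_congr_ae ?_
  filter_upwards [fourier_proj η k φ] with ζ hζ
  rw [hζ, enorm_mul, mul_pow, ofReal_pow (η.dyadic_nonneg _ _)]
  congr 2
  rw [← ofReal_norm, norm_real, norm_eq_abs, abs_of_nonneg (η.dyadic_nonneg _ _)]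

lemma sobolevNorm_sq (s : ℝ) (φ : L2) : sobolevNorm s φ ^ 2 =
    ∫⁻ ζ, ofReal ((1 + freqX ζ ^ 2) ^ s) * ‖(𝓕 φ : L2) ζ‖ₑ ^ 2 := by
  rw [sobolevNorm, eLpNorm_eq_lintegral_rpow_enorm_toReal (by norm_num) (by norm_num)]
  simp only [ENNReal.toReal_ofNat, ENNReal.rpow_ofNat]
  rw [sq_rpow_half]
  refine lintegral_congr fun ζ => ?_
  have h : (0 : ℝ) ≤ 1 + freqX ζ ^ 2 := by positivity
  rw [enorm_smul, mul_pow, ← ofReal_norm (_ : ℝ), norm_eq_abs,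
    abs_of_nonneg (Real.rpow_nonneg h _), ← ofReal_pow (Real.rpow_nonneg h _),
    ← Real.rpow_natCast, ← Real.rpow_mul h]
  norm_num

lemma tsum_proj_le (η : Cutoff) {s : ℝ} (hs : 0 ≤ s) (φ : L2) :
    ∑' k : ℕ, (2 : ℝ≥0∞) ^ (2 * s * (k : ℝ)) * ‖proj η k φ‖ₑ ^ 2 ≤
      ofReal (4 ^ s) * sobolevNorm s φ ^ 2 := by
  have hm : ∀ k : ℕ, AEMeasurable (fun ζ : Plane =>
      ofReal (η.dyadic k (freqX ζ) ^ 2) * ‖(𝓕 φ : L2) ζ‖ₑ ^ 2) := fun k => by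
    have h1 : Continuous freqX := by unfold freqX; fun_prop
    have h2 := (η.measurable_dyadic k).comp h1.measurable
    have h3 := (Lp.aestronglyMeasurable (𝓕 φ : L2)).enorm
    exact ((h2.pow_const 2).ennreal_ofReal.aemeasurable).mul (h3.pow_const 2)
  have hm' : AEMeasurable (fun ζ : Plane =>
      ofReal ((1 + freqX ζ ^ 2) ^ s) * ‖(𝓕 φ : L2) ζ‖ₑ ^ 2) := by
    have h1 : Measurable freqX := by
      have : Continuous freqX := by unfold freqX; fun_prop
      exact this.measurable
    have h3 := (Lp.aestronglyMeasurable (𝓕 φ : L2)).enorm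
    exact (by fun_prop : Measurable fun ζ : Plane =>
      ofReal ((1 + freqX ζ ^ 2) ^ s)).aemeasurable.mul (h3.pow_const 2)
  simp only [enorm_proj_sq, sobolevNorm_sq]
  rw [← lintegral_const_mul'' _ hm']
  have e : ∀ k : ℕ, (2 : ℝ≥0∞) ^ (2 * s * (k : ℝ)) * ∫⁻ ζ, ofReal (η.dyadic k (freqX ζ) ^ 2) *
      ‖(𝓕 φ : L2) ζ‖ₑ ^ 2 = ∫⁻ ζ, (2 : ℝ≥0∞) ^ (2 * s * (k : ℝ)) *
      (ofReal (η.dyadic k (freqX ζ) ^ 2) * ‖(𝓕 φ : L2) ζ‖ₑ ^ 2) := fun k =>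
    (lintegral_const_mul'' _ (hm k)).symm
  simp only [e]
  rw [← lintegral_tsum fun k => (hm k).const_mul _]
  refine lintegral_mono fun ζ => ?_
  simp only [← mul_assoc, ENNReal.tsum_mul_right]
  refine mul_le_mul' ?_ le_rfl
  rw [← mul_one (ofReal (4 ^ s) * _), ← η.tsum_ofReal_dyadic (freqX ζ), ← ENNReal.tsum_mul_left]
  refine tsum_le_tsum fun k => ?_
  set x := freqX ζ
  rw [← ofReal_ofNat, ENNReal.ofReal_rpow_of_pos (by norm_num),
    ← ofReal_mul (by positivity), ← ofReal_mul (by positivity),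
    ← ofReal_mul (by positivity)]
  refine ofReal_le_ofReal ?_
  by_cases h0 : η.dyadic k x = 0
  · rw [h0]; simp
  have hd0 := η.dyadic_nonneg k x
  have hd1 := η.dyadic_le_one k x
  have hk : (2 : ℝ) ^ (2 * s * (k : ℝ)) ≤ 4 ^ s * (1 + x ^ 2) ^ s := by
    have e1 : (2 : ℝ) ^ (2 * s * (k : ℝ)) = ((2 ^ k) ^ 2) ^ s := by
      rw [← pow_mul, ← Real.rpow_natCast, ← Real.rpow_mul (by norm_num)]
      congr 1; push_cast; ring
    rw [e1, ← Real.mul_rpow (by norm_num) (by positivity)]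
    refine Real.rpow_le_rpow (by positivity) ?_ hs
    rcases Nat.eq_zero_or_pos k with rfl | hk
    · nlinarith [sq_nonneg x]
    · have h1 := η.le_abs_of_dyadic_ne_zero hk h0
      have h2 : (0 : ℝ) < 2 ^ k := by positivity
      have h3 : (5 / 8 * 2 ^ k) ^ 2 ≤ |x| ^ 2 := pow_le_pow_left₀ (by positivity) h1 2
      rw [sq_abs] at h3
      nlinarith
  calc 2 ^ (2 * s * (k : ℝ)) * η.dyadic k x ^ 2
      ≤ 4 ^ s * (1 + x ^ 2) ^ s * (η.dyadic k x * 1) := by rw [sq]; gcongr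
    _ = _ := by ring

lemma SchwartzMap.exists_decay (γ : 𝓢(Plane, ℂ)) (N : ℕ) :
    ∃ C : ℝ, 0 ≤ C ∧ ∀ z, (1 + ‖z‖) ^ N * ‖γ z‖ ≤ C := by
  have h := fun z => SchwartzMap.one_add_le_sup_seminorm_apply (𝕜 := ℝ) (m := (N, 0)) (k := N)
    (n := 0) le_rfl le_rfl γ z
  simp only [norm_iteratedFDeriv_zero] at h
  exact ⟨_, (by positivity : (0 : ℝ) ≤ (1 + ‖(0 : Plane)‖) ^ N * ‖γ 0‖).trans (h 0), h⟩

lemma integrable_one_add_norm_inv : Integrable fun z : Plane => ((1 + ‖z‖) ^ 3)⁻¹ := by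
  have := integrable_one_add_norm (E := Plane) (μ := volume) (r := 3)
    (by rw [finrank_euclideanSpace_fin]; norm_num)
  refine this.congr (.of_forall fun z => ?_)
  simp only
  rw [Real.rpow_neg (by positivity)]
  norm_cast

lemma fourierInv_cutoff (X γ : 𝓢(Plane, ℂ)) (r : ℝ) (ζ : Plane) :
    𝓕⁻ (fun z => 𝓕⁻ (X : Plane → ℂ) (r • z) * 𝓕 (γ : Plane → ℂ) z) ζ =
      ∫ v, X v * γ (ζ + r • v) := by
  obtain ⟨G, hG⟩ : ∃ G : 𝓢(Plane, ℂ), G = 𝓕 γ := ⟨_, rfl⟩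
  have hG1 : 𝓕 (γ : Plane → ℂ) = G := by rw [hG, fourier_coe]
  have hG2 : ∀ w, 𝓕⁻ (G : Plane → ℂ) w = γ w := fun w => by
    rw [← fourierInv_coe, hG, FourierTransform.fourierInv_fourier_eq]
  have he : Continuous fun p : Plane × Plane =>
      ((fourierChar (inner ℝ p.1 (ζ + r • p.2)) : Circle) : ℂ) :=
    continuous_subtype_val.comp (Real.continuous_fourierChar.comp (by fun_prop))
  have hint : Integrable (fun p : Plane × Plane =>
      (fourierChar (inner ℝ p.1 (ζ + r • p.2)) : ℂ) * (G p.1 * X p.2))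
      (volume.prod volume) := by
    refine (Integrable.mul_prod G.integrable X.integrable).mono ?_
      (.of_forall fun p => by rw [norm_mul, Circle.norm_coe, one_mul])
    exact (he.mul (by fun_prop)).aestronglyMeasurable
  rw [hG1, fourierInv_eq]
  calc ∫ z, fourierChar (inner ℝ z ζ) • (𝓕⁻ (X : Plane → ℂ) (r • z) * G z)
      = ∫ z, ∫ v, (fourierChar (inner ℝ z (ζ + r • v)) : ℂ) * (G z * X v) := by
        refine integral_congr_ae (.of_forall fun z => ?_)
        simp only [fourierInv_eq, Circle.smul_def, smul_eq_mul]
        rw [← integral_mul_const, ← integral_const_mul]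
        refine integral_congr_ae (.of_forall fun v => ?_)
        simp only [inner_add_right, inner_smul_right, AddChar.map_add_eq_mul, Circle.coe_mul,
          real_inner_comm]
        ring
    _ = ∫ v, ∫ z, (fourierChar (inner ℝ z (ζ + r • v)) : ℂ) * (G z * X v) :=
        integral_integral_swap hint
    _ = ∫ v, X v * γ (ζ + r • v) := by
        refine integral_congr_ae (.of_forall fun v => ?_)
        simp only [← hG2, fourierInv_eq, Circle.smul_def, smul_eq_mul]
        rw [← integral_const_mul]
        refine integral_congr_ae (.of_forall fun z => ?_)
        simp only
        ring

/-- A function of polynomial growth that is orthogonal to the inverse Fourier transforms of all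
test functions vanishes. -/
lemma ae_eq_zero_of_fourierInv {S : Plane → ℂ} (hS : Measurable S) {N : ℕ}
    (hSi : Integrable fun ζ => ((1 + ‖ζ‖) ^ N)⁻¹ * ‖S ζ‖)
    (h : ∀ b : Plane → ℝ, ContDiff ℝ ∞ b → HasCompactSupport b →
      ∫ ζ, 𝓕⁻ (fun z => (b z : ℂ)) ζ * S ζ = 0) : ∀ᵐ ζ, S ζ = 0 := by
  have hdom : ∀ (B : Plane → ℂ), Continuous B → ∀ C : ℝ, (∀ z, (1 + ‖z‖) ^ N * ‖B z‖ ≤ C) →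
      (∀ z, ‖B z * S z‖ ≤ C * (((1 + ‖z‖) ^ N)⁻¹ * ‖S z‖)) ∧ Integrable fun z => B z * S z := by
    intro B hB C hC
    have h1 : ∀ z, ‖B z * S z‖ ≤ C * (((1 + ‖z‖) ^ N)⁻¹ * ‖S z‖) := by
      intro z
      have h2 : ‖B z‖ ≤ C * ((1 + ‖z‖) ^ N)⁻¹ := by
        rw [← div_eq_mul_inv, le_div_iff₀ (by positivity), mul_comm]
        exact hC z
      rw [norm_mul, ← mul_assoc]
      gcongr
    refine ⟨h1, (hSi.const_mul C).mono' (hB.measurable.mul hS).aestronglyMeasurable (.of_forall h1)⟩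
  have hcomplex : ∀ B₁ B₂ : 𝓢(Plane, ℂ), (∃ b : Plane → ℝ, ContDiff ℝ ∞ b ∧
      HasCompactSupport b ∧ ∀ z, B₁ z = b z) → (∃ b : Plane → ℝ, ContDiff ℝ ∞ b ∧
      HasCompactSupport b ∧ ∀ z, B₂ z = b z) →
      ∫ ζ, 𝓕⁻ (fun z => B₁ z + I * B₂ z) ζ * S ζ = 0 := by
    rintro B₁ B₂ ⟨b₁, h1, h2, h3⟩ ⟨b₂, h4, h5, h6⟩
    have e : ∀ ζ, 𝓕⁻ (fun z => B₁ z + I * B₂ z) ζ =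
        𝓕⁻ (B₁ : Plane → ℂ) ζ + I * 𝓕⁻ (B₂ : Plane → ℂ) ζ := by
      intro ζ
      have := congrFun (fourierInv_coe (B₁ + I • B₂)) ζ
      have e2 : (𝓕⁻ (B₁ + I • B₂) : 𝓢(Plane, ℂ)) = 𝓕⁻ B₁ + I • 𝓕⁻ B₂ := by
        rw [FourierTransform.fourierInv_add, FourierTransform.fourierInv_smul]
      rw [e2] at this
      rw [← fourierInv_coe, ← fourierInv_coe]
      exact this.symm
    have hB : ∀ B : 𝓢(Plane, ℂ), Integrable fun z => 𝓕⁻ (B : Plane → ℂ) z * S z := by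
      intro B
      obtain ⟨C, _, hC⟩ := SchwartzMap.exists_decay (𝓕⁻ B) N
      rw [← fourierInv_coe]
      exact (hdom _ (𝓕⁻ B : 𝓢(Plane, ℂ)).continuous C hC).2
    have z1 := h b₁ h1 h2
    have z2 := h b₂ h4 h5
    simp only [← h3] at z1
    simp only [← h6] at z2
    simp only [e, add_mul, mul_assoc]
    rw [integral_add (hB B₁) ((hB B₂).const_mul _), integral_const_mul]
    erw [z1, z2]
    simp
  obtain ⟨χ, hχs, hχc, hχ0⟩ : ∃ χ : Plane → ℝ, ContDiff ℝ ∞ χ ∧ HasCompactSupport χ ∧ χ 0 = 1 := by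
    let f : ContDiffBump (0 : Plane) := ⟨1, 2, by norm_num, by norm_num⟩
    exact ⟨f, f.contDiff, f.hasCompactSupport, f.one_of_mem_closedBall (by simp [f])⟩
  have hχC : ContDiff ℝ ∞ fun z => (χ z : ℂ) := ofRealCLM.contDiff.comp hχs
  have hχCc : HasCompactSupport fun z => (χ z : ℂ) := hχc.comp_left (g := fun x : ℝ => (x : ℂ)) rfl
  obtain ⟨X, hX⟩ : ∃ X : 𝓢(Plane, ℂ), X = 𝓕 (hχCc.toSchwartzMap hχC) := ⟨_, rfl⟩
  have hXχ : ∀ z, 𝓕⁻ (X : Plane → ℂ) z = χ z := fun z => by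
    rw [← fourierInv_coe, hX, FourierTransform.fourierInv_fourier_eq]
    rfl
  have hXint : ∫ v, X v = 1 := by
    have := hXχ 0
    rw [fourierInv_eq, hχ0] at this
    simpa using this
  have hloc : LocallyIntegrable S := by
    refine (locallyIntegrable_iff.2 fun K hK => ?_)
    obtain ⟨D, hD⟩ := hK.isBounded.exists_norm_le
    have h1 := (hSi.const_mul ((1 + |D|) ^ N)).integrableOn (s := K)
    refine h1.mono' hS.aestronglyMeasurable.restrict
      ((ae_restrict_iff' hK.measurableSet).2 (.of_forall fun z hz => ?_))
    have h2 : (1 + ‖z‖) ^ N ≤ (1 + |D|) ^ N := by gcongr; exact (hD z hz).trans (le_abs_self D)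
    rw [← mul_assoc]
    refine le_mul_of_one_le_left (norm_nonneg _) ?_
    rw [← div_eq_mul_inv, one_le_div (by positivity)]
    exact h2
  refine ae_eq_zero_of_integral_contDiff_smul_eq_zero hloc fun g hg hgc => ?_
  have hgC : ContDiff ℝ ∞ fun z => (g z : ℂ) := ofRealCLM.contDiff.comp hg
  have hgCc : HasCompactSupport fun z => (g z : ℂ) := hgc.comp_left (g := fun x : ℝ => (x : ℂ)) rfl
  obtain ⟨γ, hγ⟩ : ∃ γ : 𝓢(Plane, ℂ), ∀ z, γ z = g z := ⟨hgCc.toSchwartzMap hgC, fun _ => rfl⟩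
  obtain ⟨G, hG⟩ : ∃ G : 𝓢(Plane, ℂ), (G : Plane → ℂ) = 𝓕 (γ : Plane → ℂ) := ⟨𝓕 γ, fourier_coe γ⟩
  set r : ℕ → ℝ := fun j => 1 / ((j : ℝ) + 1) with hr
  have hr0 : ∀ j, 0 ≤ r j := fun j => by positivity
  have hr1 : ∀ j, r j ≤ 1 := fun j => by
    rw [hr]; simp only
    rw [div_le_one (by positivity)]
    linarith [Nat.cast_nonneg (α := ℝ) j]
  have hzero : ∀ j, ∫ ζ, (∫ v, X v * γ (ζ + r j • v)) * S ζ = 0 := by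
    intro j
    have hc1 : HasCompactSupport fun z : Plane => χ (r j • z) :=
      hχc.comp_smul (by simp only [hr]; positivity)
    have hs1 : ContDiff ℝ ∞ fun z : Plane => χ (r j • z) := hχs.comp (by fun_prop)
    have hGs : ContDiff ℝ ∞ (G : Plane → ℂ) := G.smooth ⊤
    have key : ∀ L : ℂ →L[ℝ] ℝ, ∃ B : 𝓢(Plane, ℂ), (∀ z, B z = ((χ (r j • z) * L (G z) : ℝ) : ℂ)) ∧
        ∃ b : Plane → ℝ, ContDiff ℝ ∞ b ∧ HasCompactSupport b ∧ ∀ z, B z = b z := by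
      intro L
      have hs2 : ContDiff ℝ ∞ fun z => χ (r j • z) * L (G z) := hs1.mul (L.contDiff.comp hGs)
      have hc2 : HasCompactSupport fun z => χ (r j • z) * L (G z) := hc1.mul_right
      have hs3 : ContDiff ℝ ∞ fun z => ((χ (r j • z) * L (G z) : ℝ) : ℂ) :=
        ofRealCLM.contDiff.comp hs2
      have hc3 : HasCompactSupport fun z => ((χ (r j • z) * L (G z) : ℝ) : ℂ) :=
        hc2.comp_left (g := fun x : ℝ => (x : ℂ)) rfl
      exact ⟨hc3.toSchwartzMap hs3, fun _ => rfl, _, hs2, hc2, fun _ => rfl⟩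
    obtain ⟨B₁, e1, h1⟩ := key reCLM
    obtain ⟨B₂, e2, h2⟩ := key Complex.imCLM
    have := hcomplex B₁ B₂ h1 h2
    have e3 : (fun z => B₁ z + I * B₂ z) =
        fun z => 𝓕⁻ (X : Plane → ℂ) (r j • z) * 𝓕 (γ : Plane → ℂ) z := by
      funext z
      rw [e1, e2, hXχ, ← hG]
      simp only [Complex.reCLM_apply, Complex.imCLM_apply]
      push_cast
      conv_rhs => rw [← Complex.re_add_im (G z)]
      ring
    rw [e3] at this
    simpa only [fourierInv_cutoff] using this
  obtain ⟨Cγ, hCγ0, hCγ⟩ := SchwartzMap.exists_decay γ N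
  obtain ⟨CX, hCX0, hCX⟩ := SchwartzMap.exists_decay X (N + 3)
  have hXN : Integrable fun v => ‖X v‖ * (1 + ‖v‖) ^ N := by
    refine (integrable_one_add_norm_inv.const_mul CX).mono' (by fun_prop) (.of_forall fun v => ?_)
    rw [norm_of_nonneg (by positivity), ← div_eq_mul_inv, le_div_iff₀ (by positivity)]
    refine le_trans (le_of_eq ?_) (hCX v)
    rw [pow_add]; ring
  have hbound : ∀ j ζ v, (1 + ‖ζ‖) ^ N * ‖γ (ζ + r j • v)‖ ≤ Cγ * (1 + ‖v‖) ^ N := by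
    intro j ζ v
    have h1 : 1 + ‖ζ‖ ≤ (1 + ‖ζ + r j • v‖) * (1 + ‖v‖) := by
      have h2 : ‖ζ‖ ≤ ‖ζ + r j • v‖ + ‖v‖ := by
        calc ‖ζ‖ = ‖(ζ + r j • v) - r j • v‖ := by rw [add_sub_cancel_right]
          _ ≤ ‖ζ + r j • v‖ + ‖r j • v‖ := norm_sub_le _ _
          _ ≤ _ := by
            rw [norm_smul, norm_of_nonneg (hr0 j)]
            gcongr
            exact mul_le_of_le_one_left (norm_nonneg _) (hr1 j)
      nlinarith [norm_nonneg (ζ + r j • v), norm_nonneg v]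
    calc (1 + ‖ζ‖) ^ N * ‖γ (ζ + r j • v)‖
        ≤ ((1 + ‖ζ + r j • v‖) * (1 + ‖v‖)) ^ N * ‖γ (ζ + r j • v)‖ := by gcongr
      _ = ((1 + ‖ζ + r j • v‖) ^ N * ‖γ (ζ + r j • v)‖) * (1 + ‖v‖) ^ N := by rw [mul_pow]; ring
      _ ≤ _ := by gcongr; exact hCγ _
  have hlim : Tendsto (fun j => ∫ ζ, (∫ v, X v * γ (ζ + r j • v)) * S ζ) atTop
      (𝓝 (∫ ζ, γ ζ * S ζ)) := by
    set D := Cγ * ∫ v, ‖X v‖ * (1 + ‖v‖) ^ N with hD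
    have hDb : ∀ j ζ, (1 + ‖ζ‖) ^ N * ‖∫ v, X v * γ (ζ + r j • v)‖ ≤ D := by
      intro j ζ
      rw [hD, ← integral_const_mul, ← norm_of_nonneg (by positivity : 0 ≤ (1 + ‖ζ‖) ^ N),
        ← norm_smul, ← integral_smul]
      refine norm_integral_le_of_norm_le (hXN.const_mul Cγ) (.of_forall fun v => ?_)
      rw [norm_smul, norm_of_nonneg (by positivity), norm_mul]
      calc (1 + ‖ζ‖) ^ N * (‖X v‖ * ‖γ (ζ + r j • v)‖)
          = ‖X v‖ * ((1 + ‖ζ‖) ^ N * ‖γ (ζ + r j • v)‖) := by ring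
        _ ≤ ‖X v‖ * (Cγ * (1 + ‖v‖) ^ N) := mul_le_mul_of_nonneg_left (hbound j ζ v) (norm_nonneg _)
        _ = _ := by ring
    obtain ⟨K, hK⟩ : ∃ K, ∀ z, ‖γ z‖ ≤ K := by
      obtain ⟨K, _, hK⟩ := SchwartzMap.exists_decay γ 0
      exact ⟨K, by simpa using hK⟩
    have hcont : ∀ j, Continuous fun ζ => ∫ v, X v * γ (ζ + r j • v) := by
      intro j
      refine continuous_of_dominated (fun ζ => by fun_prop)
        (fun ζ => .of_forall fun v => ?_) (X.integrable.norm.mul_const K)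
        (.of_forall fun v => by fun_prop)
      rw [norm_mul]
      gcongr
      exact hK _
    refine tendsto_integral_of_dominated_convergence _
      (fun j => ((hcont j).measurable.mul hS).aestronglyMeasurable) (hSi.const_mul D)
      (fun j => .of_forall fun ζ => (hdom _ (hcont j) D (hDb j)).1 ζ)
      (.of_forall fun ζ => ?_)
    refine Tendsto.mul_const _ ?_
    have : Tendsto (fun j => ∫ v, X v * γ (ζ + r j • v)) atTop (𝓝 (∫ v, X v * γ ζ)) := by
      refine tendsto_integral_of_dominated_convergence (fun v => ‖X v‖ * K)
        (fun j => by fun_prop) (X.integrable.norm.mul_const K)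
        (fun j => .of_forall fun v => by rw [norm_mul]; gcongr; exact hK _)
        (.of_forall fun v => ?_)
      refine Tendsto.const_mul _ ((γ.continuous.tendsto ζ).comp ?_)
      have h3 : Tendsto r atTop (𝓝 0) := tendsto_one_div_add_atTop_nhds_zero_nat
      simpa using (h3.smul_const v).const_add ζ
    rwa [integral_mul_const, hXint, one_mul] at this
  simp only [hzero] at hlim
  have := tendsto_nhds_unique hlim tendsto_const_nhds
  simpa [hγ, real_smul] using this

lemma integral_schwartz_mul (φ : L2) (h : 𝓢(Plane, ℂ)) :
    ∫ z, h z * φ z = ∫ ζ, 𝓕⁻ (h : Plane → ℂ) ζ * (𝓕 φ : L2) ζ := by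
  have h1 := congrArg (fun D => D (𝓕⁻ h)) (Lp.fourier_toTemperedDistribution_eq φ)
  simp only [TemperedDistribution.fourier_apply, FourierTransform.fourier_fourierInv_eq,
    Lp.toTemperedDistribution_apply, smul_eq_mul, fourierInv_coe] at h1
  exact h1

/-- The pairing `∫ φ ψ` on `L²`. -/
def pairing : L2 →L[ℂ] L2 →L[ℂ] ℂ := (ContinuousLinearMap.mul ℂ ℂ).lpPairing volume 2 2

lemma pairing_apply (φ ψ : L2) : pairing φ ψ = ∫ z, φ z * ψ z :=
  ContinuousLinearMap.lpPairing_eq_integral _ _ _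

/-- The reflected translate `w ↦ φ (ζ - w)`. -/
def reflect (ζ : Plane) (φ : L2) : L2 :=
  Lp.compMeasurePreserving (fun w => ζ - w) (Measure.measurePreserving_sub_left volume ζ) φ

lemma continuous_reflect (ζ : Plane) : Continuous (reflect ζ) :=
  (Lp.isometry_compMeasurePreserving _).continuous

lemma norm_reflect (ζ : Plane) (φ : L2) : ‖reflect ζ φ‖ = ‖φ‖ := Lp.norm_compMeasurePreserving _ _

lemma reflect_ae (ζ : Plane) (φ : L2) : ∀ᵐ w, reflect ζ φ w = φ (ζ - w) :=
  Lp.coeFn_compMeasurePreserving _ _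

/-- The convolution of `φ` with itself. -/
def convSelf (φ : L2) (ζ : Plane) : ℂ := ∫ w, φ w * φ (ζ - w)

lemma convSelf_eq (φ : L2) (ζ : Plane) : convSelf φ ζ = pairing φ (reflect ζ φ) := by
  rw [pairing_apply, convSelf]
  refine integral_congr_ae ?_
  filter_upwards [reflect_ae ζ φ] with w hw
  rw [hw]

lemma continuous_convSelf (ζ : Plane) : Continuous fun φ : L2 => convSelf φ ζ := by
  simp only [convSelf_eq]
  exact (pairing.continuous).clm_apply (continuous_reflect ζ)

lemma norm_convSelf_le (φ : L2) (ζ : Plane) : ‖convSelf φ ζ‖ ≤ ‖pairing‖ * ‖φ‖ ^ 2 := by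
  rw [convSelf_eq, sq, ← mul_assoc]
  simpa only [norm_reflect] using pairing.le_opNorm₂ φ (reflect ζ φ)

lemma convSelf_congr {φ : L2} {F : Plane → ℂ} (h : ∀ᵐ w, φ w = F w) (ζ : Plane) :
    convSelf φ ζ = ∫ w, F w * F (ζ - w) := by
  refine integral_congr_ae ?_
  filter_upwards [h, (Measure.measurePreserving_sub_left volume ζ).quasiMeasurePreserving.ae h]
    with w h1 h2
  rw [h1, h2]

lemma measurable_convSelf (φ : L2) : AEStronglyMeasurable (convSelf φ) volume := by
  obtain ⟨F, hF, hφ⟩ := (Lp.aestronglyMeasurable φ).aemeasurable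
  have : convSelf φ = fun ζ => ∫ w, F w * F (ζ - w) := funext (convSelf_congr hφ)
  rw [this]
  have hm : Measurable fun p : Plane × Plane => F p.2 * F (p.1 - p.2) :=
    (hF.comp measurable_snd).mul (hF.comp (measurable_fst.sub measurable_snd))
  exact hm.stronglyMeasurable.integral_prod_right.aestronglyMeasurable

lemma continuous_integral_mul_sq (h : 𝓢(Plane, ℂ)) :
    Continuous fun φ : L2 => ∫ z, h z * φ z ^ 2 := by
  have e : ∀ φ : L2, ∫ z, h z * φ z ^ 2 =
      pairing ((ContinuousLinearMap.mul ℂ ℂ).holderL volume ⊤ 2 2 (h.toLp ⊤) φ) φ := by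
    intro φ
    rw [pairing_apply]
    refine integral_congr_ae ?_
    filter_upwards [(ContinuousLinearMap.mul ℂ ℂ).coeFn_holder (r := 2) (h.toLp ⊤) φ,
      h.coeFn_toLp ⊤ volume] with z h1 h2
    rw [ContinuousLinearMap.holderL_apply_apply, h1, h2]
    simp only [ContinuousLinearMap.mul_apply']
    ring
  simp only [e]
  exact (pairing.continuous.comp (ContinuousLinearMap.continuous _)).clm_apply continuous_id

lemma continuous_integral_convSelf {B : Plane → ℂ} (hB : Integrable B) :
    Continuous fun φ : L2 => ∫ ζ, B ζ * convSelf φ ζ := by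
  refine continuous_iff_continuousAt.2 fun φ => ?_
  refine continuousAt_of_dominated (bound := fun ζ => ‖B ζ‖ * (‖pairing‖ * (‖φ‖ + 1) ^ 2))
    (.of_forall fun ψ => hB.aestronglyMeasurable.mul (measurable_convSelf ψ)) ?_
    (hB.norm.mul_const _)
    (.of_forall fun ζ => (continuous_const.mul (continuous_convSelf ζ)).continuousAt)
  have h1 : ∀ᶠ ψ in 𝓝 φ, ‖ψ‖ < ‖φ‖ + 1 :=
    (continuous_norm.tendsto φ).eventually (gt_mem_nhds (by linarith))
  filter_upwards [h1] with ψ hψ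
  refine .of_forall fun ζ => ?_
  rw [norm_mul]
  refine mul_le_mul_of_nonneg_left ((norm_convSelf_le ψ ζ).trans ?_) (norm_nonneg _)
  gcongr

lemma integral_schwartz_mul_sq (φ : L2) (h : 𝓢(Plane, ℂ)) :
    ∫ z, h z * φ z ^ 2 = ∫ ζ, 𝓕⁻ (h : Plane → ℂ) ζ * convSelf (𝓕 φ) ζ := by
  have hB : Integrable (𝓕⁻ (h : Plane → ℂ)) := by
    rw [← fourierInv_coe]
    exact (𝓕⁻ h : 𝓢(Plane, ℂ)).integrable
  refine DenseRange.induction_on (p := fun φ : L2 => ∫ z, h z * φ z ^ 2 =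
      ∫ ζ, 𝓕⁻ (h : Plane → ℂ) ζ * convSelf (𝓕 φ) ζ)
    (SchwartzMap.denseRange_toLpCLM (E := Plane) (F := ℂ) (p := 2) (μ := volume)
      ENNReal.ofNat_ne_top) φ
    (isClosed_eq (continuous_integral_mul_sq h) ((continuous_integral_convSelf hB).comp
      FourierTransform.continuous_fourier)) fun f => ?_
  obtain ⟨g, hg⟩ : ∃ g : 𝓢(Plane, ℂ), g = 𝓕 f := ⟨_, rfl⟩
  have hf : ∀ z, 𝓕⁻ (g : Plane → ℂ) z = f z := fun z => by
    rw [← fourierInv_coe, hg, FourierTransform.fourierInv_fourier_eq]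
  obtain ⟨c, hc⟩ : ∃ c : 𝓢(Plane, ℂ),
      c = SchwartzMap.convolution (ContinuousLinearMap.mul ℂ ℂ) g g := ⟨_, rfl⟩
  have hcc : ∀ ζ, convSelf (𝓕 (SchwartzMap.toLpCLM ℝ (E := Plane) ℂ 2 volume f)) ζ = c ζ := by
    intro ζ
    have h1 : (𝓕 (SchwartzMap.toLpCLM ℝ (E := Plane) ℂ 2 volume f) : L2) = g.toLp 2 := by
      rw [SchwartzMap.toLpCLM_apply, SchwartzMap.toLp_fourier_eq, hg]
    rw [h1, convSelf_congr (g.coeFn_toLp 2 volume), hc, SchwartzMap.convolution_apply]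
    rfl
  have hcf : ∀ z, (𝓕⁻ c : 𝓢(Plane, ℂ)) z = f z ^ 2 := by
    intro z
    have h1 := congrArg (fun w => w (-z))
      (SchwartzMap.fourier_convolution (ContinuousLinearMap.mul ℂ ℂ) g g)
    simp only [← hc, SchwartzMap.pairing_apply_apply, ContinuousLinearMap.mul_apply',
      fourier_coe] at h1
    rw [← Real.fourierInv_eq_fourier_neg, ← Real.fourierInv_eq_fourier_neg, hf] at h1
    rw [fourierInv_coe, h1, sq]
  simp only [hcc]
  have h2 := SchwartzMap.integral_fourierInv_mul_eq h c
  simp only [hcf, fourierInv_coe h] at h2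
  rw [h2]
  refine integral_congr_ae ?_
  filter_upwards [f.coeFn_toLp 2 volume] with z hz
  rw [SchwartzMap.toLpCLM_apply, hz]

lemma exists_primitive {f : ℝ → ℝ} (hf : ContDiff ℝ ∞ f) {r : ℝ}
    (hs : ∀ x, r < |x| → f x = 0) (h0 : ∫ x, f x = 0) :
    ∃ a : ℝ → ℝ, ContDiff ℝ ∞ a ∧ (∀ x, HasDerivAt a (f x) x) ∧ ∀ x, r < |x| → a x = 0 := by
  have hd : ∀ x, HasDerivAt (fun x => ∫ y in (-|r| - 1)..x, f y) (f x) x := fun x =>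
    intervalIntegral.integral_hasDerivAt_right (hf.continuous.intervalIntegrable _ _)
      (hf.continuous.stronglyMeasurableAtFilter _ _) hf.continuous.continuousAt
  have hconst : ∀ x y, (∀ z ∈ uIoc x y, f z = 0) → ∫ z in x..y, f z = 0 := fun x y h => by
    rw [intervalIntegral.integral_congr_ae (g := fun _ => 0) (.of_forall fun z hz => h z hz)]
    simp
  refine ⟨_, ?_, hd, fun x hx => ?_⟩
  · rw [contDiff_infty_iff_deriv]
    refine ⟨fun x => (hd x).differentiableAt, ?_⟩
    rwa [show deriv (fun x => ∫ y in (-|r| - 1)..x, f y) = f from funext fun x => (hd x).deriv]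
  · rcases lt_abs.1 hx with h | h
    · have h1 : ∫ y in (-|r| - 1)..(|r| + |x|), f y = 0 := by
        rw [intervalIntegral.integral_eq_integral_of_support_subset, h0]
        intro y hy
        have : ¬ r < |y| := fun h' => hy (hs y h')
        have h2 := abs_le.1 ((not_lt.1 this).trans (le_abs_self r))
        exact ⟨by linarith [h2.1], by
          have := abs_pos.2 (show x ≠ 0 by
            rintro rfl
            have := (abs_nonneg y).trans (not_lt.1 this)
            linarith)
          linarith [h2.2]⟩
      have h2 : ∫ y in x..(|r| + |x|), f y = 0 := hconst _ _ fun z hz => by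
        rw [uIoc_of_le (by linarith [le_abs_self x, abs_nonneg r])] at hz
        exact hs z (lt_of_lt_of_le (h.trans hz.1) (le_abs_self z))
      rw [← intervalIntegral.integral_add_adjacent_intervals
        (hf.continuous.intervalIntegrable _ x) (hf.continuous.intervalIntegrable _ _), h2,
        add_zero] at h1
      exact h1
    · refine hconst _ _ fun z hz => hs z ?_
      have h1 : z ≤ max (-|r| - 1) x := hz.2
      rcases le_max_iff.1 h1 with h2 | h2
      · have := neg_le_abs z
        linarith [le_abs_self r]
      · have := neg_le_abs z
        linarith

lemma exists_radius {K : Set ℝ} (hK : IsCompact K) {T : ℝ} (hT : 0 < T) (h : K ⊆ Ioo (-T) T) :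
    ∃ r, 0 < r ∧ r < T ∧ ∀ x, r < |x| → x ∉ K := by
  rcases K.eq_empty_or_nonempty with rfl | hne
  · exact ⟨T / 2, by linarith, by linarith, fun _ _ => id⟩
  · obtain ⟨x, hx, hm⟩ := hK.exists_isMaxOn hne continuous_abs.continuousOn
    have hxT := abs_lt.2 (h hx)
    refine ⟨max |x| (T / 2), by positivity, max_lt hxT (by linarith), fun y hy hyK => ?_⟩
    exact absurd (hm hyK) (not_le.2 ((le_max_left _ _).trans_lt hy))

lemma compactSupport_of_radius {a : ℝ → ℝ} {r T : ℝ} (hr : r < T)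
    (h : ∀ x, r < |x| → a x = 0) : HasCompactSupport a ∧ tsupport a ⊆ Ioo (-T) T := by
  have h1 : Function.support a ⊆ Icc (-r) r := fun x hx =>
    abs_le.1 (not_lt.1 fun h' => hx (h x h'))
  have h2 : tsupport a ⊆ Icc (-r) r := closure_minimal h1 isClosed_Icc
  exact ⟨isCompact_Icc.of_isClosed_subset (isClosed_tsupport a) h2,
    h2.trans fun x hx => ⟨by linarith [hx.1], by linarith [hx.2]⟩⟩

/-- A continuous function whose distributional derivative on `(-T, T)` is continuous is a
primitive of it. -/
lemma sub_eq_integral_of_weak {P Q : ℝ → ℂ} (hP : Continuous P) (hQ : Continuous Q) {T : ℝ}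
    (hT : 0 < T) (h : ∀ a a' : ℝ → ℝ, ContDiff ℝ ∞ a → (∀ x, HasDerivAt a (a' x) x) →
      HasCompactSupport a → tsupport a ⊆ Ioo (-T) T → ∫ t, (a' t * P t + a t * Q t : ℂ) = 0) :
    ∀ t ∈ Icc (-T) T, P t - P 0 = ∫ s in (0 : ℝ)..t, Q s := by
  obtain ⟨R, hR⟩ : ∃ R : ℝ → ℂ, ∀ t, R t = P t - ∫ s in (0 : ℝ)..t, Q s := ⟨_, fun _ => rfl⟩
  have hG : ∀ t, HasDerivAt (fun t => ∫ s in (0 : ℝ)..t, Q s) (Q t) t := fun x =>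
    intervalIntegral.integral_hasDerivAt_right (hQ.intervalIntegrable _ _)
      (hQ.stronglyMeasurableAtFilter _ _) hQ.continuousAt
  have hGc : Continuous fun t => ∫ s in (0 : ℝ)..t, Q s :=
    continuous_iff_continuousAt.2 fun t => (hG t).continuousAt
  have hRc : Continuous R := by
    rw [show R = fun t => P t - ∫ s in (0 : ℝ)..t, Q s from funext hR]
    exact hP.sub hGc
  have hint : ∀ (a : ℝ → ℝ) (V : ℝ → ℂ), Continuous a → Continuous V → HasCompactSupport a →
      Integrable fun t => (a t : ℂ) * V t := fun a V ha hV hc =>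
    ((continuous_ofReal.comp ha).mul hV).integrable_of_hasCompactSupport
      ((hc.comp_left (g := fun x : ℝ => (x : ℂ)) rfl).mul_right)
  have hkey : ∀ (f : ℝ → ℝ) (r : ℝ), ContDiff ℝ ∞ f → r < T → (∀ x, r < |x| → f x = 0) →
      ∫ x, f x = 0 → ∫ t, (f t : ℂ) * R t = 0 := by
    intro f r hf hr hs h0
    obtain ⟨a, ha, had, has⟩ := exists_primitive hf hs h0
    obtain ⟨hc, hsub⟩ := compactSupport_of_radius hr has
    have hfc := (compactSupport_of_radius hr hs).1
    have e1 := h a f ha had hc hsub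
    have e2 : ∫ t, ((f t : ℂ) * (∫ s in (0 : ℝ)..t, Q s) + a t * Q t) = 0 :=
      integral_eq_zero_of_hasDerivAt_of_integrable (fun t => (had t).ofReal_comp.mul (hG t))
        ((hint f _ hf.continuous hGc hfc).add (hint a _ ha.continuous hQ hc))
        (hint a _ ha.continuous hGc hc)
    rw [integral_add (hint f _ hf.continuous hP hfc) (hint a _ ha.continuous hQ hc)] at e1
    rw [integral_add (hint f _ hf.continuous hGc hfc) (hint a _ ha.continuous hQ hc)] at e2
    simp only [hR, mul_sub]
    rw [integral_sub (hint f _ hf.continuous hP hfc) (hint f _ hf.continuous hGc hfc)]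
    linear_combination e1 - e2
  let f0 : ContDiffBump (0 : ℝ) := ⟨T / 4, T / 2, by linarith, by linarith⟩
  obtain ⟨a₀, ha₀s, ha₀0, ha₀1⟩ : ∃ a₀ : ℝ → ℝ, ContDiff ℝ ∞ a₀ ∧ (∀ x, T / 2 < |x| → a₀ x = 0) ∧
      ∫ x, a₀ x = 1 := by
    refine ⟨f0.normed volume, f0.contDiff_normed, fun x hx => ?_, f0.integral_normed⟩
    have : x ∉ Function.support (f0.normed volume) := by
      rw [f0.support_normed_eq]
      simp only [Metric.mem_ball, dist_zero_right, norm_eq_abs, f0]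
      exact not_lt.2 hx.le
    simpa using this
  set c : ℂ := ∫ t, (a₀ t : ℂ) * R t with hc
  have hae : ∀ᵐ t, t ∈ Ioo (-T) T → R t - c = 0 := by
    refine isOpen_Ioo.ae_eq_zero_of_integral_contDiff_smul_eq_zero
      ((hRc.sub continuous_const).locallyIntegrable.locallyIntegrableOn _) fun g hg hgc hgs => ?_
    obtain ⟨r, hr0, hrT, hr⟩ := exists_radius hgc hT hgs
    have hgz : ∀ x, r < |x| → g x = 0 := fun x hx => image_eq_zero_of_notMem_tsupport (hr x hx)
    have ha₀c := (compactSupport_of_radius (by linarith) ha₀0 : _ ∧ tsupport a₀ ⊆ Ioo (-T) T).1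
    have hgi : Integrable g := hg.continuous.integrable_of_hasCompactSupport hgc
    have hai : Integrable a₀ := ha₀s.continuous.integrable_of_hasCompactSupport ha₀c
    have e := hkey (fun x => g x - (∫ y, g y) * a₀ x) (max r (T / 2))
      (hg.sub (contDiff_const.mul ha₀s)) (max_lt hrT (by linarith))
      (fun x hx => by
        rw [hgz x ((le_max_left _ _).trans_lt hx), ha₀0 x ((le_max_right _ _).trans_lt hx)]
        simp)
      (by rw [integral_sub hgi (hai.const_mul _), integral_const_mul, ha₀1]; ring)
    have e2 : (fun t => ((g t - (∫ y, g y) * a₀ t : ℝ) : ℂ) * R t) = fun t =>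
        (g t : ℂ) * R t - ((∫ y, g y : ℝ) : ℂ) * ((a₀ t : ℂ) * R t) := by
      funext t; push_cast; ring
    rw [e2, integral_sub (hint g _ hg.continuous hRc hgc)
      ((hint a₀ _ ha₀s.continuous hRc ha₀c).const_mul _), integral_const_mul, ← hc] at e
    have e3 : (fun t => g t • (R t - c)) = fun t => (g t : ℂ) * R t - (g t : ℂ) * c := by
      funext t; rw [real_smul]; ring
    rw [e3, integral_sub (hint g _ hg.continuous hRc hgc)
      (hint g _ hg.continuous continuous_const hgc), integral_mul_const, integral_complex_ofReal]
    exact e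
  have heq : EqOn R (fun _ => c) (Ioo (-T) T) := by
    refine Measure.eqOn_open_of_ae_eq (μ := volume) ?_ isOpen_Ioo hRc.continuousOn
      continuousOn_const
    refine (ae_restrict_iff' measurableSet_Ioo).2 ?_
    filter_upwards [hae] with t ht hm
    exact sub_eq_zero.1 (ht hm)
  have heq2 : EqOn R (fun _ => c) (Icc (-T) T) := by
    have := heq.closure hRc continuous_const
    rwa [closure_Ioo (by linarith)] at this
  intro t ht
  have h1 := heq2 ht
  have h2 := heq2 (show (0 : ℝ) ∈ Icc (-T) T from ⟨by linarith, hT.le⟩)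
  have h3 : R t = R 0 := h1.trans h2.symm
  rw [hR, hR, intervalIntegral.integral_same] at h3
  linear_combination h3

open LineDeriv

lemma dirDeriv_space {a : ℝ → ℝ} {a' : ℝ → ℝ} (ha : ∀ x, HasDerivAt a (a' x) x)
    (B : 𝓢(Plane, ℂ)) (m : Plane) :
    dirDeriv (0, m) (fun p => a p.1 * (B p.2).re) = fun p => a p.1 * ((∂_{m} B) p.2).re := by
  funext p
  have h1 : HasFDerivAt (fun p : ℝ × Plane => a p.1)
      ((a' p.1) • ContinuousLinearMap.fst ℝ ℝ Plane) p :=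
    (ha p.1).comp_hasFDerivAt p hasFDerivAt_fst
  have h2 : HasFDerivAt (fun p : ℝ × Plane => (B p.2).re)
      ((reCLM.comp (fderiv ℝ B p.2)).comp (ContinuousLinearMap.snd ℝ ℝ Plane)) p :=
    (reCLM.hasFDerivAt.comp p.2 B.differentiableAt.hasFDerivAt).comp p hasFDerivAt_snd
  simp only [dirDeriv]
  have h3 : HasFDerivAt (fun p : ℝ × Plane => a p.1 * (B p.2).re) _ p := h1.mul h2
  rw [h3.fderiv]
  simp [SchwartzMap.lineDerivOp_apply_eq_fderiv]

lemma dirDeriv_time {a : ℝ → ℝ} {a' : ℝ → ℝ} (ha : ∀ x, HasDerivAt a (a' x) x) (B : 𝓢(Plane, ℂ)) :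
    dt (fun p => a p.1 * (B p.2).re) = fun p => a' p.1 * (B p.2).re := by
  funext p
  have h1 : HasFDerivAt (fun p : ℝ × Plane => a p.1)
      ((a' p.1) • ContinuousLinearMap.fst ℝ ℝ Plane) p :=
    (ha p.1).comp_hasFDerivAt p hasFDerivAt_fst
  have h2 : HasFDerivAt (fun p : ℝ × Plane => (B p.2).re)
      ((reCLM.comp (fderiv ℝ B p.2)).comp (ContinuousLinearMap.snd ℝ ℝ Plane)) p :=
    (reCLM.hasFDerivAt.comp p.2 B.differentiableAt.hasFDerivAt).comp p hasFDerivAt_snd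
  simp only [dt, dirDeriv]
  have h3 : HasFDerivAt (fun p : ℝ × Plane => a p.1 * (B p.2).re) _ p := h1.mul h2
  rw [h3.fderiv]
  simp [mul_comm]

lemma lineDeriv_im {B : 𝓢(Plane, ℂ)} (h : ∀ z, (B z).im = 0) (m z : Plane) :
    ((∂_{m} B) z).im = 0 := by
  have h2 : HasFDerivAt (fun z : Plane => (B z).im) (Complex.imCLM.comp (fderiv ℝ B z)) z :=
    Complex.imCLM.hasFDerivAt.comp z B.differentiableAt.hasFDerivAt
  simp only [h] at h2
  have h3 := h2.unique (hasFDerivAt_const (0 : ℝ) z)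
  have := congrArg (fun L => L m) h3
  simpa [SchwartzMap.lineDerivOp_apply_eq_fderiv] using this

/-- The unit vectors of the plane. -/
def ex : Plane := EuclideanSpace.single 0 1
def ey : Plane := EuclideanSpace.single 1 1

lemma fourierInv_lineDeriv (B : 𝓢(Plane, ℂ)) (m ζ : Plane) :
    𝓕⁻ ((∂_{m} B : 𝓢(Plane, ℂ)) : Plane → ℂ) ζ =
      -(2 * π * I) * ((inner ℝ ζ m : ℝ) : ℂ) * 𝓕⁻ (B : Plane → ℂ) ζ := by
  have h : (inner ℝ · m : Plane → ℝ).HasTemperateGrowth := by fun_prop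
  rw [← fourierInv_coe, SchwartzMap.fourierInv_lineDerivOp_eq,
    smul_apply, SchwartzMap.smulLeftCLM_apply_apply h, ← fourierInv_coe,
    smul_eq_mul, real_smul]
  ring

lemma fourierInv_dx (B : 𝓢(Plane, ℂ)) (ζ : Plane) : 𝓕⁻ ((∂_{ex} B : 𝓢(Plane, ℂ)) : Plane → ℂ) ζ =
      -I * freqX ζ * 𝓕⁻ (B : Plane → ℂ) ζ := by
  rw [fourierInv_lineDeriv, ex, EuclideanSpace.inner_single_right, freqX]
  simp only [conj_trivial, mul_one]
  push_cast
  ring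

lemma fourierInv_dy (B : 𝓢(Plane, ℂ)) (ζ : Plane) : 𝓕⁻ ((∂_{ey} B : 𝓢(Plane, ℂ)) : Plane → ℂ) ζ =
      -I * freqY ζ * 𝓕⁻ (B : Plane → ℂ) ζ := by
  rw [fourierInv_lineDeriv, ey, EuclideanSpace.inner_single_right, freqY]
  simp only [conj_trivial, mul_one]
  push_cast
  ring

open LineDeriv

lemma exists_continuous_extension {T : ℝ} (hT : 0 < T) {u : ℝ → L2} (hu : IsContinuousHInfty T u) :
    ∃ v : ℝ → L2, Continuous v ∧ ∀ t ∈ Icc (-T) T, v t = u t := by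
  have h0 : ∀ φ : L2, sobolevNorm 0 φ = ‖φ‖ₑ := by
    intro φ
    have h1 : ‖(𝓕 φ : L2)‖ₑ = ‖φ‖ₑ := by rw [← ofReal_norm, ← ofReal_norm, Lp.norm_fourier_eq]
    rw [← h1, Lp.enorm_def, sobolevNorm]
    simp
  have hc : ContinuousOn u (Icc (-T) T) := by
    intro t ht
    have h1 := (hu 0 le_rfl t ht).2
    simp only [h0] at h1
    rw [ContinuousWithinAt, tendsto_iff_edist_tendsto_0]
    simpa only [edist_eq_enorm_sub] using h1
  have hle : -T ≤ T := by linarith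
  refine ⟨IccExtend hle ((Icc (-T) T).domRestrict u),
    (continuousOn_iff_continuous_domRestrict.1 hc).Icc_extend', fun t ht => ?_⟩
  rw [IccExtend_of_mem hle _ ht]
  rfl

/-- The nonlinear symbol of the equation on the Fourier side. -/
def evolution (ζ : Plane) (a b : ℂ) : ℂ := (freqX ζ ^ 4 + freqY ζ ^ 2) * a - freqX ζ ^ 2 / 2 * b

lemma integrable_mul (φ : L2) (h : 𝓢(Plane, ℂ)) : Integrable fun z => h z * φ z := by
  have := MemLp.integrable_mul (h.memLp 2 volume) (Lp.memLp φ)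
  exact this

lemma continuous_integral_schwartz_mul (h : 𝓢(Plane, ℂ)) :
    Continuous fun φ : L2 => ∫ z, h z * φ z := by
  obtain ⟨g, hg⟩ : ∃ g : L2, ∀ᵐ z, g z = h z := 
    ⟨(h.memLp 2 volume).toLp h, (h.memLp 2 volume).coeFn_toLp⟩
  have e : ∀ φ : L2, ∫ z, h z * φ z = pairing g φ := fun φ => by
    rw [pairing_apply]
    refine integral_congr_ae ?_
    filter_upwards [hg] with z hz
    rw [hz]
  simp only [e]
  exact (pairing g).continuous

lemma integrable_mul_sq (h : 𝓢(Plane, ℂ)) (φ : L2) : Integrable fun z => h z * φ z ^ 2 := by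
  obtain ⟨K, hK0, hK⟩ := SchwartzMap.exists_decay h 0
  have h2 : Integrable fun z => φ z ^ 2 := by
    have := MemLp.integrable_mul (Lp.memLp φ) (Lp.memLp φ)
    simp only [sq]
    exact this
  exact h2.bdd_mul (c := K) h.continuous.aestronglyMeasurable
    (.of_forall fun z => by simpa using hK z)

set_option maxHeartbeats 1000000 in
lemma weak_fourier {T : ℝ} (hT : 0 < T) {u v : ℝ → L2} (hu : SolvesKPI T u) (hv : Continuous v)
    (huv : ∀ t ∈ Icc (-T) T, v t = u t) (B : 𝓢(Plane, ℂ)) (hB : ∀ z, (B z).im = 0)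
    (hBc : HasCompactSupport B) {t : ℝ} (ht : t ∈ Icc (-T) T) :
    (∫ ζ, 𝓕⁻ (B : Plane → ℂ) ζ * (-I * freqX ζ * (𝓕 (v t) : L2) ζ)) -
        ∫ ζ, 𝓕⁻ (B : Plane → ℂ) ζ * (-I * freqX ζ * (𝓕 (v 0) : L2) ζ) =
      ∫ s in (0 : ℝ)..t, ∫ ζ, 𝓕⁻ (B : Plane → ℂ) ζ *
        evolution ζ ((𝓕 (v s) : L2) ζ) (convSelf (𝓕 (v s)) ζ) := by
  obtain ⟨B1, hB1⟩ : ∃ D : 𝓢(Plane, ℂ), D = ∂_{ex} B := ⟨_, rfl⟩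
  obtain ⟨B2, hB2⟩ : ∃ D : 𝓢(Plane, ℂ), D = ∂_{ex} B1 := ⟨_, rfl⟩
  obtain ⟨B3, hB3⟩ : ∃ D : 𝓢(Plane, ℂ), D = ∂_{ex} B2 := ⟨_, rfl⟩
  obtain ⟨B4, hB4⟩ : ∃ D : 𝓢(Plane, ℂ), D = ∂_{ex} B3 := ⟨_, rfl⟩
  obtain ⟨C1, hC1⟩ : ∃ D : 𝓢(Plane, ℂ), D = ∂_{ey} B := ⟨_, rfl⟩
  obtain ⟨C2, hC2⟩ : ∃ D : 𝓢(Plane, ℂ), D = ∂_{ey} C1 := ⟨_, rfl⟩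
  have i1 : ∀ z, (B1 z).im = 0 := fun z => hB1 ▸ lineDeriv_im hB ex z
  have i2 : ∀ z, (B2 z).im = 0 := fun z => hB2 ▸ lineDeriv_im i1 ex z
  have i3 : ∀ z, (B3 z).im = 0 := fun z => hB3 ▸ lineDeriv_im i2 ex z
  have i4 : ∀ z, (B4 z).im = 0 := fun z => hB4 ▸ lineDeriv_im i3 ex z
  have j1 : ∀ z, (C1 z).im = 0 := fun z => hC1 ▸ lineDeriv_im hB ey z
  have j2 : ∀ z, (C2 z).im = 0 := fun z => hC2 ▸ lineDeriv_im j1 ey z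
  have f1 : ∀ ζ, 𝓕⁻ (B1 : Plane → ℂ) ζ = -I * freqX ζ * 𝓕⁻ (B : Plane → ℂ) ζ :=
    fun ζ => hB1 ▸ fourierInv_dx B ζ
  have f2 : ∀ ζ, 𝓕⁻ (B2 : Plane → ℂ) ζ = -freqX ζ ^ 2 * 𝓕⁻ (B : Plane → ℂ) ζ := fun ζ => by
    rw [hB2, fourierInv_dx, f1]
    linear_combination (freqX ζ ^ 2 * 𝓕⁻ (B : Plane → ℂ) ζ) * I_sq
  have f4 : ∀ ζ, 𝓕⁻ (B4 : Plane → ℂ) ζ = freqX ζ ^ 4 * 𝓕⁻ (B : Plane → ℂ) ζ := fun ζ => by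
    rw [hB4, fourierInv_dx, hB3, fourierInv_dx, f2]
    linear_combination (-freqX ζ ^ 4 * 𝓕⁻ (B : Plane → ℂ) ζ) * I_sq
  have g2 : ∀ ζ, 𝓕⁻ (C2 : Plane → ℂ) ζ = -freqY ζ ^ 2 * 𝓕⁻ (B : Plane → ℂ) ζ := fun ζ => by
    rw [hC2, fourierInv_dy, hC1, fourierInv_dy]
    linear_combination (freqY ζ ^ 2 * 𝓕⁻ (B : Plane → ℂ) ζ) * I_sq
  have hlin : ∀ h : 𝓢(Plane, ℂ), Continuous fun t => ∫ z, h z * v t z :=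
    fun h => (continuous_integral_schwartz_mul h).comp hv
  have hsq := integrable_mul_sq
  have hQlin : ∀ φ : L2, Integrable fun z => B4 z * φ z - C2 z * φ z := fun φ =>
    (integrable_mul φ B4).sub (integrable_mul φ C2)
  obtain ⟨Q, hQ⟩ : ∃ Q : ℝ → ℂ, ∀ t, Q t = (∫ z, B4 z * v t z) - (∫ z, C2 z * v t z) +
    (1 / 2) * ∫ z, B2 z * v t z ^ 2 := ⟨_, fun _ => rfl⟩
  have hQc : Continuous Q := by
    rw [show Q = fun t => _ from funext hQ]
    exact ((hlin B4).sub (hlin C2)).add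
      (continuous_const.mul ((continuous_integral_mul_sq B2).comp hv))
  have hmain := sub_eq_integral_of_weak (hlin B1) hQc hT (fun a a' ha had hac has => by
    have h1 := hu (fun p => a p.1 * (B p.2).re)
      ((ha.comp contDiff_fst).mul (reCLM.contDiff.comp (B.smooth ⊤ |>.comp contDiff_snd)))
      (by
        refine HasCompactSupport.intro (hac.isCompact.prod hBc.isCompact) fun p hp => ?_
        rw [mem_prod, not_and_or] at hp
        rcases hp with hp | hp
        · rw [image_eq_zero_of_notMem_tsupport hp, zero_mul]
        · rw [image_eq_zero_of_notMem_tsupport hp, Complex.zero_re, mul_zero])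
      (by
        have h2 : tsupport (fun p : ℝ × Plane => a p.1 * (B p.2).re) ⊆ tsupport a ×ˢ univ := by
          refine closure_minimal (fun p hp => ⟨?_, trivial⟩) ((isClosed_tsupport a).prod isClosed_univ)
          exact subset_closure (left_ne_zero_of_mul hp)
        exact h2.trans (prod_mono has subset_rfl))
    have d1 : dx (fun p => a p.1 * (B p.2).re) = fun p => a p.1 * (B1 p.2).re := by
      rw [hB1]; exact dirDeriv_space had B ex
    have d2 : dx (fun p => a p.1 * (B1 p.2).re) = fun p => a p.1 * (B2 p.2).re := by
      rw [hB2]; exact dirDeriv_space had B1 ex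
    have d3 : dx (fun p => a p.1 * (B2 p.2).re) = fun p => a p.1 * (B3 p.2).re := by
      rw [hB3]; exact dirDeriv_space had B2 ex
    have d4 : dx (fun p => a p.1 * (B3 p.2).re) = fun p => a p.1 * (B4 p.2).re := by
      rw [hB4]; exact dirDeriv_space had B3 ex
    have e1 : dy (fun p => a p.1 * (B p.2).re) = fun p => a p.1 * (C1 p.2).re := by
      rw [hC1]; exact dirDeriv_space had B ey
    have e2 : dy (fun p => a p.1 * (C1 p.2).re) = fun p => a p.1 * (C2 p.2).re := by
      rw [hC2]; exact dirDeriv_space had C1 ey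
    rw [d1, d2, d3, d4, e1, e2, dirDeriv_time had B1] at h1
    rw [← h1]
    refine integral_congr_ae (.of_forall fun t => ?_)
    simp only
    by_cases ht : t ∈ tsupport a
    · have htI : t ∈ Icc (-T) T := Ioo_subset_Icc_self (has ht)
      have r : ∀ {D : 𝓢(Plane, ℂ)}, (∀ z, (D z).im = 0) → ∀ z, ((D z).re : ℂ) = D z :=
        fun h z => Complex.ext rfl (by simp [h z])
      have e : (fun z => (a' t * (B1 z).re + a t * (B4 z).re - a t * (C2 z).re) • u t z +
          (a t * (B2 z).re / 2) • u t z ^ 2) = fun z => ((a' t : ℂ) * (B1 z * v t z) +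
          a t * (B4 z * v t z - C2 z * v t z)) + (a t / 2 : ℂ) * (B2 z * v t z ^ 2) := by
        funext z
        rw [← huv t htI, real_smul, real_smul]
        push_cast
        rw [r i1, r i2, r i4, r j2]
        ring
      have e' : Integrable fun z => (a' t : ℂ) * (B1 z * v t z) +
          a t * (B4 z * v t z - C2 z * v t z) :=
        ((integrable_mul _ B1).const_mul _).add ((hQlin _).const_mul _)
      rw [e, integral_add e' ((hsq _ _).const_mul _),
        integral_add ((integrable_mul _ B1).const_mul _) ((hQlin _).const_mul _),
        integral_const_mul, integral_const_mul, integral_const_mul,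
        integral_sub (integrable_mul _ B4) (integrable_mul _ C2), hQ]
      ring
    · have h3 : a t = 0 := image_eq_zero_of_notMem_tsupport ht
      have h4 : a' t = 0 := by
        rw [← (had t).deriv]
        exact image_eq_zero_of_notMem_tsupport fun h => ht (tsupport_deriv_subset h)
      simp [h3, h4]) t ht
  have eP : ∀ t, ∫ z, B1 z * v t z = ∫ ζ, 𝓕⁻ (B : Plane → ℂ) ζ *
      (-I * freqX ζ * (𝓕 (v t) : L2) ζ) := fun t => by
    rw [integral_schwartz_mul]
    refine integral_congr_ae (.of_forall fun ζ => ?_)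
    simp only [f1]
    ring
  rw [← eP t, ← eP 0, hmain]
  refine intervalIntegral.integral_congr fun s _ => ?_
  rw [hQ, integral_schwartz_mul, integral_schwartz_mul, integral_schwartz_mul_sq]
  have k : ∀ D : 𝓢(Plane, ℂ), ∃ E : 𝓢(Plane, ℂ), 𝓕⁻ (D : Plane → ℂ) = E :=
    fun D => ⟨𝓕⁻ D, (fourierInv_coe D).symm⟩
  obtain ⟨E4, k4⟩ := k B4
  obtain ⟨E2, k2⟩ := k B2
  obtain ⟨G2, l2⟩ := k C2
  have m2 : Integrable fun ζ => 𝓕⁻ (B2 : Plane → ℂ) ζ * convSelf (𝓕 (v s)) ζ := by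
    rw [k2]
    exact E2.integrable.mul_bdd (c := ‖pairing‖ * ‖(𝓕 (v s) : L2)‖ ^ 2)
      (measurable_convSelf _) (.of_forall fun ζ => norm_convSelf_le _ ζ)
  have m4 : Integrable fun ζ => 𝓕⁻ (B4 : Plane → ℂ) ζ * (𝓕 (v s) : L2) ζ := by
    rw [k4]; exact integrable_mul _ _
  have n2 : Integrable fun ζ => 𝓕⁻ (C2 : Plane → ℂ) ζ * (𝓕 (v s) : L2) ζ := by
    rw [l2]; exact integrable_mul _ _
  have o2 : Integrable fun ζ => 𝓕⁻ (B4 : Plane → ℂ) ζ * (𝓕 (v s) : L2) ζ -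
      𝓕⁻ (C2 : Plane → ℂ) ζ * (𝓕 (v s) : L2) ζ := m4.sub n2
  rw [← integral_const_mul, ← integral_sub m4 n2, ← integral_add o2 (m2.const_mul _)]
  refine integral_congr_ae (.of_forall fun ζ => ?_)
  simp only [f2, f4, g2, evolution]
  ring

lemma abs_freqX_le (ζ : Plane) : |freqX ζ| ≤ 7 * (1 + ‖ζ‖) := by
  have h1 : |ζ 0| ≤ ‖ζ‖ := by simpa using PiLp.norm_apply_le ζ 0
  rw [freqX, abs_mul, abs_of_pos Real.two_pi_pos]
  nlinarith [Real.pi_lt_d2, pi_pos, abs_nonneg (ζ 0)]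

lemma abs_freqY_le (ζ : Plane) : |freqY ζ| ≤ 7 * (1 + ‖ζ‖) := by
  have h1 : |ζ 1| ≤ ‖ζ‖ := by simpa using PiLp.norm_apply_le ζ 1
  rw [freqY, abs_mul, abs_of_pos Real.two_pi_pos]
  nlinarith [Real.pi_lt_d2, pi_pos, abs_nonneg (ζ 1)]

lemma norm_evolution_le (ζ : Plane) (a b : ℂ) :
    ‖evolution ζ a b‖ ≤ 2450 * (1 + ‖ζ‖) ^ 4 * (‖a‖ + ‖b‖) := by
  have h1 : (1 : ℝ) ≤ 1 + ‖ζ‖ := by linarith [norm_nonneg ζ]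
  have hx : freqX ζ ^ 2 ≤ (7 * (1 + ‖ζ‖)) ^ 2 := sq_le_sq' (abs_le.1 (abs_freqX_le ζ)).1
    (abs_le.1 (abs_freqX_le ζ)).2
  have hy : freqY ζ ^ 2 ≤ (7 * (1 + ‖ζ‖)) ^ 2 := sq_le_sq' (abs_le.1 (abs_freqY_le ζ)).1
    (abs_le.1 (abs_freqY_le ζ)).2
  have hx4 : freqX ζ ^ 4 ≤ 2401 * (1 + ‖ζ‖) ^ 4 := by
    calc freqX ζ ^ 4 = (freqX ζ ^ 2) ^ 2 := by ring
      _ ≤ ((7 * (1 + ‖ζ‖)) ^ 2) ^ 2 := by gcongr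
      _ = _ := by ring
  have h2 : (1 + ‖ζ‖) ^ 2 ≤ (1 + ‖ζ‖) ^ 4 := pow_le_pow_right₀ h1 (by norm_num)
  have n1 : ‖((freqX ζ ^ 4 + freqY ζ ^ 2 : ℝ) : ℂ)‖ ≤ 2450 * (1 + ‖ζ‖) ^ 4 := by
    rw [norm_real, norm_of_nonneg (by positivity)]
    nlinarith
  have n2 : ‖((freqX ζ ^ 2 / 2 : ℝ) : ℂ)‖ ≤ 2450 * (1 + ‖ζ‖) ^ 4 := by
    rw [norm_real, norm_of_nonneg (by positivity)]
    nlinarith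
  push_cast at n1 n2
  rw [evolution, mul_add]
  refine (norm_sub_le _ _).trans ?_
  rw [norm_mul, norm_mul]
  gcongr

/-- The weight `(1 + ‖ζ‖)⁻⁷`. -/
def decay (ζ : Plane) : ℝ := ((1 + ‖ζ‖) ^ 7)⁻¹

lemma decay_mul_le {ζ : Plane} {K a : ℝ} (hK : 0 ≤ K) (ha : 0 ≤ a) :
    decay ζ * (K * (1 + ‖ζ‖) ^ 4 * a) ≤ K * (((1 + ‖ζ‖) ^ 3)⁻¹ + a ^ 2) := by
  have h1 : (1 : ℝ) ≤ (1 + ‖ζ‖) ^ 3 := one_le_pow₀ (by linarith [norm_nonneg ζ])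
  have h2 : decay ζ * (K * (1 + ‖ζ‖) ^ 4 * a) = K * (((1 + ‖ζ‖) ^ 3)⁻¹ * a) := by
    rw [decay]
    field_simp
  have h3 : ((1 + ‖ζ‖) ^ 3)⁻¹ ≤ 1 := inv_le_one_of_one_le₀ h1
  have h4 : 0 ≤ ((1 + ‖ζ‖) ^ 3)⁻¹ := by positivity
  rw [h2]
  refine mul_le_mul_of_nonneg_left ?_ hK
  nlinarith [sq_nonneg (a - 1), sq_nonneg a]

lemma measurable_decay : Measurable decay := by
  unfold decay
  fun_prop

lemma measurable_freqX : Measurable freqX := by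
  unfold freqX
  fun_prop

lemma measurable_freqY : Measurable freqY := by
  unfold freqY
  fun_prop

section

variable {v : ℝ → L2} {F : ℝ × Plane → ℂ} {T : ℝ}

/-- The right-hand side of the integrated equation on the Fourier side. -/
def forcing (F : ℝ × Plane → ℂ) (p : ℝ × Plane) : ℂ :=
  evolution p.2 (F p) (∫ w, F (p.1, w) * F (p.1, p.2 - w))

lemma measurable_conv (hF : Measurable F) :
    Measurable fun p : ℝ × Plane => ∫ w, F (p.1, w) * F (p.1, p.2 - w) := by
  have hm : Measurable fun q : (ℝ × Plane) × Plane => F (q.1.1, q.2) * F (q.1.1, q.1.2 - q.2) :=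
    (hF.comp (by fun_prop)).mul (hF.comp (by fun_prop))
  exact hm.stronglyMeasurable.integral_prod_right.measurable

lemma measurable_forcing (hF : Measurable F) : Measurable (forcing F) := by
  have h1 := measurable_freqX.comp (measurable_snd : Measurable (Prod.snd : ℝ × Plane → Plane))
  have h2 := measurable_freqY.comp (measurable_snd : Measurable (Prod.snd : ℝ × Plane → Plane))
  have h3 := measurable_conv hF
  have e : forcing F = fun p => _ := funext fun p => rfl
  simp only [forcing, evolution, Function.comp_def] at *
  rw [e]
  fun_prop

lemma convSelf_rep (hFv : ∀ t, (fun ζ => F (t, ζ)) =ᵐ[volume] (𝓕 (v t) : L2)) (s : ℝ)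
    (ζ : Plane) : convSelf (𝓕 (v s)) ζ = ∫ w, F (s, w) * F (s, ζ - w) :=
  convSelf_congr (hFv s).symm ζ

lemma exists_conv_bound (hv : Continuous v)
    (hFv : ∀ t, (fun ζ => F (t, ζ)) =ᵐ[volume] (𝓕 (v t) : L2)) (T : ℝ) :
    ∃ D : ℝ, 0 ≤ D ∧ ∀ s ∈ Icc (-T) T, ‖v s‖ ≤ D ∧ ∀ ζ, ‖∫ w, F (s, w) * F (s, ζ - w)‖ ≤ D := by
  obtain ⟨R, hR⟩ := (isCompact_Icc (a := -T) (b := T)).exists_bound_of_continuousOn hv.continuousOn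
  refine ⟨max |R| (‖pairing‖ * R ^ 2), by positivity, fun s hs =>
    ⟨((hR s hs).trans (le_abs_self R)).trans (le_max_left _ _), fun ζ => ?_⟩⟩
  rw [← convSelf_rep hFv]
  refine (norm_convSelf_le _ _).trans (le_trans ?_ (le_max_right _ _))
  rw [Lp.norm_fourier_eq]
  gcongr
  exact hR s hs

lemma integral_rep_sq (hFv : ∀ t, (fun ζ => F (t, ζ)) =ᵐ[volume] (𝓕 (v t) : L2)) (t : ℝ) :
    Integrable (fun ζ => ‖F (t, ζ)‖ ^ 2) ∧ ∫ ζ, ‖F (t, ζ)‖ ^ 2 = ‖v t‖ ^ 2 := by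
  have h1 : Integrable fun ζ => ‖(𝓕 (v t) : L2) ζ‖ ^ 2 :=
    (memLp_two_iff_integrable_sq_norm (Lp.aestronglyMeasurable _)).1 (Lp.memLp _)
  have h2 : (fun ζ => ‖(𝓕 (v t) : L2) ζ‖ ^ 2) =ᵐ[volume] fun ζ => ‖F (t, ζ)‖ ^ 2 := by
    filter_upwards [hFv t] with ζ hζ
    rw [hζ]
  refine ⟨h1.congr h2, ?_⟩
  rw [← integral_congr_ae h2, ← Lp.norm_fourier_eq, ← inner_self_eq_norm_sq (𝕜 := ℂ), L2.inner_def,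
    ← integral_re (L2.integrable_inner _ _)]
  refine integral_congr_ae (.of_forall fun ζ => ?_)
  simp only [inner_self_eq_norm_sq]

lemma integrable_majorant (hv : Continuous v) (hF : Measurable F)
    (hFv : ∀ t, (fun ζ => F (t, ζ)) =ᵐ[volume] (𝓕 (v t) : L2)) :
    Integrable (fun p : ℝ × Plane => ((1 + ‖p.2‖) ^ 3)⁻¹ + ‖F p‖ ^ 2)
      ((volume.restrict (Icc (-T) T)).prod volume) := by
  refine (integrable_one_add_norm_inv.comp_snd _).add ?_
  rw [integrable_prod_iff (by fun_prop)]
  refine ⟨.of_forall fun t => (integral_rep_sq hFv t).1, ?_⟩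
  simp only [norm_pow, norm_norm]
  simp only [(integral_rep_sq hFv _).2]
  exact (hv.norm.pow 2).integrableOn_Icc

lemma integrable_decay_forcing (hv : Continuous v) (hF : Measurable F)
    (hFv : ∀ t, (fun ζ => F (t, ζ)) =ᵐ[volume] (𝓕 (v t) : L2)) :
    Integrable (fun p : ℝ × Plane => decay p.2 * ‖forcing F p‖)
      ((volume.restrict (Icc (-T) T)).prod volume) := by
  obtain ⟨D, hD0, hD⟩ := exists_conv_bound hv hFv T
  have hm : Measurable fun p : ℝ × Plane => decay p.2 * ‖forcing F p‖ :=
    (measurable_decay.comp measurable_snd).mul (measurable_forcing hF).norm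
  refine ((((integrable_majorant (T := T) hv hF hFv).add
    ((integrable_one_add_norm_inv.mul_const (1 + D ^ 2)).comp_snd _)).const_mul 2450)).mono'
    hm.aestronglyMeasurable ?_
  have h1 : ∀ᵐ p : ℝ × Plane ∂(volume.restrict (Icc (-T) T)).prod volume, p.1 ∈ Icc (-T) T :=
    Measure.quasiMeasurePreserving_fst.ae (ae_restrict_mem measurableSet_Icc)
  filter_upwards [h1] with p hp
  have hd : 0 ≤ decay p.2 := by unfold decay; positivity
  rw [norm_of_nonneg (by positivity)]
  have h2 : ‖forcing F p‖ ≤ 2450 * (1 + ‖p.2‖) ^ 4 * (‖F p‖ + D) :=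
    (norm_evolution_le _ _ _).trans (by gcongr; exact (hD p.1 hp).2 p.2)
  have h3 : decay p.2 * (2450 * (1 + ‖p.2‖) ^ 4 * D) ≤ 2450 * (((1 + ‖p.2‖) ^ 3)⁻¹ * (1 + D ^ 2)) := by
    have h4 : decay p.2 * (2450 * (1 + ‖p.2‖) ^ 4 * D) = 2450 * (((1 + ‖p.2‖) ^ 3)⁻¹ * D) := by
      rw [decay]; field_simp
    rw [h4]
    have : D ≤ 1 + D ^ 2 := by nlinarith [sq_nonneg (D - 1), sq_nonneg D]
    gcongr
  calc decay p.2 * ‖forcing F p‖ ≤ decay p.2 * (2450 * (1 + ‖p.2‖) ^ 4 * (‖F p‖ + D)) := by gcongr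
    _ = decay p.2 * (2450 * (1 + ‖p.2‖) ^ 4 * ‖F p‖) +
        decay p.2 * (2450 * (1 + ‖p.2‖) ^ 4 * D) := by ring
    _ ≤ 2450 * (((1 + ‖p.2‖) ^ 3)⁻¹ + ‖F p‖ ^ 2) + 2450 * (((1 + ‖p.2‖) ^ 3)⁻¹ * (1 + D ^ 2)) :=
      add_le_add (decay_mul_le (by norm_num) (norm_nonneg _)) h3
    _ = _ := by simp only [Pi.add_apply]; ring

lemma ae_integrableOn_forcing (hv : Continuous v) (hF : Measurable F)
    (hFv : ∀ t, (fun ζ => F (t, ζ)) =ᵐ[volume] (𝓕 (v t) : L2)) :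
    ∀ᵐ ζ, IntegrableOn (fun s => forcing F (s, ζ)) (Icc (-T) T) := by
  filter_upwards [(integrable_decay_forcing (T := T) hv hF hFv).prod_left_ae] with ζ hζ
  have hd : decay ζ ≠ 0 := by unfold decay; positivity
  have h1 := hζ.const_mul (decay ζ)⁻¹
  simp only [inv_mul_cancel_left₀ hd] at h1
  exact (integrable_norm_iff ((measurable_forcing hF).comp (by fun_prop)).aestronglyMeasurable).1 h1

lemma measurable_primitive (hF : Measurable F) :
    Measurable fun p : ℝ × Plane => ∫ s in (0 : ℝ)..p.1, forcing F (s, p.2) := by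
  have h1 : Measurable fun q : (ℝ × Plane) × ℝ => forcing F (q.2, q.1.2) :=
    (measurable_forcing hF).comp (by fun_prop)
  have key (a b : ℝ → ℝ) (ha : Measurable a) (hb : Measurable b) :
      Measurable fun p : ℝ × Plane => ∫ s in Ioc (a p.1) (b p.1), forcing F (s, p.2) := by
    have hm := h1.indicator ((measurableSet_lt (ha.comp (measurable_fst.comp measurable_fst))
      measurable_snd).inter (measurableSet_le measurable_snd
        (hb.comp (measurable_fst.comp measurable_fst))))
    convert (StronglyMeasurable.integral_prod_right' (ν := volume) hm.stronglyMeasurable).measurable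
      using 2
    rw [← integral_indicator measurableSet_Ioc]
    rfl
  exact (key _ _ measurable_const measurable_id).sub (key _ _ measurable_id measurable_const)

lemma ae_integrated_equation (hT : 0 < T) {u : ℝ → L2} (hu : SolvesKPI T u) (hv : Continuous v)
    (huv : ∀ t ∈ Icc (-T) T, v t = u t) (hF : Measurable F)
    (hFv : ∀ t, (fun ζ => F (t, ζ)) =ᵐ[volume] (𝓕 (v t) : L2)) {t : ℝ} (ht : t ∈ Icc (-T) T) :
    ∀ᵐ ζ, -I * freqX ζ * (F (t, ζ) - F (0, ζ)) = ∫ s in (0 : ℝ)..t, forcing F (s, ζ) := by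
  have h0 : (0 : ℝ) ∈ Icc (-T) T := ⟨by linarith, hT.le⟩
  have hsub : uIoc 0 t ⊆ Icc (-T) T := uIoc_subset_uIcc.trans (uIcc_subset_Icc h0 ht)
  have hle : (volume.restrict (uIoc 0 t)).prod (volume : Measure Plane) ≤
      (volume.restrict (Icc (-T) T)).prod volume :=
    Measure.prod_mono (Measure.restrict_mono hsub le_rfl) le_rfl
  have hHi := (integrable_decay_forcing (T := T) hv hF hFv).mono_measure hle
  have hLi : ∀ t, Integrable fun ζ => decay ζ * ‖-I * freqX ζ * F (t, ζ)‖ := by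
    intro t
    have hm : Measurable fun ζ => decay ζ * ‖-I * freqX ζ * F (t, ζ)‖ := by
      have h1 := measurable_freqX
      have h2 := measurable_decay
      fun_prop
    refine ((integrable_one_add_norm_inv.add (integral_rep_sq hFv t).1).const_mul 7).mono'
      hm.aestronglyMeasurable (.of_forall fun ζ => ?_)
    have hd : 0 ≤ decay ζ := by unfold decay; positivity
    rw [norm_of_nonneg (by positivity)]
    refine le_trans ?_ (decay_mul_le (ζ := ζ) (K := 7) (by norm_num) (norm_nonneg (F (t, ζ))))
    rw [norm_mul, norm_mul, norm_neg, Complex.norm_I, one_mul, norm_real, norm_eq_abs]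
    gcongr
    refine (abs_freqX_le ζ).trans ?_
    gcongr
    exact le_self_pow₀ (by linarith [norm_nonneg ζ]) (by norm_num)
  have hmS : Measurable fun ζ => ∫ s in (0 : ℝ)..t, forcing F (s, ζ) :=
    (measurable_primitive hF).comp (measurable_prodMk_left (x := t))
  have hIi : Integrable fun ζ => decay ζ * ‖∫ s in (0 : ℝ)..t, forcing F (s, ζ)‖ := by
    refine hHi.integral_prod_right.mono' (measurable_decay.mul hmS.norm).aestronglyMeasurable
      (.of_forall fun ζ => ?_)
    have hd : 0 ≤ decay ζ := by unfold decay; positivity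
    rw [norm_of_nonneg (by positivity)]
    simp only [integral_const_mul]
    gcongr
    rw [intervalIntegral.norm_integral_eq_norm_integral_uIoc]
    exact norm_integral_le_integral_norm _
  have hmL : ∀ t, Measurable fun ζ => -I * freqX ζ * F (t, ζ) := fun t => by
    have h1 := measurable_freqX
    fun_prop
  obtain ⟨S, hS⟩ : ∃ S : Plane → ℂ, ∀ ζ, S ζ = (-I * freqX ζ * F (t, ζ) -
      -I * freqX ζ * F (0, ζ)) - ∫ s in (0 : ℝ)..t, forcing F (s, ζ) := ⟨_, fun _ => rfl⟩
  have hSm : Measurable S := by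
    rw [show S = fun ζ => _ from funext hS]
    exact ((hmL t).sub (hmL 0)).sub hmS
  have hSi : Integrable fun ζ => ((1 + ‖ζ‖) ^ 7)⁻¹ * ‖S ζ‖ := by
    refine (((hLi t).add (hLi 0)).add hIi).mono'
      (measurable_decay.mul hSm.norm).aestronglyMeasurable (.of_forall fun ζ => ?_)
    rw [norm_of_nonneg (by positivity), hS]
    simp only [Pi.add_apply]
    rw [← mul_add, ← mul_add, decay]
    refine mul_le_mul_of_nonneg_left ?_ (by positivity)
    exact (norm_sub_le _ _).trans (add_le_add_left (norm_sub_le _ _) _)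
  have key := ae_eq_zero_of_fourierInv hSm hSi (fun b hb hbc => by
    have hbC : ContDiff ℝ ∞ fun z => (b z : ℂ) := ofRealCLM.contDiff.comp hb
    have hbCc : HasCompactSupport fun z => (b z : ℂ) :=
      hbc.comp_left (g := fun x : ℝ => (x : ℂ)) rfl
    obtain ⟨B, hB⟩ : ∃ B : 𝓢(Plane, ℂ), (B : Plane → ℂ) = fun z => (b z : ℂ) :=
      ⟨hbCc.toSchwartzMap hbC, rfl⟩
    obtain ⟨G, hG⟩ : ∃ G : 𝓢(Plane, ℂ), 𝓕⁻ (B : Plane → ℂ) = G := ⟨𝓕⁻ B, (fourierInv_coe B).symm⟩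
    have hw := weak_fourier hT hu hv huv B (fun z => by rw [hB]; simp) (by rw [hB]; exact hbCc) ht
    rw [← hB]
    rw [hG] at hw ⊢
    obtain ⟨C, hC0, hC⟩ := SchwartzMap.exists_decay G 7
    have hGd : ∀ ζ, ‖G ζ‖ ≤ C * decay ζ := fun ζ => by
      rw [decay, ← div_eq_mul_inv, le_div_iff₀ (by positivity), mul_comm]
      exact hC ζ
    have hint : ∀ L : Plane → ℂ, Measurable L → (Integrable fun ζ => decay ζ * ‖L ζ‖) →
        Integrable fun ζ => G ζ * L ζ := fun L hL hi => by
      refine (hi.const_mul C).mono' (G.continuous.measurable.mul hL).aestronglyMeasurable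
        (.of_forall fun ζ => ?_)
      rw [norm_mul, ← mul_assoc]
      exact mul_le_mul_of_nonneg_right (hGd ζ) (norm_nonneg _)
    have hfub : Integrable (fun p : ℝ × Plane => G p.2 * forcing F p)
        ((volume.restrict (uIoc 0 t)).prod volume) := by
      refine (hHi.const_mul C).mono' ((G.continuous.measurable.comp measurable_snd).mul
          (measurable_forcing hF)).aestronglyMeasurable (.of_forall fun p => ?_)
      rw [norm_mul, ← mul_assoc]
      exact mul_le_mul_of_nonneg_right (hGd p.2) (norm_nonneg _)
    have eL : ∀ t, ∫ ζ, G ζ * (-I * freqX ζ * (𝓕 (v t) : L2) ζ) =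
        ∫ ζ, G ζ * (-I * freqX ζ * F (t, ζ)) := fun t => by
      refine integral_congr_ae ?_
      filter_upwards [hFv t] with ζ hζ
      rw [hζ]
    have eH : ∀ s, ∫ ζ, G ζ * evolution ζ ((𝓕 (v s) : L2) ζ) (convSelf (𝓕 (v s)) ζ) =
        ∫ ζ, G ζ * forcing F (s, ζ) := fun s => by
      refine integral_congr_ae ?_
      filter_upwards [hFv s] with ζ hζ
      rw [← hζ, convSelf_rep hFv]
      rfl
    simp only [eL, eH] at hw
    have eI : ∫ s in (0 : ℝ)..t, ∫ ζ, G ζ * forcing F (s, ζ) =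
        ∫ ζ, G ζ * ∫ s in (0 : ℝ)..t, forcing F (s, ζ) := by
      rw [intervalIntegral.intervalIntegral_eq_integral_uIoc, integral_integral_swap hfub,
        ← integral_smul]
      refine integral_congr_ae (.of_forall fun ζ => ?_)
      simp only [intervalIntegral.intervalIntegral_eq_integral_uIoc, integral_const_mul,
        real_smul, smul_eq_mul]
      ring
    rw [eI] at hw
    simp only [hS, mul_sub (G _)]
    have k1 := hint _ (hmL t) (hLi t)
    have k2 := hint _ (hmL 0) (hLi 0)
    have k3 := hint _ hmS hIi
    rw [integral_sub (f := fun ζ => _ - _) (k1.sub k2) k3, integral_sub k1 k2, hw, sub_self])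
  filter_upwards [key] with ζ hζ
  rw [hS, sub_eq_zero] at hζ
  rw [mul_sub, hζ]

end

lemma normSq_sub_eq_integral {f N : ℝ → ℂ} {T ξ μ : ℝ} (hT : 0 < T) (hξ : ξ ≠ 0) (hN : Continuous N)
    (hH : IntegrableOn (fun s => (ξ ^ 4 + μ ^ 2) * f s - ξ ^ 2 / 2 * N s) (Icc (-T) T))
    (h : ∀ᵐ t, t ∈ Icc (-T) T → -I * ξ * (f t - f 0) =
      ∫ s in (0 : ℝ)..t, ((ξ ^ 4 + μ ^ 2) * f s - ξ ^ 2 / 2 * N s))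
    {t₀ : ℝ} (ht₀ : t₀ ∈ Icc (-T) T) (h₀ : -I * ξ * (f t₀ - f 0) =
      ∫ s in (0 : ℝ)..t₀, ((ξ ^ 4 + μ ^ 2) * f s - ξ ^ 2 / 2 * N s)) :
    ‖f t₀‖ ^ 2 - ‖f 0‖ ^ 2 = ∫ s in (0 : ℝ)..t₀, ξ * ((starRingEnd ℂ) (f s) * N s).im := by
  have hle : -T ≤ T := by linarith
  have h0 : (0 : ℝ) ∈ Icc (-T) T := ⟨by linarith, hT.le⟩
  have hξc : (ξ : ℂ) ≠ 0 := Complex.ofReal_ne_zero.2 hξ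
  obtain ⟨Z, hZ⟩ : ∃ Z : ℝ → ℂ, ∀ t, Z t = f 0 + I / ξ *
    ∫ s in (0 : ℝ)..t, ((ξ ^ 4 + μ ^ 2) * f s - ξ ^ 2 / 2 * N s) := ⟨_, fun _ => rfl⟩
  have hfZ : ∀ t, -I * ξ * (f t - f 0) =
      ∫ s in (0 : ℝ)..t, ((ξ ^ 4 + μ ^ 2) * f s - ξ ^ 2 / 2 * N s) → f t = Z t := fun t ht => by
    rw [hZ, ← ht]
    field_simp
    linear_combination (f t - f 0) * I_sq
  have hZc : ContinuousOn Z (Icc (-T) T) := by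
    rw [show Z = fun t => _ from funext hZ]
    have hi : IntervalIntegrable (fun s => (ξ ^ 4 + μ ^ 2) * f s - ξ ^ 2 / 2 * N s) volume
        (-T) T := (intervalIntegrable_iff_integrableOn_Icc_of_le hle).2 hH
    have := intervalIntegral.continuousOn_primitive_interval' hi (a := 0) (by rwa [uIcc_of_le hle])
    rw [uIcc_of_le hle] at this
    exact continuousOn_const.add (continuousOn_const.mul this)
  obtain ⟨V, hV, hVZ⟩ : ∃ V : ℝ → ℂ, Continuous V ∧ ∀ t ∈ Icc (-T) T, V t = Z t :=
    ⟨_, (continuousOn_iff_continuous_domRestrict.1 hZc).Icc_extend' (h := hle), fun t ht =>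
      IccExtend_of_mem hle _ ht⟩
  have hsub : ∀ t ∈ Icc (-T) T, uIoc 0 t ⊆ Icc (-T) T := fun t ht =>
    uIoc_subset_uIcc.trans (uIcc_subset_Icc h0 ht)
  have hfV : ∀ᵐ t, t ∈ Icc (-T) T → f t = V t := by
    filter_upwards [h] with t ht hm
    rw [hVZ t hm, hfZ t (ht hm)]
  obtain ⟨Y, hY⟩ : ∃ Y : ℝ → ℂ, ∀ t, Y t = f 0 + I / ξ *
    ∫ s in (0 : ℝ)..t, ((ξ ^ 4 + μ ^ 2) * V s - ξ ^ 2 / 2 * N s) := ⟨_, fun _ => rfl⟩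
  have hYV : ∀ t ∈ Icc (-T) T, Y t = V t := fun t ht => by
    rw [hVZ t ht, hZ, hY]
    congr 2
    refine intervalIntegral.integral_congr_ae ?_
    filter_upwards [hfV] with s hs hm
    rw [hs (hsub t ht hm)]
  have hc : Continuous fun s => (ξ ^ 4 + μ ^ 2) * V s - ξ ^ 2 / 2 * N s := by fun_prop
  have hYd : ∀ t, HasDerivAt Y (I / ξ * ((ξ ^ 4 + μ ^ 2) * V t - ξ ^ 2 / 2 * N t)) t := by
    intro t
    rw [show Y = fun t => _ from funext hY]
    exact ((intervalIntegral.integral_hasDerivAt_right (hc.intervalIntegrable _ _)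
      (hc.stronglyMeasurableAtFilter _ _) hc.continuousAt).const_mul _).const_add _
  have hYc : Continuous Y := continuous_iff_continuousAt.2 fun t => (hYd t).continuousAt
  have e := intervalIntegral.integral_eq_sub_of_hasDerivAt (a := 0) (b := t₀)
    (fun t _ => (hYd t).norm_sq) (Continuous.intervalIntegrable (by fun_prop) _ _)
  have y0 : Y 0 = f 0 := by rw [hY, intervalIntegral.integral_same]; simp
  have yt : Y t₀ = f t₀ := by rw [hYV t₀ ht₀, hVZ t₀ ht₀, hfZ t₀ h₀]
  rw [y0, yt] at e
  rw [← e]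
  refine intervalIntegral.integral_congr_ae ?_
  filter_upwards [hfV] with s hs hm
  have hm' := hsub t₀ ht₀ hm
  rw [hYV s hm', hs hm', Complex.inner]
  have e1 : (starRingEnd ℂ) (V s) * V s = ((‖V s‖ ^ 2 : ℝ) : ℂ) := by
    rw [mul_comm, Complex.mul_conj, Complex.normSq_eq_norm_sq]
  have e2 : (starRingEnd ℂ) (V s) * (I / ξ * ((ξ ^ 4 + μ ^ 2) * V s - ξ ^ 2 / 2 * N s)) =
      ((((ξ ^ 4 + μ ^ 2) / ξ * ‖V s‖ ^ 2 : ℝ) : ℂ) -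
        ((ξ / 2 : ℝ) : ℂ) * ((starRingEnd ℂ) (V s) * N s)) * I := by
    push_cast at e1 ⊢
    field_simp
    linear_combination (ξ ^ 4 + μ ^ 2 : ℂ) * 2 * e1
  rw [mul_comm _ ((starRingEnd ℂ) (V s)), e2, Complex.mul_I_re, Complex.sub_im, Complex.ofReal_im, Complex.im_ofReal_mul]
  ring

lemma ae_freqX_ne_zero : ∀ᵐ ζ : Plane, freqX ζ ≠ 0 := by
  have hm : MeasurableSet {ζ : Plane | freqX ζ = 0} := measurable_freqX (measurableSet_singleton 0)
  have h1 : ∀ᵐ p : ℝ², p.1 ≠ 0 := Measure.quasiMeasurePreserving_fst.ae (Measure.ae_ne volume 0)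
  rw [ae_iff]
  simp only [not_not]
  rw [← lintegral_indicator_one hm, lintegral_toPlane]
  refine mul_eq_zero_of_right _ ?_
  rw [← lintegral_zero (α := ℝ²) (μ := volume)]
  refine lintegral_congr_ae ?_
  filter_upwards [h1] with p hp
  exact indicator_of_notMem (by simpa using hp) _

lemma ae_energy_identity {v u : ℝ → L2} {F : ℝ × Plane → ℂ} {T : ℝ} (hT : 0 < T)
    (hu : SolvesKPI T u) (hv : Continuous v) (huv : ∀ t ∈ Icc (-T) T, v t = u t)
    (hF : Measurable F) (hFv : ∀ t, (fun ζ => F (t, ζ)) =ᵐ[volume] (𝓕 (v t) : L2)) {t : ℝ}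
    (ht : t ∈ Icc (-T) T) :
    ∀ᵐ ζ, ‖F (t, ζ)‖ ^ 2 - ‖F (0, ζ)‖ ^ 2 = ∫ s in (0 : ℝ)..t,
      freqX ζ * ((starRingEnd ℂ) (F (s, ζ)) * ∫ w, F (s, w) * F (s, ζ - w)).im := by
  have hm : MeasurableSet {p : ℝ × Plane | p.1 ∈ Icc (-T) T → -I * freqX p.2 *
      (F p - F (0, p.2)) = ∫ s in (0 : ℝ)..p.1, forcing F (s, p.2)} := by
    have h1 := measurable_freqX
    have h2 := measurable_primitive hF
    refine MeasurableSet.imp (measurable_fst measurableSet_Icc) (measurableSet_eq_fun ?_ h2)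
    fun_prop
  have h1 : ∀ᵐ p : ℝ × Plane, p.1 ∈ Icc (-T) T → -I * freqX p.2 *
      (F p - F (0, p.2)) = ∫ s in (0 : ℝ)..p.1, forcing F (s, p.2) := by
    rw [volume_eq_prod, Measure.ae_prod_iff_ae_ae hm]
    refine .of_forall fun s => ?_
    by_cases hs : s ∈ Icc (-T) T
    · filter_upwards [ae_integrated_equation hT hu hv huv hF hFv hs] with ζ hζ _
      exact hζ
    · exact .of_forall fun ζ h => absurd h hs
  have h2 : ∀ᵐ ζ : Plane, ∀ᵐ s : ℝ, s ∈ Icc (-T) T → -I * freqX ζ *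
      (F (s, ζ) - F (0, ζ)) = ∫ r in (0 : ℝ)..s, forcing F (r, ζ) := by
    rw [volume_eq_prod, Measure.ae_prod_iff_ae_ae hm] at h1
    exact (Measure.ae_ae_comm hm).1 h1
  filter_upwards [h2, ae_integrated_equation hT hu hv huv hF hFv ht, ae_freqX_ne_zero,
    ae_integrableOn_forcing (T := T) hv hF hFv] with ζ h3 h4 h5 h6
  refine normSq_sub_eq_integral (f := fun s => F (s, ζ))
    (N := fun s => ∫ w, F (s, w) * F (s, ζ - w)) hT h5 (μ := freqY ζ) ?_ h6 h3 ht h4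
  simp only [← convSelf_rep hFv]
  exact (continuous_convSelf ζ).comp (FourierTransform.continuous_fourier.comp hv)

/-- The Fourier transform of a real function is Hermitian. -/
lemma ae_conj_fourier {φ : L2} (hφ : ∀ᵐ z, (φ z).im = 0) {G : Plane → ℂ} (hG : Measurable G)
    (hGφ : G =ᵐ[volume] (𝓕 φ : L2)) : ∀ᵐ ζ, (starRingEnd ℂ) (G ζ) = G (-ζ) := by
  have hsq : Integrable fun ζ => ‖G ζ‖ ^ 2 := by
    have h1 : Integrable fun ζ => ‖(𝓕 φ : L2) ζ‖ ^ 2 :=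
      (memLp_two_iff_integrable_sq_norm (Lp.aestronglyMeasurable _)).1 (Lp.memLp _)
    refine h1.congr ?_
    filter_upwards [hGφ] with ζ hζ
    rw [hζ]
  have hconj : Measurable fun ζ => (starRingEnd ℂ) (G ζ) := Complex.continuous_conj.measurable.comp hG
  have hneg : Measurable fun ζ => G (-ζ) := hG.comp measurable_neg
  have hsqn : Integrable fun ζ => ‖G (-ζ)‖ ^ 2 := hsq.comp_neg
  have key := ae_eq_zero_of_fourierInv (S := fun ζ => (starRingEnd ℂ) (G ζ) - G (-ζ)) (N := 3)
    (hconj.sub hneg) (by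
      refine ((integrable_one_add_norm_inv.const_mul 2).add (hsq.add hsqn)).mono'
        (by fun_prop) (.of_forall fun ζ => ?_)
      have h1 : (1 : ℝ) ≤ (1 + ‖ζ‖) ^ 3 := one_le_pow₀ (by linarith [norm_nonneg ζ])
      have h3 : ((1 + ‖ζ‖) ^ 3)⁻¹ ≤ 1 := inv_le_one_of_one_le₀ h1
      have h4 : 0 ≤ ((1 + ‖ζ‖) ^ 3)⁻¹ := by positivity
      have h5 : ‖(starRingEnd ℂ) (G ζ) - G (-ζ)‖ ≤ ‖G ζ‖ + ‖G (-ζ)‖ :=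
        (norm_sub_le _ _).trans (by rw [RCLike.norm_conj])
      rw [norm_of_nonneg (by positivity)]
      simp only [Pi.add_apply]
      have h6 : ∀ a : ℝ, 0 ≤ a → ((1 + ‖ζ‖) ^ 3)⁻¹ * a ≤ ((1 + ‖ζ‖) ^ 3)⁻¹ + a ^ 2 := fun a ha => by
        nlinarith [sq_nonneg (a - 1), sq_nonneg a]
      refine (mul_le_mul_of_nonneg_left h5 h4).trans ?_
      linarith [h6 _ (norm_nonneg (G ζ)), h6 _ (norm_nonneg (G (-ζ)))]) (fun b hb hbc => by
    have hreal : ∀ b : Plane → ℝ, ContDiff ℝ ∞ b → HasCompactSupport b →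
        (Integrable fun ζ => 𝓕⁻ (fun z => (b z : ℂ)) ζ * G ζ) ∧
        (∫ ζ, 𝓕⁻ (fun z => (b z : ℂ)) ζ * G ζ).im = 0 := by
      intro b hb hbc
      obtain ⟨B, hB⟩ : ∃ B : 𝓢(Plane, ℂ), (B : Plane → ℂ) = fun z => (b z : ℂ) :=
        ⟨(hbc.comp_left (g := fun x : ℝ => (x : ℂ)) rfl).toSchwartzMap
          (ofRealCLM.contDiff.comp hb), rfl⟩
      have e : (fun ζ => 𝓕⁻ (B : Plane → ℂ) ζ * (𝓕 φ : L2) ζ) =ᵐ[volume]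
          fun ζ => 𝓕⁻ (B : Plane → ℂ) ζ * G ζ := by
        filter_upwards [hGφ] with ζ hζ
        rw [hζ]
      rw [← hB]
      constructor
      · refine Integrable.congr ?_ e
        rw [← fourierInv_coe]
        exact integrable_mul _ _
      · rw [← integral_congr_ae e, ← integral_schwartz_mul]
        have h1 := integral_im (integrable_mul φ B)
        refine h1.symm.trans (integral_eq_zero_of_ae ?_)
        filter_upwards [hφ] with z hz
        rw [hB]
        simp [hz]
    have hc : ∀ ζ, (starRingEnd ℂ) (𝓕⁻ (fun z => (b z : ℂ)) ζ) = 𝓕⁻ (fun z => (b z : ℂ)) (-ζ) := by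
      intro ζ
      rw [fourierInv_eq, fourierInv_eq, ← integral_conj]
      refine integral_congr_ae (.of_forall fun z => ?_)
      simp only [Circle.smul_def, smul_eq_mul, map_mul, Complex.conj_ofReal, inner_neg_right,
        AddChar.map_neg_eq_inv, Circle.coe_inv_eq_conj]
    have hn : ∀ ζ, 𝓕⁻ (fun z => (b (-z) : ℂ)) ζ = 𝓕⁻ (fun z => (b z : ℂ)) (-ζ) := by
      intro ζ
      rw [fourierInv_eq, fourierInv_eq, ← integral_neg_eq_self]
      refine integral_congr_ae (.of_forall fun z => ?_)
      simp only [inner_neg_right, inner_neg_left, neg_neg]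
    obtain ⟨i1, r1⟩ := hreal (fun z => b (-z)) (hb.comp contDiff_neg)
      (hbc.comp_homeomorph (Homeomorph.neg Plane))
    simp only [hn] at i1 r1
    have i2 : Integrable fun ζ => 𝓕⁻ (fun z => (b z : ℂ)) ζ * G (-ζ) := by simpa using i1.comp_neg
    have e3 : (fun ζ => 𝓕⁻ (fun z => (b z : ℂ)) ζ * (starRingEnd ℂ) (G ζ)) =
        fun ζ => (starRingEnd ℂ) (𝓕⁻ (fun z => (b z : ℂ)) (-ζ) * G ζ) := by
      funext ζ
      rw [map_mul, hc, neg_neg]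
    have i3 : Integrable fun ζ => 𝓕⁻ (fun z => (b z : ℂ)) ζ * (starRingEnd ℂ) (G ζ) := by
      rw [e3]
      exact (Complex.conjCLE.toContinuousLinearMap.integrable_comp i1)
    simp only [mul_sub]
    rw [integral_sub i3 i2, e3, integral_conj,
      ← integral_neg_eq_self fun ζ => 𝓕⁻ (fun z => (b z : ℂ)) ζ * G (-ζ)]
    simp only [neg_neg]
    rw [Complex.conj_eq_iff_im.2 r1, sub_self])
  filter_upwards [key] with ζ hζ
  exact sub_eq_zero.1 hζ

/-- The integrand of the time derivative of the truncated energy; the last two variables are an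
output and an input frequency. -/
def energyKernel (η : Cutoff) (k A : ℕ) (U : ℝ³ → ℂ) (x : ℝ × ℝ⁴) : ℂ :=
  {p : ℝ² | |p.2| ≤ A}.indicator (fun p => (energySymbol η k p.1 : ℂ)) x.2.1 *
    ((starRingEnd ℂ) (U (x.1, x.2.1)) * (U (x.1, x.2.2) * U (x.1, x.2.1 - x.2.2)))

lemma measurableSet_strip (A : ℕ) : MeasurableSet {p : ℝ² | |p.2| ≤ (A : ℝ)} :=
  (by fun_prop : Measurable fun p : ℝ² => |p.2|) measurableSet_Iic

variable {η : Cutoff} {k A : ℕ} {U : ℝ³ → ℂ} {α β : ℝ}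

lemma energyKernel_ae_eq (hU : Measurable U)
    (hconj : ∀ s ∈ Icc α β, ∀ᵐ p, (starRingEnd ℂ) (U (s, p)) = U (s, -p)) :
    energyKernel η k A U =ᵐ[timeFreq α β] fun x =>
      -(energyMult η k A (x.2.2, -x.2.2 + x.2.1) * triProd U (x.1, (x.2.2, -x.2.2 + x.2.1))) := by
  have hm : MeasurableSet {y : ℝ³ | (starRingEnd ℂ) (U y) = U (y.1, -y.2)} :=
    measurableSet_eq_fun (Complex.continuous_conj.measurable.comp hU) (hU.comp (by fun_prop))
  have h1 : ∀ᵐ y ∂(volume.restrict (Icc α β)).prod (volume : Measure ℝ²),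
      (starRingEnd ℂ) (U y) = U (y.1, -y.2) := by
    rw [Measure.ae_prod_iff_ae_ae hm]
    exact (ae_restrict_iff' measurableSet_Icc).2 (.of_forall hconj)
  have h2 : Measure.QuasiMeasurePreserving (fun x : ℝ × ℝ⁴ => (x.1, x.2.1)) (timeFreq α β)
      ((volume.restrict (Icc α β)).prod volume) :=
    Measure.quasiMeasurePreserving_fst.comp ((measurePreserving_prodAssoc
      (volume.restrict (Icc α β)) (volume : Measure ℝ²) volume).symm
      MeasurableEquiv.prodAssoc).quasiMeasurePreserving
  filter_upwards [h2.ae h1] with x hx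
  have e1 : -(x.2.2 + (-x.2.2 + x.2.1)) = -x.2.1 := by abel
  have e2 : -x.2.2 + x.2.1 = x.2.1 - x.2.2 := by abel
  have e3 : energyMult η k A (x.2.2, -x.2.2 + x.2.1) =
      -{p : ℝ² | |p.2| ≤ A}.indicator (fun p => (energySymbol η k p.1 : ℂ)) x.2.1 := by
    simp only [energyMult, e1]
    by_cases hA : |x.2.1.2| ≤ A
    · rw [indicator_of_mem (by simpa using hA), indicator_of_mem (by simpa using hA), Prod.fst_neg,
        energySymbol_neg, Complex.ofReal_neg]
    · rw [indicator_of_notMem (by simpa using hA), indicator_of_notMem (by simpa using hA), neg_zero]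
  rw [e3]
  simp only [energyKernel, triProd, e1, e2, hx]
  ring

lemma integral_energyKernel (hU : Measurable U)
    (hconj : ∀ s ∈ Icc α β, ∀ᵐ p, (starRingEnd ℂ) (U (s, p)) = U (s, -p))
    (hi : Integrable (fun x => energyMult η k A x.2 * triProd U x) (timeFreq α β)) :
    Integrable (energyKernel η k A U) (timeFreq α β) ∧
    ∫ x, energyKernel η k A U x ∂timeFreq α β =
      -∫ x, energyMult η k A x.2 * triProd U x ∂timeFreq α β := by
  have hS : MeasurePreserving fun z : ℝ⁴ => (z.2, -z.2 + z.1) :=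
    measurePreserving_prod_neg_add_swap volume volume
  have hG : Measurable fun x : ℝ × ℝ⁴ => energyMult η k A x.2 * triProd U x :=
    ((measurable_energyMult η k A).comp measurable_snd).mul (measurable_triProd hU)
  obtain ⟨h1, h2⟩ := integral_timeFreq_comp hS (α := α) (β := β) hG
  have h3 := energyKernel_ae_eq (η := η) (k := k) (A := A) hU hconj
  exact ⟨(h2 hi).neg.congr h3.symm, by rw [integral_congr_ae h3, integral_neg, h1]⟩

lemma integral_energyKernel_iterated (hi : Integrable (energyKernel η k A U) (timeFreq α β)) :
    Integrable (fun y : ℝ³ => ∫ q, energyKernel η k A U (y.1, (y.2, q)))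
      ((volume.restrict (Icc α β)).prod volume) ∧
    ∫ y : ℝ³, (∫ q, energyKernel η k A U (y.1, (y.2, q)))
      ∂((volume.restrict (Icc α β)).prod volume) = ∫ x, energyKernel η k A U x ∂timeFreq α β := by
  have h := measurePreserving_prodAssoc (volume.restrict (Icc α β))
    (volume : Measure ℝ²) (volume : Measure ℝ²)
  have h1 : Integrable (fun x => energyKernel η k A U (MeasurableEquiv.prodAssoc x))
      (((volume.restrict (Icc α β)).prod volume).prod volume) :=
    h.integrable_comp_of_integrable (g := energyKernel η k A U) hi
  refine ⟨h1.integral_prod_left, ?_⟩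
  have h2 := h.integral_comp' (energyKernel η k A U)
  rw [integral_prod _ h1] at h2
  exact h2

lemma setLIntegral_strip_eq {f : ℝ² → ℂ} (hf : Measurable f) (hi : Integrable fun p => ‖f p‖ ^ 2) :
    (Integrable fun p => {p : ℝ² | |p.2| ≤ A}.indicator
      (fun p => η.dyadic k p.1 ^ 2) p * ‖f p‖ ^ 2) ∧
    ∫⁻ p in {p : ℝ² | |p.2| ≤ A}, ofReal (η.dyadic k p.1 ^ 2) * ‖f p‖ₑ ^ 2 =
      ofReal (∫ p, {p : ℝ² | |p.2| ≤ A}.indicator (fun p => η.dyadic k p.1 ^ 2) p * ‖f p‖ ^ 2) := by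
  have hd : Measurable fun p : ℝ² => η.dyadic k p.1 ^ 2 :=
    (((η.continuous_dyadic k).comp continuous_fst).pow 2).measurable
  have h0 : ∀ p : ℝ², 0 ≤ {p : ℝ² | |p.2| ≤ A}.indicator (fun p => η.dyadic k p.1 ^ 2) p :=
    fun p => indicator_nonneg (fun p _ => sq_nonneg _) p
  have hI : Integrable fun p => {p : ℝ² | |p.2| ≤ A}.indicator
      (fun p => η.dyadic k p.1 ^ 2) p * ‖f p‖ ^ 2 := by
    refine hi.bdd_mul (c := 1) (hd.indicator (measurableSet_strip A)).aestronglyMeasurable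
      (.of_forall fun p => ?_)
    rw [norm_of_nonneg (h0 p)]
    exact (indicator_le_self' (fun p _ => sq_nonneg _) p).trans
      (pow_le_one₀ (η.dyadic_nonneg k p.1) (η.dyadic_le_one k p.1))
  refine ⟨hI, ?_⟩
  rw [ofReal_integral_eq_lintegral_ofReal hI (.of_forall fun p =>
    mul_nonneg (h0 p) (by positivity)), ← lintegral_indicator (measurableSet_strip A)]
  refine lintegral_congr fun p => ?_
  by_cases hp : p ∈ {p : ℝ² | |p.2| ≤ (A : ℝ)}
  · rw [indicator_of_mem hp, indicator_of_mem hp, ofReal_mul (sq_nonneg _),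
      ofReal_pow (norm_nonneg _), ofReal_norm]
  · rw [indicator_of_notMem hp, indicator_of_notMem hp, zero_mul, ENNReal.ofReal_zero]

lemma truncated_energy_le (hU : Measurable U) {t₀ : ℝ} (hsq : ∀ t, Integrable fun p => ‖U (t, p)‖ ^ 2)
    (hconj : ∀ s ∈ Icc (min 0 t₀) (max 0 t₀), ∀ᵐ p, (starRingEnd ℂ) (U (s, p)) = U (s, -p))
    (hi : Integrable (fun x => energyMult η k A x.2 * triProd U x) (timeFreq (min 0 t₀) (max 0 t₀)))
    (hid : ∀ᵐ p, ‖U (t₀, p)‖ ^ 2 - ‖U (0, p)‖ ^ 2 = ∫ s in (0 : ℝ)..t₀,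
      p.1 * ((starRingEnd ℂ) (U (s, p)) * (jac • ∫ q, U (s, q) * U (s, p - q))).im) :
    ∫⁻ p in {p : ℝ² | |p.2| ≤ A}, ofReal (η.dyadic k p.1 ^ 2) * ‖U (t₀, p)‖ₑ ^ 2 ≤
      (∫⁻ p, ofReal (η.dyadic k p.1 ^ 2) * ‖U (0, p)‖ₑ ^ 2) + ofReal jac *
        ‖∫ x, energyMult η k A x.2 * triProd U x ∂timeFreq (min 0 t₀) (max 0 t₀)‖ₑ := by
  obtain ⟨hK, hKi⟩ := integral_energyKernel hU hconj hi
  obtain ⟨hJ, hJi⟩ := integral_energyKernel_iterated hK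
  obtain ⟨I, hI⟩ : ∃ I : ℝ³ → ℂ, ∀ y, I y = ∫ q, energyKernel η k A U (y.1, (y.2, q)) :=
    ⟨_, fun _ => rfl⟩
  simp only [← hI] at hJ hJi
  obtain ⟨ρ, hρ⟩ : ∃ ρ : ℝ² → ℝ, ∀ p, ρ p = {p : ℝ² | |p.2| ≤ A}.indicator
    (fun p => η.dyadic k p.1 ^ 2) p := ⟨_, fun _ => rfl⟩
  have hf : ∀ t, Measurable fun p => U (t, p) := fun t => hU.comp (by fun_prop)
  obtain ⟨i1, e1⟩ := setLIntegral_strip_eq (η := η) (k := k) (A := A) (hf t₀) (hsq t₀)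
  obtain ⟨i0, e0⟩ := setLIntegral_strip_eq (η := η) (k := k) (A := A) (hf 0) (hsq 0)
  simp only [← hρ] at i1 e1 i0 e0
  obtain ⟨σ, hσ, hσi⟩ : ∃ σ : ℝ, |σ| = 1 ∧ ∀ g : ℝ → ℝ, ∫ s in (0 : ℝ)..t₀, g s =
      σ * ∫ s in Icc (min 0 t₀) (max 0 t₀), g s := by
    refine ⟨if 0 ≤ t₀ then 1 else -1, by split_ifs <;> simp, fun g => ?_⟩
    rw [intervalIntegral.intervalIntegral_eq_integral_uIoc, integral_Icc_eq_integral_Ioc]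
    rfl
  have key : ∀ᵐ p, ρ p * ‖U (t₀, p)‖ ^ 2 - ρ p * ‖U (0, p)‖ ^ 2 =
      σ * jac * ∫ s in Icc (min 0 t₀) (max 0 t₀), (I (s, p)).im := by
    filter_upwards [hid] with p hp
    rw [← mul_sub, hp, hσi, mul_left_comm, mul_assoc, ← integral_const_mul (ρ p),
      ← integral_const_mul jac]
    congr 1
    refine integral_congr_ae (.of_forall fun s => ?_)
    simp only [hI, energyKernel]
    rw [integral_const_mul, integral_const_mul, hρ]
    by_cases hpA : p ∈ {p : ℝ² | |p.2| ≤ (A : ℝ)}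
    · rw [indicator_of_mem hpA, indicator_of_mem hpA, Complex.im_ofReal_mul, mul_smul_comm,
        Complex.smul_im, energySymbol, smul_eq_mul]
      ring
    · rw [indicator_of_notMem hpA, indicator_of_notMem hpA]
      simp
  have e2 := integral_congr_ae key
  rw [integral_sub i1 i0, integral_const_mul] at e2
  have e3 : ∫ p, ∫ s in Icc (min 0 t₀) (max 0 t₀), (I (s, p)).im =
      (∫ x, energyKernel η k A U x ∂timeFreq (min 0 t₀) (max 0 t₀)).im := by
    rw [← hJi, ← integral_prod_symm (fun y => (I y).im) hJ.im]
    exact integral_im hJ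
  rw [e3, hKi] at e2
  set Θ := ∫ x, energyMult η k A x.2 * triProd U x ∂timeFreq (min 0 t₀) (max 0 t₀) with hΘ
  have e4 : ∫ p, ρ p * ‖U (t₀, p)‖ ^ 2 ≤ (∫ p, ρ p * ‖U (0, p)‖ ^ 2) + jac * ‖Θ‖ := by
    have h1 : |σ * jac * (-Θ).im| ≤ jac * ‖Θ‖ := by
      rw [abs_mul, abs_mul, hσ, one_mul, abs_of_pos jac_pos, Complex.neg_im, abs_neg]
      exact mul_le_mul_of_nonneg_left (Complex.abs_im_le_norm Θ) jac_pos.le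
    linarith [le_abs_self (σ * jac * (-Θ).im)]
  have h0 : 0 ≤ ∫ p, ρ p * ‖U (0, p)‖ ^ 2 := integral_nonneg fun p => mul_nonneg
    (by rw [hρ]; exact indicator_nonneg (fun p _ => sq_nonneg _) p) (by positivity)
  rw [e1]
  refine (ofReal_le_ofReal e4).trans ?_
  rw [ENNReal.ofReal_add h0 (mul_nonneg jac_pos.le (norm_nonneg _)), ← e0,
    ofReal_mul jac_pos.le, ofReal_norm]
  exact add_le_add_left (setLIntegral_le_lintegral _ _) _

lemma exists_truncated_energy_le (η : Cutoff) {T : ℝ} (hT : 0 < T) {u : ℝ → L2}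
    (hu : IsSmoothSolution T u) : ∃ U : ℝ³ → ℂ, Measurable U ∧ IsFourierRep T u U ∧
      (∃ R : ℝ≥0∞, R ≠ ⊤ ∧ ∀ t ∈ Icc (-T) T, l2n (fun p => ‖U (t, p)‖ₑ) ≤ R) ∧
      ∀ t₀ ∈ Icc (-T) T, ∀ k A : ℕ,
        ∫⁻ p in {p : ℝ² | |p.2| ≤ A}, ofReal (η.dyadic k p.1 ^ 2) * ‖U (t₀, p)‖ₑ ^ 2 ≤
          (∫⁻ p, ofReal (η.dyadic k p.1 ^ 2) * ‖U (0, p)‖ₑ ^ 2) + ofReal jac *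
            ‖∫ x, energyMult η k A x.2 * triProd U x ∂timeFreq (min 0 t₀) (max 0 t₀)‖ₑ := by
  obtain ⟨v, hv, huv⟩ := exists_continuous_extension hT hu.continuous_hInfty
  obtain ⟨F, hF, hFv⟩ := exists_measurable_rep (FourierTransform.continuous_fourier.comp hv)
  simp only [Function.comp_apply] at hFv
  obtain ⟨U, hUF⟩ : ∃ U : ℝ³ → ℂ, ∀ t p, U (t, p) = F (t, toPlane p) :=
    ⟨fun y => F (y.1, toPlane y.2), fun _ _ => rfl⟩
  have hU : Measurable U := by
    rw [show U = fun y => F (y.1, toPlane y.2) from funext fun y => hUF y.1 y.2]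
    exact hF.comp (by fun_prop)
  have hjac : ofReal jac ≠ 0 := (ENNReal.ofReal_pos.2 jac_pos).ne'
  have hl2 : ∀ t, ∫⁻ p, ‖U (t, p)‖ₑ ^ 2 = (ofReal jac)⁻¹ * ‖v t‖ₑ ^ 2 := by
    intro t
    have h1 : ‖v t‖ₑ ^ 2 = ∫⁻ ζ, ‖F (t, ζ)‖ₑ ^ 2 := by
      rw [← ofReal_norm, ← Lp.norm_fourier_eq, ofReal_norm, ← lintegral_enorm_sq]
      refine lintegral_congr_ae ?_
      filter_upwards [hFv t] with ζ hζ
      rw [hζ]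
    rw [h1, lintegral_toPlane, ENNReal.inv_mul_cancel_left' (by simp [hjac]) (by simp)]
    simp only [hUF]
  obtain ⟨D, hD0, hD⟩ := exists_conv_bound hv hFv T
  have hR : ∀ t ∈ Icc (-T) T, l2n (fun p => ‖U (t, p)‖ₑ) ≤
      ((ofReal jac)⁻¹ * ofReal D ^ 2) ^ (1 / 2 : ℝ) := by
    intro t ht
    rw [l2n, hl2, ← ofReal_norm]
    gcongr
    exact (hD t ht).1
  have hRtop : ((ofReal jac)⁻¹ * ofReal D ^ 2) ^ (1 / 2 : ℝ) ≠ ⊤ :=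
    rpow_ne_top_of_nonneg (by norm_num) (mul_ne_top (by simp [jac_pos]) (by finiteness))
  refine ⟨U, hU, fun t ht => ?_, ⟨_, hRtop, hR⟩, fun t₀ ht₀ k A => ?_⟩
  · rw [← huv t ht]
    filter_upwards [ae_toPlane (hFv t)] with p hp
    rw [hUF, hp]
  · have h0 : (0 : ℝ) ∈ Icc (-T) T := ⟨by linarith, hT.le⟩
    have hsub : Icc (min 0 t₀) (max 0 t₀) ⊆ Icc (-T) T :=
      Icc_subset_Icc (le_min h0.1 ht₀.1) (max_le h0.2 ht₀.2)
    refine truncated_energy_le hU (fun t => ?_) (fun s hs => ?_) (integrable_mul_triProd hU hRtop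
      (fun t ht => hR t (hsub ht)) (isMultiplier_energyMult η k A)) ?_
    · refine ⟨(by fun_prop : Measurable fun p => ‖U (t, p)‖ ^ 2).aestronglyMeasurable, ?_⟩
      rw [hasFiniteIntegral_iff_enorm]
      simp only [enorm_pow, enorm_norm, hl2]
      exact (mul_ne_top (by simp [jac_pos]) (by finiteness)).lt_top
    · have hs' := hsub hs
      have h1 := ae_conj_fourier (φ := v s) (by rw [huv s hs']; exact hu.real_valued s hs')
        (hF.comp measurable_prodMk_left) (hFv s)
      filter_upwards [ae_toPlane h1] with p hp
      rw [hUF, hUF, toPlane_neg]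
      exact hp
    · filter_upwards [ae_toPlane (ae_energy_identity hT hu.solves hv huv hF hFv ht₀)] with p hp
      have e : ∀ s, ∫ w, F (s, w) * F (s, toPlane p - w) =
          jac • ∫ q, U (s, q) * U (s, p - q) := fun s => by
        rw [integral_toPlane]
        simp only [hUF, sub_eq_add_neg, toPlane_add, toPlane_neg]
      simp only [e, freqX_toPlane, ← hUF] at hp
      exact hp

lemma enorm_proj_sq_eq {η : Cutoff} {T : ℝ} {u : ℝ → L2} {U : ℝ³ → ℂ}
    (hU : IsFourierRep T u U) (k : ℕ) {t : ℝ} (ht : t ∈ Icc (-T) T) : ‖proj η k (u t)‖ₑ ^ 2 =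
      ofReal jac * ∫⁻ p, ofReal (η.dyadic k p.1 ^ 2) * ‖U (t, p)‖ₑ ^ 2 := by
  rw [enorm_proj_sq, lintegral_toPlane]
  congr 1
  refine lintegral_congr_ae ?_
  filter_upwards [hU t ht] with p hp
  rw [hp, freqX_toPlane]

/-- The energy estimate for a dyadic piece of the solution. -/
lemma exists_enorm_proj_sq_le (η : Cutoff) : ∃ C : ℝ≥0, ∀ T : ℝ, 0 < T → T ≤ 1 → ∀ u : ℝ → L2,
    IsSmoothSolution T u → ∀ (a : ℕ → ℝ≥0∞),
    (∀ k, a k = fkNormOn η k T (fun t => proj η k (u t))) → (∀ k, a k ≠ ⊤) →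
    ∑' k, ofReal √(2 ^ k) * a k ≠ ⊤ → ∀ k, ∀ t ∈ Icc (-T) T,
      ‖proj η (k + 1) (u t)‖ₑ ^ 2 ≤ ‖proj η (k + 1) (u 0)‖ₑ ^ 2 + C * energySum a k := by
  obtain ⟨C, hC⟩ := exists_energyMult_le η
  refine ⟨Real.toNNReal jac * Real.toNNReal jac * C, fun T hT hT1 u hu a ha hat hS k t₀ ht₀ => ?_⟩
  obtain ⟨U, hU, hUu, ⟨R, hR, hUR⟩, hE⟩ := exists_truncated_energy_le η hT hu
  have h0 : (0 : ℝ) ∈ Icc (-T) T := ⟨by linarith, hT.le⟩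
  rcases eq_or_ne t₀ 0 with rfl | hne
  · exact le_self_add
  have hlt : min 0 t₀ < max 0 t₀ := min_lt_max.2 hne.symm
  have hsub : Icc (min 0 t₀) (max 0 t₀) ⊆ Icc (-T) T :=
    Icc_subset_Icc (le_min h0.1 ht₀.1) (max_le h0.2 ht₀.2)
  have hlen : max 0 t₀ - min 0 t₀ ≤ 1 := by
    rw [max_sub_min_eq_abs, sub_zero]
    exact abs_le.2 ⟨by linarith [ht₀.1], by linarith [ht₀.2]⟩
  obtain ⟨err, herr, hle⟩ := hC T u U hUu hU R hR _ _ hlt hlen hsub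
    (fun t ht => hUR t (hsub ht)) a ha hat hS k
  rw [enorm_proj_sq_eq hUu _ ht₀, enorm_proj_sq_eq hUu _ h0]
  obtain ⟨F, hF⟩ : ∃ F : ℝ² → ℝ≥0∞, ∀ p, F p =
    ofReal (η.dyadic (k + 1) p.1 ^ 2) * ‖U (t₀, p)‖ₑ ^ 2 := ⟨_, fun _ => rfl⟩
  simp only [← hF] at hE ⊢
  have hE' := fun A => hE t₀ ht₀ (k + 1) A
  simp only [← hF] at hE'
  have hS : ∀ A : ℕ, MeasurableSet {p : ℝ² | |p.2| ≤ A} := fun A =>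
    (by fun_prop : Measurable fun p : ℝ² => |p.2|) measurableSet_Iic
  have hFm : Measurable F := by
    have : F = fun p => ofReal (η.dyadic (k + 1) p.1 ^ 2) * ‖U (t₀, p)‖ₑ ^ 2 := funext hF
    rw [this]; fun_prop
  have hlim : Tendsto (fun A : ℕ => ∫⁻ p in {p : ℝ² | |p.2| ≤ A}, F p) atTop (𝓝 (∫⁻ p, F p)) := by
    simp only [← lintegral_indicator (hS _)]
    refine lintegral_tendsto_of_tendsto_of_monotone (fun A => (hFm.indicator (hS A)).aemeasurable)
      (.of_forall fun p A B hAB => ?_) (.of_forall fun p => ?_)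
    · have hAB' : (A : ℝ) ≤ B := by exact_mod_cast hAB
      have hsub' : {p : ℝ² | |p.2| ≤ (A : ℝ)} ⊆ {p : ℝ² | |p.2| ≤ (B : ℝ)} :=
        fun q hq => le_trans hq hAB'
      exact indicator_le_indicator_of_subset hsub' (fun _ => zero_le) p
    · obtain ⟨N, hN⟩ := exists_nat_ge |p.2|
      refine tendsto_const_nhds.congr' ?_
      filter_upwards [eventually_ge_atTop N] with A hA
      have : (N : ℝ) ≤ A := by exact_mod_cast hA
      rw [indicator_of_mem (by exact hN.trans this)]
  have hlim2 := (ENNReal.Tendsto.const_mul (a := ofReal jac)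
    (tendsto_const_nhds.add herr) (Or.inr ofReal_ne_top)).const_add
      (∫⁻ p, ofReal (η.dyadic (k + 1) p.1 ^ 2) * ‖U (0, p)‖ₑ ^ 2)
    (f := fun A => ofReal jac * (C * energySum a k + err A))
  rw [add_zero] at hlim2
  have key := le_of_tendsto_of_tendsto' hlim hlim2 fun A => (hE' A).trans
    (add_le_add le_rfl (mul_le_mul' le_rfl (hle A)))
  refine (mul_le_mul' le_rfl key).trans (le_of_eq ?_)
  rw [mul_add]
  push_cast
  rw [ofReal]
  ring

lemma fNorm_sq (η : Cutoff) (s T : ℝ) (u : ℝ → L2) : fNorm η s T u ^ 2 =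
    ∑' k : ℕ, (2 : ℝ≥0∞) ^ (2 * s * (k : ℝ)) * fkNormOn η k T (fun t => proj η k (u t)) ^ 2 := by
  rw [fNorm, sq_rpow_half]
  simp only [rpow_two]

lemma two_rpow_mul_eq (s : ℝ) (k : ℕ) : (2 : ℝ≥0∞) ^ (2 * s * (k : ℝ)) = ((2 ^ s) ^ 2) ^ k := by
  rw [← pow_mul, ← rpow_natCast, ← rpow_mul]
  congr 1
  push_cast
  ring

end KPI

end

theorem proposition3p3 (η : KPI.Cutoff) (s ε : ℝ) (hs : 1 / 2 < s) (hε : 0 < ε) :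
    ∃ C : ℝ≥0, ∀ T : ℝ, 0 < T → T ≤ 1 → ∀ u : ℝ → KPI.L2, KPI.IsSmoothSolution T u →
      KPI.eNorm η s T u ^ 2 ≤
        C * (KPI.sobolevNorm s (u 0) ^ 2
          + KPI.fNorm η (1 / 2 + ε) T u * KPI.fNorm η s T u ^ 2) := by
  obtain ⟨C₁, h₁⟩ := KPI.exists_enorm_proj_sq_le η
  obtain ⟨C₂, h₂⟩ := KPI.exists_tsum_sqrt_le hε
  have hρ : ∃ ρ : ℝ≥0, (ρ : ℝ≥0∞) = 2 ^ s :=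
    ⟨((2 : ℝ≥0∞) ^ s).toNNReal, ENNReal.coe_toNNReal (by finiteness)⟩
  obtain ⟨ρ, hρ⟩ := hρ
  have hρ1 : (1 : ℝ≥0∞) ≤ 2 ^ s := ENNReal.one_le_rpow (by norm_num) (by linarith)
  have hρ2 : (2 : ℝ≥0∞) ≤ (2 ^ s) ^ 2 := by
    rw [← ENNReal.rpow_natCast, ← ENNReal.rpow_mul]
    calc (2 : ℝ≥0∞) = 2 ^ (1 : ℝ) := (ENNReal.rpow_one 2).symm
      _ ≤ _ := ENNReal.rpow_le_rpow_of_exponent_le (by norm_num) (by push_cast; linarith)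
  refine ⟨1 + Real.toNNReal (4 ^ s) + C₁ * (60 * ρ ^ 6) * C₂, fun T hT hT1 u hu => ?_⟩
  obtain ⟨a, ha⟩ : ∃ a : ℕ → ℝ≥0∞, ∀ k, a k =
    KPI.fkNormOn η k T (fun t => KPI.proj η k (u t)) := ⟨_, fun _ => rfl⟩
  set F := KPI.fNorm η (1 / 2 + ε) T u with hF
  set G := KPI.fNorm η s T u with hG
  have hS : ∑' k, ENNReal.ofReal √(2 ^ k) * a k ≤ C₂ * F := by
    have := h₂ a
    simpa only [hF, KPI.fNorm, ← ha] using this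
  have hG2 : G ^ 2 = ∑' k : ℕ, (2 : ℝ≥0∞) ^ (2 * s * (k : ℝ)) * a k ^ 2 := by
    rw [hG, KPI.fNorm_sq]; simp only [← ha]
  have hF2 : F ^ 2 = ∑' k : ℕ, (2 : ℝ≥0∞) ^ (2 * (1 / 2 + ε) * (k : ℝ)) * a k ^ 2 := by
    rw [hF, KPI.fNorm_sq]; simp only [← ha]
  have hpos : ∀ r : ℝ, ∀ k : ℕ, (2 : ℝ≥0∞) ^ (2 * r * (k : ℝ)) ≠ 0 := fun r k =>
    (ENNReal.rpow_pos (by norm_num) (by norm_num)).ne'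
  by_cases hFG : F * G ^ 2 = ⊤
  · rw [hFG, add_top, ENNReal.mul_top]
    · exact le_top
    · norm_cast
      positivity
  have hzero : ∀ r : ℝ, ∑' k : ℕ, (2 : ℝ≥0∞) ^ (2 * r * (k : ℝ)) * a k ^ 2 = 0 →
      ∀ k, a k = 0 := fun r h k => by
    have := (ENNReal.tsum_eq_zero.1 h) k
    simpa [hpos r k] using this
  have hFt : F ≠ ⊤ := by
    intro h
    have hG0 : G ^ 2 = 0 := by
      by_contra hne
      exact hFG (by rw [h, ENNReal.top_mul hne])
    have ha0 := hzero s (hG2 ▸ hG0)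
    have : F ^ 2 = 0 := by rw [hF2]; simp [ha0]
    rw [h] at this
    simp at this
  have hat : ∀ k, a k ≠ ⊤ := by
    intro k hk
    have : F ^ 2 = ⊤ := by
      rw [hF2]
      refine ENNReal.tsum_eq_top_of_eq_top ⟨k, ?_⟩
      rw [hk, ENNReal.top_pow two_ne_zero, ENNReal.mul_top (hpos _ k)]
    exact hFt (by simpa using this)
  have hSt : ∑' k, ENNReal.ofReal √(2 ^ k) * a k ≠ ⊤ := ne_top_of_le_ne_top (by finiteness) hS
  have hmain := h₁ T hT hT1 u hu a ha hat hSt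
  have hsum := KPI.tsum_energySum_le hρ1 hρ2 a
  have hproj := KPI.tsum_proj_le η (by linarith : 0 ≤ s) (u 0)
  have hE : KPI.eNorm η s T u ^ 2 ≤
      ENNReal.ofReal (4 ^ s) * KPI.sobolevNorm s (u 0) ^ 2 +
        C₁ * ∑' k : ℕ, (((2 : ℝ≥0∞) ^ s) ^ 2) ^ (k + 1) * KPI.energySum a k := by
    rw [KPI.eNorm, KPI.sq_rpow_half]
    refine le_trans ?_ (add_le_add hproj le_rfl)
    rw [tsum_eq_zero_add' (f := fun k : ℕ => (2 : ℝ≥0∞) ^ (2 * s * (k : ℝ)) *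
      ‖KPI.proj η k (u 0)‖ₑ ^ 2) ENNReal.summable, add_assoc]
    refine add_le_add (by simp) ?_
    rw [← ENNReal.tsum_mul_left, ← ENNReal.tsum_add]
    refine ENNReal.tsum_le_tsum fun k => iSup₂_le fun t ht => ?_
    rw [ENNReal.rpow_two]
    refine (mul_le_mul' le_rfl (hmain k t ht)).trans (le_of_eq ?_)
    rw [mul_add, ← KPI.two_rpow_mul_eq]
    ring
  refine hE.trans ?_
  have hlast : C₁ * ∑' k : ℕ, (((2 : ℝ≥0∞) ^ s) ^ 2) ^ (k + 1) * KPI.energySum a k ≤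
      C₁ * (60 * ρ ^ 6) * C₂ * (F * G ^ 2) := by
    calc _ ≤ C₁ * (60 * (2 ^ s) ^ 6 * ((∑' k, ENNReal.ofReal √(2 ^ k) * a k) *
          ∑' k, (((2 : ℝ≥0∞) ^ s) ^ 2) ^ k * a k ^ 2)) := mul_le_mul' le_rfl hsum
      _ ≤ C₁ * (60 * (2 ^ s) ^ 6 * ((C₂ * F) * G ^ 2)) := by
          rw [hG2]
          simp only [KPI.two_rpow_mul_eq]
          gcongr
      _ = _ := by rw [hρ]; ring
  push_cast
  rw [mul_add]
  refine add_le_add (mul_le_mul' ?_ le_rfl) (hlast.trans (mul_le_mul' ?_ le_rfl))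
  · rw [ENNReal.ofReal]
    exact le_add_self.trans le_self_add
  · exact le_add_self
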